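/- Let $(M,\omega)$ be a (Hausdorff, second countable) smooth symplectic manifold of dimension $2n$ and let $f=(f_1,\dots,f_n):M\to\mathbb R^n$ be a smooth map with pairwise Poisson-commuting components, all of whose level sets are compact and connected (possibly empty). Let $B\subseteq\mathbb R^n$ be the set of regular values of $f$ in its image, and $\Lambda_b=f^{-1}(b)$, $b\in B$, the Liouville tori. Local action variables are diffeomorphisms $I=(I_1,\dots,I_n):U\to V$ between open subsets of $\mathbb R^n$ for which there is a diffeomorphism $(I\circ f,\varphi):f^{-1}(U)\to V\times(\mathbb R/2\pi\mathbb Z)^n$ with $\omega=\sum_k dI_k\wedge d\varphi_k$ (writing $I_k$ also for $I_k\circ f$). 0. $B$ is open, and the domains $U$ of the local action variables are contained in $B$ and cover it. There is a unique smooth connection $\nabla^{can}$ on $TB=B\times\mathbb R^n$ which, over each such $U$, is the pullback of $d$ by $I$, that is, corresponds to the trivial connection $d$ under $dI:TU\to U\times\mathbb R^n$. It is flat. 1. The local action variables form a covariantly constant section: for each system $I$ of local action variables, $dI_1,\dots,dI_n$ are covariantly constant for the dual of $\nabla^{can}$ on $T^*B$; and on overlaps two systems are related by $dI'_j=\sum_i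 Z_{ij}\,dI_i$ with a locally constant matrix $Z\in GL(n,\mathbb Z)$. The holonomy of $\nabla^{can}$ is the monodromy: let $b\in B$ and let $\gamma$ be a $C^1$ loop in $B$ at $b$. There are continuous families of diffeomorphisms $\Phi_t:\Lambda_b\to\Lambda_{\gamma(t)}$, $0\le t\le1$, with $\Phi_0=\mathrm{id}$. The map $\mu_c=(\Phi_1)_*$ on $H_1(\Lambda_b,\mathbb Z)$ (the classical monodromy) and the map $\mu_q=(\Phi_1^{-1})^*$ on the de Rham cohomology $H^1(\Lambda_b,\mathbb R)$ (the quantum monodromy) do not depend on the choice of $\Phi$. For every system of local action-angle variables near $b$, the cycles $\gamma_1,\dots,\gamma_n$ of the angles (along $\gamma_j$, $\varphi_j$ runs from $0$ to $2\pi$ and the other angles are $0$) form a basis of $H_1(\Lambda_b,\mathbb Z)$, and there is one matrix $Z\in SL(n,\mathbb Z)$ which is both the matrix of $\mu_c$ in the basis $(\gamma_j)$ and the matrix, in the basis $(dI_j)$ of $T_b^*B$, of the holonomy along $\gamma$ of the dual of $\nabla^{can}$; the holonomy on $T_bB$ is the contragredient one. 2. $\mu_q=(\mu_c)^{-T}$: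 the period pairing $\langle[\theta],[c]\rangle=\int_c\theta$ is well defined and identifies $H^1(\Lambda_b,\mathbb R)$ with $\mathrm{Hom}(H_1(\Lambda_b,\mathbb Z),\mathbb R)$; one has $\langle\mu_q a,\mu_c z\rangle=\langle a,z\rangle$ for all $a,z$; every $\mathbb Z$-basis of $H_1(\Lambda_b,\mathbb Z)$ has a dual basis in $H^1(\Lambda_b,\mathbb R)$, and in such dual bases the matrix of $\mu_q$ is the inverse transpose of that of $\mu_c$. -/

import Mathlib

open scoped Manifold ContDiff Topology

noncomputable section

namespace LiouvilleMonodromy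

/-- Euclidean space `ℝᵈ`. -/
abbrev Eucl (d : ℕ) : Type := EuclideanSpace ℝ (Fin d)

/-! ### Differential forms of degree one and two on a manifold -/

section Forms

variable {d : ℕ} {X : Type*} [TopologicalSpace X] [ChartedSpace (Eucl d) X]

variable (d X) in
/-- Fields of covectors, that is, `1`-forms (not necessarily continuous). -/
def OneForm : Type _ := ∀ x : X, TangentSpace (𝓡 d) x →L[ℝ] ℝ

instance : AddCommGroup (OneForm d X) :=
  inferInstanceAs (AddCommGroup (∀ x : X, TangentSpace (𝓡 d) x →L[ℝ] ℝ))

instance : Module ℝ (OneForm d X) :=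
  inferInstanceAs (Module ℝ (∀ x : X, TangentSpace (𝓡 d) x →L[ℝ] ℝ))

/-- The coordinate expression, in the chart at `x₀`, of a field `θ` of covectors. -/
def oneFormInChart (θ : OneForm d X) (x₀ : X) :
    Eucl d → (Eucl d →L[ℝ] ℝ) := fun y =>
  (θ ((extChartAt (𝓡 d) x₀).symm y)).comp
    (mfderiv 𝓘(ℝ, Eucl d) (𝓡 d) (extChartAt (𝓡 d) x₀).symm y)

/-- The coordinate expression, in the chart at `x₀`, of a field `Ω` of bilinear forms. -/
def twoFormInChart (Ω : ∀ x : X, TangentSpace (𝓡 d) x →L[ℝ] TangentSpace (𝓡 d) x →L[ℝ] ℝ)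
    (x₀ : X) : Eucl d → (Eucl d →L[ℝ] Eucl d →L[ℝ] ℝ) := fun y =>
  let B : Eucl d →L[ℝ] Eucl d →L[ℝ] ℝ := Ω ((extChartAt (𝓡 d) x₀).symm y)
  let D : Eucl d →L[ℝ] Eucl d := mfderiv 𝓘(ℝ, Eucl d) (𝓡 d) (extChartAt (𝓡 d) x₀).symm y
  B.bilinearComp D D

variable (d X) in
/-- The space of smooth closed `1`-forms on `X`. -/
def closedForms : Submodule ℝ (OneForm d X) where
  carrier := {θ | ∀ x₀ : X,
    ContDiffOn ℝ ∞ (oneFormInChart θ x₀) (extChartAt (𝓡 d) x₀).target ∧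
    ∀ y ∈ (extChartAt (𝓡 d) x₀).target, ∀ u v : Eucl d,
      fderiv ℝ (oneFormInChart θ x₀) y u v = fderiv ℝ (oneFormInChart θ x₀) y v u}
  zero_mem' := by
    intro x₀
    have h : oneFormInChart (0 : OneForm d X) x₀ = fun _ => 0 := rfl
    rw [h]
    exact ⟨contDiffOn_const, by simp⟩
  add_mem' := by
    intro θ θ' h h' x₀
    have e : oneFormInChart (θ + θ') x₀ = oneFormInChart θ x₀ + oneFormInChart θ' x₀ := rfl
    rw [e]
    refine ⟨(h x₀).1.add (h' x₀).1, fun y hy u v => ?_⟩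
    have ht := (isOpen_extChartAt_target (I := 𝓡 d) x₀).mem_nhds hy
    have d1 := ((h x₀).1.contDiffAt ht).differentiableAt (by simp)
    have d2 := ((h' x₀).1.contDiffAt ht).differentiableAt (by simp)
    rw [fderiv_add d1 d2]
    simp [(h x₀).2 y hy u v, (h' x₀).2 y hy u v]
  smul_mem' := by
    intro r θ h x₀
    have e : oneFormInChart (r • θ) x₀ = r • oneFormInChart θ x₀ := rfl
    rw [e]
    refine ⟨(h x₀).1.const_smul r, fun y hy u v => ?_⟩
    have ht := (isOpen_extChartAt_target (I := 𝓡 d) x₀).mem_nhds hy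
    have d1 := ((h x₀).1.contDiffAt ht).differentiableAt (by simp)
    rw [fderiv_const_smul d1]
    simp [(h x₀).2 y hy u v]

variable (d X) in
/-- The space of exact `1`-forms `dg`, with `g` a smooth function on `X`. -/
def exactForms : Submodule ℝ (OneForm d X) where
  carrier := {θ | ∃ g : X → ℝ, ContMDiff (𝓡 d) 𝓘(ℝ, ℝ) ∞ g ∧
    ∀ x, θ x = mfderiv (𝓡 d) 𝓘(ℝ, ℝ) g x}
  zero_mem' := by
    refine ⟨fun _ => 0, contMDiff_const, fun x => ?_⟩
    have h : mfderiv (𝓡 d) 𝓘(ℝ, ℝ) (fun _ : X => (0 : ℝ)) x = 0 := mfderiv_const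
    exact h.symm
  add_mem' := by
    rintro θ θ' ⟨g, hg, e⟩ ⟨g', hg', e'⟩
    refine ⟨g + g', hg.add hg', fun x => ?_⟩
    have h := mfderiv_add (hg.mdifferentiableAt (by simp) (x := x))
      (hg'.mdifferentiableAt (by simp) (x := x))
    refine Eq.trans ?_ h.symm
    refine Eq.trans (show (θ + θ') x = θ x + θ' x from rfl) ?_
    rw [e, e']
    rfl
  smul_mem' := by
    rintro r θ ⟨g, hg, e⟩
    have hr : ContMDiff (𝓡 d) 𝓘(ℝ, ℝ) ∞ (fun _ : X => r) := contMDiff_const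
    refine ⟨r • g, hr.smul hg, fun x => ?_⟩
    have h := const_smul_mfderiv (hg.mdifferentiableAt (by simp) (x := x)) r
    refine Eq.trans ?_ h.symm
    refine Eq.trans (show (r • θ) x = r • θ x from rfl) ?_
    rw [e]
    rfl

variable (d X) in
/-- The first de Rham cohomology space `H¹(X, ℝ)`. -/
abbrev DeRhamH1 : Type _ :=
  closedForms d X ⧸ (exactForms d X).submoduleOf (closedForms d X)

/-- The de Rham class of a closed `1`-form. -/
def deRhamClass (θ : closedForms d X) : DeRhamH1 d X := Submodule.Quotient.mk θ

/-- The pullback `φ^* θ` of a `1`-form by a self-map `φ` of `X`. -/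
def pullbackForm (φ : X → X) (θ : OneForm d X) : OneForm d X :=
  fun x => (θ (φ x)).comp (mfderiv (𝓡 d) (𝓡 d) φ x)

end Forms

/-! ### Smooth singular homology in degree one -/

section Homology

/-- Smooth singular simplices with domain `K ⊆ W`: maps `K → X` that are restrictions of smooth
maps. (For the convex sets `K` below, a smooth map on a neighbourhood of `K` agrees on `K` with a
smooth map on all of `W`.) -/
structure SmoothSimplex (d : ℕ) {W : Type} [NormedAddCommGroup W] [NormedSpace ℝ W] (K : Set W)
    (X : Type*) [TopologicalSpace X] [ChartedSpace (Eucl d) X] where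
  /-- The underlying map. -/
  toFun : K → X
  smooth : ∃ g : W → X, ContMDiff 𝓘(ℝ, W) (𝓡 d) ∞ g ∧ ∀ p : K, g p = toFun p

/-- The standard `2`-simplex, with vertices `(0,0)`, `(1,0)`, `(0,1)`. -/
def triangle : Set (ℝ × ℝ) := {p | 0 ≤ p.1 ∧ 0 ≤ p.2 ∧ p.1 + p.2 ≤ 1}

variable {d : ℕ} {X : Type*} [TopologicalSpace X] [ChartedSpace (Eucl d) X]

variable (d X) in
/-- Smooth singular `1`-simplices. -/
abbrev SmoothPath : Type _ := SmoothSimplex d (Set.Icc (0 : ℝ) 1) X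

variable (d X) in
/-- Smooth singular `2`-simplices. -/
abbrev SmoothTriangle : Type _ := SmoothSimplex d triangle X

/-- The face opposite to the vertex `(0,0)`. -/
def face0 (τ : SmoothTriangle d X) : SmoothPath d X :=
  ⟨fun t => τ.toFun ⟨(1 - t.1, t.1), by
      have := t.2.1; have := t.2.2; simp only [triangle, Set.mem_ofPred_eq]
      refine ⟨?_, ?_, ?_⟩ <;> linarith⟩, by
    obtain ⟨g, hg, h⟩ := τ.smooth
    refine ⟨fun t => g (1 - t, t), hg.comp ?_, fun p => h ⟨_, _⟩⟩
    exact ContDiff.contMDiff (by fun_prop)⟩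

/-- The face opposite to the vertex `(1,0)`. -/
def face1 (τ : SmoothTriangle d X) : SmoothPath d X :=
  ⟨fun t => τ.toFun ⟨(0, t.1), by
      have := t.2.1; have := t.2.2; simp only [triangle, Set.mem_ofPred_eq]
      refine ⟨?_, ?_, ?_⟩ <;> linarith⟩, by
    obtain ⟨g, hg, h⟩ := τ.smooth
    refine ⟨fun t => g (0, t), hg.comp ?_, fun p => h ⟨_, _⟩⟩
    exact ContDiff.contMDiff (by fun_prop)⟩

/-- The face opposite to the vertex `(0,1)`. -/
def face2 (τ : SmoothTriangle d X) : SmoothPath d X :=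
  ⟨fun t => τ.toFun ⟨(t.1, 0), by
      have := t.2.1; have := t.2.2; simp only [triangle, Set.mem_ofPred_eq]
      refine ⟨?_, ?_, ?_⟩ <;> linarith⟩, by
    obtain ⟨g, hg, h⟩ := τ.smooth
    refine ⟨fun t => g (t, 0), hg.comp ?_, fun p => h ⟨_, _⟩⟩
    exact ContDiff.contMDiff (by fun_prop)⟩

variable (d X) in
/-- The boundary `∂ σ = σ(1) - σ(0)` of singular `1`-chains. -/
def boundary1 : (SmoothPath d X →₀ ℤ) →ₗ[ℤ] (X →₀ ℤ) :=
  Finsupp.linearCombination ℤ fun σ =>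
    Finsupp.single (σ.toFun ⟨1, by simp⟩) 1 - Finsupp.single (σ.toFun ⟨0, by simp⟩) 1

variable (d X) in
/-- The boundary of singular `2`-chains: the alternating sum of the faces. -/
def boundary2 : (SmoothTriangle d X →₀ ℤ) →ₗ[ℤ] (SmoothPath d X →₀ ℤ) :=
  Finsupp.linearCombination ℤ fun τ =>
    Finsupp.single (face0 τ) 1 - Finsupp.single (face1 τ) 1 + Finsupp.single (face2 τ) 1

theorem boundary1_boundary2 (c : SmoothTriangle d X →₀ ℤ) :
    boundary1 d X (boundary2 d X c) = 0 := by
  have : (boundary1 d X).comp (boundary2 d X) = 0 := by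
    ext1 τ
    ext1
    simp [boundary1, boundary2, face0, face1, face2]
  exact LinearMap.congr_fun this c

variable (d X) in
/-- The group of smooth singular `1`-cycles. -/
abbrev cycles1 : Submodule ℤ (SmoothPath d X →₀ ℤ) := LinearMap.ker (boundary1 d X)

variable (d X) in
/-- The first smooth singular homology group `H₁(X, ℤ)`. -/
abbrev SingH1 : Type _ :=
  cycles1 d X ⧸ (LinearMap.range (boundary2 d X)).submoduleOf (cycles1 d X)

/-- The homology class of a cycle. -/
def homologyClass (c : cycles1 d X) : SingH1 d X := Submodule.Quotient.mk c

/-- Push-forward of smooth simplices by a smooth self-map. -/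
def pushSimplex {W : Type} [NormedAddCommGroup W] [NormedSpace ℝ W] {K : Set W}
    (φ : X → X) (hφ : ContMDiff (𝓡 d) (𝓡 d) ∞ φ) (σ : SmoothSimplex d K X) :
    SmoothSimplex d K X :=
  ⟨φ ∘ σ.toFun, by
    obtain ⟨g, hg, h⟩ := σ.smooth
    exact ⟨φ ∘ g, hφ.comp hg, fun p => congrArg φ (h p)⟩⟩

/-- Push-forward of singular `1`-chains by a smooth self-map. -/
def pushChain (φ : X → X) (hφ : ContMDiff (𝓡 d) (𝓡 d) ∞ φ) :
    (SmoothPath d X →₀ ℤ) →ₗ[ℤ] (SmoothPath d X →₀ ℤ) :=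
  Finsupp.lmapDomain ℤ ℤ (pushSimplex φ hφ)

theorem boundary1_pushChain (φ : X → X) (hφ : ContMDiff (𝓡 d) (𝓡 d) ∞ φ)
    (c : SmoothPath d X →₀ ℤ) :
    boundary1 d X (pushChain φ hφ c) = Finsupp.lmapDomain ℤ ℤ φ (boundary1 d X c) := by
  have : (boundary1 d X).comp (pushChain φ hφ)
      = (Finsupp.lmapDomain ℤ ℤ φ).comp (boundary1 d X) := by
    ext1 σ
    ext1
    simp [boundary1, pushChain, pushSimplex, map_sub, Finsupp.mapDomain_single]
  exact LinearMap.congr_fun this c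

theorem pushChain_boundary2 (φ : X → X) (hφ : ContMDiff (𝓡 d) (𝓡 d) ∞ φ)
    (c : SmoothTriangle d X →₀ ℤ) :
    pushChain φ hφ (boundary2 d X c)
      = boundary2 d X (Finsupp.lmapDomain ℤ ℤ (pushSimplex φ hφ) c) := by
  have : (pushChain φ hφ).comp (boundary2 d X)
      = (boundary2 d X).comp (Finsupp.lmapDomain ℤ ℤ (pushSimplex φ hφ)) := by
    ext1 τ
    ext1
    simp [boundary2, pushChain, map_sub, map_add, Finsupp.mapDomain_single]
    rfl
  exact LinearMap.congr_fun this c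

/-- Push-forward of `1`-cycles by a smooth self-map. -/
def pushCycle (φ : X → X) (hφ : ContMDiff (𝓡 d) (𝓡 d) ∞ φ) : cycles1 d X →ₗ[ℤ] cycles1 d X :=
  (pushChain φ hφ).restrict fun c hc => by
    rw [LinearMap.mem_ker] at hc ⊢
    rw [boundary1_pushChain, hc, map_zero]

/-- The map `φ_* : H₁(X, ℤ) → H₁(X, ℤ)` induced by a smooth self-map `φ` of `X`. -/
def homologyMap (φ : X → X) (hφ : ContMDiff (𝓡 d) (𝓡 d) ∞ φ) : SingH1 d X →ₗ[ℤ] SingH1 d X :=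
  Submodule.mapQ _ _ (pushCycle φ hφ) <| by
    rintro ⟨c, hc⟩ ⟨a, ha⟩
    refine ⟨Finsupp.lmapDomain ℤ ℤ (pushSimplex φ hφ) a, ?_⟩
    rw [← pushChain_boundary2, ha]
    rfl

/-- The integral of a `1`-form along a smooth path. -/
def pathIntegral (θ : OneForm d X) (σ : SmoothPath d X) : ℝ :=
  ∫ t in (0 : ℝ)..1, θ (σ.smooth.choose t) (mfderiv 𝓘(ℝ, ℝ) (𝓡 d) σ.smooth.choose t (1 : ℝ))

/-- The integral of a `1`-form along a singular `1`-chain. -/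
def chainIntegral (θ : OneForm d X) (c : SmoothPath d X →₀ ℤ) : ℝ :=
  c.sum fun σ k => (k : ℝ) * pathIntegral θ σ

/-- `P` is the period pairing `⟨[θ], [c]⟩ = ∫_c θ` between `H¹(X, ℝ)` and `H₁(X, ℤ)`. -/
def IsPeriodPairing (P : DeRhamH1 d X →ₗ[ℝ] (SingH1 d X →ₗ[ℤ] ℝ)) : Prop :=
  ∀ (θ : closedForms d X) (c : cycles1 d X),
    P (deRhamClass θ) (homologyClass c) = chainIntegral θ.1 c.1

end Homology

/-! ### Symplectic manifolds, integrable systems and local action-angle coordinates -/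

section Systems

/-- Symplectic forms: smooth, closed, nondegenerate `2`-forms. -/
structure SymplecticForm (m : ℕ) (M : Type*) [TopologicalSpace M] [ChartedSpace (Eucl m) M] where
  /-- The value of the form at a point. -/
  form : ∀ x : M, TangentSpace (𝓡 m) x →L[ℝ] TangentSpace (𝓡 m) x →L[ℝ] ℝ
  alternating : ∀ x v, form x v v = 0
  nondegenerate : ∀ x v, (∀ w, form x v w = 0) → v = 0
  smooth : ∀ x₀, ContDiffOn ℝ ∞ (twoFormInChart form x₀) (extChartAt (𝓡 m) x₀).target
  closed : ∀ x₀, ∀ y ∈ (extChartAt (𝓡 m) x₀).target, ∀ u v w : Eucl m,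
    fderiv ℝ (twoFormInChart form x₀) y u v w + fderiv ℝ (twoFormInChart form x₀) y v w u
      + fderiv ℝ (twoFormInChart form x₀) y w u v = 0

variable {n : ℕ} {M : Type*} [TopologicalSpace M] [ChartedSpace (Eucl (2 * n)) M]

/-- The differential at `x` of the `i`-th component of `f : M → ℝⁿ`. -/
def dComponent (f : M → Eucl n) (i : Fin n) (x : M) : TangentSpace (𝓡 (2 * n)) x →L[ℝ] ℝ :=
  mfderiv (𝓡 (2 * n)) 𝓘(ℝ, ℝ) (fun y => f y i) x

/-- A completely integrable system with `n` degrees of freedom on the `2n`-dimensional symplectic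
manifold `(M, Ω)`: the energy-momentum map `f = (f₁, …, fₙ)` is smooth, its components
Poisson-commute, and its level sets are compact and connected (possibly empty). -/
structure IsIntegrableSystem (Ω : SymplecticForm (2 * n) M) (f : M → Eucl n) : Prop where
  smooth : ContMDiff (𝓡 (2 * n)) 𝓘(ℝ, Eucl n) ∞ f
  /-- `{f_i, f_j} = Ω(X_i, X_j) = 0`, with `X_i` the Hamiltonian vector field of `f_i`,
  `Ω(X_i, ·) = - df_i`. -/
  commute : ∀ (i j : Fin n) (x : M) (Xi Xj : TangentSpace (𝓡 (2 * n)) x),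
    (∀ w, Ω.form x Xi w = - dComponent f i x w) →
    (∀ w, Ω.form x Xj w = - dComponent f j x w) → Ω.form x Xi Xj = 0
  compact : ∀ c : Eucl n, IsCompact (f ⁻¹' {c})
  connected : ∀ c : Eucl n, IsPreconnected (f ⁻¹' {c})

/-- The set `B` of regular values of `f` (in the image of `f`). -/
def regularValues (f : M → Eucl n) : Set (Eucl n) :=
  {b | b ∈ Set.range f ∧ ∀ x, f x = b →
    Function.Surjective (mfderiv (𝓡 (2 * n)) 𝓘(ℝ, Eucl n) f x)}

/-- The Liouville torus `Λ_b = f⁻¹(b)`. -/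
abbrev Fibre (f : M → Eucl n) (b : Eucl n) : Type _ := (f ⁻¹' {b} : Set M)

/-- Local action-angle coordinates. The local action variables `I = action : U → V` are a
diffeomorphism between open subsets `U` and `V` of `ℝⁿ`. The diffeomorphism
`(I ∘ f, φ) : f⁻¹(U) → V × (ℝ / 2πℤ)ⁿ` is given through its inverse, that is, through the map
`param : V × ℝⁿ → f⁻¹(U)`, `2πℤⁿ`-periodic in the angles; `Ω = ∑ dI_k ∧ dφ_k`. -/
structure ActionAngleChart (Ω : SymplecticForm (2 * n) M) (f : M → Eucl n) where
  /-- The local action variables, as functions on an open subset of the base. -/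
  action : OpenPartialHomeomorph (Eucl n) (Eucl n)
  action_smooth : ContDiffOn ℝ ∞ action action.source
  action_symm_smooth : ContDiffOn ℝ ∞ action.symm action.target
  /-- The point with given action and angle coordinates. -/
  param : Eucl n × Eucl n → M
  param_smooth : ContMDiffOn 𝓘(ℝ, Eucl n × Eucl n) (𝓡 (2 * n)) ∞ param
    (action.target ×ˢ Set.univ)
  image_param : param '' (action.target ×ˢ Set.univ) = f ⁻¹' action.source
  action_param : ∀ J ∈ action.target, ∀ φ, f (param (J, φ)) = action.symm J
  param_eq_iff : ∀ J ∈ action.target, ∀ φ φ', param (J, φ) = param (J, φ') ↔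
    ∃ k : Fin n → ℤ, ∀ i, φ' i = φ i + 2 * Real.pi * k i
  darboux : ∀ J ∈ action.target, ∀ φ, ∀ u v : Eucl n × Eucl n,
    Ω.form (param (J, φ))
      (mfderiv 𝓘(ℝ, Eucl n × Eucl n) (𝓡 (2 * n)) param (J, φ) u)
      (mfderiv 𝓘(ℝ, Eucl n × Eucl n) (𝓡 (2 * n)) param (J, φ) v)
        = ∑ k, (u.1 k * v.2 k - v.1 k * u.2 k)

/-- The differential `dI_j` at `b` of the `j`-th action variable. -/
def ActionAngleChart.dAction {Ω : SymplecticForm (2 * n) M} {f : M → Eucl n}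
    (c : ActionAngleChart Ω f) (j : Fin n) (b : Eucl n) : Eucl n →L[ℝ] ℝ :=
  fderiv ℝ (fun y => c.action y j) b

/-- `e` is the basis of `H₁(Λ_b, ℤ)` formed by the cycles `γ_1, …, γ_n` of the angles: along `γ_j`
the angle `φ_j` runs from `0` to `2π`, and the other angles are zero. -/
def IsAngleBasis {Ω : SymplecticForm (2 * n) M} {f : M → Eucl n} (c : ActionAngleChart Ω f)
    (b : Eucl n) [ChartedSpace (Eucl n) (Fibre f b)]
    (e : Module.Basis (Fin n) ℤ (SingH1 n (Fibre f b))) : Prop :=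
  ∀ j, ∃ (σ : SmoothPath n (Fibre f b)) (h : Finsupp.single σ 1 ∈ cycles1 n (Fibre f b)),
    (∀ t, (σ.toFun t : M) =
      c.param (c.action b, EuclideanSpace.single j (2 * Real.pi * (t : ℝ)))) ∧
    e j = homologyClass ⟨Finsupp.single σ 1, h⟩

end Systems

/-! ### Connections on trivial vector bundles over subsets of `ℝⁿ` -/

section Connections

variable {n : ℕ} {F : Type} [NormedAddCommGroup F] [NormedSpace ℝ F]

/-- The connection form `A` of a connection `∇ = d + A` on the trivial bundle with fibre `F`;
`A b X` is the endomorphism of `F` attached to the point `b` and the tangent vector `X`. -/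
abbrev ConnectionForm (n : ℕ) (F : Type) [NormedAddCommGroup F] [NormedSpace ℝ F] : Type :=
  Eucl n → Eucl n →L[ℝ] F →L[ℝ] F

/-- The covariant derivative `(∇_X s)(b) = (X s)(b) + A_b(X) s(b)`. -/
def covDeriv (A : ConnectionForm n F) (s : Eucl n → F) (b X : Eucl n) : F :=
  fderiv ℝ s b X + A b X (s b)

/-- The curvature `dA + A ∧ A` vanishes on `B`. -/
def IsFlatOn (A : ConnectionForm n F) (B : Set (Eucl n)) : Prop :=
  ∀ b ∈ B, ∀ X Y : Eucl n,
    fderiv ℝ A b X Y - fderiv ℝ A b Y X + ((A b X).comp (A b Y) - (A b Y).comp (A b X)) = 0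

/-- The dual connection on the trivial bundle with fibre the dual of `F`:
`(∇_X α)(s) = X (α(s)) - α(∇_X s)`. -/
def dualConnection (A : ConnectionForm n F) : ConnectionForm n (F →L[ℝ] ℝ) := fun b =>
  -(((ContinuousLinearMap.compL ℝ F F ℝ).flip).comp (A b))

/-- `s` is parallel along the path `γ : [0, 1] → ℝⁿ`. -/
def IsParallelAlong (A : ConnectionForm n F) (γ : ℝ → Eucl n) (s : ℝ → F) : Prop :=
  ∀ t ∈ Set.Icc (0 : ℝ) 1, HasDerivWithinAt s
    (-(A (γ t) (derivWithin γ (Set.Icc 0 1) t) (s t))) (Set.Icc 0 1) t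

/-- `T` is the parallel transport along `γ` from `γ(0)` to `γ(1)` (the holonomy, if `γ` is a
loop): every vector extends to a parallel section along `γ`, and `T` maps the initial value of
each parallel section to its final value. -/
def IsHolonomy (A : ConnectionForm n F) (γ : ℝ → Eucl n) (T : F →ₗ[ℝ] F) : Prop :=
  (∀ v, ∃ s, IsParallelAlong A γ s ∧ s 0 = v) ∧ ∀ s, IsParallelAlong A γ s → s 1 = T (s 0)

/-- Over `U`, the connection `d + A` on `TU = U × ℝⁿ` is the pullback of `d` by `I : U → ℝⁿ`:
the isomorphism `dI : TU → U × ℝⁿ` carries `∇` to `d`. -/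
def IsPullbackOfD (A : ConnectionForm n (Eucl n)) (I : Eucl n → Eucl n) (U : Set (Eucl n)) :
    Prop :=
  ∀ b ∈ U, ∀ s : Eucl n → Eucl n, DifferentiableAt ℝ s b → ∀ X : Eucl n,
    fderiv ℝ I b (covDeriv A s b X) = fderiv ℝ (fun y => fderiv ℝ I y (s y)) b X

variable {M : Type*} [TopologicalSpace M] [ChartedSpace (Eucl (2 * n)) M]

/-- `d + A` is the canonical connection on `TB = B × ℝⁿ`: it is smooth, and it restricts to the
pullback of `d` by the local action map of each system of local action-angle coordinates. -/
structure IsCanonicalConnection (Ω : SymplecticForm (2 * n) M) (f : M → Eucl n)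
    (A : ConnectionForm n (Eucl n)) : Prop where
  smooth : ContDiffOn ℝ ∞ A (regularValues f)
  pullback : ∀ c : ActionAngleChart Ω f, IsPullbackOfD A c.action c.action.source

end Connections

/-! ### Monodromy of the torus bundle -/

section Monodromy

variable {n : ℕ} {M : Type*} [TopologicalSpace M] [ChartedSpace (Eucl (2 * n)) M]

/-- A transport of the fibre over `b` along the path `γ` in the base: a continuous family of
diffeomorphisms `Φ t : Λ_b → Λ_{γ(t)}`, `0 ≤ t ≤ 1`, starting at the identity. -/
structure IsFibreTransport (f : M → Eucl n) (b : Eucl n) [ChartedSpace (Eucl n) (Fibre f b)]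
    (γ : ℝ → Eucl n) (Φ : ℝ → Fibre f b → M) : Prop where
  continuousOn : ContinuousOn (Function.uncurry Φ) (Set.Icc 0 1 ×ˢ Set.univ)
  start : ∀ x, Φ 0 x = x
  smooth : ∀ t ∈ Set.Icc (0 : ℝ) 1, ContMDiff (𝓡 n) (𝓡 (2 * n)) ∞ (Φ t)
  immersion : ∀ t ∈ Set.Icc (0 : ℝ) 1, ∀ x,
    Function.Injective (mfderiv (𝓡 n) (𝓡 (2 * n)) (Φ t) x)
  injective : ∀ t ∈ Set.Icc (0 : ℝ) 1, Function.Injective (Φ t)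
  range_eq : ∀ t ∈ Set.Icc (0 : ℝ) 1, Set.range (Φ t) = f ⁻¹' {γ t}

/-- `φ` is a monodromy diffeomorphism of `Λ_b` along the loop `γ` at `b`: the end of a transport
of `Λ_b` along `γ`. -/
def IsMonodromyDiffeo (f : M → Eucl n) (b : Eucl n) [ChartedSpace (Eucl n) (Fibre f b)]
    (γ : ℝ → Eucl n) (φ : Diffeomorph (𝓡 n) (𝓡 n) (Fibre f b) (Fibre f b) ∞) : Prop :=
  ∃ Φ, IsFibreTransport f b γ Φ ∧ ∀ x, (φ x : M) = Φ 1 x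

/-- `μ` is the classical monodromy along `γ`, acting on `H₁(Λ_b, ℤ)`: cycles are transported
along `γ`, `μ = φ_*`. -/
def IsClassicalMonodromy (f : M → Eucl n) (b : Eucl n) [ChartedSpace (Eucl n) (Fibre f b)]
    (γ : ℝ → Eucl n) (μ : SingH1 n (Fibre f b) ≃ₗ[ℤ] SingH1 n (Fibre f b)) : Prop :=
  ∀ φ, IsMonodromyDiffeo f b γ φ → ∀ a, μ a = homologyMap φ φ.contMDiff a

/-- `μ` is the quantum monodromy along `γ`, acting on `H¹(Λ_b, ℝ)`: de Rham classes of connection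
forms are transported along `γ`, `μ = (φ⁻¹)^*`. -/
def IsQuantumMonodromy (f : M → Eucl n) (b : Eucl n) [ChartedSpace (Eucl n) (Fibre f b)]
    (γ : ℝ → Eucl n)
    (μ : DeRhamH1 n (Fibre f b) ≃ₗ[ℝ] DeRhamH1 n (Fibre f b)) : Prop :=
  ∀ φ, IsMonodromyDiffeo f b γ φ → ∀ θ : closedForms n (Fibre f b),
    ∃ θ' : closedForms n (Fibre f b),
      θ'.1 = pullbackForm φ.symm θ.1 ∧ μ (deRhamClass θ) = deRhamClass θ'

end Monodromy

end LiouvilleMonodromy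

end

open LiouvilleMonodromy

open scoped Manifold ContDiff Topology

noncomputable section

namespace LiouvilleMonodromy

/-! ### Integrals depending on a parameter; the Poincaré lemma for two-forms. -/

section Calculus

open Set MeasureTheory

variable {E F : Type} [NormedAddCommGroup E] [NormedSpace ℝ E] [NormedAddCommGroup F]
  [NormedSpace ℝ F]

/-! Local theory. Near a regular point the commuting components make the fibres of `f` isotropic. A
local primitive of Ω is therefore closed along the fibres; subtracting the differential of a
fibrewise primitive leaves a horizontal one-form, whose coefficients are, up to sign, conjugate
coordinates q (`exists_darboux`). Canonical coordinates (f, q) are unique up to translation of q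
along each fibre (`IsDarbouxOn.eventually_eq`), so vertical lines in them are the orbits of the
local action of ℝⁿ by the Hamiltonian flows. No vector field is integrated: compactness of a fibre
gives coordinate boxes of uniform size, and a local homomorphism defined on a vector space extends
to a global one (`exists_hom_of_local`, `exists_action`). Flowing out from a section on which q is
constant gives a parametrization F(c, s) of f⁻¹(U) that is canonical and global along the connected
fibres (`exists_polarization`).

Actions. The periods of F(c, ·) form a lattice: it is discrete because F is locally injective and
cocompact because the fibre is compact. Lattice bases extend smoothly to nearby fibres, and a smooth
family of periods is a closed one-form because translation by it is symplectic. The primitives of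
these forms, divided by 2π, are the actions (`exists_actionAngleChart`). Conversely every
action-angle chart yields the lattice spanned by the 2π dI_j, and this lattice depends on Ω and f
only. Hence two coframes dI, dI' differ by a unimodular integer matrix, locally constant by
continuity (`ActionAngleChart.exists_transition`, `ActionAngleChart.eventually_transition`). So
(dI)⁻¹ D(dI) does not depend on the chart: it is the canonical connection, and its flatness and the
parallelism of the dI_j are computed in one chart.

Tori. The angles present Λ_b as ℝⁿ modulo 2πℤⁿ (`IsTorusCover`). Through this covering H₁ is
computed by winding vectors of lifted paths and H¹ by periods of primitives on ℝⁿ, so the period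
pairing is perfect. A self-map acts on H₁ by the matrix through which its lift moves the lattice.
The quantum monodromy is the contragredient of the classical one, since the integral of (φ⁻¹)^*θ
over φ_*c equals that of θ over c.

Holonomy. Along a loop the angle parametrizations of successive charts are glued by affine
unimodular maps to one continuous family Θ_t, accompanied by the covariantly constant frame K_t of
the matching actions (`exists_angleTransport`). At the end of the loop Θ₁ = Θ₀ ∘ (Z · + φ₀) and K₁ =
Zᵀ K₀ with the same Z: this is the equality of monodromy and holonomy
(`IsAngleTransport.exists_matrix`). Since det K_t never vanishes, det Z is 1 and not -1. An
arbitrary transport Φ_t of the fibre is compared with Θ_t by homotopy lifting: the lift commutes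
with the lattice for all t because it does at t = 0, so Φ₁ also acts by Z
(`IsAngleTransport.hasDeckMatrix`). -/

theorem hasFDerivAt_integral_param [CompleteSpace F] {W : Set ℝ} {U : Set E} (hW : IsOpen W)
    (hU : IsOpen U) (h01 : Icc 0 1 ⊆ W) {h : ℝ × E → F} (hh : ContDiffOn ℝ 1 h (W ×ˢ U)) {y : E}
    (hy : y ∈ U) :
    HasFDerivAt (fun y => ∫ t in (0 : ℝ)..1, h (t, y))
      (∫ t in (0 : ℝ)..1, (fderiv ℝ h (t, y)).comp (ContinuousLinearMap.inr ℝ ℝ E)) y := by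
  have hWU : IsOpen (W ×ˢ U) := hW.prod hU
  have hd : ContinuousOn (fun p => (fderiv ℝ h p).comp (ContinuousLinearMap.inr ℝ ℝ E))
      (W ×ˢ U) := by
    have := hh.continuousOn_fderiv_of_isOpen hWU le_rfl
    fun_prop
  have hc : ContinuousOn h (W ×ˢ U) := hh.continuousOn
  have slice : ∀ y ∈ U, ContinuousOn (fun t : ℝ => (t, y)) (Icc 0 1) := fun y _ => by fun_prop
  have maps : ∀ y ∈ U, MapsTo (fun t : ℝ => (t, y)) (Icc 0 1) (W ×ˢ U) :=
    fun y hy t ht => ⟨h01 ht, hy⟩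
  obtain ⟨C, hC⟩ := (isCompact_Icc (a := (0 : ℝ)) (b := 1)).exists_bound_of_continuousOn
    (hd.comp (slice y hy) (maps y hy))
  obtain ⟨V, hVo, hyV, hVU, hVC⟩ : ∃ V : Set E, IsOpen V ∧ y ∈ V ∧ V ⊆ U ∧
      ∀ t ∈ Icc (0 : ℝ) 1, ∀ z ∈ V,
        ‖(fderiv ℝ h (t, z)).comp (ContinuousLinearMap.inr ℝ ℝ E)‖ ≤ C + 1 := by
    -- The bound C holds over the compact slice [0, 1] × {y}; by the tube lemma C + 1 is a bound for
    -- all parameters near y. This is the domination needed to differentiate under the integral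
    -- sign.
    have ho := hd.norm.isOpen_inter_preimage hWU (isOpen_Iio (a := C + 1))
    obtain ⟨u, v, -, hv, hu, hyv, huv⟩ := generalized_tube_lemma
      (isCompact_Icc (a := (0 : ℝ)) (b := 1)) (isCompact_singleton (x := y)) ho (by
        rintro ⟨t, z⟩ ⟨ht, rfl⟩
        refine ⟨⟨h01 ht, hy⟩, ?_⟩
        have := hC t ht
        simp only [mem_preimage, mem_Iio, Function.comp_apply] at this ⊢
        linarith)
    refine ⟨v ∩ U, hv.inter hU, ⟨hyv rfl, hy⟩, inter_subset_right, fun t ht z hz => ?_⟩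
    have := (huv (show (t, z) ∈ u ×ˢ v from ⟨hu ht, hz.1⟩)).2
    exact le_of_lt this
  have uI : uIoc (0 : ℝ) 1 ⊆ Icc 0 1 := by
    rw [uIoc_of_le zero_le_one]; exact Ioc_subset_Icc_self
  have cont : ∀ z ∈ U, ContinuousOn (fun t => h (t, z)) (Icc 0 1) :=
    fun z hz => hc.comp (slice z hz) (maps z hz)
  refine (intervalIntegral.hasFDerivAt_integral_of_dominated_of_fderiv_le (s := V)
    (F := fun y t => h (t, y))
    (F' := fun y t => (fderiv ℝ h (t, y)).comp (ContinuousLinearMap.inr ℝ ℝ E))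
    (bound := fun _ => C + 1) (hVo.mem_nhds hyV) ?_ ?_ ?_ ?_ ?_ ?_)
  · filter_upwards [hVo.mem_nhds hyV] with z hz
    exact ((cont z (hVU hz)).mono uI).aestronglyMeasurable measurableSet_uIoc
  · exact (cont y hy).intervalIntegrable_of_Icc zero_le_one
  · exact (((hd.comp (slice y hy) (maps y hy))).mono uI).aestronglyMeasurable measurableSet_uIoc
  · exact Filter.Eventually.of_forall fun t ht z hz => hVC t (uI ht) z hz
  · exact intervalIntegrable_const
  · refine Filter.Eventually.of_forall fun t ht z hz => ?_
    have h1 : HasFDerivAt h (fderiv ℝ h (t, z)) (t, z) :=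
      ((hh.contDiffAt (hWU.mem_nhds ⟨h01 (uI ht), hVU hz⟩)).differentiableAt
        (by simp)).hasFDerivAt
    exact h1.comp z (hasFDerivAt_prodMk_right t z)

/-- The derivative is an integral of the same kind with values in `E →L[ℝ] F`, so the order of
differentiability rises by induction, with `F` generalized. -/
theorem contDiffOn_integral_param [CompleteSpace F] {W : Set ℝ} {U : Set E} (hW : IsOpen W)
    (hU : IsOpen U) (h01 : Icc 0 1 ⊆ W) {h : ℝ × E → F} (hh : ContDiffOn ℝ ∞ h (W ×ˢ U)) :
    ContDiffOn ℝ ∞ (fun y => ∫ t in (0 : ℝ)..1, h (t, y)) U := by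
  rw [contDiffOn_infty]
  intro n
  induction n generalizing F with
  | zero =>
    refine contDiffOn_zero.2 fun y hy => ?_
    exact (hasFDerivAt_integral_param hW hU h01 (hh.of_le (by simp)) hy).continuousAt.continuousWithinAt
  | succ n ih =>
    have hd := fun y hy =>
      hasFDerivAt_integral_param (y := y) hW hU h01 (hh.of_le (by simp)) hy
    push_cast
    rw [contDiffOn_succ_iff_fderiv_of_isOpen hU]
    refine ⟨fun y hy => (hd y hy).differentiableAt.differentiableWithinAt, by simp, ?_⟩
    refine (ih (h := fun p => (fderiv ℝ h p).comp (ContinuousLinearMap.inr ℝ ℝ E)) ?_).congr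
      fun y hy => (hd y hy).fderiv
    have := hh.fderiv_of_isOpen (hW.prod hU) (m := ∞) (by simp)
    exact this.clm_comp contDiffOn_const

theorem fderiv_integral_param_apply [CompleteSpace F] {W : Set ℝ} {U : Set E} (hW : IsOpen W)
    (hU : IsOpen U) (h01 : Icc 0 1 ⊆ W) {h : ℝ × E → F} (hh : ContDiffOn ℝ 1 h (W ×ˢ U)) {y : E}
    (hy : y ∈ U) (u : E) :
    fderiv ℝ (fun y => ∫ t in (0 : ℝ)..1, h (t, y)) y u
      = ∫ t in (0 : ℝ)..1, fderiv ℝ (fun z => h (t, z)) y u ∧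
    ContinuousOn (fun t => fderiv ℝ (fun z => h (t, z)) y u) (Icc 0 1) := by
  have hWU : IsOpen (W ×ˢ U) := hW.prod hU
  have e : ∀ t ∈ Icc (0 : ℝ) 1, fderiv ℝ (fun z => h (t, z)) y
      = (fderiv ℝ h (t, y)).comp (ContinuousLinearMap.inr ℝ ℝ E) := fun t ht =>
    (((hh.contDiffAt (hWU.mem_nhds ⟨h01 ht, hy⟩)).differentiableAt
      (by simp)).hasFDerivAt.comp y (hasFDerivAt_prodMk_right t y)).fderiv
  have hd : ContinuousOn (fun t => (fderiv ℝ h (t, y)).comp (ContinuousLinearMap.inr ℝ ℝ E))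
      (Icc 0 1) := by
    have h1 := hh.continuousOn_fderiv_of_isOpen hWU le_rfl
    have h2 : ContinuousOn (fun t => fderiv ℝ h (t, y)) (Icc (0 : ℝ) 1) :=
      h1.comp (f := fun t : ℝ => (t, y)) (by fun_prop) fun t ht => ⟨h01 ht, hy⟩
    fun_prop
  constructor
  · rw [(hasFDerivAt_integral_param hW hU h01 hh hy).fderiv,
      ContinuousLinearMap.intervalIntegral_apply
        (hd.intervalIntegrable_of_Icc zero_le_one)]
    refine intervalIntegral.integral_congr fun t ht => ?_
    rw [uIcc_of_le zero_le_one] at ht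
    simp only [e t ht]
  · refine ContinuousOn.congr (hd.clm_apply (continuousOn_const (c := u))) fun t ht => ?_
    simp only [e t ht]

/-- The Poincaré lemma for `2`-forms on balls. -/
theorem exists_primitive_twoForm {r : ℝ} {w : E → E →L[ℝ] E →L[ℝ] ℝ}
    (hw : ContDiffOn ℝ ∞ w (Metric.ball 0 r))
    (alt : ∀ p ∈ Metric.ball (0 : E) r, ∀ u v, w p u v = -w p v u)
    (closed : ∀ p ∈ Metric.ball (0 : E) r, ∀ u v z,
      fderiv ℝ w p u v z + fderiv ℝ w p v z u + fderiv ℝ w p z u v = 0) :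
    ∃ α : E → E →L[ℝ] ℝ, ContDiffOn ℝ ∞ α (Metric.ball 0 (r / 2)) ∧
      ∀ p ∈ Metric.ball (0 : E) (r / 2), ∀ u v,
        fderiv ℝ α p u v - fderiv ℝ α p v u = w p u v := by
  -- The parameter runs over an open interval around [0, 1] on which |t| ≤ 2; this costs the factor
  -- 2 in the radius.
  have key : ∀ t ∈ Ioo (-1 : ℝ) 2, ∀ y ∈ Metric.ball (0 : E) (r / 2),
      t • y ∈ Metric.ball (0 : E) r := by
    intro t ht y hy
    rw [mem_ball_zero_iff] at hy ⊢
    rw [norm_smul, Real.norm_eq_abs]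
    have : |t| ≤ 2 := abs_le.2 ⟨by linarith [ht.1], ht.2.le⟩
    nlinarith [norm_nonneg y]
  have h01 : Icc (0 : ℝ) 1 ⊆ Ioo (-1) 2 := fun t ht => ⟨by linarith [ht.1], by linarith [ht.2]⟩
  -- The radial homotopy operator: the primitive at y is ∫ t · w(ty)(y, ·) dt.
  set h : ℝ × E → (E →L[ℝ] ℝ) := fun p => p.1 • w (p.1 • p.2) p.2 with hdef
  have hh : ContDiffOn ℝ ∞ h (Ioo (-1) 2 ×ˢ Metric.ball 0 (r / 2)) := by
    have h1 : ContDiffOn ℝ ∞ (fun p : ℝ × E => w (p.1 • p.2))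
        (Ioo (-1) 2 ×ˢ Metric.ball 0 (r / 2)) :=
      hw.comp (f := fun p : ℝ × E => p.1 • p.2) (by fun_prop) fun p hp => key _ hp.1 _ hp.2
    exact contDiffOn_fst.smul (h1.clm_apply contDiffOn_snd)
  refine ⟨fun y => ∫ t in (0 : ℝ)..1, h (t, y),
    contDiffOn_integral_param isOpen_Ioo Metric.isOpen_ball h01 hh, fun y hy u v => ?_⟩
  have wd : ∀ t ∈ Icc (0 : ℝ) 1, HasFDerivAt w (fderiv ℝ w (t • y)) (t • y) := fun t ht =>
    ((hw.contDiffAt (Metric.isOpen_ball.mem_nhds (key t (h01 ht) y hy))).differentiableAt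
      (by simp)).hasFDerivAt
  have D : ∀ t ∈ Icc (0 : ℝ) 1, ∀ u v, fderiv ℝ (fun z => h (t, z)) y u v
      = t * (t * fderiv ℝ w (t • y) u y v + w (t • y) u v) := by
    intro t ht u v
    have h1 : HasFDerivAt (fun z : E => w (t • z)) ((fderiv ℝ w (t • y)).comp
        (t • ContinuousLinearMap.id ℝ E)) y := by
      have h0 : HasFDerivAt (fun z : E => t • z) (t • ContinuousLinearMap.id ℝ E) y :=
        (hasFDerivAt_id y).const_smul t
      exact HasFDerivAt.comp (g := w) (g' := fderiv ℝ w (t • y)) y (by exact wd t ht) h0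
    have h2 := ((h1.clm_apply (hasFDerivAt_id y)).const_smul t)
    rw [show (fun z => h (t, z)) = t • fun z => (w (t • z)) (id z) from rfl, h2.fderiv]
    simp
    ring
  have C := fun u => fderiv_integral_param_apply isOpen_Ioo Metric.isOpen_ball h01
    (hh.of_le (by simp)) hy u
  have I : ∀ u v, (fderiv ℝ (fun y => ∫ t in (0 : ℝ)..1, h (t, y)) y u) v
      = ∫ t in (0 : ℝ)..1, fderiv ℝ (fun z => h (t, z)) y u v := fun u v => by
    rw [(C u).1, ContinuousLinearMap.intervalIntegral_apply
      ((C u).2.intervalIntegrable_of_Icc zero_le_one)]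
  have J : ∀ u v, IntervalIntegrable (fun t => fderiv ℝ (fun z => h (t, z)) y u v) volume 0 1 :=
    fun u v => ((C u).2.clm_apply continuousOn_const).intervalIntegrable_of_Icc zero_le_one
  rw [I, I, ← intervalIntegral.integral_sub (J u v) (J v u)]
  -- Closedness and antisymmetry turn the integrand of dα into the t-derivative of t² w(ty)(u, v).
  rw [intervalIntegral.integral_eq_sub_of_hasDerivAt
    (f := fun t => t ^ 2 * w (t • y) u v) (fun t ht => ?_) ((J u v).sub (J v u))]
  · simp
  · rw [uIcc_of_le zero_le_one] at ht
    have h1 : HasDerivAt (fun t : ℝ => w (t • y)) (fderiv ℝ w (t • y) y) t := by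
      have h2 : HasDerivAt (fun t : ℝ => t • y) y t := by
        simpa using (hasDerivAt_id t).smul_const y
      exact HasFDerivAt.comp_hasDerivAt (l := w) (f := fun t : ℝ => t • y) t (wd t ht) h2
    have h2 : HasDerivAt (fun t : ℝ => w (t • y) u v) (fderiv ℝ w (t • y) y u v) t := by
      have := (h1.clm_apply (hasDerivAt_const t u)).clm_apply (hasDerivAt_const t v)
      simpa using this
    refine (((hasDerivAt_id t).pow 2).mul h2).congr_deriv ?_
    rw [D t ht, D t ht]
    have hp := key t (h01 ht) y hy
    have a1 : ∀ a b c, fderiv ℝ w (t • y) a b c = -fderiv ℝ w (t • y) a c b := by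
      intro a b c
      have e : (fun p => w p b c) =ᶠ[𝓝 (t • y)] fun p => -w p c b :=
        Filter.eventually_of_mem (Metric.isOpen_ball.mem_nhds hp) fun p hp => alt p hp b c
      have h3 := fun b c => ((wd t ht).clm_apply (hasFDerivAt_const b (t • y))).clm_apply
        (hasFDerivAt_const c (t • y))
      have h4 := (h3 b c).unique ((h3 c b).neg.congr_of_eventuallyEq e)
      simpa using DFunLike.congr_fun h4 a
    have a2 := alt _ hp u v
    have a3 := closed _ hp u v y
    have a4 := a1 u y v
    simp only [id, Pi.pow_apply]
    linear_combination (t ^ 2) * a3 - t ^ 2 * a4 + t * a2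

end Calculus

/-! ### Fibrewise primitives and conjugate coordinates. -/

section Lagrangian

open Set MeasureTheory

variable {E F : Type} [NormedAddCommGroup E] [NormedSpace ℝ E] [NormedAddCommGroup F]
  [NormedSpace ℝ F]

/-- A `1`-form on a ball in a product, closed along the second factor, has a primitive along the
second factor. -/
theorem exists_fibrewise_primitive {r : ℝ} {α : E × F → (E × F) →L[ℝ] ℝ}
    (hα : ContDiffOn ℝ ∞ α (Metric.ball 0 r))
    (closed : ∀ p ∈ Metric.ball (0 : E × F) r, ∀ u v : F,
      fderiv ℝ α p (0, u) (0, v) = fderiv ℝ α p (0, v) (0, u)) :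
    ∃ S : E × F → ℝ, ContDiffOn ℝ ∞ S (Metric.ball 0 (r / 2)) ∧
      ∀ p ∈ Metric.ball (0 : E × F) (r / 2), ∀ v : F, fderiv ℝ S p (0, v) = α p (0, v) := by
  have key : ∀ t ∈ Ioo (-1 : ℝ) 2, ∀ y ∈ Metric.ball (0 : E × F) (r / 2),
      (y.1, t • y.2) ∈ Metric.ball (0 : E × F) r := by
    intro t ht y hy
    rw [mem_ball_zero_iff] at hy ⊢
    have h1 := (norm_fst_le y).trans_lt hy
    have h2 := (norm_snd_le y).trans_lt hy
    rw [Prod.norm_mk, norm_smul, Real.norm_eq_abs]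
    have : |t| ≤ 2 := abs_le.2 ⟨by linarith [ht.1], ht.2.le⟩
    exact max_lt (by linarith [norm_nonneg y.1]) (by nlinarith [norm_nonneg y.2])
  have h01 : Icc (0 : ℝ) 1 ⊆ Ioo (-1) 2 := fun t ht => ⟨by linarith [ht.1], by linarith [ht.2]⟩
  -- The primitive at (x, y) is the integral of α along the vertical segment from (x, 0), so only
  -- closedness in vertical directions matters.
  set h : ℝ × (E × F) → ℝ := fun p => α (p.2.1, p.1 • p.2.2) (0, p.2.2) with hdef
  have hh : ContDiffOn ℝ ∞ h (Ioo (-1) 2 ×ˢ Metric.ball 0 (r / 2)) := by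
    have h1 : ContDiffOn ℝ ∞ (fun p : ℝ × (E × F) => α (p.2.1, p.1 • p.2.2))
        (Ioo (-1) 2 ×ˢ Metric.ball 0 (r / 2)) :=
      hα.comp (f := fun p : ℝ × (E × F) => (p.2.1, p.1 • p.2.2)) (by fun_prop)
        fun p hp => key _ hp.1 _ hp.2
    exact h1.clm_apply (by fun_prop)
  refine ⟨fun y => ∫ t in (0 : ℝ)..1, h (t, y),
    contDiffOn_integral_param isOpen_Ioo Metric.isOpen_ball h01 hh, fun y hy v => ?_⟩
  have ad : ∀ t ∈ Icc (0 : ℝ) 1,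
      HasFDerivAt α (fderiv ℝ α (y.1, t • y.2)) (y.1, t • y.2) := fun t ht =>
    ((hα.contDiffAt (Metric.isOpen_ball.mem_nhds (key t (h01 ht) y hy))).differentiableAt
      (by simp)).hasFDerivAt
  have D : ∀ t ∈ Icc (0 : ℝ) 1, fderiv ℝ (fun z => h (t, z)) y (0, v)
      = t * fderiv ℝ α (y.1, t • y.2) (0, v) (0, y.2) + α (y.1, t • y.2) (0, v) := by
    intro t ht
    have h0 : HasFDerivAt (fun z : E × F => (z.1, t • z.2)) ((ContinuousLinearMap.fst ℝ E F).prod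
        (t • ContinuousLinearMap.snd ℝ E F)) y :=
      hasFDerivAt_fst.prodMk (hasFDerivAt_snd.const_smul t)
    have h1 : HasFDerivAt (fun z : E × F => α (z.1, t • z.2)) ((fderiv ℝ α (y.1, t • y.2)).comp
        ((ContinuousLinearMap.fst ℝ E F).prod (t • ContinuousLinearMap.snd ℝ E F))) y :=
      HasFDerivAt.comp (g := α) (g' := fderiv ℝ α (y.1, t • y.2)) y (by exact ad t ht) h0
    have h3 : HasFDerivAt (fun z : E × F => ((0 : E), z.2))
        ((0 : E × F →L[ℝ] E).prod (ContinuousLinearMap.snd ℝ E F)) y :=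
      (hasFDerivAt_const _ _).prodMk hasFDerivAt_snd
    have h2 := h1.clm_apply h3
    rw [show (fun z => h (t, z)) = fun z : E × F => (α (z.1, t • z.2)) (0, z.2) from rfl, h2.fderiv]
    have e : ((0 : E), t • v) = t • ((0 : E), v) := by simp
    simp only [add_apply, ContinuousLinearMap.comp_apply, ContinuousLinearMap.flip_apply,
      ContinuousLinearMap.prod_apply, ContinuousLinearMap.coe_fst', ContinuousLinearMap.coe_snd',
      smul_apply, zero_apply, e, map_smul, smul_eq_mul]
    ring
  have C := fderiv_integral_param_apply isOpen_Ioo Metric.isOpen_ball h01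
    (hh.of_le (by simp)) hy (0, v)
  -- By vertical closedness the integrand is the t-derivative of t · α(x, ty)(0, v).
  rw [C.1, intervalIntegral.integral_eq_sub_of_hasDerivAt
    (f := fun t => t * α (y.1, t • y.2) (0, v)) (fun t ht => ?_)
    (C.2.intervalIntegrable_of_Icc zero_le_one)]
  · simp
  · rw [uIcc_of_le zero_le_one] at ht
    have h1 : HasDerivAt (fun t : ℝ => α (y.1, t • y.2))
        (fderiv ℝ α (y.1, t • y.2) (0, y.2)) t := by
      have h2 : HasDerivAt (fun t : ℝ => (y.1, t • y.2)) (0, y.2) t := by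
        simpa using (hasDerivAt_const t y.1).prodMk ((hasDerivAt_id t).smul_const y.2)
      exact HasFDerivAt.comp_hasDerivAt (l := α) (f := fun t : ℝ => (y.1, t • y.2)) t (ad t ht) h2
    have h2 : HasDerivAt (fun t : ℝ => α (y.1, t • y.2) (0, v))
        (fderiv ℝ α (y.1, t • y.2) (0, y.2) (0, v)) t := by
      have := h1.clm_apply (hasDerivAt_const t ((0 : E), v))
      simpa using this
    refine ((hasDerivAt_id t).mul h2).congr_deriv ?_
    rw [D t ht, closed _ (key t (h01 ht) y hy) v y.2]
    simp only [id]
    ring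

variable {n : ℕ}

/-- The vector representing a covector for the Euclidean inner product. -/
def vecOf : (Eucl n →L[ℝ] ℝ) →L[ℝ] Eucl n :=
  LinearMap.toContinuousLinearMap
    { toFun := fun l => ∑ k, l (EuclideanSpace.single k 1) • EuclideanSpace.single k (1 : ℝ)
      map_add' := fun l l' => by simp [add_smul, Finset.sum_add_distrib]
      map_smul' := fun c l => by simp [Finset.smul_sum, smul_smul] }

@[simp] theorem vecOf_apply (l : Eucl n →L[ℝ] ℝ) (k : Fin n) :
    vecOf l k = l (EuclideanSpace.single k 1) := by
  simp [vecOf, Pi.single_apply]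

theorem inner_vecOf (l : Eucl n →L[ℝ] ℝ) (v : Eucl n) : inner ℝ (vecOf l) v = l v := by
  have hv : v = ∑ k, v k • EuclideanSpace.single k (1 : ℝ) := by
    ext j
    simp [Pi.single_apply]
  conv_rhs => rw [hv]
  simp [PiLp.inner_apply, map_sum]

/-- The standard symplectic form on `ℝⁿ × ℝⁿ`. -/
def stdForm (u v : Eucl n × Eucl n) : ℝ := inner ℝ u.1 v.2 - inner ℝ v.1 u.2

theorem stdForm_eq_sum (u v : Eucl n × Eucl n) :
    stdForm u v = ∑ k, (u.1 k * v.2 k - v.1 k * u.2 k) := by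
  simp [stdForm, PiLp.inner_apply, Finset.sum_sub_distrib, mul_comm]

theorem stdForm_nondegenerate {u : Eucl n × Eucl n} (h : ∀ v, stdForm u v = 0) : u = 0 := by
  have h1 := h (0, u.1)
  have h2 := h (u.2, 0)
  simp [stdForm] at h1 h2
  exact Prod.ext h1 h2

/-- A closed `2`-form near `0` in `ℝⁿ × ℝⁿ` for which the fibres of the first projection are
isotropic is of the form `∑ dc_k ∧ dq_k`. -/
theorem exists_conjugate_coordinates {r : ℝ} (hr : 0 < r)
    {w : Eucl n × Eucl n → (Eucl n × Eucl n) →L[ℝ] (Eucl n × Eucl n) →L[ℝ] ℝ}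
    (hw : ContDiffOn ℝ ∞ w (Metric.ball 0 r))
    (alt : ∀ p ∈ Metric.ball (0 : Eucl n × Eucl n) r, ∀ u v, w p u v = -w p v u)
    (closed : ∀ p ∈ Metric.ball (0 : Eucl n × Eucl n) r, ∀ u v z,
      fderiv ℝ w p u v z + fderiv ℝ w p v z u + fderiv ℝ w p z u v = 0)
    (isotropic : ∀ p ∈ Metric.ball (0 : Eucl n × Eucl n) r, ∀ u v, w p (0, u) (0, v) = 0) :
    ∃ r' > 0, r' ≤ r ∧ ∃ q : Eucl n × Eucl n → Eucl n, ContDiffOn ℝ ∞ q (Metric.ball 0 r') ∧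
      ∀ p ∈ Metric.ball (0 : Eucl n × Eucl n) r', ∀ u v,
        w p u v = stdForm (u.1, fderiv ℝ q p u) (v.1, fderiv ℝ q p v) := by
  obtain ⟨α, hα, dα⟩ := exists_primitive_twoForm hw alt closed
  have sub1 : Metric.ball (0 : Eucl n × Eucl n) (r / 2) ⊆ Metric.ball 0 r :=
    Metric.ball_subset_ball (by linarith)
  have sub2 : Metric.ball (0 : Eucl n × Eucl n) (r / 2 / 2) ⊆ Metric.ball 0 (r / 2) :=
    Metric.ball_subset_ball (by linarith)
  -- Isotropy says that α is closed along the fibres. Then α - dS still has exterior derivative w,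
  -- but vanishes on vertical vectors.
  obtain ⟨S, hS, dS⟩ := exists_fibrewise_primitive hα fun p hp u v => by
    have := dα p hp (0, u) (0, v)
    rw [isotropic p (sub1 hp)] at this
    linarith
  set β : Eucl n × Eucl n → (Eucl n × Eucl n) →L[ℝ] ℝ := fun p => α p - fderiv ℝ S p with hβ
  have hSd : ContDiffOn ℝ ∞ (fderiv ℝ S) (Metric.ball 0 (r / 2 / 2)) :=
    hS.fderiv_of_isOpen Metric.isOpen_ball (by simp)
  have hβs : ContDiffOn ℝ ∞ β (Metric.ball 0 (r / 2 / 2)) := (hα.mono sub2).sub hSd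
  -- Writing β = ∑ β_k dc_k gives w = ∑ dβ_k ∧ dc_k = ∑ dc_k ∧ d(-β_k), so q_k = -β_k; hence the
  -- sign.
  let R : ((Eucl n × Eucl n) →L[ℝ] ℝ) →L[ℝ] Eucl n :=
    -(vecOf.comp ((ContinuousLinearMap.compL ℝ (Eucl n) (Eucl n × Eucl n) ℝ).flip
      (ContinuousLinearMap.inl ℝ (Eucl n) (Eucl n))))
  refine ⟨r / 2 / 2, by positivity, by linarith, fun p => R (β p),
    R.contDiff.comp_contDiffOn hβs, fun p hp u v => ?_⟩
  have nh := Metric.isOpen_ball.mem_nhds hp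
  have bd : HasFDerivAt β (fderiv ℝ β p) p :=
    ((hβs.contDiffAt nh).differentiableAt (by simp)).hasFDerivAt
  have qd : fderiv ℝ (fun p => R (β p)) p = R.comp (fderiv ℝ β p) :=
    (R.hasFDerivAt.comp p bd).fderiv
  have e1 : fderiv ℝ β p = fderiv ℝ α p - fderiv ℝ (fderiv ℝ S) p := by
    refine fderiv_sub ?_ ?_
    · exact ((hα.mono sub2).contDiffAt nh).differentiableAt (by simp)
    · exact (hSd.contDiffAt nh).differentiableAt (by simp)
  have sym : fderiv ℝ (fderiv ℝ S) p u v = fderiv ℝ (fderiv ℝ S) p v u :=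
    (hS.contDiffAt nh).isSymmSndFDerivAt (by
      rw [minSmoothness_of_isRCLikeNormedField]
      exact WithTop.coe_le_coe.2 (le_top (a := (2 : ℕ∞)))) u v
  have vert : ∀ u v, fderiv ℝ β p u (0, v) = 0 := by
    intro u v
    have h1 : HasFDerivAt (fun p => β p (0, v)) _ p := bd.clm_apply (hasFDerivAt_const (0, v) p)
    have h2 : (fun p => β p (0, v)) =ᶠ[𝓝 p] fun _ => 0 :=
      Filter.eventually_of_mem nh fun z hz => by simp [hβ, dS z hz v]
    have h3 := h1.unique ((hasFDerivAt_const (0 : ℝ) p).congr_of_eventuallyEq h2)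
    simpa using DFunLike.congr_fun h3 u
  have hR : ∀ (l : (Eucl n × Eucl n) →L[ℝ] ℝ) (x : Eucl n), inner ℝ x (R l) = -l (x, 0) := by
    intro l x
    simp only [R, neg_apply, inner_neg_right]
    rw [real_inner_comm, ContinuousLinearMap.comp_apply, inner_vecOf]
    simp
  have hor : ∀ u v : Eucl n × Eucl n, fderiv ℝ β p u (v.1, 0) = fderiv ℝ β p u v := by
    intro u v
    conv_rhs => rw [show v = (v.1, 0) + (0, v.2) by simp, map_add, vert, add_zero]
  rw [← dα p (sub2 hp), qd, stdForm]
  simp only [ContinuousLinearMap.comp_apply]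
  rw [hR, hR, hor, hor, e1]
  simp only [sub_apply]
  linarith

end Lagrangian

/-! ### Differentials in charts and the inverse function theorem. -/

section LocalDiffeomorphisms

open Set

variable {d : ℕ} {X : Type*} [TopologicalSpace X] [ChartedSpace (Eucl d) X]
  {W : Type} [NormedAddCommGroup W] [NormedSpace ℝ W]

/-- The chart at a point, as a partial diffeomorphism from the model space. -/
def chartParam [IsManifold (𝓡 d) ∞ X] (x : X) :
    PartialDiffeomorph 𝓘(ℝ, Eucl d) (𝓡 d) (Eucl d) X ∞ where
  toPartialEquiv := (extChartAt (𝓡 d) x).symm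
  open_source := isOpen_extChartAt_target x
  open_target := isOpen_extChartAt_source x
  contMDiffOn_toFun := contMDiffOn_extChartAt_symm x
  contMDiffOn_invFun := by
    rw [PartialEquiv.symm_target, extChartAt_source]
    exact contMDiffOn_extChartAt

variable (d) in
/-- The differential of a map from a normed space to a manifold, as a linear map between the model
spaces. -/
def mder (g : W → X) (w : W) : W →L[ℝ] Eucl d := mfderiv 𝓘(ℝ, W) (𝓡 d) g w

theorem mder_eq_fderiv_chart {g : W → X} {w : W}
    (hg : MDifferentiableAt 𝓘(ℝ, W) (𝓡 d) g w) :
    mder d g w = fderiv ℝ (fun z => extChartAt (𝓡 d) (g w) (g z)) w := by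
  have h1 := hg.mfderiv
  have h2 : fderivWithin ℝ (writtenInExtChartAt 𝓘(ℝ, W) (𝓡 d) w g) (range 𝓘(ℝ, W))
      (extChartAt 𝓘(ℝ, W) w w) = fderiv ℝ (fun z => extChartAt (𝓡 d) (g w) (g z)) w := by
    simp [writtenInExtChartAt, Function.comp_def, chartAt_self_eq]
  exact Eq.trans h1 h2

theorem mder_comp {W' : Type} [NormedAddCommGroup W'] [NormedSpace ℝ W'] {g : W → X} {k : W' → W}
    {x : W'} (hg : MDifferentiableAt 𝓘(ℝ, W) (𝓡 d) g (k x)) (hk : DifferentiableAt ℝ k x) :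
    mder d (g ∘ k) x = (mder d g (k x)).comp (fderiv ℝ k x) := by
  have h := mfderiv_comp x hg hk.mdifferentiableAt
  have h' : mfderiv 𝓘(ℝ, W') 𝓘(ℝ, W) k x = fderiv ℝ k x := mfderiv_eq_fderiv
  refine Eq.trans h ?_
  exact congrArg (fun L : W' →L[ℝ] W => (mder d g (k x)).comp L) h'

theorem mder_congr {g g' : W → X} {x : W} (h : g =ᶠ[𝓝 x] g') : mder d g x = mder d g' x :=
  h.mfderiv_eq

/-- The inverse function theorem, with control of the source. -/
theorem exists_partialDiffeomorph {E : Type} [NormedAddCommGroup E] [NormedSpace ℝ E]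
    [FiniteDimensional ℝ E] [FiniteDimensional ℝ W]
    (hd : Module.finrank ℝ W = Module.finrank ℝ E) {k : W → E} {w : W} {O : Set W} (hO : IsOpen O)
    (hwO : w ∈ O) (ks : ContDiffOn ℝ ∞ k O) (inj : Function.Injective (fderiv ℝ k w)) :
    ∃ Φ : PartialDiffeomorph 𝓘(ℝ, W) 𝓘(ℝ, E) W E ∞, w ∈ Φ.source ∧ Φ.source ⊆ O ∧
      ∀ z, Φ z = k z := by
  have kw := ks.contDiffAt (hO.mem_nhds hwO)
  have : CompleteSpace W := FiniteDimensional.complete ℝ W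
  let L : W ≃L[ℝ] E := (LinearEquiv.ofInjectiveOfFinrankEq (fderiv ℝ k w).toLinearMap inj
    hd).toContinuousLinearEquiv
  have hL : (L : W →L[ℝ] E) = fderiv ℝ k w := by ext; rfl
  have kd : HasFDerivAt k (L : W →L[ℝ] E) w := by
    rw [hL]; exact (kw.differentiableAt (by simp)).hasFDerivAt
  -- Invertibility of the derivative is an open condition. Restricting to where it holds makes the
  -- inverse smooth on its whole domain, not merely at the image of w.
  have hinv : ∀ᶠ z in 𝓝 w, fderiv ℝ k z ∈ range ((↑) : (W ≃L[ℝ] E) → W →L[ℝ] E) := by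
    have c := (ks.continuousOn_fderiv_of_isOpen hO (by simp)).continuousAt (hO.mem_nhds hwO)
    refine c.preimage_mem_nhds ?_
    rw [← hL]
    exact ContinuousLinearEquiv.nhds L
  obtain ⟨O', hO'sub, hO', hwO'⟩ := mem_nhds_iff.1 (Filter.inter_mem (hO.mem_nhds hwO) hinv)
  let e := (kw.toOpenPartialHomeomorph k kd (by simp)).restrOpen O' hO'
  have hes : ∀ z ∈ e.source, z ∈ O' := fun z hz => by
    simp only [e, OpenPartialHomeomorph.restrOpen_source] at hz; exact hz.2
  refine ⟨{ toPartialEquiv := e.toPartialEquiv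
            open_source := e.open_source
            open_target := e.open_target
            contMDiffOn_toFun := ?_
            contMDiffOn_invFun := ?_ }, ⟨kw.mem_toOpenPartialHomeomorph_source kd (by simp), hwO'⟩,
    fun z hz => (hO'sub (hes z hz)).1, fun z => rfl⟩
  · rw [contMDiffOn_iff_contDiffOn]
    exact ks.mono fun z hz => (hO'sub (hes z hz)).1
  · rw [contMDiffOn_iff_contDiffOn]
    intro y hy
    have hz := hes _ (e.map_target hy)
    obtain ⟨L', hL'⟩ := (hO'sub hz).2
    have ck := ks.contDiffAt (hO.mem_nhds (hO'sub hz).1)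
    refine (e.contDiffAt_symm (f₀' := L') hy ?_ ck).contDiffWithinAt
    rw [hL']
    exact (ck.differentiableAt (by simp)).hasFDerivAt

/-- The inverse function theorem for maps from a normed space to a manifold. -/
theorem isLocalDiffeomorphAt_of_injective [IsManifold (𝓡 d) ∞ X] [FiniteDimensional ℝ W]
    (hd : Module.finrank ℝ W = d) {g : W → X} {w : W} {U : Set W} (hU : U ∈ 𝓝 w)
    (hg : ContMDiffOn 𝓘(ℝ, W) (𝓡 d) ∞ g U)
    (inj : Function.Injective (mder d g w)) :
    ∃ Φ : PartialDiffeomorph 𝓘(ℝ, W) (𝓡 d) W X ∞, w ∈ Φ.source ∧ Φ.source ⊆ U ∧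
      ∀ z ∈ Φ.source, Φ z = g z := by
  have hgw : ContMDiffAt 𝓘(ℝ, W) (𝓡 d) ∞ g w := hg.contMDiffAt hU
  obtain ⟨O, hOU, hO, hwO⟩ := mem_nhds_iff.1 (Filter.inter_mem hU
    (hgw.continuousAt.preimage_mem_nhds (extChartAt_source_mem_nhds (I := 𝓡 d) (g w))))
  have ks : ContDiffOn ℝ ∞ (fun z => extChartAt (𝓡 d) (g w) (g z)) O := by
    rw [← contMDiffOn_iff_contDiffOn]
    exact contMDiffOn_extChartAt.comp (hg.mono fun z hz => (hOU hz).1) fun z hz => by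
      simpa using (hOU hz).2
  rw [mder_eq_fderiv_chart (hgw.mdifferentiableAt (by simp))] at inj
  obtain ⟨Φ, hw, hsub, hΦ⟩ := exists_partialDiffeomorph (by simpa using hd) hO hwO ks inj
  refine ⟨Φ.trans (chartParam (g w)), ⟨hw, ?_⟩, fun z hz => (hOU (hsub hz.1)).1, ?_⟩
  · change Φ w ∈ (extChartAt (𝓡 d) (g w)).target
    rw [hΦ]
    exact mem_extChartAt_target (I := 𝓡 d) (g w)
  · intro z hz
    change (extChartAt (𝓡 d) (g w)).symm (Φ z) = g z
    rw [hΦ]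
    exact (extChartAt (𝓡 d) (g w)).left_inv (hOU (hsub hz.1)).2

theorem PartialDiffeomorph.mder_bijective (Φ : PartialDiffeomorph 𝓘(ℝ, W) (𝓡 d) W X ∞) {w : W}
    (hw : w ∈ Φ.source) : Function.Bijective (mder d Φ w) :=
  ((PartialDiffeomorph.isLocalDiffeomorphAt _ _ _ Φ hw).mfderivToContinuousLinearEquiv
    (by simp)).bijective

end LocalDiffeomorphisms

/-! ### Pullbacks of symplectic forms. -/

section Pullback

open Set

variable {m : ℕ} {M : Type*} [TopologicalSpace M] [ChartedSpace (Eucl m) M]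
  {W W' : Type} [NormedAddCommGroup W] [NormedSpace ℝ W] [NormedAddCommGroup W'] [NormedSpace ℝ W']

/-- The value of a symplectic form at a point, as a bilinear form on the model space. -/
def SymplecticForm.at (Ω : SymplecticForm m M) (x : M) : Eucl m →L[ℝ] Eucl m →L[ℝ] ℝ := Ω.form x

theorem SymplecticForm.at_self (Ω : SymplecticForm m M) (x : M) (u : Eucl m) : Ω.at x u u = 0 :=
  Ω.alternating x u

theorem SymplecticForm.antisymm (Ω : SymplecticForm m M) (x : M) (u v : Eucl m) :
    Ω.at x u v = -Ω.at x v u := by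
  have h := Ω.at_self x (u + v)
  simp only [map_add, add_apply, Ω.at_self] at h
  linarith

/-- The pullback of a symplectic form by a map from a normed space. -/
def pullbackTwo (Ω : SymplecticForm m M) (g : W → M) (x u v : W) : ℝ :=
  Ω.at (g x) (mder m g x u) (mder m g x v)

theorem pullbackTwo_comp (Ω : SymplecticForm m M) {g : W → M} {k : W' → W} {x : W'}
    (hg : MDifferentiableAt 𝓘(ℝ, W) (𝓡 m) g (k x)) (hk : DifferentiableAt ℝ k x) (u v : W') :
    pullbackTwo Ω (g ∘ k) x u v = pullbackTwo Ω g (k x) (fderiv ℝ k x u) (fderiv ℝ k x v) := by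
  rw [pullbackTwo, mder_comp hg hk]
  rfl

theorem pullbackTwo_congr (Ω : SymplecticForm m M) {g g' : W → M} {x : W} (h : g =ᶠ[𝓝 x] g')
    (u v : W) : pullbackTwo Ω g x u v = pullbackTwo Ω g' x u v := by
  rw [pullbackTwo, pullbackTwo, mder_congr h, h.eq_of_nhds]

/-- The pullback of a smooth closed `2`-form by a smooth map is smooth and closed. -/
theorem exists_pullback_closed {E : Type} [NormedAddCommGroup E] [NormedSpace ℝ E] {V : Set E}
    (hV : IsOpen V) {B : E → E →L[ℝ] E →L[ℝ] ℝ} (Bs : ContDiffOn ℝ ∞ B V)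
    (anti : ∀ y a b, B y a b = -B y b a)
    (Bc : ∀ y ∈ V, ∀ u v z, fderiv ℝ B y u v z + fderiv ℝ B y v z u + fderiv ℝ B y z u v = 0)
    {k : W → E} {U : Set W} (hU : IsOpen U) (hk : ContDiffOn ℝ ∞ k U) (maps : MapsTo k U V) :
    ∃ w : W → W →L[ℝ] W →L[ℝ] ℝ, ContDiffOn ℝ ∞ w U ∧
      (∀ p u v, w p u v = B (k p) (fderiv ℝ k p u) (fderiv ℝ k p v)) ∧
      ∀ p ∈ U, ∀ u v z,
        fderiv ℝ w p u v z + fderiv ℝ w p v z u + fderiv ℝ w p z u v = 0 := by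
  obtain ⟨D, hD⟩ : ∃ D, D = fderiv ℝ k := ⟨_, rfl⟩
  have Ds : ContDiffOn ℝ ∞ D U := hD ▸ hk.fderiv_of_isOpen hU (by simp)
  let w : W → W →L[ℝ] W →L[ℝ] ℝ := fun p =>
    ((ContinuousLinearMap.compL ℝ W E ℝ).flip (D p)).comp ((B (k p)).comp (D p))
  have wapp : ∀ p u v, w p u v = B (k p) (D p u) (D p v) := fun p u v => rfl
  have Bk : ContDiffOn ℝ ∞ (fun p => B (k p)) U := Bs.comp hk maps
  have Cs : ContDiffOn ℝ ∞ (fun p => (ContinuousLinearMap.compL ℝ W E ℝ).flip (D p)) U :=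
    ContDiff.comp_contDiffOn (ContinuousLinearMap.contDiff _) Ds
  have ws : ContDiffOn ℝ ∞ w U := Cs.clm_comp (Bk.clm_comp Ds)
  clear_value w
  refine ⟨w, ws, fun p u v => by rw [wapp, hD], fun p hp u v z => ?_⟩
  have nh := hU.mem_nhds hp
  have kd : HasFDerivAt k (D p) p := by
    rw [hD]; exact ((hk.contDiffAt nh).differentiableAt (by simp)).hasFDerivAt
  have Dd : HasFDerivAt D (fderiv ℝ D p) p :=
    ((Ds.contDiffAt nh).differentiableAt (by simp)).hasFDerivAt
  have Bd : HasFDerivAt B (fderiv ℝ B (k p)) (k p) :=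
    ((Bs.contDiffAt (hV.mem_nhds (maps hp))).differentiableAt (by simp)).hasFDerivAt
  have wd : HasFDerivAt w (fderiv ℝ w p) p :=
    ((ws.contDiffAt nh).differentiableAt (by simp)).hasFDerivAt
  have sym : ∀ u v, fderiv ℝ D p u v = fderiv ℝ D p v u := fun u v => by
    rw [hD]
    exact (hk.contDiffAt nh).isSymmSndFDerivAt (by
      rw [minSmoothness_of_isRCLikeNormedField]
      exact WithTop.coe_le_coe.2 (le_top (a := (2 : ℕ∞)))) u v
  have hBk : HasFDerivAt (fun p => B (k p)) ((fderiv ℝ B (k p)).comp (D p)) p :=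
    HasFDerivAt.comp (g := B) (g' := fderiv ℝ B (k p)) p (by exact Bd) kd
  -- In the cyclic sum the terms with the second derivative of k cancel in pairs, by its symmetry
  -- and the antisymmetry of B; what is left is closedness of B.
  have der : ∀ u v z, fderiv ℝ w p u v z = fderiv ℝ B (k p) (D p u) (D p v) (D p z)
      + B (k p) (fderiv ℝ D p u v) (D p z) + B (k p) (D p v) (fderiv ℝ D p u z) := by
    intro u v z
    have h1 := (wd.clm_apply (hasFDerivAt_const v p)).clm_apply (hasFDerivAt_const z p)
    simp only [wapp] at h1
    have h2 := ((hBk.clm_apply (Dd.clm_apply (hasFDerivAt_const v p))).clm_apply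
      (Dd.clm_apply (hasFDerivAt_const z p)))
    have h3 := DFunLike.congr_fun (h1.unique h2) u
    simp only [add_apply, ContinuousLinearMap.comp_apply, ContinuousLinearMap.flip_apply,
      zero_apply, map_zero, zero_add] at h3
    rw [h3]
    ring
  rw [der, der, der]
  have c := Bc (k p) (maps hp) (D p u) (D p v) (D p z)
  rw [sym v u, sym z u, sym z v, anti _ (D p v) (fderiv ℝ D p u z),
    anti _ (D p z) (fderiv ℝ D p u v), anti _ (D p u) (fderiv ℝ D p v z)]
  linarith

/-- The pullback of a symplectic form by a smooth map with values in a chart is a smooth closed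
`2`-form. -/
theorem exists_pullback_form [IsManifold (𝓡 m) ∞ M] (Ω : SymplecticForm m M) (x₀ : M)
    {k : W → Eucl m} {U : Set W} (hU : IsOpen U) (hk : ContDiffOn ℝ ∞ k U)
    (maps : MapsTo k U (extChartAt (𝓡 m) x₀).target) :
    ∃ w : W → W →L[ℝ] W →L[ℝ] ℝ, ContDiffOn ℝ ∞ w U ∧
      (∀ p ∈ U, ∀ u v, w p u v = pullbackTwo Ω ((extChartAt (𝓡 m) x₀).symm ∘ k) p u v) ∧
      ∀ p ∈ U, ∀ u v z,
        fderiv ℝ w p u v z + fderiv ℝ w p v z u + fderiv ℝ w p z u v = 0 := by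
  obtain ⟨w, ws, wapp, wc⟩ := exists_pullback_closed (isOpen_extChartAt_target x₀) (Ω.smooth x₀)
    (fun y a b => Ω.antisymm _ _ _) (Ω.closed x₀) hU hk maps
  refine ⟨w, ws, fun p hp u v => ?_, wc⟩
  have hg : MDifferentiableAt 𝓘(ℝ, Eucl m) (𝓡 m) (extChartAt (𝓡 m) x₀).symm (k p) :=
    ((contMDiffOn_extChartAt_symm (n := ∞) x₀).contMDiffAt
      ((isOpen_extChartAt_target x₀).mem_nhds (maps hp))).mdifferentiableAt (by simp)
  rw [pullbackTwo_comp Ω hg ((hk.contDiffAt (hU.mem_nhds hp)).differentiableAt (by simp)), wapp]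
  rfl

end Pullback

/-! ### Isotropy of the fibres and Darboux parametrizations. -/

section Darboux

open Set

variable {n : ℕ} {M : Type*} [TopologicalSpace M] [ChartedSpace (Eucl (2 * n)) M]

/-- The differential of `f`, as a linear map between the model spaces. -/
def dBase (f : M → Eucl n) (x : M) : Eucl (2 * n) →L[ℝ] Eucl n :=
  mfderiv (𝓡 (2 * n)) 𝓘(ℝ, Eucl n) f x

theorem dComponent_eq {f : M → Eucl n} {x : M}
    (hf : MDifferentiableAt (𝓡 (2 * n)) 𝓘(ℝ, Eucl n) f x) (i : Fin n) (w : Eucl (2 * n)) :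
    dComponent f i x w = dBase f x w i := by
  have hp : HasMFDerivAt 𝓘(ℝ, Eucl n) 𝓘(ℝ, ℝ) (fun y : Eucl n => y i) (f x)
      (EuclideanSpace.proj i : Eucl n →L[ℝ] ℝ) :=
    (EuclideanSpace.proj i : Eucl n →L[ℝ] ℝ).hasMFDerivAt
  have h := (hp.comp x hf.hasMFDerivAt).mfderiv
  exact DFunLike.congr_fun h w

theorem dBase_comp_mder {f : M → Eucl n} {W : Type} [NormedAddCommGroup W] [NormedSpace ℝ W]
    {g : W → M} {w : W} (hf : MDifferentiableAt (𝓡 (2 * n)) 𝓘(ℝ, Eucl n) f (g w))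
    (hg : MDifferentiableAt 𝓘(ℝ, W) (𝓡 (2 * n)) g w) (u : W) :
    dBase f (g w) (mder (2 * n) g w u) = fderiv ℝ (f ∘ g) w u := by
  have h := mfderiv_comp w hf hg
  have h' : mfderiv 𝓘(ℝ, W) 𝓘(ℝ, Eucl n) (f ∘ g) w = fderiv ℝ (f ∘ g) w := mfderiv_eq_fderiv
  exact (DFunLike.congr_fun (h'.symm.trans h) u).symm

/-- The fibres of an integrable system are isotropic at regular points. -/
theorem IsIntegrableSystem.isotropic {Ω : SymplecticForm (2 * n) M} {f : M → Eucl n}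
    (hf : IsIntegrableSystem Ω f) {x : M} (hx : Function.Surjective (dBase f x))
    {u v : Eucl (2 * n)} (hu : dBase f x u = 0) (hv : dBase f x v = 0) : Ω.at x u v = 0 := by
  have hfx : MDifferentiableAt (𝓡 (2 * n)) 𝓘(ℝ, Eucl n) f x :=
    hf.smooth.mdifferentiableAt (by simp)
  have commute : ∀ (i j : Fin n) (Xi Xj : Eucl (2 * n)), (∀ w, Ω.at x Xi w = -dBase f x w i) →
      (∀ w, Ω.at x Xj w = -dBase f x w j) → Ω.at x Xi Xj = 0 := fun i j Xi Xj hi hj =>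
    hf.commute i j x Xi Xj (fun w => (hi w).trans (congrArg _ (dComponent_eq hfx i w).symm))
      (fun w => (hj w).trans (congrArg _ (dComponent_eq hfx j w).symm))
  have nd : ∀ v : Eucl (2 * n), (∀ w, Ω.at x v w = 0) → v = 0 := Ω.nondegenerate x
  generalize Ω.at x = B at *
  generalize dBase f x = A at *
  let flat : Eucl (2 * n) →ₗ[ℝ] (Eucl (2 * n) →L[ℝ] ℝ) := B.toLinearMap
  have flat_inj : Function.Injective flat := by
    rw [← LinearMap.ker_eq_bot, LinearMap.ker_eq_bot']
    exact fun v hv => nd v fun w => DFunLike.congr_fun hv w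
  have hdim : Module.finrank ℝ (Eucl (2 * n)) = Module.finrank ℝ (Eucl (2 * n) →L[ℝ] ℝ) :=
    (InnerProductSpace.toDual ℝ (Eucl (2 * n))).toLinearEquiv.finrank_eq
  let Fl := LinearEquiv.ofInjectiveOfFinrankEq flat flat_inj hdim
  -- Y a is the covector -d⟨a, f⟩, so that Z a below is the Hamiltonian vector of ⟨a, f⟩ at x.
  let Y : Eucl n →ₗ[ℝ] (Eucl (2 * n) →L[ℝ] ℝ) :=
    { toFun := fun a => -(innerSL ℝ a).comp A
      map_add' := fun a b => by ext; simp; ring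
      map_smul' := fun c a => by ext; simp }
  let Z : Eucl n →ₗ[ℝ] Eucl (2 * n) := Fl.symm.toLinearMap ∘ₗ Y
  have hZ : ∀ a w, B (Z a) w = -inner ℝ a (A w) := fun a w => by
    have : Fl (Z a) = Y a := Fl.apply_symm_apply _
    exact DFunLike.congr_fun this w
  have hZs : ∀ i w, B (Z (EuclideanSpace.single i 1)) w = -A w i := fun i w => by
    rw [hZ]; simp [EuclideanSpace.inner_single_left]
  have Zinj : Function.Injective Z := by
    rw [← LinearMap.ker_eq_bot, LinearMap.ker_eq_bot']
    intro a ha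
    obtain ⟨w, hw⟩ := hx a
    have := hZ a w
    rw [ha, hw] at this
    simpa using this
  have hAZ : ∀ a, A (Z a) = 0 := by
    intro a
    have hs : ∀ i, A (Z (EuclideanSpace.single i 1)) = 0 := by
      intro i
      ext j
      have h1 := commute j i _ _ (hZs j) (hZs i)
      rw [hZs] at h1
      simpa using h1
    have ha : a = ∑ k, a k • EuclideanSpace.single k (1 : ℝ) := by
      ext j
      simp [Pi.single_apply]
    rw [ha]
    simp [map_sum, hs]
  -- Commutation makes the Hamiltonian vectors tangent to the fibre, and both spaces have dimension
  -- n. So every tangent vector of the fibre is some Z a, and Ω(Z a, v) = -⟨a, df v⟩ vanishes for v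
  -- tangent too.
  have hker : LinearMap.range Z = LinearMap.ker A.toLinearMap := by
    refine Submodule.eq_of_le_of_finrank_eq ?_ ?_
    · rintro _ ⟨a, rfl⟩
      exact hAZ a
    · have h1 := LinearMap.finrank_range_of_inj Zinj
      have h2 := A.toLinearMap.finrank_range_add_finrank_ker
      rw [LinearMap.range_eq_top.2 hx, finrank_top] at h2
      simp at h1 h2
      omega
  obtain ⟨a, rfl⟩ : u ∈ LinearMap.range Z := by rw [hker]; exact hu
  rw [hZ, hv, inner_zero_right, neg_zero]

/-- `H` is a local parametrization of `M` by Darboux coordinates `(f, q)`. -/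
structure IsDarbouxOn (Ω : SymplecticForm (2 * n) M) (f : M → Eucl n) (H : Eucl n × Eucl n → M)
    (S : Set (Eucl n × Eucl n)) : Prop where
  isOpen : IsOpen S
  smooth : ContMDiffOn 𝓘(ℝ, Eucl n × Eucl n) (𝓡 (2 * n)) ∞ H S
  base : ∀ p ∈ S, f (H p) = p.1
  darboux : ∀ p ∈ S, ∀ u v, pullbackTwo Ω H p u v = stdForm u v

variable {Ω : SymplecticForm (2 * n) M} {f : M → Eucl n} {H : Eucl n × Eucl n → M}
  {S : Set (Eucl n × Eucl n)}

theorem IsDarbouxOn.mono (h : IsDarbouxOn Ω f H S) {S' : Set (Eucl n × Eucl n)} (ho : IsOpen S')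
    (hs : S' ⊆ S) : IsDarbouxOn Ω f H S' :=
  ⟨ho, h.smooth.mono hs, fun p hp => h.base p (hs hp), fun p hp => h.darboux p (hs hp)⟩

theorem IsDarbouxOn.congr (h : IsDarbouxOn Ω f H S) {H' : Eucl n × Eucl n → M}
    (e : ∀ p ∈ S, H' p = H p) : IsDarbouxOn Ω f H' S :=
  ⟨h.isOpen, h.smooth.congr e, fun p hp => by rw [e p hp, h.base p hp], fun p hp u v => by
    rw [pullbackTwo_congr Ω (Filter.eventually_of_mem (h.isOpen.mem_nhds hp) e), h.darboux p hp]⟩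

theorem IsDarbouxOn.mdifferentiableAt (h : IsDarbouxOn Ω f H S) {p : Eucl n × Eucl n}
    (hp : p ∈ S) : MDifferentiableAt 𝓘(ℝ, Eucl n × Eucl n) (𝓡 (2 * n)) H p :=
  (h.smooth.contMDiffAt (h.isOpen.mem_nhds hp)).mdifferentiableAt (by simp)

/-- A vector killed by the differential lies in the radical of the pulled-back form, which is the
nondegenerate standard form. -/
theorem IsDarbouxOn.mder_injective (h : IsDarbouxOn Ω f H S) {p : Eucl n × Eucl n} (hp : p ∈ S) :
    Function.Injective (mder (2 * n) H p) := by
  rw [injective_iff_map_eq_zero]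
  intro u hu
  refine stdForm_nondegenerate fun v => ?_
  rw [← h.darboux p hp, pullbackTwo, hu]
  simp

theorem finrank_phase : Module.finrank ℝ (Eucl n × Eucl n) = 2 * n := by
  simp [Module.finrank_prod]; ring

/-- Darboux parametrizations are local diffeomorphisms. -/
theorem IsDarbouxOn.exists_chart [IsManifold (𝓡 (2 * n)) ∞ M] (h : IsDarbouxOn Ω f H S)
    {p : Eucl n × Eucl n} (hp : p ∈ S) :
    ∃ Φ : PartialDiffeomorph 𝓘(ℝ, Eucl n × Eucl n) (𝓡 (2 * n)) (Eucl n × Eucl n) M ∞,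
      p ∈ Φ.source ∧ Φ.source ⊆ S ∧ (∀ z ∈ Φ.source, Φ z = H z) ∧ IsDarbouxOn Ω f Φ Φ.source := by
  obtain ⟨Φ, h1, h2, h3⟩ := isLocalDiffeomorphAt_of_injective finrank_phase
    (h.isOpen.mem_nhds hp) h.smooth (h.mder_injective hp)
  exact ⟨Φ, h1, h2, h3, (h.mono Φ.open_source h2).congr h3⟩

/-- The kernel of A has dimension n; take for B a projection onto it, followed by an isomorphism
with ℝⁿ. This provides the coordinates that complete f to a chart. -/
theorem exists_complementary_projection {A : Eucl (2 * n) →L[ℝ] Eucl n}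
    (hA : Function.Surjective A) :
    ∃ B : Eucl (2 * n) →L[ℝ] Eucl n, Function.Injective (A.prod B) := by
  obtain ⟨C, hC⟩ := (LinearMap.ker A.toLinearMap).exists_isCompl
  have h2 := A.toLinearMap.finrank_range_add_finrank_ker
  rw [LinearMap.range_eq_top.2 hA, finrank_top] at h2
  simp only [finrank_euclideanSpace, Fintype.card_fin] at h2
  have e : LinearMap.ker A.toLinearMap ≃ₗ[ℝ] Eucl n := LinearEquiv.ofFinrankEq _ _ (by simp; omega)
  refine ⟨LinearMap.toContinuousLinearMap
    (e.toLinearMap ∘ₗ (LinearMap.ker A.toLinearMap).projectionOnto C hC), ?_⟩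
  rw [injective_iff_map_eq_zero]
  intro u hu
  have hu1 : u ∈ LinearMap.ker A.toLinearMap := congrArg Prod.fst hu
  have hu2 : e ((LinearMap.ker A.toLinearMap).projectionOnto C hC u) = 0 := congrArg Prod.snd hu
  rw [map_eq_zero_iff e e.injective, Submodule.projectionOnto_apply_eq_zero_iff] at hu2
  exact Submodule.disjoint_def.1 hC.disjoint u hu1 hu2

end Darboux

/-! ### Existence of canonical coordinates at regular points. -/

section DarbouxExistence

open Set

variable {n : ℕ} {M : Type*} [TopologicalSpace M] [ChartedSpace (Eucl (2 * n)) M]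
  {Ω : SymplecticForm (2 * n) M} {f : M → Eucl n}

/-- Around a regular point of `f` there are coordinates `(f, y)`, in which the symplectic form is
smooth and closed. -/
theorem exists_adapted_param [IsManifold (𝓡 (2 * n)) ∞ M]
    (hf : IsIntegrableSystem Ω f) {x : M} (hx : Function.Surjective (dBase f x)) :
    ∃ Φ : PartialDiffeomorph 𝓘(ℝ, Eucl n × Eucl n) (𝓡 (2 * n)) (Eucl n × Eucl n) M ∞,
      0 ∈ Φ.source ∧ Φ 0 = x ∧ (∀ p ∈ Φ.source, f (Φ p) = p.1 + f x) ∧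
      ∃ w : Eucl n × Eucl n → (Eucl n × Eucl n) →L[ℝ] (Eucl n × Eucl n) →L[ℝ] ℝ,
        ContDiffOn ℝ ∞ w Φ.source ∧
        (∀ p ∈ Φ.source, ∀ u v, w p u v = pullbackTwo Ω Φ p u v) ∧
        ∀ p ∈ Φ.source, ∀ u v z,
          fderiv ℝ w p u v z + fderiv ℝ w p v z u + fderiv ℝ w p z u v = 0 := by
  set φ := extChartAt (𝓡 (2 * n)) x with hφ
  have hφt : IsOpen φ.target := isOpen_extChartAt_target x
  have hxt : φ x ∈ φ.target := mem_extChartAt_target x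
  have hφx : φ.symm (φ x) = x := extChartAt_to_inv x
  obtain ⟨A, hA⟩ : ∃ A, A = dBase f x := ⟨_, rfl⟩
  rw [← hA] at hx
  obtain ⟨B, hB⟩ := exists_complementary_projection hx
  have φs : ContMDiffOn 𝓘(ℝ, Eucl (2 * n)) (𝓡 (2 * n)) ∞ φ.symm φ.target :=
    contMDiffOn_extChartAt_symm x
  let k₀ : Eucl (2 * n) → Eucl n := fun y => f (φ.symm y)
  have k₀s : ContDiffOn ℝ ∞ k₀ φ.target := by
    rw [← contMDiffOn_iff_contDiffOn]
    exact hf.smooth.comp_contMDiffOn φs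
  have k₀d : HasFDerivAt k₀ A (φ x) := by
    have h1 := (hf.smooth.mdifferentiableAt (x := x) (by simp)).mfderiv
    have h2 : A = fderivWithin ℝ (writtenInExtChartAt (𝓡 (2 * n)) 𝓘(ℝ, Eucl n) x f)
      (range (𝓡 (2 * n))) (φ x) := hA.trans h1
    have h3 : fderivWithin ℝ (writtenInExtChartAt (𝓡 (2 * n)) 𝓘(ℝ, Eucl n) x f)
      (range (𝓡 (2 * n))) (φ x) = fderiv ℝ k₀ (φ x) := by
      have e : writtenInExtChartAt (𝓡 (2 * n)) 𝓘(ℝ, Eucl n) x f = k₀ := by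
        ext1 y
        simp [writtenInExtChartAt, k₀, hφ, chartAt_self_eq]
      rw [e]
      simp
    rw [h2, h3]
    exact ((k₀s.contDiffAt (hφt.mem_nhds hxt)).differentiableAt (by simp)).hasFDerivAt
  -- The coordinates are centred, since the Poincaré lemmas above are stated on balls around 0.
  let G : Eucl (2 * n) → Eucl n × Eucl n := fun y => (k₀ y - f x, B y - B (φ x))
  have Gs : ContDiffOn ℝ ∞ G φ.target :=
    (k₀s.sub contDiffOn_const).prodMk (B.contDiff.contDiffOn.sub contDiffOn_const)
  have Gd : fderiv ℝ G (φ x) = A.prod B :=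
    ((k₀d.sub_const _).prodMk (B.hasFDerivAt.sub_const _)).fderiv
  obtain ⟨Γ, hΓx, hΓs, hΓ⟩ := exists_partialDiffeomorph (by rw [finrank_phase]; simp) hφt hxt Gs
    (by rw [Gd]; exact hB)
  let Φ := Γ.symm.trans (chartParam x)
  have hΦs : ∀ p, p ∈ Φ.source ↔ p ∈ Γ.target ∧ Γ.symm p ∈ φ.target := fun p => Iff.rfl
  have hΦ : ∀ p, Φ p = φ.symm (Γ.symm p) := fun p => rfl
  have hmem : ∀ p ∈ Γ.target, Γ.symm p ∈ φ.target := fun p hp => hΓs (Γ.map_target hp)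
  have hΓ0 : Γ (φ x) = 0 := by
    rw [hΓ]
    simp only [G, k₀, hφx, sub_self]
    rfl
  have h0 : (0 : Eucl n × Eucl n) ∈ Γ.target := hΓ0 ▸ Γ.map_source hΓx
  have hs0 : Γ.symm 0 = φ x := by rw [← hΓ0]; exact Γ.left_inv hΓx
  have hsrc : Φ.source = Γ.target :=
    Set.ext fun p => ⟨fun h => ((hΦs p).1 h).1, fun h => (hΦs p).2 ⟨h, hmem p h⟩⟩
  refine ⟨Φ, ?_, ?_, ?_, ?_⟩
  · rw [hsrc]; exact h0
  · rw [hΦ, hs0, hφx]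
  · intro p hp
    have h1 : Γ (Γ.symm p) = p := Γ.right_inv ((hΦs p).1 hp).1
    rw [hΓ] at h1
    have h2 := congrArg Prod.fst h1
    simp only [G, k₀] at h2
    rw [hΦ, ← h2, sub_add_cancel]
  · have ks : ContDiffOn ℝ ∞ Γ.symm Φ.source := by
      rw [hsrc, ← contMDiffOn_iff_contDiffOn]
      exact Γ.contMDiffOn_invFun
    exact exists_pullback_form Ω x Φ.open_source ks fun p hp => ((hΦs p).1 hp).2

/-- **Darboux–Carathéodory**: around a regular point of an integrable system there are canonical
coordinates `(f, q)`. -/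
theorem exists_darboux [IsManifold (𝓡 (2 * n)) ∞ M]
    (hf : IsIntegrableSystem Ω f) {x : M} (hx : Function.Surjective (dBase f x)) :
    ∃ Φ : PartialDiffeomorph 𝓘(ℝ, Eucl n × Eucl n) (𝓡 (2 * n)) (Eucl n × Eucl n) M ∞,
      IsDarbouxOn Ω f Φ Φ.source ∧ x ∈ Φ.target := by
  obtain ⟨Φ, h0, hΦ0, hbase, w, ws, wapp, wc⟩ := exists_adapted_param hf hx
  have Φd : ∀ p ∈ Φ.source, MDifferentiableAt 𝓘(ℝ, Eucl n × Eucl n) (𝓡 (2 * n)) Φ p :=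
    fun p hp => Φ.mdifferentiableAt (by simp) hp
  have fd : ∀ y, MDifferentiableAt (𝓡 (2 * n)) 𝓘(ℝ, Eucl n) f y :=
    fun y => hf.smooth.mdifferentiableAt (by simp)
  have dB : ∀ p ∈ Φ.source, ∀ u, dBase f (Φ p) (mder (2 * n) Φ p u) = u.1 := by
    intro p hp u
    rw [dBase_comp_mder (fd _) (Φd p hp)]
    have e : (f ∘ Φ) =ᶠ[𝓝 p] fun p => p.1 + f x :=
      Filter.eventually_of_mem (Φ.open_source.mem_nhds hp) hbase
    rw [e.fderiv_eq, fderiv_add_const, fderiv_fst]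
    rfl
  obtain ⟨r, hr, hrsub⟩ := Metric.isOpen_iff.1 Φ.open_source 0 h0
  obtain ⟨r', hr', hle, q, qs, hq⟩ := exists_conjugate_coordinates hr (ws.mono hrsub)
    (fun p hp u v => by rw [wapp p (hrsub hp), wapp p (hrsub hp)]; exact Ω.antisymm _ _ _)
    (fun p hp => wc p (hrsub hp)) (fun p hp u v => by
      rw [wapp p (hrsub hp)]
      refine hf.isotropic (fun a => ⟨_, dB p (hrsub hp) (a, 0)⟩) ?_ ?_
      · rw [dB p (hrsub hp)]
      · rw [dB p (hrsub hp)])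
  have sub' : Metric.ball 0 r' ⊆ Φ.source := (Metric.ball_subset_ball hle).trans hrsub
  have h0' : (0 : Eucl n × Eucl n) ∈ Metric.ball 0 r' := Metric.mem_ball_self hr'
  have qd : ∀ p ∈ Metric.ball (0 : Eucl n × Eucl n) r', HasFDerivAt q (fderiv ℝ q p) p :=
    fun p hp => ((qs.contDiffAt (Metric.isOpen_ball.mem_nhds hp)).differentiableAt
      (by simp)).hasFDerivAt
  -- Q is the change from adapted to canonical coordinates; the pullback of Ω in the former is the
  -- pullback of the standard form by Q.
  let Q : Eucl n × Eucl n → Eucl n × Eucl n := fun p => (p.1 + f x, q p)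
  have Qd : ∀ p ∈ Metric.ball (0 : Eucl n × Eucl n) r', HasFDerivAt Q
      ((ContinuousLinearMap.fst ℝ _ _).prod (fderiv ℝ q p)) p := fun p hp =>
    (hasFDerivAt_fst.add_const _).prodMk (qd p hp)
  have form : ∀ p ∈ Metric.ball (0 : Eucl n × Eucl n) r', ∀ u v,
      pullbackTwo Ω Φ p u v = stdForm (fderiv ℝ Q p u) (fderiv ℝ Q p v) := by
    intro p hp u v
    rw [← wapp p (sub' hp), hq p hp, (Qd p hp).fderiv]
    rfl
  -- A vector in the kernel of dQ at 0 would lie in the radical of Ω, so nondegeneracy makes Q a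
  -- local diffeomorphism.
  obtain ⟨Ψ, hΨ0, hΨs, hΨ⟩ := exists_partialDiffeomorph (k := Q) rfl Metric.isOpen_ball h0'
    ((contDiffOn_fst.add contDiffOn_const).prodMk qs) (by
      rw [injective_iff_map_eq_zero]
      intro u hu
      have h1 : mder (2 * n) Φ 0 u = 0 := Ω.nondegenerate (Φ 0) _ fun v => by
        obtain ⟨v, rfl⟩ := (PartialDiffeomorph.mder_bijective Φ h0).2 v
        refine (form 0 h0' u v).trans ?_
        rw [hu]
        simp [stdForm]
      exact (map_eq_zero_iff _ (PartialDiffeomorph.mder_bijective Φ h0).1).1 h1)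
  let Θ := Ψ.symm.trans Φ
  have hΘs : ∀ p, p ∈ Θ.source ↔ p ∈ Ψ.target ∧ Ψ.symm p ∈ Φ.source := fun p => Iff.rfl
  have hb : ∀ p ∈ Θ.source, Ψ.symm p ∈ Metric.ball (0 : Eucl n × Eucl n) r' := fun p hp =>
    hΨs (Ψ.map_target ((hΘs p).1 hp).1)
  have hr' : ∀ p ∈ Θ.source, Q (Ψ.symm p) = p := fun p hp => by
    have h1 : Ψ (Ψ.symm p) = p := Ψ.right_inv ((hΘs p).1 hp).1
    rwa [hΨ] at h1
  refine ⟨Θ, ⟨Θ.open_source, Θ.contMDiffOn_toFun, fun p hp => ?_, fun p hp u v => ?_⟩, ?_⟩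
  · refine (hbase _ ((hΘs p).1 hp).2).trans ?_
    exact congrArg Prod.fst (hr' p hp)
  · have sd : DifferentiableAt ℝ Ψ.symm p := by
      have := (Ψ.contMDiffOn_invFun.contMDiffAt (Ψ.open_target.mem_nhds
        ((hΘs p).1 hp).1)).mdifferentiableAt (by simp)
      exact mdifferentiableAt_iff_differentiableAt.1 this
    have comp : fderiv ℝ Q (Ψ.symm p) ∘L fderiv ℝ Ψ.symm p = ContinuousLinearMap.id ℝ _ := by
      have h1 : HasFDerivAt (Q ∘ Ψ.symm) (fderiv ℝ Q (Ψ.symm p) ∘L fderiv ℝ Ψ.symm p) p :=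
        HasFDerivAt.comp p (Qd _ (hb p hp)).differentiableAt.hasFDerivAt sd.hasFDerivAt
      have h2 : (Q ∘ Ψ.symm) =ᶠ[𝓝 p] id :=
        Filter.eventually_of_mem (Θ.open_source.mem_nhds hp) hr'
      exact h1.unique ((hasFDerivAt_id p).congr_of_eventuallyEq h2)
    have h1 := pullbackTwo_comp Ω (k := Ψ.symm) (x := p) (Φd _ ((hΘs p).1 hp).2) sd u v
    refine h1.trans ?_
    rw [form _ (hb p hp)]
    have e : ∀ u, fderiv ℝ Q (Ψ.symm p) (fderiv ℝ Ψ.symm p u) = u := fun u =>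
      DFunLike.congr_fun comp u
    rw [e, e]
  · have h1 : Ψ 0 ∈ Θ.source := by
      rw [hΘs]
      refine ⟨Ψ.map_source hΨ0, ?_⟩
      have : Ψ.symm (Ψ 0) = 0 := Ψ.left_inv hΨ0
      rw [this]; exact h0
    have h2 : Θ (Ψ 0) = x := by
      refine Eq.trans ?_ hΦ0
      exact congrArg Φ (Ψ.left_inv hΨ0)
    rw [← h2]
    exact Θ.map_source h1

end DarbouxExistence

/-! ### Uniqueness of canonical coordinates; orbit maps. -/

section Orbits

open Set

variable {n : ℕ} {M : Type*} [TopologicalSpace M] [ChartedSpace (Eucl (2 * n)) M]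
  {Ω : SymplecticForm (2 * n) M} {f : M → Eucl n}

theorem add_pair_zero (p : Eucl n × Eucl n) : p + (0, 0) = p := add_zero p

/-- Canonical coordinates `(f, q)` are unique up to translations of `q` along the fibres. -/
theorem IsDarbouxOn.eventually_eq [IsManifold (𝓡 (2 * n)) ∞ M] {H H' : Eucl n × Eucl n → M}
    {S S' : Set (Eucl n × Eucl n)} (h : IsDarbouxOn Ω f H S) (h' : IsDarbouxOn Ω f H' S')
    {p p' : Eucl n × Eucl n} (hp : p ∈ S) (hp' : p' ∈ S') (e : H p = H' p') :
    ∀ᶠ s in 𝓝 (0 : Eucl n), H (p + (0, s)) = H' (p' + (0, s)) := by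
  obtain ⟨Φ, hpΦ, -, hΦ, hD⟩ := h'.exists_chart hp'
  have hsymm : ∀ y ∈ Φ.target, Φ (Φ.symm y) = y := fun y hy => Φ.right_inv hy
  have hmap : ∀ y ∈ Φ.target, Φ.symm y ∈ Φ.source := fun y hy => Φ.map_target hy
  set O : Set (Eucl n × Eucl n) := S ∩ H ⁻¹' Φ.target with hO
  have hOo : IsOpen O := h.smooth.continuousOn.isOpen_inter_preimage h.isOpen Φ.open_target
  have hHp : H p = Φ p' := by rw [hΦ p' hpΦ, e]
  have hpO : p ∈ O := ⟨hp, by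
    rw [mem_preimage, hHp]; exact Φ.map_source hpΦ⟩
  -- The transition map preserves both the first component and the standard form; this forces it to
  -- be a translation along each fibre.
  set κ : Eucl n × Eucl n → Eucl n × Eucl n := fun z => Φ.symm (H z) with hκ
  have κp : κ p = p' := by
    rw [hκ]; simp only [hHp]; exact Φ.left_inv hpΦ
  have κs : ∀ z ∈ O, DifferentiableAt ℝ κ z := by
    intro z hz
    have h1 : ContMDiffAt (𝓡 (2 * n)) 𝓘(ℝ, Eucl n × Eucl n) ∞ Φ.symm (H z) :=
      Φ.contMDiffOn_invFun.contMDiffAt (Φ.open_target.mem_nhds hz.2)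
    have h2 := h1.comp z (h.smooth.contMDiffAt (h.isOpen.mem_nhds hz.1))
    exact mdifferentiableAt_iff_differentiableAt.1 (h2.mdifferentiableAt (by simp))
  have κ1 : ∀ z ∈ O, (κ z).1 = z.1 := by
    intro z hz
    rw [← hD.base _ (hmap _ hz.2), hsymm _ hz.2, h.base z hz.1]
  have D1 : ∀ z ∈ O, ∀ u, (fderiv ℝ κ z u).1 = u.1 := by
    intro z hz u
    have e1 : (fun z => (κ z).1) =ᶠ[𝓝 z] fun z => z.1 :=
      Filter.eventually_of_mem (hOo.mem_nhds hz) κ1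
    have h1 := (κs z hz).hasFDerivAt.fst
    have h2 := h1.unique (hasFDerivAt_fst.congr_of_eventuallyEq e1)
    exact DFunLike.congr_fun h2 u
  have Dform : ∀ z ∈ O, ∀ u v, stdForm (fderiv ℝ κ z u) (fderiv ℝ κ z v) = stdForm u v := by
    intro z hz u v
    have e1 : H =ᶠ[𝓝 z] Φ ∘ κ :=
      Filter.eventually_of_mem (hOo.mem_nhds hz) fun y hy => (hsymm _ hy.2).symm
    have h1 := h.darboux z hz.1 u v
    rwa [pullbackTwo_congr Ω e1,
      pullbackTwo_comp Ω (hD.mdifferentiableAt (hmap _ hz.2)) (κs z hz),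
      hD.darboux _ (hmap _ hz.2)] at h1
  -- Let w be the second component of dκ(0, a) minus a. Invariance of the form on the pair (0, a),
  -- (w, 0) says ‖w‖² = 0.
  have D2 : ∀ z ∈ O, ∀ a : Eucl n, fderiv ℝ κ z (0, a) = (0, a) := by
    intro z hz a
    have h1 := D1 z hz (0, a)
    refine Prod.ext h1 ?_
    have h2 := Dform z hz (0, a) ((fderiv ℝ κ z (0, a)).2 - a, 0)
    simp only [stdForm, h1, D1 z hz, inner_zero_left, zero_sub, neg_inj] at h2
    rw [← sub_eq_zero, ← inner_sub_right] at h2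
    exact sub_eq_zero.1 (inner_self_eq_zero.1 h2)
  set L : Eucl n → Eucl n × Eucl n := fun s => p + (0, s) with hL
  have Lc : Continuous L := by fun_prop
  have L0 : L 0 = p := by simp [hL]
  have hLO : L ⁻¹' O ∈ 𝓝 (0 : Eucl n) :=
    Lc.continuousAt.preimage_mem_nhds (by rw [L0]; exact hOo.mem_nhds hpO)
  obtain ⟨ρ, hρ, hball⟩ := Metric.mem_nhds_iff.1 hLO
  have const : ∀ s ∈ Metric.ball (0 : Eucl n) ρ, κ (L s) = p' + (0, s) := by
    intro s hs
    have hd : ∀ s ∈ Metric.ball (0 : Eucl n) ρ,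
        HasFDerivAt (fun s => κ (L s) - ((0 : Eucl n), s)) (0 : Eucl n →L[ℝ] Eucl n × Eucl n) s := by
      intro s hs
      have hLd : HasFDerivAt L (ContinuousLinearMap.inr ℝ (Eucl n) (Eucl n)) s := by
        simpa [hL] using ((ContinuousLinearMap.inr ℝ (Eucl n) (Eucl n)).hasFDerivAt).const_add p
      have h1 : HasFDerivAt (fun s => κ (L s))
          ((fderiv ℝ κ (L s)).comp (ContinuousLinearMap.inr ℝ (Eucl n) (Eucl n))) s :=
        HasFDerivAt.comp s (κs _ (hball hs)).hasFDerivAt hLd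
      refine (h1.sub (ContinuousLinearMap.inr ℝ (Eucl n) (Eucl n)).hasFDerivAt).congr_fderiv ?_
      ext1 a
      simp [D2 _ (hball hs) a]
    have h1 := (convex_ball (0 : Eucl n) ρ).is_const_of_fderivWithin_eq_zero (𝕜 := ℝ)
      (fun s hs => (hd s hs).differentiableAt.differentiableWithinAt)
      (fun s hs => by
        rw [fderivWithin_of_isOpen Metric.isOpen_ball hs]; exact (hd s hs).fderiv)
      hs (Metric.mem_ball_self hρ)
    rw [L0, κp] at h1
    rw [sub_eq_iff_eq_add] at h1
    rw [h1]
    simp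
  have hs' : ∀ᶠ s in 𝓝 (0 : Eucl n), p' + ((0 : Eucl n), s) ∈ Φ.source := by
    have c : Continuous fun s : Eucl n => p' + ((0 : Eucl n), s) := by fun_prop
    exact c.continuousAt.preimage_mem_nhds (by
      rw [add_pair_zero]; exact Φ.open_source.mem_nhds hpΦ)
  filter_upwards [Metric.ball_mem_nhds 0 hρ, hs'] with s hs hsΦ
  rw [← hΦ _ hsΦ, ← const s hs]
  exact (hsymm _ (hball hs).2).symm

variable (Ω f) in
/-- `g` is an orbit map of the local action of `ℝⁿ` by the flows of the components of `f`. -/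
def IsOrbitOn (g : Eucl n → M) (T : Set (Eucl n)) : Prop :=
  ∀ s ∈ T, ∃ H S p, IsDarbouxOn Ω f H S ∧ p ∈ S ∧ ∀ᶠ t in 𝓝 (0 : Eucl n), g (s + t) = H (p + (0, t))

theorem IsOrbitOn.mono {g : Eucl n → M} {T T' : Set (Eucl n)} (h : IsOrbitOn Ω f g T)
    (hT : T' ⊆ T) : IsOrbitOn Ω f g T' := fun s hs => h s (hT hs)

theorem IsOrbitOn.comp_add {g : Eucl n → M} {T : Set (Eucl n)} (h : IsOrbitOn Ω f g T)
    (a : Eucl n) : IsOrbitOn Ω f (fun s => g (a + s)) ((a + ·) ⁻¹' T) := by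
  intro s hs
  obtain ⟨H, S, p, hH, hp, e⟩ := h (a + s) hs
  exact ⟨H, S, p, hH, hp, by simpa [add_assoc] using e⟩

theorem IsDarbouxOn.isOrbitOn {H : Eucl n × Eucl n → M} {S : Set (Eucl n × Eucl n)}
    (h : IsDarbouxOn Ω f H S) (p : Eucl n × Eucl n) :
    IsOrbitOn Ω f (fun s => H (p + (0, s))) {s | p + (0, s) ∈ S} := by
  intro s hs
  exact ⟨H, S, p + (0, s), h, hs, Filter.Eventually.of_forall fun t => by simp [add_assoc]⟩

theorem IsOrbitOn.continuousAt {g : Eucl n → M} {T : Set (Eucl n)} (h : IsOrbitOn Ω f g T)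
    {s : Eucl n} (hs : s ∈ T) : ContinuousAt g s := by
  obtain ⟨H, S, p, hH, hp, e⟩ := h s hs
  have h1 : ContinuousAt (fun t : Eucl n => H (p + (0, t))) 0 := by
    refine ContinuousAt.comp (g := H) (f := fun t : Eucl n => p + ((0 : Eucl n), t)) ?_ (by fun_prop)
    rw [add_pair_zero]
    exact hH.smooth.continuousOn.continuousAt (hH.isOpen.mem_nhds hp)
  have h2 : ContinuousAt (fun t => g (s + t)) 0 := h1.congr (e.mono fun _ h => h.symm)
  have h3 : ContinuousAt ((fun t => g (s + t)) ∘ fun t => t - s) s := by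
    refine ContinuousAt.comp ?_ (by fun_prop)
    simpa using h2
  simpa [Function.comp_def] using h3

/-- Both maps are vertical lines in canonical coordinates, and those agree up to a vertical
translation. -/
theorem IsOrbitOn.eventually_eq [IsManifold (𝓡 (2 * n)) ∞ M] {g g' : Eucl n → M}
    {T T' : Set (Eucl n)} (h : IsOrbitOn Ω f g T) (h' : IsOrbitOn Ω f g' T') {s s' : Eucl n}
    (hs : s ∈ T) (hs' : s' ∈ T') (e : g s = g' s') :
    ∀ᶠ t in 𝓝 (0 : Eucl n), g (s + t) = g' (s' + t) := by
  obtain ⟨H, S, p, hH, hp, e1⟩ := h s hs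
  obtain ⟨H', S', p', hH', hp', e2⟩ := h' s' hs'
  have a1 := e1.self_of_nhds
  have a2 := e2.self_of_nhds
  rw [add_zero, add_pair_zero] at a1 a2
  filter_upwards [e1, e2, hH.eventually_eq hH' hp hp' (by rw [← a1, ← a2, e])] with t h1 h2 h3
  rw [h1, h2, h3]

/-- Orbit maps are determined by one value. -/
theorem IsOrbitOn.eqOn [IsManifold (𝓡 (2 * n)) ∞ M] [T2Space M] {g g' : Eucl n → M}
    {T : Set (Eucl n)} (h : IsOrbitOn Ω f g T) (h' : IsOrbitOn Ω f g' T) (hT : IsPreconnected T)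
    {s : Eucl n} (hs : s ∈ T) (e : g s = g' s) : EqOn g g' T := by
  have loc : ∀ s ∈ T, g s = g' s → ∀ᶠ t in 𝓝 s, g t = g' t := by
    intro s hs e
    have h1 := h.eventually_eq h' hs hs e
    have h2 : Filter.Tendsto (fun t => t - s) (𝓝 s) (𝓝 0) := by
      have : ContinuousAt (fun t : Eucl n => t - s) s := by fun_prop
      simpa [ContinuousAt] using this
    simpa using h2.eventually h1
  -- Agreement is open by local uniqueness, disagreement is open because `M` is Hausdorff, and T is
  -- connected.
  have key : T ⊆ {s | ∀ᶠ t in 𝓝 s, g t = g' t} := by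
    refine IsPreconnected.subset_left_of_subset_union (v := {s | ∀ᶠ t in 𝓝 s, g t ≠ g' t})
      isOpen_setOfPred_eventually_nhds isOpen_setOfPred_eventually_nhds ?_ ?_ ⟨s, hs, loc s hs e⟩ hT
    · rw [Set.disjoint_left]
      intro s h1 h2
      exact h2.self_of_nhds h1.self_of_nhds
    · intro s hs
      by_cases hg : g s = g' s
      · exact Or.inl (loc s hs hg)
      · exact Or.inr ((h.continuousAt hs).ne_iff_eventually_ne (h'.continuousAt hs) |>.1 hg)
  exact fun s hs => (key hs).self_of_nhds

end Orbits

/-! ### Extension of local homomorphisms. -/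

section LocalHomomorphisms

/-- A local homomorphism from a normed space to a monoid extends to a homomorphism. -/
theorem exists_hom_of_local {G V : Type*} [Monoid G] [NormedAddCommGroup V] [NormedSpace ℝ V]
    (φ : V → G) {ε : ℝ} (hε : 0 < ε)
    (hφ : ∀ s t, ‖s‖ < ε → ‖t‖ < ε → φ (s + t) = φ s * φ t) :
    ∃ Φ : V → G, (∀ s t, Φ (s + t) = Φ s * Φ t) ∧ ∀ s, ‖s‖ < ε → Φ s = φ s := by
  -- The extension at s is this value for any large k: φ turns doubling of small vectors into
  -- squaring, so the value stabilizes.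
  let a : V → ℕ → G := fun s k => φ ((2 ^ k : ℝ)⁻¹ • s) ^ (2 ^ k)
  have small : ∀ s : V, ∃ k : ℕ, ∀ m ≥ k, ‖(2 ^ m : ℝ)⁻¹ • s‖ < ε := by
    intro s
    obtain ⟨k, hk⟩ := pow_unbounded_of_one_lt (‖s‖ / ε) (one_lt_two (α := ℝ))
    refine ⟨k, fun m hm => ?_⟩
    have h1 : (2 : ℝ) ^ k ≤ 2 ^ m := pow_le_pow_right₀ one_le_two hm
    rw [norm_smul, norm_inv, norm_pow, Real.norm_two, inv_mul_lt_iff₀ (by positivity)]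
    rw [div_lt_iff₀ hε] at hk
    nlinarith
  have step : ∀ s k, ‖(2 ^ (k + 1) : ℝ)⁻¹ • s‖ < ε → a s (k + 1) = a s k := by
    intro s k hk
    have e : (2 ^ k : ℝ)⁻¹ • s = (2 ^ (k + 1) : ℝ)⁻¹ • s + (2 ^ (k + 1) : ℝ)⁻¹ • s := by
      rw [← add_smul]
      congr 1
      field_simp
      ring
    simp only [a]
    rw [e, hφ _ _ hk hk, ← pow_two, ← pow_mul]
    congr 1
    ring
  have stable : ∀ s k, (∀ m ≥ k, ‖(2 ^ m : ℝ)⁻¹ • s‖ < ε) → ∀ m ≥ k, a s m = a s k := by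
    intro s k hk m hm
    induction m, hm using Nat.le_induction with
    | base => rfl
    | succ m hm ih => rw [step s m (hk _ (by omega)), ih]
  choose K hK using small
  refine ⟨fun s => a s (K s), fun s t => ?_, fun s hs => ?_⟩
  · set m := max (K (s + t)) (max (K s) (K t))
    have hs : K s ≤ m := (le_max_left _ _).trans (le_max_right _ _)
    have ht : K t ≤ m := (le_max_right _ _).trans (le_max_right _ _)
    show a (s + t) (K (s + t)) = a s (K s) * a t (K t)
    rw [← stable _ _ (hK (s + t)) m (le_max_left _ _), ← stable _ _ (hK s) m hs,
      ← stable _ _ (hK t) m ht]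
    have h1 := hK s m hs
    have h2 := hK t m ht
    -- The monoid need not be commutative, but the two values commute because s + t = t + s; so the
    -- power of their product splits.
    have comm : Commute (φ ((2 ^ m : ℝ)⁻¹ • s)) (φ ((2 ^ m : ℝ)⁻¹ • t)) := by
      rw [Commute, SemiconjBy, ← hφ _ _ h1 h2, ← hφ _ _ h2 h1, add_comm]
    simp only [a]
    rw [smul_add, hφ _ _ h1 h2, comm.mul_pow]
  · have h0 : ∀ m ≥ 0, ‖(2 ^ m : ℝ)⁻¹ • s‖ < ε := by
      intro m _
      have h1 : (1 : ℝ) ≤ 2 ^ m := one_le_pow₀ one_le_two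
      rw [norm_smul, norm_inv, norm_pow, Real.norm_two, inv_mul_lt_iff₀ (by positivity)]
      nlinarith
    show a s (K s) = φ s
    rw [stable s 0 h0 _ (Nat.zero_le _)]
    simp [a]

end LocalHomomorphisms

/-! ### Neighbourhoods of a compact fibre; openness of the regular values. -/

section Tube

open Set

variable {n : ℕ} {M : Type*} [TopologicalSpace M] [ChartedSpace (Eucl (2 * n)) M]
  {Ω : SymplecticForm (2 * n) M} {f : M → Eucl n}

theorem mem_regularValues {b : Eucl n} : b ∈ regularValues f ↔
    (∃ x, f x = b) ∧ ∀ x, f x = b → Function.Surjective (dBase f x) := Iff.rfl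

/-- The fibres over points near a regular value `b` are contained in any given neighbourhood of the
fibre over `b`, and are not empty. -/
theorem eventually_fibre_subset [IsManifold (𝓡 (2 * n)) ∞ M] [T2Space M]
    (hf : IsIntegrableSystem Ω f) {b : Eucl n} (hb : b ∈ regularValues f) {W : Set M}
    (hW : IsOpen W) (hbW : f ⁻¹' {b} ⊆ W) :
    ∀ᶠ c in 𝓝 b, (∃ x, f x = c) ∧ f ⁻¹' {c} ⊆ W := by
  have : LocallyCompactSpace M := ChartedSpace.locallyCompactSpace (Eucl (2 * n)) M
  obtain ⟨⟨x, hx⟩, hreg⟩ := mem_regularValues.1 hb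
  -- For c near b the fibre over c meets the interior of the compact set L, since f is a projection
  -- in canonical coordinates, and it misses L \ interior L, whose compact image does not contain b.
  -- Being connected, it stays in the interior.
  obtain ⟨L, hL, hbL, hLW⟩ := exists_compact_between (hf.compact b) hW hbW
  have fc : Continuous f := hf.smooth.continuous
  have h1 : ∀ᶠ c in 𝓝 b, ∃ y, f y = c ∧ y ∈ interior L := by
    obtain ⟨Φ, hΦ, hxΦ⟩ := exists_darboux hf (hreg x hx)
    obtain ⟨p, hp, rfl⟩ : ∃ p ∈ Φ.source, Φ p = x :=
      ⟨Φ.symm x, Φ.map_target hxΦ, Φ.right_inv hxΦ⟩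
    have hpb : p.1 = b := by rw [← hx]; exact (hΦ.base p hp).symm
    have hc : ContinuousAt Φ p := hΦ.smooth.continuousOn.continuousAt (hΦ.isOpen.mem_nhds hp)
    have h2 : Φ.source ∩ Φ ⁻¹' interior L ∈ 𝓝 p :=
      Filter.inter_mem (hΦ.isOpen.mem_nhds hp)
        (hc.preimage_mem_nhds (isOpen_interior.mem_nhds (hbL hx)))
    have h3 : Filter.Tendsto (fun c : Eucl n => (c, p.2)) (𝓝 b) (𝓝 p) := by
      have : ContinuousAt (fun c : Eucl n => (c, p.2)) b := by fun_prop
      rw [ContinuousAt, ← hpb] at this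
      rwa [← hpb]
    filter_upwards [h3 h2] with c hc
    exact ⟨Φ (c, p.2), hΦ.base _ hc.1, hc.2⟩
  have h2 : ∀ᶠ c in 𝓝 b, c ∉ f '' (L \ interior L) := by
    have hK : IsCompact (L \ interior L) := hL.diff isOpen_interior
    refine (hK.image fc).isClosed.isOpen_compl.mem_nhds ?_
    rintro ⟨y, hy, hyb⟩
    exact hy.2 (hbL hyb)
  filter_upwards [h1, h2] with c ⟨y, hyc, hyL⟩ hc
  refine ⟨⟨y, hyc⟩, ?_⟩
  have h3 : f ⁻¹' {c} ⊆ interior L := by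
    refine IsPreconnected.subset_left_of_subset_union (v := Lᶜ) isOpen_interior
      hL.isClosed.isOpen_compl (disjoint_compl_right.mono_left interior_subset) ?_ ⟨y, hyc, hyL⟩
      (hf.connected c)
    intro z hz
    by_cases hzi : z ∈ interior L
    · exact Or.inl hzi
    · exact Or.inr fun hzL => hc ⟨z, ⟨hzL, hzi⟩, hz⟩
  exact h3.trans (interior_subset.trans hLW)

variable (Ω f) in
/-- At `x` there are canonical coordinates defined on boxes of size `ε` around all points near
`x`. -/
def HasUniformBox (ε : ℝ) (x : M) : Prop :=
  ∃ Φ : PartialDiffeomorph 𝓘(ℝ, Eucl n × Eucl n) (𝓡 (2 * n)) (Eucl n × Eucl n) M ∞,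
    IsDarbouxOn Ω f Φ Φ.source ∧ x ∈ Φ.target ∧
      ∀ᶠ y in 𝓝 x, ∀ s : Eucl n, ‖s‖ < ε → Φ.symm y + (0, s) ∈ Φ.source

theorem PartialDiffeomorph.continuousAt_symm
    (Φ : PartialDiffeomorph 𝓘(ℝ, Eucl n × Eucl n) (𝓡 (2 * n)) (Eucl n × Eucl n) M ∞) {x : M}
    (hx : x ∈ Φ.target) : ContinuousAt Φ.symm x :=
  Φ.contMDiffOn_invFun.continuousOn.continuousAt (Φ.open_target.mem_nhds hx)

theorem HasUniformBox.mono {ε ε' : ℝ} {x : M} (h : HasUniformBox Ω f ε x) (he : ε' ≤ ε) :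
    HasUniformBox Ω f ε' x := by
  obtain ⟨Φ, h1, h2, h3⟩ := h
  exact ⟨Φ, h1, h2, h3.mono fun y hy s hs => hy s (hs.trans_le he)⟩

/-- A ball of radius r in one coordinate domain serves all nearby points: half of r is spent on
moving the base point, the other half on moving along the fibre. -/
theorem exists_uniformBox [IsManifold (𝓡 (2 * n)) ∞ M] (hf : IsIntegrableSystem Ω f) {x : M}
    (hx : Function.Surjective (dBase f x)) : ∃ ε > 0, ∀ᶠ y in 𝓝 x, HasUniformBox Ω f ε y := by
  obtain ⟨Φ, hΦ, hxΦ⟩ := exists_darboux hf hx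
  have hp : Φ.symm x ∈ Φ.source := Φ.map_target hxΦ
  obtain ⟨r, hr, hball⟩ := Metric.isOpen_iff.1 Φ.open_source _ hp
  have h1 : ∀ᶠ y in 𝓝 x, y ∈ Φ.target ∧ Φ.symm y ∈ Metric.ball (Φ.symm x) (r / 2) :=
    Filter.inter_mem (Φ.open_target.mem_nhds hxΦ)
      ((PartialDiffeomorph.continuousAt_symm Φ hxΦ).preimage_mem_nhds
        (Metric.ball_mem_nhds _ (by positivity)))
  refine ⟨r / 2, by positivity, ?_⟩
  filter_upwards [h1.eventually_nhds] with y hy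
  refine ⟨Φ, hΦ, hy.self_of_nhds.1, hy.mono fun z hz s hs => hball ?_⟩
  have h2 := hz.2
  rw [mem_ball_iff_norm] at h2 ⊢
  calc ‖Φ.symm z + (0, s) - Φ.symm x‖ = ‖(Φ.symm z - Φ.symm x) + (0, s)‖ := by congr 1; abel
    _ ≤ ‖Φ.symm z - Φ.symm x‖ + ‖((0 : Eucl n), s)‖ := norm_add_le _ _
    _ < r / 2 + r / 2 := add_lt_add h2 (by simpa [Prod.norm_mk] using hs)
    _ = r := by ring

/-- Over a neighbourhood of a regular value there are canonical coordinates on boxes of uniform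
size; in particular all values there are regular. -/
theorem exists_uniformBox_tube [IsManifold (𝓡 (2 * n)) ∞ M] [T2Space M]
    (hf : IsIntegrableSystem Ω f) {b : Eucl n} (hb : b ∈ regularValues f) :
    ∃ U : Set (Eucl n), IsOpen U ∧ b ∈ U ∧ (∀ c ∈ U, ∃ x, f x = c) ∧
      ∃ ε > 0, ∀ x, f x ∈ U → HasUniformBox Ω f ε x := by
  obtain ⟨ε, hε, W, hW, hbW, hbox⟩ : ∃ ε > 0, ∃ W : Set M, IsOpen W ∧ f ⁻¹' {b} ⊆ W ∧
      ∀ x ∈ W, HasUniformBox Ω f ε x := by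
    -- Compactness of the fibre makes the box size uniform; a union takes the smaller of two sizes.
    refine (hf.compact b).induction_on
      (p := fun K => ∃ ε > 0, ∃ W : Set M, IsOpen W ∧ K ⊆ W ∧ ∀ x ∈ W, HasUniformBox Ω f ε x)
      ⟨1, one_pos, ∅, isOpen_empty, Subset.rfl, by simp⟩ ?_ ?_ ?_
    · rintro s t hst ⟨ε, hε, W, hW, h, h'⟩
      exact ⟨ε, hε, W, hW, hst.trans h, h'⟩
    · rintro s t ⟨ε, hε, W, hW, h, h'⟩ ⟨ε₂, hε₂, W₂, hW₂, h₂, h₂'⟩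
      refine ⟨min ε ε₂, lt_min hε hε₂, W ∪ W₂, hW.union hW₂, union_subset_union h h₂, ?_⟩
      rintro x (hx | hx)
      · exact (h' x hx).mono (min_le_left _ _)
      · exact (h₂' x hx).mono (min_le_right _ _)
    · intro x hx
      obtain ⟨ε, hε, h⟩ := exists_uniformBox hf (hb.2 x hx)
      obtain ⟨W, hWs, hW, hxW⟩ := eventually_nhds_iff.1 h
      exact ⟨W, mem_nhdsWithin_of_mem_nhds (hW.mem_nhds hxW), ε, hε, W, hW, Subset.rfl, hWs⟩
  obtain ⟨U, hUs, hU, hbU⟩ := eventually_nhds_iff.1 (eventually_fibre_subset hf hb hW hbW)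
  exact ⟨U, hU, hbU, fun c hc => (hUs c hc).1, ε, hε, fun x hx => hbox x ((hUs _ hx).2 rfl)⟩

theorem IsDarbouxOn.surjective_dBase {H : Eucl n × Eucl n → M} {S : Set (Eucl n × Eucl n)}
    (h : IsDarbouxOn Ω f H S) (hf : IsIntegrableSystem Ω f) {p : Eucl n × Eucl n} (hp : p ∈ S) :
    Function.Surjective (dBase f (H p)) := by
  intro a
  refine ⟨mder (2 * n) H p (a, 0), ?_⟩
  rw [dBase_comp_mder (hf.smooth.mdifferentiableAt (by simp)) (h.mdifferentiableAt hp)]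
  have e : (f ∘ H) =ᶠ[𝓝 p] fun p => p.1 :=
    Filter.eventually_of_mem (h.isOpen.mem_nhds hp) h.base
  rw [e.fderiv_eq, fderiv_fst]
  rfl

theorem HasUniformBox.surjective_dBase {ε : ℝ} {x : M} (h : HasUniformBox Ω f ε x)
    (hf : IsIntegrableSystem Ω f) : Function.Surjective (dBase f x) := by
  obtain ⟨Φ, hΦ, hx, -⟩ := h
  have h1 := hΦ.surjective_dBase hf (Φ.map_target hx)
  have h2 : Φ (Φ.symm x) = x := Φ.right_inv hx
  exact h2 ▸ h1

/-- Canonical coordinates exist at every point over a neighbourhood of a regular value, and f is a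
submersion wherever they exist; the nearby fibres are nonempty as well. -/
theorem isOpen_regularValues [IsManifold (𝓡 (2 * n)) ∞ M] [T2Space M]
    (hf : IsIntegrableSystem Ω f) : IsOpen (regularValues f) := by
  rw [isOpen_iff_mem_nhds]
  intro b hb
  obtain ⟨U, hU, hbU, hne, ε, -, hbox⟩ := exists_uniformBox_tube hf hb
  refine Filter.mem_of_superset (hU.mem_nhds hbU) fun c hc => mem_regularValues.2 ⟨hne c hc, ?_⟩
  rintro x rfl
  exact (hbox x hc).surjective_dBase hf

end Tube

/-! ### The action of ℝⁿ over a neighbourhood of a regular value. -/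

section Flow

open Set

variable {n : ℕ} {M : Type*} [TopologicalSpace M] [ChartedSpace (Eucl (2 * n)) M]
  {Ω : SymplecticForm (2 * n) M} {f : M → Eucl n}

theorem IsOrbitOn.of_param
    {Φ : PartialDiffeomorph 𝓘(ℝ, Eucl n × Eucl n) (𝓡 (2 * n)) (Eucl n × Eucl n) M ∞}
    (hΦ : IsDarbouxOn Ω f Φ Φ.source) {x : M} {ε : ℝ}
    (h : ∀ s : Eucl n, ‖s‖ < ε → Φ.symm x + (0, s) ∈ Φ.source) :
    IsOrbitOn Ω f (fun s => Φ (Φ.symm x + (0, s))) (Metric.ball 0 ε) :=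
  (hΦ.isOrbitOn (Φ.symm x)).mono fun s hs => h s (by simpa using hs)

/-- Over a set of values with uniform boxes, the local actions of `ℝⁿ` extend to an action. -/
theorem exists_action [IsManifold (𝓡 (2 * n)) ∞ M] [T2Space M] {U : Set (Eucl n)} {ε : ℝ}
    (hε : 0 < ε) (hbox : ∀ x, f x ∈ U → HasUniformBox Ω f ε x) :
    ∃ Ψ : Eucl n → M → M, ∀ x, f x ∈ U → Ψ 0 x = x ∧ (∀ s, f (Ψ s x) = f x) ∧
      (∀ s t, Ψ (s + t) x = Ψ s (Ψ t x)) ∧ IsOrbitOn Ω f (fun s => Ψ s x) univ := by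
  have loc : ∀ x, ∃ g : Eucl n → M, f x ∈ U → g 0 = x ∧ (∀ s, ‖s‖ < ε → f (g s) = f x) ∧
      IsOrbitOn Ω f g (Metric.ball 0 ε) := by
    intro x
    by_cases hx : f x ∈ U
    swap
    · exact ⟨fun _ => x, fun h => absurd h hx⟩
    obtain ⟨Φ, hΦ, hxΦ, hev⟩ := hbox x hx
    have h2 : Φ (Φ.symm x) = x := Φ.right_inv hxΦ
    refine ⟨fun s => Φ (Φ.symm x + (0, s)), fun _ => ⟨?_, fun s hs => ?_,
      IsOrbitOn.of_param hΦ hev.self_of_nhds⟩⟩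
    · simp only [add_pair_zero]
      exact h2
    · refine (hΦ.base _ (hev.self_of_nhds s hs)).trans ?_
      have h1 : f (Φ (Φ.symm x)) = (Φ.symm x).1 := hΦ.base _ (Φ.map_target hxΦ)
      rw [h2] at h1
      simp [h1]
  choose g g0 using loc
  let φ : Eucl n → M → M := fun s x => g x s
  have φ0 : ∀ x, f x ∈ U → φ 0 x = x := fun x hx => (g0 x hx).1
  have φf : ∀ x, f x ∈ U → ∀ s, ‖s‖ < ε → f (φ s x) = f x := fun x hx => (g0 x hx).2.1
  have φo : ∀ x, f x ∈ U → IsOrbitOn Ω f (fun s => φ s x) (Metric.ball 0 ε) :=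
    fun x hx => (g0 x hx).2.2
  -- As functions of s both sides are orbit maps with the same value at s = 0; the half radius keeps
  -- s + t inside the box.
  have φadd : ∀ x, f x ∈ U → ∀ s t, ‖s‖ < ε / 2 → ‖t‖ < ε / 2 → φ (s + t) x = φ s (φ t x) := by
    intro x hx s t hs ht
    have ht' : ‖t‖ < ε := by linarith
    have hy : f (φ t x) ∈ U := by rw [φf x hx t ht']; exact hx
    have o1 := ((φo x hx).comp_add t).mono (T' := Metric.ball 0 (ε / 2)) fun s hs => by
      rw [mem_ball_zero_iff] at hs
      rw [mem_preimage, mem_ball_zero_iff]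
      exact (norm_add_le _ _).trans_lt (by linarith)
    have o2 := (φo _ hy).mono (Metric.ball_subset_ball (by linarith : ε / 2 ≤ ε))
    have := o1.eqOn o2 (convex_ball _ _).isPreconnected (Metric.mem_ball_self (by positivity))
      (by simp only [add_zero]; exact (φ0 _ hy).symm) (show s ∈ _ by simpa using hs)
    simpa [add_comm] using this
  let X := {x : M // f x ∈ U}
  let G : Eucl n → Function.End X := fun s x =>
    if hs : ‖s‖ < ε then ⟨φ s x, by rw [φf x x.2 s hs]; exact x.2⟩ else x
  have Gv : ∀ s, ‖s‖ < ε → ∀ x : X, (G s x : M) = φ s x := fun s hs x => by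
    simp only [G, dif_pos hs]
  obtain ⟨Γ, hΓ, hΓs⟩ := exists_hom_of_local G (half_pos hε) (by
    intro s t hs ht
    funext x
    apply Subtype.ext
    have h1 := Gv (s + t) ((norm_add_le s t).trans_lt (by linarith)) x
    have h2 := Gv s (by linarith) (G t x)
    have h3 := Gv t (by linarith) x
    refine h1.trans ((φadd x x.2 s t hs ht).trans ?_)
    rw [← h3, ← h2]
    rfl)
  have small : ∀ (y : X) s, ‖s‖ < ε / 2 → (Γ s y : M) = φ s y := fun y s hs => by
    rw [hΓs s hs]
    exact Gv s (by linarith) y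
  have step : ∀ s t (x : X), ‖t‖ < ε / 2 → (Γ (s + t) x : M) = φ t (Γ s x) := fun s t x ht => by
    rw [add_comm s t, hΓ]
    exact small _ t ht
  have hΓ0 : ∀ x : X, (Γ 0 x : M) = x := fun x => by
    rw [small _ 0 (by simpa using hε)]
    exact φ0 x x.2
  have hΓf : ∀ s (x : X), f (Γ s x) = f x := by
    intro s x
    -- Small steps preserve f, and ℝⁿ is connected.
    have lc : IsLocallyConstant fun s => f (Γ s x) := by
      rw [IsLocallyConstant.iff_eventually_eq]
      intro s
      filter_upwards [Metric.ball_mem_nhds s (half_pos hε)] with t ht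
      rw [mem_ball_iff_norm] at ht
      have h1 := step s (t - s) x ht
      rw [add_sub_cancel] at h1
      rw [h1]
      exact φf _ (Γ s x).2 _ (by linarith)
    have := lc.apply_eq_of_preconnectedSpace s 0
    rwa [hΓ0] at this
  classical
  refine ⟨fun s x => if hx : f x ∈ U then Γ s ⟨x, hx⟩ else x, fun x hx => ?_⟩
  have hU : ∀ s, f (Γ s ⟨x, hx⟩) ∈ U := fun s => (Γ s ⟨x, hx⟩).2
  simp only [dif_pos hx, dif_pos (hU _)]
  refine ⟨hΓ0 _, fun s => hΓf s _, fun s t => ?_, fun s _ => ?_⟩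
  · rw [hΓ]
    rfl
  · obtain ⟨H, S, p, hH, hp, e⟩ := φo _ (hU s) 0 (Metric.mem_ball_self hε)
    refine ⟨H, S, p, hH, hp, ?_⟩
    filter_upwards [e, Metric.ball_mem_nhds (0 : Eucl n) (half_pos hε)] with t ht hts
    rw [zero_add] at ht
    rw [← ht]
    exact step s t _ (by simpa using hts)

end Flow

/-! ### Canonical coordinates that are global along the fibres. -/

section Polarization

open Set

variable {n : ℕ} {M : Type*} [TopologicalSpace M] [ChartedSpace (Eucl (2 * n)) M]
  {Ω : SymplecticForm (2 * n) M} {f : M → Eucl n}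

/-- Orbit maps are open maps to the fibres. -/
theorem IsOrbitOn.eventually_mem_image [IsManifold (𝓡 (2 * n)) ∞ M] {g : Eucl n → M}
    {T : Set (Eucl n)} (h : IsOrbitOn Ω f g T) {s : Eucl n} (hs : s ∈ T) {N : Set (Eucl n)}
    (hN : N ∈ 𝓝 s) : ∀ᶠ z in 𝓝 (g s), f z = f (g s) → z ∈ g '' N := by
  obtain ⟨H, S, p, hH, hp, e⟩ := h s hs
  obtain ⟨Φ, hpΦ, -, hΦ, hD⟩ := hH.exists_chart hp
  have e0 : g s = Φ p := by
    have := e.self_of_nhds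
    rw [add_zero, add_pair_zero] at this
    rw [this, hΦ p hpΦ]
  have hx : g s ∈ Φ.target := by rw [e0]; exact Φ.map_source hpΦ
  have hsymm : Φ.symm (g s) = p := by rw [e0]; exact Φ.left_inv hpΦ
  have h1 : Filter.Tendsto (fun z => (Φ.symm z).2 - p.2) (𝓝 (g s)) (𝓝 0) := by
    have : ContinuousAt (fun z => (Φ.symm z).2 - p.2) (g s) :=
      ((PartialDiffeomorph.continuousAt_symm Φ hx).snd).sub continuousAt_const
    rw [ContinuousAt, hsymm, sub_self] at this
    exact this
  have hsN : ∀ᶠ t in 𝓝 (0 : Eucl n), s + t ∈ N := by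
    have : ContinuousAt (fun t => s + t) 0 := by fun_prop
    exact this.preimage_mem_nhds (by simpa using hN)
  filter_upwards [Φ.open_target.mem_nhds hx, h1.eventually e, h1.eventually hsN]
    with z hz hze hzN hfz
  have h2 : Φ (Φ.symm z) = z := Φ.right_inv hz
  have h3 : Φ.symm z ∈ Φ.source := Φ.map_target hz
  have h4 : (Φ.symm z).1 = p.1 := by
    rw [← hD.base _ h3, h2, hfz, e0, hD.base _ hpΦ]
  refine ⟨s + ((Φ.symm z).2 - p.2), hzN, ?_⟩
  rw [hze]
  have h5 : p + (0, (Φ.symm z).2 - p.2) = Φ.symm z := Prod.ext ((by simp : _ = p.1).trans h4.symm) (by simp)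
  rw [h5, ← hΦ _ h3, h2]

theorem IsDarbouxOn.of_local {F : Eucl n × Eucl n → M} {S : Set (Eucl n × Eucl n)}
    (hS : IsOpen S) (h : ∀ p ∈ S, ∃ O, p ∈ O ∧ IsDarbouxOn Ω f F O) : IsDarbouxOn Ω f F S := by
  refine ⟨hS, fun p hp => ?_, fun p hp => ?_, fun p hp => ?_⟩ <;> obtain ⟨O, hpO, hO⟩ := h p hp
  · exact (hO.smooth.contMDiffAt (hO.isOpen.mem_nhds hpO)).contMDiffWithinAt
  · exact hO.base p hpO
  · exact hO.darboux p hpO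

variable (Ω f) in
/-- `F` parametrizes `f⁻¹(U)` by canonical coordinates `(f, s)`, globally along the fibres. -/
structure IsPolarization (F : Eucl n × Eucl n → M) (U : Set (Eucl n)) : Prop where
  darbouxOn : IsDarbouxOn Ω f F (U ×ˢ univ)
  surj : ∀ x, f x ∈ U → ∃ s, F (f x, s) = x

theorem IsPolarization.isOrbitOn {F : Eucl n × Eucl n → M} {U : Set (Eucl n)}
    (h : IsPolarization Ω f F U) {c : Eucl n} (hc : c ∈ U) :
    IsOrbitOn Ω f (fun s => F (c, s)) univ := by
  have h1 := (h.darbouxOn.isOrbitOn (c, 0)).mono (T' := univ) fun s _ => by simpa using hc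
  simpa using h1

theorem IsPolarization.base {F : Eucl n × Eucl n → M} {U : Set (Eucl n)}
    (h : IsPolarization Ω f F U) {c : Eucl n} (hc : c ∈ U) (s : Eucl n) : f (F (c, s)) = c :=
  h.darbouxOn.base (c, s) ⟨hc, mem_univ _⟩

/-- By uniqueness of orbits, F on a whole box is Φ ∘ κ, where κ continues the transition map k = Φ⁻¹
∘ F from s₀ by vertical translation. Since k is symplectic over s₀, so is κ on the box, and F stays
canonical at distance up to ε along the fibre. -/
theorem IsDarbouxOn.extend_step [IsManifold (𝓡 (2 * n)) ∞ M] [T2Space M]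
    {F : Eucl n × Eucl n → M} {U : Set (Eucl n)} (hU : IsOpen U)
    (ho : ∀ c ∈ U, IsOrbitOn Ω f (fun s => F (c, s)) univ)
    {c₀ s₀ : Eucl n} {O : Set (Eucl n × Eucl n)} (hF : IsDarbouxOn Ω f F O) (hO : (c₀, s₀) ∈ O)
    (hc₀ : c₀ ∈ U) {ε : ℝ} (hε : 0 < ε) (hbox : HasUniformBox Ω f ε (F (c₀, s₀))) :
    ∀ s, ‖s - s₀‖ < ε → ∃ O, (c₀, s) ∈ O ∧ IsDarbouxOn Ω f F O := by
  obtain ⟨Φ, hΦ, hyΦ, hev⟩ := hbox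
  have hsymm : ∀ y ∈ Φ.target, Φ (Φ.symm y) = y := fun y hy => Φ.right_inv hy
  have hmap : ∀ y ∈ Φ.target, Φ.symm y ∈ Φ.source := fun y hy => Φ.map_target hy
  have Fc : ContinuousAt (fun c => F (c, s₀)) c₀ :=
    ContinuousAt.comp (g := F) (f := fun c : Eucl n => (c, s₀))
      (hF.smooth.continuousOn.continuousAt (hF.isOpen.mem_nhds hO)) (by fun_prop)
  have hOc : ∀ᶠ c in 𝓝 c₀, (c, s₀) ∈ O := by
    have : ContinuousAt (fun c : Eucl n => (c, s₀)) c₀ := by fun_prop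
    exact this.preimage_mem_nhds (hF.isOpen.mem_nhds hO)
  have hcU : ∀ᶠ c in 𝓝 c₀, c ∈ U := hU.mem_nhds hc₀
  have hFt : ∀ᶠ c in 𝓝 c₀, F (c, s₀) ∈ Φ.target :=
    Fc.preimage_mem_nhds (Φ.open_target.mem_nhds hyΦ)
  obtain ⟨N, hNs, hN, hcN⟩ := eventually_nhds_iff.1 (hcU.and (hOc.and (hFt.and (Fc.eventually hev))))
  let κ : Eucl n × Eucl n → Eucl n × Eucl n := fun z => Φ.symm (F (z.1, s₀)) + (0, z.2 - s₀)
  let k : Eucl n × Eucl n → Eucl n × Eucl n := fun z => Φ.symm (F z)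
  let O' : Set (Eucl n × Eucl n) := N ×ˢ Metric.ball s₀ ε
  have O'o : IsOpen O' := hN.prod Metric.isOpen_ball
  have κmem : ∀ z ∈ O', κ z ∈ Φ.source := fun z hz =>
    (hNs z.1 hz.1).2.2.2 _ (mem_ball_iff_norm.1 hz.2)
  have Fκ : ∀ z ∈ O', F z = Φ (κ z) := by
    intro z hz
    obtain ⟨hzU, hzO, hzt, hzb⟩ := hNs z.1 hz.1
    have o1 := IsOrbitOn.of_param hΦ hzb
    have o2 := ((ho z.1 hzU).comp_add s₀).mono (T' := Metric.ball 0 ε) fun s _ => mem_univ _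
    have := o2.eqOn o1 (convex_ball _ _).isPreconnected (Metric.mem_ball_self hε)
      (by simp only [add_zero, add_pair_zero]; exact (hsymm _ hzt).symm)
      (show z.2 - s₀ ∈ _ by simpa using mem_ball_iff_norm.1 hz.2)
    simp only [add_sub_cancel] at this
    exact this
  have ks : ∀ z ∈ O, F z ∈ Φ.target → ContMDiffAt 𝓘(ℝ, Eucl n × Eucl n) 𝓘(ℝ, Eucl n × Eucl n) ∞ k z := by
    intro z hz hzt
    have h1 : ContMDiffAt (𝓡 (2 * n)) 𝓘(ℝ, Eucl n × Eucl n) ∞ Φ.symm (F z) :=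
      Φ.contMDiffOn_invFun.contMDiffAt (Φ.open_target.mem_nhds hzt)
    exact h1.comp z (hF.smooth.contMDiffAt (hF.isOpen.mem_nhds hz))
  have κs : ∀ z ∈ O', ContDiffAt ℝ ∞ κ z := by
    intro z hz
    obtain ⟨hzU, hzO, hzt, hzb⟩ := hNs z.1 hz.1
    have h1 : ContDiffAt ℝ ∞ k (z.1, s₀) := (ks _ hzO hzt).contDiffAt
    have h2 : ContDiffAt ℝ ∞ (fun z : Eucl n × Eucl n => k (z.1, s₀)) z :=
      ContDiffAt.comp z (f := fun z : Eucl n × Eucl n => (z.1, s₀)) (g := k) h1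
        (by fun_prop)
    exact h2.add (by fun_prop)
  -- κ commutes with vertical translations and coincides with k near (z.1, s₀).
  have Dκ : ∀ z ∈ O', fderiv ℝ κ z = fderiv ℝ k (z.1, s₀) := by
    intro z hz
    obtain ⟨hzU, hzO, hzt, hzb⟩ := hNs z.1 hz.1
    have hz0 : (z.1, s₀) ∈ O' := ⟨hz.1, Metric.mem_ball_self hε⟩
    have e1 : k =ᶠ[𝓝 (z.1, s₀)] κ := by
      filter_upwards [O'o.mem_nhds hz0] with w hw
      have : Φ.symm (Φ (κ w)) = κ w := Φ.left_inv (κmem w hw)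
      simp only [k]
      rw [Fκ w hw, this]
    rw [e1.fderiv_eq]
    have e2 : κ = fun w => κ (w - (0, z.2 - s₀)) + (0, z.2 - s₀) := by
      funext w
      simp only [κ]
      rw [add_assoc]
      simp only [Prod.fst_sub, Prod.snd_sub, sub_zero, Prod.mk_add_mk, add_zero]
      congr 2
      abel
    have e3 : z - (0, z.2 - s₀) = (z.1, s₀) := by ext <;> simp
    conv_lhs => rw [e2]
    rw [fderiv_add_const, fderiv_comp_sub, e3]
  have Dk : ∀ c ∈ N, ∀ u v, stdForm (fderiv ℝ k (c, s₀) u) (fderiv ℝ k (c, s₀) v) = stdForm u v := by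
    intro c hc u v
    obtain ⟨hzU, hzO, hzt, hzb⟩ := hNs c hc
    have Fcz : ContinuousAt F (c, s₀) :=
      hF.smooth.continuousOn.continuousAt (hF.isOpen.mem_nhds hzO)
    have e1 : F =ᶠ[𝓝 (c, s₀)] Φ ∘ k := by
      filter_upwards [Fcz.preimage_mem_nhds (Φ.open_target.mem_nhds hzt)] with w hw
      exact (hsymm _ hw).symm
    have h1 := hF.darboux _ hzO u v
    rwa [pullbackTwo_congr Ω e1,
      pullbackTwo_comp Ω (hΦ.mdifferentiableAt (hmap _ hzt))
        ((ks _ hzO hzt).contDiffAt.differentiableAt (by simp)),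
      hΦ.darboux _ (hmap _ hzt)] at h1
  have key : IsDarbouxOn Ω f F O' := by
    have : IsDarbouxOn Ω f (Φ ∘ κ) O' := by
      refine ⟨O'o, fun z hz => ?_, fun z hz => ?_, fun z hz u v => ?_⟩
      · exact ((hΦ.smooth.contMDiffAt (hΦ.isOpen.mem_nhds (κmem z hz))).comp z
          (κs z hz).contMDiffAt).contMDiffWithinAt
      · obtain ⟨hzU, hzO, hzt, hzb⟩ := hNs z.1 hz.1
        refine (hΦ.base _ (κmem z hz)).trans ?_
        have h1 := hΦ.base _ (hmap _ hzt)
        rw [hsymm _ hzt, hF.base _ hzO] at h1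
        simpa [κ] using h1.symm
      · rw [pullbackTwo_comp Ω (hΦ.mdifferentiableAt (κmem z hz))
          ((κs z hz).differentiableAt (by simp)), hΦ.darboux _ (κmem z hz), Dκ z hz, Dk z.1 hz.1]
    exact this.congr Fκ
  intro s hs
  exact ⟨O', ⟨hcN, mem_ball_iff_norm.2 hs⟩, key⟩

/-- Near a regular value there are canonical coordinates which are global along the fibres. -/
theorem exists_polarization [IsManifold (𝓡 (2 * n)) ∞ M] [T2Space M]
    (hf : IsIntegrableSystem Ω f) {b : Eucl n} (hb : b ∈ regularValues f) :
    ∃ U F, IsOpen U ∧ b ∈ U ∧ IsPolarization Ω f F U := by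
  obtain ⟨U, hU, hbU, hne, ε, hε, hbox⟩ := exists_uniformBox_tube hf hb
  obtain ⟨Ψ, hΨ⟩ := exists_action hε hbox
  obtain ⟨x₀, hx₀⟩ := hne b hbU
  obtain ⟨Φ, hΦ, hxΦ⟩ := exists_darboux hf ((mem_regularValues.1 hb).2 x₀ hx₀)
  obtain ⟨p, hp, hpx⟩ : ∃ p ∈ Φ.source, Φ p = x₀ :=
    ⟨Φ.symm x₀, Φ.map_target hxΦ, Φ.right_inv hxΦ⟩
  have hpb : p.1 = b := by rw [← hx₀, ← hpx]; exact (hΦ.base p hp).symm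
  obtain ⟨U₁, hU₁, q, hq, hbU₁, hsub⟩ :
      ∃ U₁ : Set (Eucl n), IsOpen U₁ ∧ ∃ r > 0, b ∈ U₁ ∧ U₁ ×ˢ Metric.ball p.2 r ⊆ Φ.source := by
    obtain ⟨u, v, hu, hv, hpu, hpv, huv⟩ :=
      isOpen_prod_iff.1 Φ.open_source p.1 p.2 hp
    obtain ⟨r, hr, hb'⟩ := Metric.isOpen_iff.1 hv _ hpv
    exact ⟨u, hu, r, hr, hpb ▸ hpu, (prod_mono Subset.rfl hb').trans huv⟩
  -- The flow starts on the section where the coordinate q keeps the value p.2. With this choice F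
  -- is a vertical translate of Φ for small s, hence canonical there.
  let F : Eucl n × Eucl n → M := fun z => Ψ z.2 (Φ (z.1, p.2))
  have hσ : ∀ c ∈ U ∩ U₁, f (Φ (c, p.2)) = c := fun c hc =>
    hΦ.base (c, p.2) (hsub ⟨hc.2, Metric.mem_ball_self hq⟩)
  have Ff : ∀ c ∈ U ∩ U₁, ∀ s, f (F (c, s)) = c := fun c hc s => by
    have h1 : f (Φ (c, p.2)) ∈ U := by rw [hσ c hc]; exact hc.1
    exact ((hΨ _ h1).2.1 s).trans (hσ c hc)
  have Fo : ∀ c ∈ U ∩ U₁, IsOrbitOn Ω f (fun s => F (c, s)) univ := fun c hc =>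
    (hΨ _ (by rw [hσ c hc]; exact hc.1)).2.2.2
  refine ⟨U ∩ U₁, F, hU.inter hU₁, ⟨hbU, hbU₁⟩, ?_, fun x hx => ?_⟩
  · refine IsDarbouxOn.of_local ((hU.inter hU₁).prod isOpen_univ) ?_
    rintro ⟨c₀, s₁⟩ ⟨hc₀, -⟩
    -- This set is stable under moves shorter than the fixed ε, so it is open and closed; it
    -- contains 0, hence is everything.
    let A : Set (Eucl n) := {s | ∃ O, (c₀, s) ∈ O ∧ IsDarbouxOn Ω f F O}
    have step : ∀ s ∈ A, ∀ s', ‖s' - s‖ < ε → s' ∈ A := by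
      rintro s ⟨O, hsO, hO⟩ s' hs'
      exact hO.extend_step (hU.inter hU₁) Fo hsO hc₀ hε
        (hbox _ (by rw [Ff c₀ hc₀ s]; exact hc₀.1)) s' hs'
    have hA0 : (0 : Eucl n) ∈ A := by
      refine ⟨(U ∩ U₁) ×ˢ Metric.ball 0 q, ⟨hc₀, Metric.mem_ball_self hq⟩, ?_⟩
      have sub : ∀ z ∈ (U ∩ U₁) ×ˢ Metric.ball (0 : Eucl n) q, z + (0, p.2) ∈ Φ.source := by
        rintro ⟨c, s⟩ ⟨hc, hs⟩
        refine hsub ⟨by simpa using hc.2, ?_⟩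
        simpa [mem_ball_iff_norm] using hs
      have h1 : IsDarbouxOn Ω f (Φ ∘ fun z => z + (0, p.2)) ((U ∩ U₁) ×ˢ Metric.ball 0 q) := by
        refine ⟨(hU.inter hU₁).prod Metric.isOpen_ball, fun z hz => ?_, fun z hz => ?_,
          fun z hz u v => ?_⟩
        · refine ((hΦ.smooth.contMDiffAt (hΦ.isOpen.mem_nhds (sub z hz))).comp z
            (f := fun z => z + (0, p.2)) ?_).contMDiffWithinAt
          exact ContDiffAt.contMDiffAt (by fun_prop)
        · exact (hΦ.base _ (sub z hz)).trans (by simp)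
        · rw [pullbackTwo_comp Ω (k := fun z => z + (0, p.2)) (x := z)
              (hΦ.mdifferentiableAt (sub z hz)) (by fun_prop),
            hΦ.darboux _ (sub z hz), fderiv_add_const]
          simp
      refine h1.congr ?_
      rintro ⟨c, s⟩ ⟨hc, hs⟩
      have o1 := (Fo c hc).mono (T' := Metric.ball 0 q) fun s _ => mem_univ _
      have o2 := (hΦ.isOrbitOn (c, p.2)).mono (T' := Metric.ball 0 q) fun s hs => by
        have := sub (c, s) ⟨hc, hs⟩
        simpa [add_comm] using this
      have := o1.eqOn o2 (convex_ball _ _).isPreconnected (Metric.mem_ball_self hq) ?_ hs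
      · simpa [add_comm] using this
      · simp only [add_pair_zero]
        exact (hΨ _ (by rw [hσ c hc]; exact hc.1)).1
    have hAo : IsOpen A := by
      rw [Metric.isOpen_iff]
      exact fun s hs => ⟨ε, hε, fun s' hs' => step s hs s' (mem_ball_iff_norm.1 hs')⟩
    have hAc : IsClosed A := by
      rw [← isOpen_compl_iff, Metric.isOpen_iff]
      exact fun s hs => ⟨ε, hε, fun s' hs' h => hs (step s' h s (by
        rw [norm_sub_rev]; exact mem_ball_iff_norm.1 hs'))⟩
    have : A = univ := (isClopen_iff.1 ⟨hAc, hAo⟩).resolve_left (nonempty_iff_ne_empty.1 ⟨0, hA0⟩)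
    have hs₁ : s₁ ∈ A := by rw [this]; exact mem_univ s₁
    exact hs₁
  · set c := f x with hc
    -- Orbits are open in the fibre and partition it, so the connected fibre is a single orbit.
    let orb : M → Set M := fun y => range fun s => Ψ s y
    have hself : ∀ y, f y ∈ U → y ∈ orb y := fun y hy => ⟨0, (hΨ y hy).1⟩
    have hopen : ∀ y, f y = c → ∀ᶠ z in 𝓝 y, f z = c → z ∈ orb y := by
      intro y hy
      have hyU : f y ∈ U := hy ▸ hx.1
      have := (hΨ y hyU).2.2.2.eventually_mem_image (mem_univ 0) Filter.univ_mem
      simp only [(hΨ y hyU).1, image_univ] at this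
      rwa [hy] at this
    have htrans : ∀ y z w, f y = c → w ∈ orb y → w ∈ orb z → f z = c → z ∈ orb y := by
      rintro y z _ hy ⟨s, rfl⟩ ⟨t, ht⟩ hz
      have hyU : f y ∈ U := hy ▸ hx.1
      have hzU : f z ∈ U := hz ▸ hx.1
      refine ⟨-t + s, ?_⟩
      simp only at ht ⊢
      rw [(hΨ y hyU).2.2.1, ← ht, ← (hΨ z hzU).2.2.1, neg_add_cancel, (hΨ z hzU).1]
    set y₀ := Φ (c, p.2)
    have hy₀ : f y₀ = c := hσ c hx
    let V₁ := interior {z | f z = c → z ∈ orb y₀}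
    let V₂ := interior {z | f z = c → z ∉ orb y₀}
    have sub : f ⁻¹' {c} ⊆ V₁ := by
      have cover : f ⁻¹' {c} ⊆ V₁ ∪ V₂ := by
        intro z hz
        by_cases h : z ∈ orb y₀
        · refine Or.inl (mem_interior_iff_mem_nhds.2 ?_)
          filter_upwards [hopen z hz] with w hw hwc
          exact htrans y₀ w w hy₀ (by
            obtain ⟨s, rfl⟩ := h
            obtain ⟨t, rfl⟩ := hw hwc
            exact ⟨t + s, (hΨ y₀ (hy₀ ▸ hx.1)).2.2.1 t s⟩) (hself w (hwc ▸ hx.1)) hwc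
        · refine Or.inr (mem_interior_iff_mem_nhds.2 ?_)
          filter_upwards [hopen z hz] with w hw hwc hwo
          exact h (htrans y₀ z w hy₀ hwo (hw hwc) hz)
      intro w hw
      by_contra hw₁
      obtain ⟨z, hz, h1, h2⟩ := hf.connected c V₁ V₂ isOpen_interior isOpen_interior cover
        ⟨y₀, hy₀, mem_interior_iff_mem_nhds.2 (hopen y₀ hy₀)⟩
        ⟨w, hw, (cover hw).resolve_left hw₁⟩
      exact interior_subset h2 hz (interior_subset h1 hz)
    exact interior_subset (sub (show x ∈ f ⁻¹' {c} from rfl)) rfl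

end Polarization

/-! ### Period lattices. -/

section Lattice

open Set

variable {n : ℕ} {M : Type*}

/-- The periods of `F (c, ·)`. -/
def periods (F : Eucl n × Eucl n → M) (c : Eucl n) : Submodule ℤ (Eucl n) :=
  AddSubgroup.toIntSubmodule
    { carrier := {s | ∀ t, F (c, t + s) = F (c, t)}
      zero_mem' := fun t => by rw [add_zero]
      add_mem' := fun {a b} ha hb t => by rw [← add_assoc, hb, ha]
      neg_mem' := fun {a} ha t => by
        have := ha (t + -a)
        rw [neg_add_cancel_right] at this
        exact this.symm }

variable [TopologicalSpace M] [ChartedSpace (Eucl (2 * n)) M]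
  [IsManifold (𝓡 (2 * n)) ∞ M]
  {Ω : SymplecticForm (2 * n) M} {f : M → Eucl n}

theorem IsDarbouxOn.exists_injOn {H : Eucl n × Eucl n → M} {S : Set (Eucl n × Eucl n)}
    (h : IsDarbouxOn Ω f H S) {p : Eucl n × Eucl n} (hp : p ∈ S) : ∃ O ∈ 𝓝 p, InjOn H O := by
  obtain ⟨Φ, h1, -, h3, -⟩ := h.exists_chart hp
  refine ⟨Φ.source, Φ.open_source.mem_nhds h1, fun x hx y hy e => ?_⟩
  rw [← h3 x hx, ← h3 y hy] at e
  exact Φ.injOn hx hy e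

variable [T2Space M] {F : Eucl n × Eucl n → M} {U : Set (Eucl n)}
  {c : Eucl n}

/-- Two translates of an orbit map that agree at one point agree everywhere, by `IsOrbitOn.eqOn`. -/
theorem IsPolarization.eq_iff (h : IsPolarization Ω f F U) (hc : c ∈ U) {s s' : Eucl n} :
    F (c, s) = F (c, s') ↔ s' - s ∈ periods F c := by
  constructor
  · intro e t
    have o1 := (h.isOrbitOn hc).comp_add s
    have o2 := (h.isOrbitOn hc).comp_add s'
    have := o1.eqOn o2 isPreconnected_univ (mem_univ 0) (by simpa using e) (mem_univ (t - s))
    simp only [add_sub_cancel] at this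
    rw [this]
    congr 2
    abel
  · intro hs
    have := hs s
    rw [add_sub_cancel] at this
    exact this.symm

theorem IsPolarization.mem_periods_iff (h : IsPolarization Ω f F U) (hc : c ∈ U) {s : Eucl n} :
    s ∈ periods F c ↔ F (c, s) = F (c, 0) := by
  rw [eq_comm, h.eq_iff hc, sub_zero]

/-- F is injective near (c, 0), so 0 is an isolated period. -/
theorem IsPolarization.discreteTopology (h : IsPolarization Ω f F U) (hc : c ∈ U) :
    DiscreteTopology (periods F c) := by
  obtain ⟨O, hO, inj⟩ := h.darbouxOn.exists_injOn (p := (c, 0)) ⟨hc, mem_univ _⟩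
  have : DiscreteTopology (periods F c).toAddSubgroup := by
    refine discreteTopology_of_isOpen_singleton_zero ?_
    rw [isOpen_iff_mem_nhds]
    rintro _ rfl
    have hN : {s : periods F c | (c, (s : Eucl n)) ∈ O} ∈ 𝓝 (0 : periods F c) := by
      have : ContinuousAt (fun s : periods F c => (c, (s : Eucl n))) 0 := by fun_prop
      exact this.preimage_mem_nhds hO
    filter_upwards [hN] with s hs
    have := inj hs (mem_of_mem_nhds hO) ((h.mem_periods_iff hc).1 s.2)
    exact Subtype.ext (congrArg Prod.snd this)
  exact this

/-- Orbit maps are open onto the fibre, so the images of the balls of integer radius give an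
increasing open cover of the compact fibre. One ball suffices: the lattice is cocompact. -/
theorem IsPolarization.exists_radius (h : IsPolarization Ω f F U) (hf : IsIntegrableSystem Ω f)
    (hc : c ∈ U) : ∃ R : ℝ, ∀ s, ∃ s', ‖s'‖ < R ∧ s - s' ∈ periods F c := by
  let V : ℕ → Set M := fun m => {x | ∀ᶠ z in 𝓝 x, f z = c → ∃ s, ‖s‖ < m ∧ F (c, s) = z}
  have hmono : Monotone V := fun m m' hm x hx => by
    refine hx.mono fun z hz hzc => ?_
    obtain ⟨s, hs, e⟩ := hz hzc
    exact ⟨s, hs.trans_le (by exact_mod_cast hm), e⟩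
  have hcov : f ⁻¹' {c} ⊆ ⋃ m, V m := by
    rintro x (rfl : f x = c)
    obtain ⟨s, hs⟩ := h.surj x hc
    obtain ⟨m, hm⟩ := exists_nat_gt ‖s‖
    refine mem_iUnion.2 ⟨m, ?_⟩
    have o := (h.isOrbitOn hc).eventually_mem_image (mem_univ s)
      (Metric.isOpen_ball.mem_nhds (show s ∈ Metric.ball (0 : Eucl n) m by simpa using hm))
    simp only [hs] at o
    exact o.mono fun z hz hzc => by simpa using hz hzc
  obtain ⟨m, hm⟩ := (hf.compact c).elim_directed_cover V
    (fun m => isOpen_setOfPred_eventually_nhds) hcov (directed_of_isDirected_le hmono)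
  refine ⟨m, fun s => ?_⟩
  obtain ⟨s', hs', e⟩ := (hm (show F (c, s) ∈ f ⁻¹' {c} from h.base hc s)).self_of_nhds
    (h.base hc s)
  exact ⟨s', hs', (h.eq_iff hc).1 e⟩

/-- Suppose v ≠ 0 is orthogonal to all periods. Reducing (R / ‖v‖) v modulo periods keeps its inner
product R ‖v‖ with v, yet yields a vector of norm less than R, against Cauchy–Schwarz. -/
theorem IsPolarization.span_periods (h : IsPolarization Ω f F U) (hf : IsIntegrableSystem Ω f)
    (hc : c ∈ U) : Submodule.span ℝ (periods F c : Set (Eucl n)) = ⊤ := by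
  obtain ⟨R, hR⟩ := h.exists_radius hf hc
  rw [← Submodule.orthogonal_eq_bot_iff, Submodule.eq_bot_iff]
  intro v hv
  by_contra hv0
  have hvn : 0 < ‖v‖ := norm_pos_iff.2 hv0
  obtain ⟨s', hs', hmem⟩ := hR ((R / ‖v‖) • v)
  have h1 : inner ℝ ((R / ‖v‖) • v - s') v = 0 :=
    Submodule.inner_right_of_mem_orthogonal (Submodule.subset_span hmem) hv
  rw [inner_sub_left, real_inner_smul_left, real_inner_self_eq_norm_sq] at h1
  have h2 := real_inner_le_norm s' v
  have h3 : R / ‖v‖ * ‖v‖ ^ 2 = R * ‖v‖ := by field_simp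
  nlinarith

/-- The linear map with given values on the standard basis. -/
def combo (τ : Fin n → Eucl n) : Eucl n →L[ℝ] Eucl n :=
  ∑ j, (EuclideanSpace.proj j : Eucl n →L[ℝ] ℝ).smulRight (τ j)

theorem combo_apply (τ : Fin n → Eucl n) (x : Eucl n) : combo τ x = ∑ j, x j • τ j := by
  simp [combo]

theorem inner_combo (τ : Fin n → Eucl n) (x v : Eucl n) :
    inner ℝ (combo τ x) v = ∑ j, x j * inner ℝ (τ j) v := by
  simp [combo_apply, sum_inner, real_inner_smul_left]

theorem IsPolarization.exists_basis (h : IsPolarization Ω f F U) (hf : IsIntegrableSystem Ω f)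
    (hc : c ∈ U) : ∃ τ : Fin n → Eucl n, Function.Bijective (combo τ) ∧
      ∀ s, s ∈ periods F c ↔ ∃ k : Fin n → ℤ, s = ∑ j, k j • τ j := by
  have := h.discreteTopology hc
  have : IsZLattice ℝ (periods F c) := ⟨h.span_periods hf hc⟩
  have := ZLattice.module_free ℝ (periods F c)
  have := ZLattice.module_finite ℝ (periods F c)
  let e : Module.Basis (Fin n) ℤ (periods F c) := Module.finBasisOfFinrankEq ℤ _ (by
    rw [ZLattice.rank ℝ]; simp)
  let e' : Module.Basis (Fin n) ℝ (Eucl n) := e.ofZLatticeBasis ℝ (periods F c)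
  have he : ∀ j, e' j = e j := e.ofZLatticeBasis_apply ℝ (periods F c)
  refine ⟨fun j => e j, ?_, fun s => ?_⟩
  · constructor
    · rw [injective_iff_map_eq_zero]
      intro x hx
      rw [combo_apply] at hx
      simp only [← he] at hx
      have := Fintype.linearIndependent_iff.1 e'.linearIndependent (fun j => x j) hx
      ext j
      exact this j
    · intro x
      refine ⟨WithLp.toLp 2 (e'.repr x), ?_⟩
      rw [combo_apply]
      simp only [← he]
      exact e'.sum_repr x
  · constructor
    · intro hs
      refine ⟨e.repr ⟨s, hs⟩, ?_⟩
      have := congrArg Subtype.val (e.sum_repr ⟨s, hs⟩)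
      simpa only [Submodule.coe_sum, Submodule.coe_smul] using this.symm
    · rintro ⟨k, rfl⟩
      exact Submodule.sum_mem _ fun j _ => Submodule.smul_mem _ _ (e j).2

end Lattice

/-! ### Smooth families of periods. -/

section SmoothPeriods

open Set

variable {n : ℕ} {M : Type*} [TopologicalSpace M] [ChartedSpace (Eucl (2 * n)) M]
  [T2Space M] {Ω : SymplecticForm (2 * n) M} {f : M → Eucl n} {F : Eucl n × Eucl n → M} {U : Set (Eucl n)}
  {b : Eucl n}

/-- Periods extend smoothly to the neighbouring fibres. -/
theorem IsPolarization.exists_local_period [IsManifold (𝓡 (2 * n)) ∞ M] (h : IsPolarization Ω f F U) (hU : IsOpen U)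
    (hb : b ∈ U) {s₀ : Eucl n} (hs₀ : s₀ ∈ periods F b) :
    ∃ (t : Eucl n → Eucl n) (N : Set (Eucl n)), IsOpen N ∧ b ∈ N ∧ N ⊆ U ∧ ContDiffOn ℝ ∞ t N ∧
      t b = s₀ ∧ ∀ c ∈ N, t c ∈ periods F c := by
  obtain ⟨Φ, hpΦ, hΦU, hΦ, hD⟩ := h.darbouxOn.exists_chart (p := (b, s₀)) ⟨hb, mem_univ _⟩
  have e0 : F (b, 0) = Φ (b, s₀) := by rw [hΦ _ hpΦ, (h.mem_periods_iff hb).1 hs₀]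
  have Fs : ∀ c ∈ U, ContMDiffAt 𝓘(ℝ, Eucl n) (𝓡 (2 * n)) ∞ (fun c => F (c, 0)) c := by
    intro c hc
    refine ContMDiffAt.comp c (f := fun c : Eucl n => (c, (0 : Eucl n)))
      (h.darbouxOn.smooth.contMDiffAt (h.darbouxOn.isOpen.mem_nhds ⟨hc, mem_univ _⟩)) ?_
    exact ContDiffAt.contMDiffAt (by fun_prop)
  have h1 : ∀ᶠ c in 𝓝 b, F (c, 0) ∈ Φ.target :=
    (Fs b hb).continuousAt.preimage_mem_nhds (by
      rw [e0]; exact Φ.open_target.mem_nhds (Φ.map_source hpΦ))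
  obtain ⟨N, hNs, hN, hbN⟩ := eventually_nhds_iff.1 ((hU.eventually_mem hb).and h1)
  -- F has a local inverse near (b, s₀), and F(b, s₀) = F(b, 0); the continued period is the fibre
  -- coordinate of F(c, 0) under this inverse.
  refine ⟨fun c => (Φ.symm (F (c, 0))).2, N, hN, hbN, fun c hc => (hNs c hc).1, ?_, ?_, ?_⟩
  · intro c hc
    have h2 : ContMDiffAt (𝓡 (2 * n)) 𝓘(ℝ, Eucl n × Eucl n) ∞ Φ.symm (F (c, 0)) :=
      Φ.contMDiffOn_invFun.contMDiffAt (Φ.open_target.mem_nhds (hNs c hc).2)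
    have h3 := (h2.comp c (Fs c (hNs c hc).1)).contDiffAt
    exact h3.snd.contDiffWithinAt
  · have : Φ.symm (Φ (b, s₀)) = (b, s₀) := Φ.left_inv hpΦ
    simp only
    rw [e0, this]
  · intro c hc
    obtain ⟨hcU, hct⟩ := hNs c hc
    have h2 : Φ (Φ.symm (F (c, 0))) = F (c, 0) := Φ.right_inv hct
    have h3 : Φ.symm (F (c, 0)) ∈ Φ.source := Φ.map_target hct
    have h4 : (Φ.symm (F (c, 0))).1 = c := by
      rw [← hD.base _ h3, h2, h.base hcU]
    have h5 : (c, (Φ.symm (F (c, 0))).2) = Φ.symm (F (c, 0)) := Prod.ext h4.symm rfl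
    rw [h.mem_periods_iff hcU, h5, ← hΦ _ h3, h2]

theorem continuous_combo : Continuous (combo : (Fin n → Eucl n) → (Eucl n →L[ℝ] Eucl n)) := by
  unfold combo
  refine continuous_finsetSum _ fun j _ => ?_
  exact ((ContinuousLinearMap.smulRightL ℝ (Eucl n) (Eucl n)
    (EuclideanSpace.proj j : Eucl n →L[ℝ] ℝ)).continuous).comp (continuous_apply j)

/-- A basis of the lattice at b continues to independent periods nearby. They still generate:
subtracting integral parts reduces any period to a bounded one, and compactness of a ball excludes
new bounded periods. -/
theorem IsPolarization.exists_period_frame [IsManifold (𝓡 (2 * n)) ∞ M] (h : IsPolarization Ω f F U)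
    (hf : IsIntegrableSystem Ω f) (hU : IsOpen U) (hb : b ∈ U) :
    ∃ (r : ℝ) (τ : Eucl n → Fin n → Eucl n), 0 < r ∧ Metric.ball b r ⊆ U ∧
      (∀ j, ContDiffOn ℝ ∞ (fun c => τ c j) (Metric.ball b r)) ∧
      ∀ c ∈ Metric.ball b r, Function.Bijective (combo (τ c)) ∧
        ∀ s, s ∈ periods F c ↔ ∃ k : Fin n → ℤ, s = ∑ j, k j • τ c j := by
  obtain ⟨τ₀, hbij, hper⟩ := h.exists_basis hf hb
  have hτ₀ : ∀ j, τ₀ j ∈ periods F b := fun j =>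
    (hper _).2 ⟨Pi.single j 1, by simp [Pi.single_apply]⟩
  choose t N hN hbN hNU ht htb htp using fun j => h.exists_local_period hU hb (hτ₀ j)
  let τ : Eucl n → Fin n → Eucl n := fun c j => t j c
  have τb : τ b = τ₀ := funext htb
  have τc : ∀ j, ContinuousAt (t j) b := fun j =>
    (ht j).continuousOn.continuousAt ((hN j).mem_nhds (hbN j))
  have τc' : ContinuousAt τ b := continuousAt_pi.2 τc
  have ev1 : ∀ᶠ c in 𝓝 b, ∀ j, c ∈ N j := Filter.eventually_all.2 fun j => (hN j).mem_nhds (hbN j)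
  have ev2 : ∀ᶠ c in 𝓝 b, Function.Bijective (combo (τ c)) := by
    let e := (LinearEquiv.ofBijective (combo τ₀).toLinearMap hbij).toContinuousLinearEquiv
    have he : (e : Eucl n →L[ℝ] Eucl n) = combo (τ b) := by rw [τb]; ext1 x; rfl
    have h1 : ContinuousAt (fun c => combo (τ c)) b := continuous_combo.continuousAt.comp τc'
    have h2 := h1.preimage_mem_nhds (by rw [← he]; exact ContinuousLinearEquiv.nhds e)
    filter_upwards [h2] with c ⟨e', he'⟩
    have he'' : (e' : Eucl n →L[ℝ] Eucl n) = combo (τ c) := he'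
    rw [← he'']
    exact e'.bijective
  -- For c near b this bounds all combinations of the τ_j with coefficients in [0, 1).
  let R : ℝ := ∑ j, ‖τ b j‖ + 1
  have ev3 : ∀ᶠ c in 𝓝 b, ∑ j, ‖τ c j‖ < R := by
    have h1 : ContinuousAt (fun c => ∑ j, ‖τ c j‖) b :=
      tendsto_finsetSum _ fun j _ => (τc j).norm
    exact h1.eventually_lt_const (by simp [R])
  -- Near a period ∑ k_j τ_j of b, local injectivity of F leaves only the continued combination;
  -- near a non-period the inequality F(c, s) ≠ F(c, 0) persists. Compactness of the ball makes the
  -- neighbourhood of b uniform in s.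
  have ev4 : ∀ᶠ c in 𝓝 b, ∀ s ∈ Metric.closedBall (0 : Eucl n) R,
      F (c, s) = F (c, 0) → ∃ k : Fin n → ℤ, s = ∑ j, k j • τ c j := by
    refine (isCompact_closedBall 0 R).eventually_forall_of_forall_eventually fun s _ => ?_
    have Fc : ∀ s, ContinuousAt F (b, s) := fun s => h.darbouxOn.smooth.continuousOn.continuousAt
      (h.darbouxOn.isOpen.mem_nhds ⟨hb, mem_univ _⟩)
    have Fc0 : ContinuousAt (fun z : Eucl n × Eucl n => F (z.1, 0)) (b, s) :=
      ContinuousAt.comp (g := F) (f := fun z : Eucl n × Eucl n => (z.1, (0 : Eucl n))) (Fc 0)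
        (by fun_prop)
    by_cases hs : s ∈ periods F b
    · obtain ⟨k, hk⟩ := (hper s).1 hs
      obtain ⟨O, hO, inj⟩ := h.darbouxOn.exists_injOn (p := (b, s)) ⟨hb, mem_univ _⟩
      have h1 : ContinuousAt (fun z : Eucl n × Eucl n => (z.1, ∑ j, k j • τ z.1 j)) (b, s) := by
        refine continuousAt_fst.prodMk ?_
        exact tendsto_finsetSum _ fun j _ => by
          have h3 : ContinuousAt (fun z : Eucl n × Eucl n => t j z.1) (b, s) :=
            ContinuousAt.comp (g := t j) (f := Prod.fst) (τc j) continuousAt_fst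
          exact h3.const_smul (k j)
      have h2 := h1.preimage_mem_nhds (t := O) (by simp only [τb, ← hk]; exact hO)
      filter_upwards [hO, h2, continuousAt_fst.eventually ev1,
        continuousAt_fst.eventually (hU.eventually_mem hb)] with z hz1 hz2 hzN hzU e
      refine ⟨k, congrArg Prod.snd (inj hz1 hz2 (e.trans ?_))⟩
      refine ((h.mem_periods_iff hzU).1 ?_).symm
      exact Submodule.sum_mem _ fun j _ => Submodule.smul_mem _ _ (htp j _ (hzN j))
    · rw [h.mem_periods_iff hb] at hs
      filter_upwards [((Fc s).ne_iff_eventually_ne Fc0).1 hs] with z hz e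
      exact absurd e hz
  obtain ⟨r, hr, hball⟩ := Metric.eventually_nhds_iff_ball.1
    ((hU.eventually_mem hb).and (ev1.and (ev2.and (ev3.and ev4))))
  refine ⟨r, τ, hr, fun c hc => (hball c hc).1,
    fun j => (ht j).mono fun c hc => (hball c hc).2.1 j, fun c hc => ?_⟩
  obtain ⟨hcU, hcN, hcb, hcR, hcs⟩ := hball c hc
  refine ⟨hcb, fun s => ⟨fun hs => ?_, ?_⟩⟩
  · obtain ⟨x, rfl⟩ := hcb.2 s
    have hmem : ∑ j, ⌊x j⌋ • τ c j ∈ periods F c :=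
      Submodule.sum_mem _ fun j _ => Submodule.smul_mem _ _ (htp j _ (hcN j))
    have e : combo (τ c) x - ∑ j, ⌊x j⌋ • τ c j = ∑ j, Int.fract (x j) • τ c j := by
      rw [combo_apply, ← Finset.sum_sub_distrib]
      refine Finset.sum_congr rfl fun j _ => ?_
      rw [← Int.self_sub_floor, sub_smul, Int.cast_smul_eq_zsmul]
    obtain ⟨k, hk⟩ := hcs _ (by
      rw [mem_closedBall_zero_iff]
      refine (norm_sum_le _ _).trans (le_trans ?_ hcR.le)
      refine Finset.sum_le_sum fun j _ => ?_
      rw [norm_smul, Real.norm_of_nonneg (Int.fract_nonneg _)]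
      exact mul_le_of_le_one_left (norm_nonneg _) (Int.fract_lt_one _).le)
      ((h.mem_periods_iff hcU).1 (e ▸ Submodule.sub_mem _ hs hmem))
    refine ⟨fun j => k j + ⌊x j⌋, ?_⟩
    rw [sub_eq_iff_eq_add.1 (e.trans hk)]
    simp only [add_smul, Finset.sum_add_distrib]
  · rintro ⟨k, rfl⟩
    exact Submodule.sum_mem _ fun j _ => Submodule.smul_mem _ _ (htp j _ (hcN j))

omit [T2Space M] in
/-- Smooth families of periods are closed `1`-forms on the base. -/
theorem IsPolarization.period_closed (h : IsPolarization Ω f F U) {t : Eucl n → Eucl n}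
    {N : Set (Eucl n)} (hN : IsOpen N) (hNU : N ⊆ U) (ht : ContDiffOn ℝ ∞ t N)
    (htp : ∀ c ∈ N, t c ∈ periods F c) {c : Eucl n} (hc : c ∈ N) (u v : Eucl n) :
    inner ℝ u (fderiv ℝ t c v) = inner ℝ v (fderiv ℝ t c u) := by
  let κ : Eucl n × Eucl n → Eucl n × Eucl n := fun z => (z.1, z.2 + t z.1)
  have td : HasFDerivAt t (fderiv ℝ t c) c :=
    ((ht.contDiffAt (hN.mem_nhds hc)).differentiableAt (by simp)).hasFDerivAt
  have td' : HasFDerivAt (fun z : Eucl n × Eucl n => t z.1)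
      ((fderiv ℝ t c).comp (ContinuousLinearMap.fst ℝ _ _)) (c, 0) :=
    HasFDerivAt.comp (c, (0 : Eucl n)) (f := Prod.fst) (g := t) td hasFDerivAt_fst
  have κd : HasFDerivAt κ ((ContinuousLinearMap.fst ℝ _ _).prod
      (ContinuousLinearMap.snd ℝ _ _ + (fderiv ℝ t c).comp (ContinuousLinearMap.fst ℝ _ _))) (c, 0) :=
    hasFDerivAt_fst.prodMk (hasFDerivAt_snd.add td')
  -- Translation by the period does not change F, so κ preserves the standard form. On two
  -- horizontal vectors this is exactly the symmetry of the derivative of t.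
  have e1 : F =ᶠ[𝓝 (c, 0)] F ∘ κ := by
    filter_upwards [continuousAt_fst.eventually (hN.eventually_mem hc)] with z hz
    exact (htp _ hz z.2).symm
  have hcU : ∀ s : Eucl n, (c, s) ∈ U ×ˢ (univ : Set (Eucl n)) := fun s => ⟨hNU hc, mem_univ _⟩
  have h1 := h.darbouxOn.darboux (c, 0) (hcU 0) (u, 0) (v, 0)
  rw [pullbackTwo_congr Ω e1,
    pullbackTwo_comp Ω (g := F) (k := κ) (x := (c, 0)) (h.darbouxOn.mdifferentiableAt (hcU _)) κd.differentiableAt,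
    h.darbouxOn.darboux (κ (c, 0)) (hcU _), κd.fderiv] at h1
  simp [stdForm] at h1
  linarith

end SmoothPeriods

/-! ### Action variables and the Arnold–Liouville theorem. -/

section ActionVariables

open Set

variable {n : ℕ}

/-- Lifts of diffeomorphisms to the cotangent bundle are symplectic. -/
theorem stdForm_cotangentLift {ψ : Eucl n → Eucl n} {V : Set (Eucl n)} (hV : IsOpen V)
    (hψ : ContDiffOn ℝ ∞ ψ V) {W : Eucl n × Eucl n → Eucl n}
    (hW : ContDiffOn ℝ ∞ W (V ×ˢ univ))
    (hWψ : ∀ y ∈ V, ∀ s v, inner ℝ (W (y, s)) (fderiv ℝ ψ y v) = inner ℝ s v)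
    {p : Eucl n × Eucl n} (hp : p.1 ∈ V) (u v : Eucl n × Eucl n) :
    stdForm (fderiv ℝ (fun z => (ψ z.1, W z)) p u) (fderiv ℝ (fun z => (ψ z.1, W z)) p v)
      = stdForm u v := by
  have hVp : V ×ˢ (univ : Set (Eucl n)) ∈ 𝓝 p := (hV.prod isOpen_univ).mem_nhds ⟨hp, mem_univ _⟩
  have ψc := hψ.contDiffAt (hV.mem_nhds hp)
  have dψ : HasFDerivAt (fun z : Eucl n × Eucl n => ψ z.1)
      ((fderiv ℝ ψ p.1).comp (ContinuousLinearMap.fst ℝ _ _)) p :=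
    HasFDerivAt.comp p (f := Prod.fst) (g := ψ) (ψc.differentiableAt (by simp)).hasFDerivAt
      hasFDerivAt_fst
  have dψ' : ∀ a : Eucl n, HasFDerivAt (fun z : Eucl n × Eucl n => fderiv ℝ ψ z.1 a)
      (((fderiv ℝ (fderiv ℝ ψ) p.1).flip a).comp (ContinuousLinearMap.fst ℝ _ _)) p := by
    intro a
    have h1 : HasFDerivAt (fderiv ℝ ψ) (fderiv ℝ (fderiv ℝ ψ) p.1) p.1 :=
      ((ψc.fderiv_right (m := ∞) (by simp)).differentiableAt (by simp)).hasFDerivAt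
    have h2 : HasFDerivAt (fun y => fderiv ℝ ψ y a) ((fderiv ℝ (fderiv ℝ ψ) p.1).flip a) p.1 :=
      h1.clm_apply (hasFDerivAt_const a p.1) |>.congr_fderiv (by ext; simp)
    exact HasFDerivAt.comp p (f := Prod.fst) h2 hasFDerivAt_fst
  have dW : HasFDerivAt W (fderiv ℝ W p) p :=
    ((hW.contDiffAt hVp).differentiableAt (by simp)).hasFDerivAt
  have hD : fderiv ℝ (fun z => (ψ z.1, W z)) p = _ := (dψ.prodMk dW).fderiv
  have sym : ∀ a c, fderiv ℝ (fderiv ℝ ψ) p.1 a c = fderiv ℝ (fderiv ℝ ψ) p.1 c a := by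
    have h := ψc.isSymmSndFDerivAt (by
      rw [minSmoothness_of_isRCLikeNormedField]; exact WithTop.coe_le_coe.2 (le_top (a := (2 : ℕ∞))))
    exact fun a c => h a c
  -- This is the derivative of `hWψ`. When two instances are subtracted, the terms with the second
  -- derivative of ψ cancel by symmetry.
  have key : ∀ (a : Eucl n) (v : Eucl n × Eucl n),
      inner ℝ (W p) (fderiv ℝ (fderiv ℝ ψ) p.1 v.1 a) + inner ℝ (fderiv ℝ W p v) (fderiv ℝ ψ p.1 a)
        = inner ℝ v.2 a := by
    intro a v
    have h1 := dW.inner ℝ (dψ' a)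
    have h2 : HasFDerivAt (fun z : Eucl n × Eucl n => inner ℝ z.2 a)
        ((innerSL ℝ a).comp (ContinuousLinearMap.snd ℝ _ _)) p :=
      (((innerSL ℝ a).comp (ContinuousLinearMap.snd ℝ (Eucl n) (Eucl n))).hasFDerivAt (x := p)).congr_of_eventuallyEq
        (Filter.Eventually.of_forall fun z => real_inner_comm _ _)
    have h3 := h1.unique (h2.congr_of_eventuallyEq (Filter.eventually_of_mem hVp
      fun z hz => hWψ z.1 hz.1 z.2 a))
    have h4 := DFunLike.congr_fun h3 v
    simp at h4
    rw [h4, real_inner_comm]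
  rw [hD]
  have k1 := key u.1 v
  have k2 := key v.1 u
  rw [sym] at k1
  simp only [stdForm, ContinuousLinearMap.prod_apply, ContinuousLinearMap.comp_apply,
    ContinuousLinearMap.coe_fst']
  rw [real_inner_comm (fderiv ℝ W p v), real_inner_comm (fderiv ℝ W p u), real_inner_comm v.2,
    real_inner_comm u.2]
  linarith

variable {M : Type*} [TopologicalSpace M] [ChartedSpace (Eucl (2 * n)) M]
  [IsManifold (𝓡 (2 * n)) ∞ M] [T2Space M] {Ω : SymplecticForm (2 * n) M} {f : M → Eucl n}

/-- Existence of local action variables, with the periods as differentials. -/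
theorem IsPolarization.exists_action {F : Eucl n × Eucl n → M} {U : Set (Eucl n)} {b : Eucl n}
    (h : IsPolarization Ω f F U)
    (hf : IsIntegrableSystem Ω f) (hU : IsOpen U) (hb : b ∈ U) :
    ∃ (I : PartialDiffeomorph 𝓘(ℝ, Eucl n) 𝓘(ℝ, Eucl n) (Eucl n) (Eucl n) ∞)
      (τ : Eucl n → Fin n → Eucl n), b ∈ I.source ∧ I.source ⊆ U ∧
      (∀ j, ContDiffOn ℝ ∞ (fun c => τ c j) I.source) ∧
      (∀ c ∈ I.source, ∀ v j, 2 * Real.pi * fderiv ℝ I c v j = inner ℝ (τ c j) v) ∧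
      ∀ c ∈ I.source, Function.Bijective (combo (τ c)) ∧
        ∀ s, s ∈ periods F c ↔ ∃ k : Fin n → ℤ, s = ∑ j, k j • τ c j := by
  obtain ⟨r, τ, hr, hrU, hτ, hbij⟩ := h.exists_period_frame hf hU hb
  -- The factor 1/2π normalizes the angles: the period τ_j will be an increment of φ_j by 2π. The
  -- forms are closed by `IsPolarization.period_closed`, hence have primitives on the ball.
  let α : Fin n → Eucl n → (Eucl n →L[ℝ] ℝ) := fun j c => (2 * Real.pi)⁻¹ • innerSL ℝ (τ c j)
  have hα : ∀ j, ContDiffOn ℝ ∞ (α j) (Metric.ball b r) := fun j =>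
    ((innerSL ℝ (E := Eucl n)).contDiff.comp_contDiffOn (hτ j)).const_smul _
  have hper : ∀ j, ∀ c ∈ Metric.ball b r, τ c j ∈ periods F c := fun j c hc =>
    ((hbij c hc).2 _).2 ⟨Pi.single j 1, by simp [Pi.single_apply]⟩
  have prim : ∀ j, ∃ g : Eucl n → ℝ, ∀ c ∈ Metric.ball b r, HasFDerivAt g (α j c) c := by
    intro j
    refine (convex_ball b r).exists_forall_hasFDerivAt_of_fderiv_symmetric Metric.isOpen_ball
      ((hα j).differentiableOn (by simp)) fun c hc u v => ?_
    have hd : HasFDerivAt (fun c => τ c j) (fderiv ℝ (fun c => τ c j) c) c :=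
      (((hτ j).contDiffAt (Metric.isOpen_ball.mem_nhds hc)).differentiableAt (by simp)).hasFDerivAt
    have hd' := ((innerSL ℝ (E := Eucl n)).hasFDerivAt.comp c hd).const_smul (2 * Real.pi)⁻¹
    have hd'' : fderiv ℝ (α j) c = _ := hd'.fderiv
    rw [hd'']
    have := h.period_closed Metric.isOpen_ball hrU (hτ j) (hper j) hc u v
    show (2 * Real.pi)⁻¹ * inner ℝ (fderiv ℝ (fun c => τ c j) c u) v
      = (2 * Real.pi)⁻¹ * inner ℝ (fderiv ℝ (fun c => τ c j) c v) u
    rw [real_inner_comm, real_inner_comm u, this]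
  choose g hg using prim
  let k : Eucl n → Eucl n := fun c => WithLp.toLp 2 fun j => g j c
  have gs : ∀ j, ContDiffOn ℝ ∞ (g j) (Metric.ball b r) := fun j => by
    rw [contDiffOn_infty_iff_fderiv_of_isOpen Metric.isOpen_ball]
    refine ⟨fun c hc => (hg j c hc).differentiableAt.differentiableWithinAt, ?_⟩
    exact (hα j).congr fun c hc => (hg j c hc).fderiv
  have ks : ContDiffOn ℝ ∞ k (Metric.ball b r) := contDiffOn_euclidean.2 gs
  have kd : ∀ c ∈ Metric.ball b r, ∀ v j, 2 * Real.pi * fderiv ℝ k c v j = inner ℝ (τ c j) v := by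
    intro c hc v j
    have h1 : HasFDerivAt k (fderiv ℝ k c) c :=
      ((ks.contDiffAt (Metric.isOpen_ball.mem_nhds hc)).differentiableAt (by simp)).hasFDerivAt
    have h2 := ((EuclideanSpace.proj j : Eucl n →L[ℝ] ℝ).hasFDerivAt.comp c h1).unique (hg j c hc)
    have h3 := DFunLike.congr_fun h2 v
    have h4 : (fderiv ℝ k c v) j = (2 * Real.pi)⁻¹ * inner ℝ (τ c j) v := h3
    rw [h4, mul_inv_cancel_left₀ (by positivity)]
  have hbb : b ∈ Metric.ball b r := Metric.mem_ball_self hr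
  -- The rows of the derivative are, up to 2π, the spanning vectors τ_j, so a vector of the kernel
  -- is orthogonal to itself.
  have inj : Function.Injective (fderiv ℝ k b) := by
    rw [injective_iff_map_eq_zero]
    intro v hv
    obtain ⟨x, hx⟩ := (hbij b hbb).1.2 v
    have h1 : inner ℝ (combo (τ b) x) v = 0 := by
      rw [inner_combo]
      refine Finset.sum_eq_zero fun j _ => ?_
      rw [← kd b hbb, hv]
      simp
    rw [hx] at h1
    exact inner_self_eq_zero.1 h1
  obtain ⟨Φ, hbΦ, hΦ, hk⟩ := exists_partialDiffeomorph rfl Metric.isOpen_ball hbb ks inj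
  have hk' : (Φ : Eucl n → Eucl n) = k := funext hk
  exact ⟨Φ, τ, hbΦ, hΦ.trans hrU, fun j => (hτ j).mono hΦ,
    fun c hc => by rw [hk']; exact kd c (hΦ hc), fun c hc => hbij c (hΦ hc)⟩

/-- The Arnold-Liouville theorem. -/
theorem exists_actionAngleChart (hf : IsIntegrableSystem Ω f) {b : Eucl n}
    (hb : b ∈ regularValues f) : ∃ c : ActionAngleChart Ω f, b ∈ c.action.source := by
  obtain ⟨U, F, hU, hbU, h⟩ := exists_polarization hf hb
  obtain ⟨I, τ, hbI, hIU, hτ, hdI, hper⟩ := h.exists_action hf hU hbU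
  let a : OpenPartialHomeomorph (Eucl n) (Eucl n) :=
    { toPartialEquiv := I.toPartialEquiv
      open_source := I.open_source
      open_target := I.open_target
      continuousOn_toFun := I.contMDiffOn_toFun.continuousOn
      continuousOn_invFun := I.contMDiffOn_invFun.continuousOn }
  have aI : (a : Eucl n → Eucl n) = I := rfl
  have as : ContDiffOn ℝ ∞ a a.source := I.contMDiffOn_toFun.contDiffOn
  have as' : ContDiffOn ℝ ∞ a.symm a.target := I.contMDiffOn_invFun.contDiffOn
  have maps : ∀ J ∈ a.target, a.symm J ∈ a.source := fun J hJ => a.map_target hJ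
  -- The fibre coordinate s is ∑ φ_j τ_j / 2π, the transpose of dI applied to φ. So K is the
  -- cotangent lift of I⁻¹, hence symplectic, and periods become 2πℤⁿ.
  let W : Eucl n × Eucl n → Eucl n := fun z => (2 * Real.pi)⁻¹ • combo (τ (a.symm z.1)) z.2
  have Ws : ContDiffOn ℝ ∞ W (a.target ×ˢ univ) := by
    refine ContDiffOn.const_smul _ ?_
    simp only [combo_apply]
    refine ContDiffOn.sum fun j _ => ?_
    refine ContDiffOn.smul ((EuclideanSpace.proj j : Eucl n →L[ℝ] ℝ).contDiff.comp
      contDiff_snd).contDiffOn ?_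
    exact ((hτ j).comp as' maps).comp contDiff_fst.contDiffOn fun z hz => hz.1
  let K : Eucl n × Eucl n → Eucl n × Eucl n := fun z => (a.symm z.1, W z)
  have Ks : ContDiffOn ℝ ∞ K (a.target ×ˢ univ) :=
    (as'.comp contDiff_fst.contDiffOn fun z hz => hz.1).prodMk Ws
  have To : IsOpen (a.target ×ˢ (univ : Set (Eucl n))) := a.open_target.prod isOpen_univ
  have Kmem : ∀ z ∈ a.target ×ˢ (univ : Set (Eucl n)), K z ∈ U ×ˢ (univ : Set (Eucl n)) :=
    fun z hz => ⟨hIU (maps _ hz.1), mem_univ _⟩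
  have hWψ : ∀ J ∈ a.target, ∀ s v, inner ℝ (W (J, s)) (fderiv ℝ a.symm J v) = inner ℝ s v := by
    intro J hJ s v
    have d1 : DifferentiableAt ℝ a.symm J :=
      (as'.contDiffAt (a.open_target.mem_nhds hJ)).differentiableAt (by simp)
    have d2 : DifferentiableAt ℝ a (a.symm J) :=
      (as.contDiffAt (a.open_source.mem_nhds (maps J hJ))).differentiableAt (by simp)
    have e : (a ∘ a.symm) =ᶠ[𝓝 J] id :=
      Filter.eventually_of_mem (a.open_target.mem_nhds hJ) fun z hz => a.right_inv hz
    have e' : fderiv ℝ a (a.symm J) (fderiv ℝ a.symm J v) = v := by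
      have := fderiv_comp J d2 d1
      rw [e.fderiv_eq, fderiv_id] at this
      exact (DFunLike.congr_fun this v).symm
    simp only [W]
    rw [real_inner_smul_left, inner_combo, Finset.mul_sum, PiLp.inner_apply]
    refine Finset.sum_congr rfl fun j _ => ?_
    rw [← hdI _ (maps J hJ), ← aI, e']
    have hpi : (2 * Real.pi)⁻¹ * (2 * Real.pi) = 1 := inv_mul_cancel₀ (by positivity)
    simp only [RCLike.inner_apply, conj_trivial]
    linear_combination (s j * v j) * hpi
  refine ⟨{ action := a, action_smooth := as, action_symm_smooth := as', param := F ∘ K,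
            param_smooth := ?_, image_param := ?_, action_param := ?_, param_eq_iff := ?_,
            darboux := ?_ }, hbI⟩
  · exact h.darbouxOn.smooth.comp Ks.contMDiffOn Kmem
  · ext x
    constructor
    · rintro ⟨⟨J, φ⟩, ⟨hJ, -⟩, rfl⟩
      show f (F (a.symm J, _)) ∈ a.source
      rw [h.base (hIU (maps J hJ))]
      exact maps J hJ
    · intro hx
      have hx' : f x ∈ a.source := hx
      obtain ⟨s, hs⟩ := h.surj x (hIU hx')
      obtain ⟨y, rfl⟩ := (hper (f x) hx').1.2 s
      refine ⟨(a (f x), (2 * Real.pi) • y), ⟨a.map_source hx', mem_univ _⟩, ?_⟩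
      simp only [Function.comp, K, W, a.left_inv hx', map_smul]
      rw [inv_smul_smul₀ (by positivity), hs]
  · intro J hJ φ
    exact h.base (hIU (maps J hJ)) _
  · intro J hJ φ φ'
    have h1 : (F ∘ K) (J, φ) = (F ∘ K) (J, φ') ↔ F (a.symm J, W (J, φ)) = F (a.symm J, W (J, φ')) :=
      Iff.rfl
    rw [h1, h.eq_iff (hIU (maps J hJ)), (hper _ (maps J hJ)).2]
    have h2 : W (J, φ') - W (J, φ) = combo (τ (a.symm J)) ((2 * Real.pi)⁻¹ • (φ' - φ)) := by
      simp only [W, map_smul, map_sub, smul_sub]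
    have h3 : ∀ k : Fin n → ℤ, ∑ j, k j • τ (a.symm J) j
        = combo (τ (a.symm J)) (WithLp.toLp 2 fun j => (k j : ℝ)) := fun k => by
      rw [combo_apply]
      exact Finset.sum_congr rfl fun j _ => (Int.cast_smul_eq_zsmul ℝ _ _).symm
    simp only [h2, h3, (hper _ (maps J hJ)).1.1.eq_iff]
    refine exists_congr fun k => ?_
    rw [inv_smul_eq_iff₀ (by positivity)]
    constructor
    · intro e i
      have := congrArg (fun x : Eucl n => x i) e
      simp at this
      linarith
    · intro e
      ext i
      simp
      linarith [e i]
  · intro J hJ φ u v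
    have hz : (J, φ) ∈ a.target ×ˢ (univ : Set (Eucl n)) := ⟨hJ, mem_univ _⟩
    refine Eq.trans (b := pullbackTwo Ω (F ∘ K) (J, φ) u v) rfl ?_
    rw [pullbackTwo_comp Ω (h.darbouxOn.mdifferentiableAt (Kmem _ hz))
      ((Ks.contDiffAt (To.mem_nhds hz)).differentiableAt (by simp)),
      h.darbouxOn.darboux _ (Kmem _ hz), ← stdForm_eq_sum]
    exact stdForm_cotangentLift a.open_target as' Ws hWψ hJ u v

end ActionVariables

/-! ### Integer matrices and bases of lattices. -/

section IntegerMatrices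

variable {n : ℕ}

/-- The vector with given integer coordinates. -/
def intVec (k : Fin n → ℤ) : Eucl n := WithLp.toLp 2 fun j => (k j : ℝ)

@[simp] theorem intVec_apply (k : Fin n → ℤ) (j : Fin n) : intVec k j = k j := rfl

theorem intVec_injective : Function.Injective (intVec : (Fin n → ℤ) → Eucl n) := fun k k' e => by
  funext j
  have := congrArg (fun x : Eucl n => x j) e
  simpa using this

/-- The linear map given by an integer matrix. -/
def ofInt (Z : Matrix (Fin n) (Fin n) ℤ) : Eucl n →L[ℝ] Eucl n :=
  combo fun j => intVec fun i => Z i j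

theorem ofInt_apply (Z : Matrix (Fin n) (Fin n) ℤ) (x : Eucl n) (i : Fin n) :
    ofInt Z x i = ∑ j, (Z i j : ℝ) * x j := by
  simp [ofInt, combo_apply, mul_comm]

theorem ofInt_intVec (Z : Matrix (Fin n) (Fin n) ℤ) (k : Fin n → ℤ) :
    ofInt Z (intVec k) = intVec (Z.mulVec k) := by
  ext i
  rw [ofInt_apply]
  simp [Matrix.mulVec, dotProduct]

@[simp] theorem ofInt_one : ofInt (1 : Matrix (Fin n) (Fin n) ℤ) = ContinuousLinearMap.id ℝ _ := by
  ext x i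
  simp [ofInt_apply, Matrix.one_apply]

theorem ofInt_mul (Z Z' : Matrix (Fin n) (Fin n) ℤ) : ofInt (Z * Z') = (ofInt Z).comp (ofInt Z') := by
  ext x i
  simp only [ofInt_apply, ContinuousLinearMap.comp_apply, Matrix.mul_apply, Int.cast_sum,
    Int.cast_mul, Finset.sum_mul, Finset.mul_sum]
  rw [Finset.sum_comm]
  exact Finset.sum_congr rfl fun _ _ => Finset.sum_congr rfl fun _ _ => by ring

theorem ofInt_single (Z : Matrix (Fin n) (Fin n) ℤ) (j : Fin n) :
    ofInt Z (EuclideanSpace.single j 1) = intVec fun i => Z i j := by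
  ext i
  simp [ofInt_apply]

theorem ofInt_injective : Function.Injective (ofInt : Matrix (Fin n) (Fin n) ℤ → _) := by
  intro Z Z' e
  ext i j
  have h := congrArg (fun A : Eucl n →L[ℝ] Eucl n => A (EuclideanSpace.single j 1)) e
  simp only [ofInt_single] at h
  exact congrFun (intVec_injective h) i

theorem clm_ext_single {E : Type*} [NormedAddCommGroup E] [NormedSpace ℝ E]
    {A A' : Eucl n →L[ℝ] E}
    (h : ∀ j, A (EuclideanSpace.single j 1) = A' (EuclideanSpace.single j 1)) : A = A' := by
  ext x
  have ha : x = ∑ k, x k • EuclideanSpace.single k (1 : ℝ) := by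
    ext j
    simp [Pi.single_apply]
  rw [ha]
  simp [map_sum, h]

/-- Two bases of the same lattice are related by a unimodular matrix. -/
theorem exists_unimodular {A A' : Eucl n →L[ℝ] Eucl n} (hA : Function.Injective A)
    (h : ∀ k, ∃ k', A (intVec k) = A' (intVec k')) (h' : ∀ k, ∃ k', A' (intVec k) = A (intVec k')) :
    ∃ Z : Matrix (Fin n) (Fin n) ℤ, IsUnit Z.det ∧ A' = A.comp (ofInt Z) := by
  have aux : ∀ {A A' : Eucl n →L[ℝ] Eucl n}, (∀ k, ∃ k', A' (intVec k) = A (intVec k')) →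
      ∃ Z : Matrix (Fin n) (Fin n) ℤ, A' = A.comp (ofInt Z) := by
    intro A A' h
    choose z hz using fun j : Fin n => h (Pi.single j 1)
    refine ⟨Matrix.of fun i j => z j i, clm_ext_single fun j => ?_⟩
    rw [ContinuousLinearMap.comp_apply, ofInt_single]
    have e : (EuclideanSpace.single j 1 : Eucl n) = intVec (Pi.single j 1) := by
      ext i
      simp [Pi.single_apply]
    exact (congrArg A' e).trans (hz j)
  obtain ⟨Z, hZ⟩ := aux h'
  obtain ⟨Z', hZ'⟩ := aux h
  refine ⟨Z, ?_, hZ⟩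
  have : Z * Z' = 1 := by
    apply ofInt_injective
    rw [ofInt_mul, ofInt_one]
    ext1 x
    apply hA
    have := DFunLike.congr_fun hZ' x
    rw [hZ] at this
    exact this.symm
  exact Matrix.isUnit_det_of_right_inverse this

/-- The unimodular matrix relating two continuous families of bases of lattices is locally
constant. -/
theorem eventually_unimodular_eq {T : Type*} {l : Filter T} {A A' : T → Eucl n →L[ℝ] Eucl n}
    {A₀ A₀' : Eucl n →L[ℝ] Eucl n}
    (hA : Filter.Tendsto A l (𝓝 A₀)) (hA' : Filter.Tendsto A' l (𝓝 A₀')) (h0 : Function.Bijective A₀)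
    {Z : T → Matrix (Fin n) (Fin n) ℤ} {Z₀ : Matrix (Fin n) (Fin n) ℤ}
    (hZ : ∀ᶠ t in l, A' t = (A t).comp (ofInt (Z t))) (hZ₀ : A₀' = A₀.comp (ofInt Z₀)) :
    ∀ᶠ t in l, Z t = Z₀ := by
  let e := (LinearEquiv.ofBijective A₀.toLinearMap h0).toContinuousLinearEquiv
  have he : (e : Eucl n →L[ℝ] Eucl n) = A₀ := rfl
  -- Inversion is continuous at the invertible A₀, so the integer matrix A⁻¹A' converges.
  have h1 : Filter.Tendsto (fun t => ContinuousLinearMap.inverse (A t)) l (𝓝 (e.symm : Eucl n →L[ℝ] Eucl n)) := by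
    have := (contDiffAt_map_inverse (𝕜 := ℝ) (n := 0) e).continuousAt
    rw [ContinuousAt, ContinuousLinearMap.inverse_equiv, he] at this
    exact this.comp hA
  have h2 : Filter.Tendsto (fun t => (ContinuousLinearMap.inverse (A t)).comp (A' t)) l
      (𝓝 ((e.symm : Eucl n →L[ℝ] Eucl n).comp A₀')) :=
    (isBoundedBilinearMap_comp (𝕜 := ℝ) (E := Eucl n) (F := Eucl n) (G := Eucl n)).continuous.continuousAt.tendsto.comp
      (h1.prodMk_nhds hA')
  have h3 : (e.symm : Eucl n →L[ℝ] Eucl n).comp A₀' = ofInt Z₀ := by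
    rw [hZ₀, ← he]
    ext1 x
    simp
  rw [h3] at h2
  have h4 : ∀ᶠ t in l, (ContinuousLinearMap.inverse (A t)).comp (A' t) = ofInt (Z t) := by
    filter_upwards [hZ, hA.eventually (ContinuousLinearEquiv.nhds e)] with t ht ⟨e', he'⟩
    rw [ht, ← he', ContinuousLinearMap.inverse_equiv]
    ext1 x
    simp
  -- An integer at distance less than 1 from an integer equals it.
  have h5 : ∀ i j, ∀ᶠ t in l, Z t i j = Z₀ i j := by
    intro i j
    have h6 : Filter.Tendsto (fun t => (ofInt (Z t) (EuclideanSpace.single j 1)) i) l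
        (𝓝 ((ofInt Z₀ (EuclideanSpace.single j 1)) i)) := by
      have c : Continuous fun B : Eucl n →L[ℝ] Eucl n => (B (EuclideanSpace.single j 1)) i := by
        fun_prop
      exact (c.tendsto _).comp (h2.congr' h4)
    simp only [ofInt_single, intVec_apply] at h6
    have h7 := h6.eventually (Metric.ball_mem_nhds _ one_pos)
    filter_upwards [h7] with t ht
    have ht' : |(Z t i j : ℝ) - Z₀ i j| < 1 := ht
    rw [abs_sub_lt_iff] at ht'
    have h8 : (Z t i j : ℝ) < Z₀ i j + 1 := by linarith [ht'.1]
    have h9 : (Z₀ i j : ℝ) - 1 < Z t i j := by linarith [ht'.2]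
    have h10 : Z t i j < Z₀ i j + 1 := by exact_mod_cast h8
    have h11 : Z₀ i j - 1 < Z t i j := by exact_mod_cast h9
    omega
  filter_upwards [Filter.eventually_all.2 fun i => Filter.eventually_all.2 fun j => h5 i j] with t ht
  ext i j
  exact ht i j

end IntegerMatrices

/-! ### Coframes of action variables and their transition matrices. -/

section Charts

open Set

variable {n : ℕ} {M : Type*} [TopologicalSpace M] [ChartedSpace (Eucl (2 * n)) M]
  {Ω : SymplecticForm (2 * n) M} {f : M → Eucl n}

namespace ActionAngleChart

variable (c : ActionAngleChart Ω f)

theorem contDiffAt_action {y : Eucl n} (hy : y ∈ c.action.source) : ContDiffAt ℝ ∞ c.action y :=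
  c.action_smooth.contDiffAt (c.action.open_source.mem_nhds hy)

theorem differentiableAt_action {y : Eucl n} (hy : y ∈ c.action.source) :
    DifferentiableAt ℝ c.action y := (c.contDiffAt_action hy).differentiableAt (by simp)

theorem contDiffAt_symm {y : Eucl n} (hy : y ∈ c.action.source) :
    ContDiffAt ℝ ∞ c.action.symm (c.action y) :=
  c.action_symm_smooth.contDiffAt (c.action.open_target.mem_nhds (c.action.map_source hy))

theorem differentiableAt_symm {y : Eucl n} (hy : y ∈ c.action.source) :
    DifferentiableAt ℝ c.action.symm (c.action y) := (c.contDiffAt_symm hy).differentiableAt (by simp)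

theorem dAction_apply {y : Eucl n} (hy : y ∈ c.action.source) (j : Fin n) (v : Eucl n) :
    c.dAction j y v = fderiv ℝ c.action y v j := by
  have h := ((EuclideanSpace.proj j : Eucl n →L[ℝ] ℝ).hasFDerivAt.comp y
    (c.differentiableAt_action hy).hasFDerivAt).fderiv
  exact DFunLike.congr_fun h v

theorem fderiv_symm_fderiv {y : Eucl n} (hy : y ∈ c.action.source) (v : Eucl n) :
    fderiv ℝ c.action.symm (c.action y) (fderiv ℝ c.action y v) = v := by
  have e : (c.action.symm ∘ c.action) =ᶠ[𝓝 y] id :=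
    Filter.eventually_of_mem (c.action.open_source.mem_nhds hy) fun z hz => c.action.left_inv hz
  have := fderiv_comp y (c.differentiableAt_symm hy) (c.differentiableAt_action hy)
  rw [e.fderiv_eq, fderiv_id] at this
  exact (DFunLike.congr_fun this v).symm

theorem fderiv_fderiv_symm {y : Eucl n} (hy : y ∈ c.action.source) (v : Eucl n) :
    fderiv ℝ c.action y (fderiv ℝ c.action.symm (c.action y) v) = v := by
  have inj : Function.Injective (fderiv ℝ c.action y) :=
    Function.LeftInverse.injective (c.fderiv_symm_fderiv hy)
  have surj := LinearMap.injective_iff_surjective (f := (fderiv ℝ c.action y).toLinearMap) |>.1 inj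
  obtain ⟨w, rfl⟩ := surj v
  exact congrArg _ (c.fderiv_symm_fderiv hy w)

/-- The coframe `dI₁, …, dIₙ` at `y`, as a linear map. -/
def coframe (y : Eucl n) : Eucl n →L[ℝ] Eucl n := combo fun j => vecOf (c.dAction j y)

theorem coframe_single (y : Eucl n) (j : Fin n) :
    c.coframe y (EuclideanSpace.single j 1) = vecOf (c.dAction j y) := by
  simp [coframe, combo_apply]

theorem inner_coframe {y : Eucl n} (hy : y ∈ c.action.source) (φ v : Eucl n) :
    inner ℝ (c.coframe y φ) v = inner ℝ φ (fderiv ℝ c.action y v) := by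
  rw [coframe, inner_combo, PiLp.inner_apply]
  refine Finset.sum_congr rfl fun j _ => ?_
  rw [inner_vecOf, c.dAction_apply hy]
  simp [mul_comm]

/-- The inverse of the coframe. -/
def angle (z : Eucl n × Eucl n) : Eucl n :=
  vecOf ((innerSL ℝ z.2).comp (fderiv ℝ c.action.symm (c.action z.1)))

theorem inner_angle (z : Eucl n × Eucl n) (v : Eucl n) :
    inner ℝ (c.angle z) v = inner ℝ z.2 (fderiv ℝ c.action.symm (c.action z.1) v) := by
  rw [angle, inner_vecOf]
  rfl

theorem angle_coframe {y : Eucl n} (hy : y ∈ c.action.source) (φ : Eucl n) :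
    c.angle (y, c.coframe y φ) = φ := by
  refine ext_inner_right ℝ fun v => ?_
  rw [inner_angle, c.inner_coframe hy, c.fderiv_fderiv_symm hy]

theorem coframe_angle {y : Eucl n} (hy : y ∈ c.action.source) (s : Eucl n) :
    c.coframe y (c.angle (y, s)) = s := by
  refine ext_inner_right ℝ fun v => ?_
  rw [c.inner_coframe hy, inner_angle, c.fderiv_symm_fderiv hy]

theorem coframe_bijective {y : Eucl n} (hy : y ∈ c.action.source) :
    Function.Bijective (c.coframe y) :=
  Function.bijective_iff_has_inverse.2
    ⟨fun s => c.angle (y, s), c.angle_coframe hy, c.coframe_angle hy⟩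

theorem angle_smooth : ContDiffOn ℝ ∞ c.angle (c.action.source ×ˢ univ) := by
  refine contDiffOn_euclidean.2 fun k => ?_
  have h : ∀ z, c.angle z k
      = inner ℝ z.2 (fderiv ℝ c.action.symm (c.action z.1) (EuclideanSpace.single k 1)) := fun z => by
    simp [angle]
  simp only [h]
  refine contDiff_snd.contDiffOn.inner ℝ ?_
  have h1 : ContDiffOn ℝ ∞ (fderiv ℝ c.action.symm) c.action.target :=
    c.action_symm_smooth.fderiv_of_isOpen c.action.open_target (by simp)
  have h2 : ContDiffOn ℝ ∞ (fun y => fderiv ℝ c.action.symm (c.action y)) c.action.source :=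
    h1.comp c.action_smooth c.action.mapsTo
  exact (h2.comp contDiff_fst.contDiffOn fun z hz => hz.1).clm_apply contDiffOn_const

/-- The parametrization of `f⁻¹(U)` by canonical coordinates with first half `f`. -/
def lift (z : Eucl n × Eucl n) : M := c.param (c.action z.1, c.angle z)

theorem lift_coframe {y : Eucl n} (hy : y ∈ c.action.source) (φ : Eucl n) :
    c.lift (y, c.coframe y φ) = c.param (c.action y, φ) := by
  rw [lift, c.angle_coframe hy]

theorem f_param {y : Eucl n} (hy : y ∈ c.action.source) (φ : Eucl n) :
    f (c.param (c.action y, φ)) = y := by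
  rw [c.action_param _ (c.action.map_source hy), c.action.left_inv hy]

theorem surj_param {x : M} (hx : f x ∈ c.action.source) : ∃ φ, c.param (c.action (f x), φ) = x := by
  have h1 : x ∈ c.param '' (c.action.target ×ˢ univ) := by rw [c.image_param]; exact hx
  obtain ⟨⟨J, φ⟩, ⟨hJ, -⟩, rfl⟩ := h1
  refine ⟨φ, ?_⟩
  rw [c.action_param J hJ, c.action.right_inv hJ]

/-- `lift` is `param` composed with the cotangent lift of the action map, which is symplectic. Thus
an arbitrary chart inherits the results on orbits and periods. -/
theorem isPolarization_lift : IsPolarization Ω f c.lift c.action.source := by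
  have Ks : ContDiffOn ℝ ∞ (fun z : Eucl n × Eucl n => (c.action z.1, c.angle z))
      (c.action.source ×ˢ univ) :=
    (c.action_smooth.comp contDiff_fst.contDiffOn fun z hz => hz.1).prodMk c.angle_smooth
  have So : IsOpen (c.action.source ×ˢ (univ : Set (Eucl n))) := c.action.open_source.prod isOpen_univ
  have To : IsOpen (c.action.target ×ˢ (univ : Set (Eucl n))) := c.action.open_target.prod isOpen_univ
  have maps : MapsTo (fun z : Eucl n × Eucl n => (c.action z.1, c.angle z))
      (c.action.source ×ˢ univ) (c.action.target ×ˢ univ) :=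
    fun z hz => ⟨c.action.map_source hz.1, mem_univ _⟩
  refine ⟨⟨So, c.param_smooth.comp Ks.contMDiffOn maps, fun z hz => c.f_param hz.1 _,
    fun z hz u v => ?_⟩, fun x hx => ?_⟩
  · have h1 := pullbackTwo_comp Ω (g := c.param) (x := z)
      (k := fun z : Eucl n × Eucl n => (c.action z.1, c.angle z))
      ((c.param_smooth.contMDiffAt (To.mem_nhds (maps hz))).mdifferentiableAt (by simp))
      ((Ks.contDiffAt (So.mem_nhds hz)).differentiableAt (by simp)) u v
    refine h1.trans ((c.darboux _ (c.action.map_source hz.1) _ _ _).trans ?_)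
    rw [← stdForm_eq_sum]
    exact stdForm_cotangentLift c.action.open_source c.action_smooth c.angle_smooth
      (fun y hy s v => by rw [inner_angle, c.fderiv_symm_fderiv hy]) hz.1 u v
  · obtain ⟨φ, hφ⟩ := c.surj_param hx
    exact ⟨c.coframe (f x) φ, (c.lift_coframe hx φ).trans hφ⟩

theorem param_eq_iff' {J : Eucl n} (hJ : J ∈ c.action.target) (φ φ' : Eucl n) :
    c.param (J, φ) = c.param (J, φ') ↔ ∃ k : Fin n → ℤ, φ' = φ + (2 * Real.pi) • intVec k := by
  rw [c.param_eq_iff J hJ]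
  refine exists_congr fun k => ⟨fun h => ?_, fun h i => ?_⟩
  · ext i
    simpa using h i
  · simpa using congrArg (fun x : Eucl n => x i) h

/-- The lattice 2πℤⁿ of the angles is carried by the coframe to the lattice spanned by the 2π dI_j.
-/
theorem mem_periods_lift [IsManifold (𝓡 (2 * n)) ∞ M] [T2Space M] {y : Eucl n}
    (hy : y ∈ c.action.source) {s : Eucl n} :
    s ∈ periods c.lift y ↔ ∃ k : Fin n → ℤ, s = c.coframe y ((2 * Real.pi) • intVec k) := by
  rw [c.isPolarization_lift.mem_periods_iff hy, eq_comm, lift, lift,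
    c.param_eq_iff' (c.action.map_source hy)]
  refine exists_congr fun k => ?_
  have h0 : c.angle (y, 0) = 0 := by
    have := c.angle_coframe hy 0
    rwa [map_zero] at this
  rw [h0, zero_add]
  exact ⟨fun h => by rw [← h, c.coframe_angle hy], fun h => by rw [h, c.angle_coframe hy]⟩

theorem source_subset [IsManifold (𝓡 (2 * n)) ∞ M] (hf : IsIntegrableSystem Ω f) :
    c.action.source ⊆ regularValues f := by
  intro y hy
  refine mem_regularValues.2 ⟨⟨_, c.f_param hy 0⟩, ?_⟩
  rintro x rfl
  obtain ⟨s, hs⟩ := c.isPolarization_lift.surj x hy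
  rw [← hs]
  exact c.isPolarization_lift.darbouxOn.surjective_dBase hf ⟨hy, mem_univ _⟩

theorem continuousAt_dAction {y : Eucl n} (hy : y ∈ c.action.source) (j : Fin n) :
    ContinuousAt (c.dAction j) y := by
  have h1 : ContDiffAt ℝ ∞ (fun y => c.action y j) y := contDiffAt_euclidean.1 (c.contDiffAt_action hy) j
  exact (h1.fderiv_right (m := 0) (by simp)).continuousAt

theorem continuousAt_coframe {y : Eucl n} (hy : y ∈ c.action.source) : ContinuousAt c.coframe y :=
  continuous_combo.continuousAt.comp (continuousAt_pi.2 fun j =>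
    vecOf.continuous.continuousAt.comp (c.continuousAt_dAction hy j))

end ActionAngleChart

theorem vecOf_injective : Function.Injective (vecOf : (Eucl n →L[ℝ] ℝ) → Eucl n) := by
  intro l l' e
  ext v
  rw [← inner_vecOf, e, inner_vecOf]

theorem ActionAngleChart.dAction_of_coframe (c c' : ActionAngleChart Ω f) {y : Eucl n}
    {Z : Matrix (Fin n) (Fin n) ℤ} (hZ : c'.coframe y = (c.coframe y).comp (ofInt Z)) (j : Fin n) :
    c'.dAction j y = ∑ i, (Z i j : ℝ) • c.dAction i y := by
  apply vecOf_injective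
  rw [← c'.coframe_single, hZ, ContinuousLinearMap.comp_apply, ofInt_single, map_sum]
  simp only [coframe, combo_apply, map_smul, intVec_apply]

variable [IsManifold (𝓡 (2 * n)) ∞ M] [T2Space M]

/-- Two polarizations differ, on each fibre, by a translation. -/
theorem IsPolarization.translate {F F' : Eucl n × Eucl n → M} {U U' : Set (Eucl n)}
    (h : IsPolarization Ω f F U) (h' : IsPolarization Ω f F' U') {y : Eucl n} (hy : y ∈ U)
    (hy' : y ∈ U') {s₀ s₀' : Eucl n} (e : F (y, s₀) = F' (y, s₀')) (s : Eucl n) :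
    F (y, s₀ + s) = F' (y, s₀' + s) := by
  have o1 := (h.isOrbitOn hy).comp_add s₀
  have o2 := (h'.isOrbitOn hy').comp_add s₀'
  exact o1.eqOn o2 isPreconnected_univ (mem_univ 0) (by simpa using e) (mem_univ s)

/-- A shift of the fibre parameter does not change its periods, so by `IsPolarization.translate` the
lattice is an invariant of Ω and f. -/
theorem IsPolarization.periods_eq {F F' : Eucl n × Eucl n → M} {U U' : Set (Eucl n)}
    (h : IsPolarization Ω f F U) (h' : IsPolarization Ω f F' U') {y : Eucl n} (hy : y ∈ U)
    (hy' : y ∈ U') : periods F y = periods F' y := by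
  obtain ⟨s₀, hs₀⟩ := h.surj (F' (y, 0)) (by rwa [h'.base hy'])
  rw [h'.base hy'] at hs₀
  have t := h.translate h' hy hy' hs₀
  ext s
  rw [h'.mem_periods_iff hy', ← zero_add s, ← t, ← hs₀, eq_comm, h.eq_iff hy]
  simp

/-- The 2π dI_j and the 2π dI'_j are two bases of the same period lattice. -/
theorem ActionAngleChart.exists_transition (c c' : ActionAngleChart Ω f) {y : Eucl n}
    (hy : y ∈ c.action.source) (hy' : y ∈ c'.action.source) :
    ∃ Z : Matrix (Fin n) (Fin n) ℤ, IsUnit Z.det ∧ c'.coframe y = (c.coframe y).comp (ofInt Z) := by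
  have key : ∀ c c' : ActionAngleChart Ω f, y ∈ c.action.source → y ∈ c'.action.source →
      ∀ k, ∃ k', c.coframe y (intVec k) = c'.coframe y (intVec k') := by
    intro c c' hy hy' k
    have h1 := (c.mem_periods_lift hy).2 ⟨k, rfl⟩
    rw [c.isPolarization_lift.periods_eq c'.isPolarization_lift hy hy', c'.mem_periods_lift hy'] at h1
    obtain ⟨k', hk'⟩ := h1
    rw [map_smul, map_smul] at hk'
    exact ⟨k', smul_right_injective _ (by positivity : 2 * Real.pi ≠ 0) hk'⟩
  exact exists_unimodular (c.coframe_bijective hy).1 (key c c' hy hy') (key c' c hy' hy)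

/-- A transition matrix exists at each nearby point; the coframes are continuous and its entries are
integers, so it is constant near y. -/
theorem ActionAngleChart.eventually_transition (c c' : ActionAngleChart Ω f) {y : Eucl n}
    (hy : y ∈ c.action.source) (hy' : y ∈ c'.action.source) {Z : Matrix (Fin n) (Fin n) ℤ}
    (hZ : c'.coframe y = (c.coframe y).comp (ofInt Z)) :
    ∀ᶠ z in 𝓝 y, c'.coframe z = (c.coframe z).comp (ofInt Z) := by
  have ev : ∀ᶠ z in 𝓝 y, ∃ Z : Matrix (Fin n) (Fin n) ℤ, c'.coframe z = (c.coframe z).comp (ofInt Z) := by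
    filter_upwards [c.action.open_source.mem_nhds hy, c'.action.open_source.mem_nhds hy'] with z hz hz'
    obtain ⟨Z, -, h⟩ := c.exists_transition c' hz hz'
    exact ⟨Z, h⟩
  obtain ⟨Z', hZ'⟩ := ev.choice
  filter_upwards [eventually_unimodular_eq (c.continuousAt_coframe hy).tendsto
    (c'.continuousAt_coframe hy').tendsto (c.coframe_bijective hy) hZ' hZ, hZ'] with z h1 h2
  rw [h2, h1]

end Charts

/-! ### The canonical connection and its flatness. -/

section CanonicalConnection

open Set

variable {n : ℕ} {M : Type*} [TopologicalSpace M] [ChartedSpace (Eucl (2 * n)) M]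
  {Ω : SymplecticForm (2 * n) M} {f : M → Eucl n}

namespace ActionAngleChart

variable (c : ActionAngleChart Ω f)

/-- The connection form of the pullback of `d` by the action variables. -/
def connection (b : Eucl n) : Eucl n →L[ℝ] Eucl n →L[ℝ] Eucl n :=
  (ContinuousLinearMap.compL ℝ (Eucl n) (Eucl n) (Eucl n)
    (fderiv ℝ c.action.symm (c.action b))).comp (fderiv ℝ (fderiv ℝ c.action) b)

variable {c} {b : Eucl n}

theorem fderiv_connection (hb : b ∈ c.action.source) (X v : Eucl n) :
    fderiv ℝ c.action b (c.connection b X v) = fderiv ℝ (fderiv ℝ c.action) b X v :=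
  c.fderiv_fderiv_symm hb _

theorem fderiv_injective (hb : b ∈ c.action.source) :
    Function.Injective (fderiv ℝ c.action b) :=
  Function.LeftInverse.injective (c.fderiv_symm_fderiv hb)

theorem contDiffAt_fderiv (hb : b ∈ c.action.source) : ContDiffAt ℝ ∞ (fderiv ℝ c.action) b :=
  (c.contDiffAt_action hb).fderiv_right (by simp)

theorem contDiffAt_fderiv_fderiv (hb : b ∈ c.action.source) :
    ContDiffAt ℝ ∞ (fderiv ℝ (fderiv ℝ c.action)) b :=
  (contDiffAt_fderiv hb).fderiv_right (by simp)

theorem contDiffAt_connection (hb : b ∈ c.action.source) : ContDiffAt ℝ ∞ c.connection b := by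
  have h1 : ContDiffAt ℝ ∞ (fun y => fderiv ℝ c.action.symm (c.action y)) b :=
    ContDiffAt.comp b ((c.contDiffAt_symm hb).fderiv_right (by simp)) (c.contDiffAt_action hb)
  exact ((ContinuousLinearMap.compL ℝ (Eucl n) (Eucl n) (Eucl n)).contDiff.contDiffAt.comp b h1).clm_comp
    (contDiffAt_fderiv_fderiv hb)

theorem fderiv_of_coframe (c : ActionAngleChart Ω f) {c' : ActionAngleChart Ω f}
    (hb : b ∈ c.action.source) (hb' : b ∈ c'.action.source) {Z : Matrix (Fin n) (Fin n) ℤ}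
    (hZ : c'.coframe b = (c.coframe b).comp (ofInt Z)) :
    fderiv ℝ c'.action b = (ofInt Z.transpose).comp (fderiv ℝ c.action b) := by
  ext v j
  rw [← c'.dAction_apply hb', c.dAction_of_coframe c' hZ, ContinuousLinearMap.comp_apply,
    ofInt_apply]
  simp [c.dAction_apply hb]

/-- On overlaps dI' = Zᵀ dI with Z locally constant, and Zᵀ cancels in (dI)⁻¹ D(dI). -/
theorem connection_eq [IsManifold (𝓡 (2 * n)) ∞ M] [T2Space M] (c c' : ActionAngleChart Ω f)
    (hb : b ∈ c.action.source) (hb' : b ∈ c'.action.source) :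
    c'.connection b = c.connection b := by
  obtain ⟨Z, -, hZ⟩ := c.exists_transition c' hb hb'
  have ev : fderiv ℝ c'.action =ᶠ[𝓝 b] fun y => (ofInt Z.transpose).comp (fderiv ℝ c.action y) := by
    filter_upwards [c.eventually_transition c' hb hb' hZ, c.action.open_source.mem_nhds hb,
      c'.action.open_source.mem_nhds hb'] with y hy h1 h2
    exact c.fderiv_of_coframe h1 h2 hy
  have d2 : HasFDerivAt (fderiv ℝ c.action) (fderiv ℝ (fderiv ℝ c.action) b) b :=
    ((contDiffAt_fderiv hb).differentiableAt (by simp)).hasFDerivAt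
  have d3 := ((ContinuousLinearMap.compL ℝ (Eucl n) (Eucl n) (Eucl n)
    (ofInt Z.transpose)).hasFDerivAt.comp b d2).congr_of_eventuallyEq ev
  ext1 X
  ext1 v
  apply fderiv_injective hb'
  rw [fderiv_connection hb', d3.fderiv, ev.eq_of_nhds]
  exact congrArg (ofInt Z.transpose) (fderiv_connection hb X v).symm

theorem isPullbackOfD {A : ConnectionForm n (Eucl n)}
    (hA : ∀ b ∈ c.action.source, A b = c.connection b) :
    IsPullbackOfD A c.action c.action.source := by
  intro b hb s hs X
  have d2 : HasFDerivAt (fderiv ℝ c.action) (fderiv ℝ (fderiv ℝ c.action) b) b :=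
    ((contDiffAt_fderiv hb).differentiableAt (by simp)).hasFDerivAt
  rw [covDeriv, hA b hb, map_add, fderiv_connection hb, (d2.clm_apply hs.hasFDerivAt).fderiv]
  simp

/-- Constant sections v suffice as tests: they give dI(A_X v) = D²I(X, v), and dI is injective. -/
theorem eq_connection_of_pullback {A : ConnectionForm n (Eucl n)}
    (hA : IsPullbackOfD A c.action c.action.source) (hb : b ∈ c.action.source) :
    A b = c.connection b := by
  ext1 X
  ext1 v
  apply fderiv_injective hb
  have d2 : HasFDerivAt (fderiv ℝ c.action) (fderiv ℝ (fderiv ℝ c.action) b) b :=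
    ((contDiffAt_fderiv hb).differentiableAt (by simp)).hasFDerivAt
  have h := hA b hb (fun _ => v) (differentiableAt_const v) X
  rw [covDeriv, (d2.clm_apply (hasFDerivAt_const v b)).fderiv] at h
  rw [fderiv_connection hb]
  simpa using h

/-- Differentiate dI ∘ A = D(dI) and antisymmetrize: the third derivatives of I drop out, and what
remains is dI applied to the curvature. -/
theorem connection_flat (hb : b ∈ c.action.source) (X Y : Eucl n) :
    fderiv ℝ c.connection b X Y - fderiv ℝ c.connection b Y X
      + ((c.connection b X).comp (c.connection b Y) - (c.connection b Y).comp (c.connection b X))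
      = 0 := by
  ext1 v
  apply fderiv_injective hb
  have d2 : HasFDerivAt (fderiv ℝ c.action) (fderiv ℝ (fderiv ℝ c.action) b) b :=
    ((contDiffAt_fderiv hb).differentiableAt (by simp)).hasFDerivAt
  have d3 : HasFDerivAt (fderiv ℝ (fderiv ℝ c.action)) (fderiv ℝ (fderiv ℝ (fderiv ℝ c.action)) b) b :=
    ((contDiffAt_fderiv_fderiv hb).differentiableAt (by simp)).hasFDerivAt
  have dc : HasFDerivAt c.connection (fderiv ℝ c.connection b) b :=
    ((contDiffAt_connection hb).differentiableAt (by simp)).hasFDerivAt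
  have sym : ∀ X Y, fderiv ℝ (fderiv ℝ (fderiv ℝ c.action)) b X Y
      = fderiv ℝ (fderiv ℝ (fderiv ℝ c.action)) b Y X := by
    have h := (contDiffAt_fderiv hb).isSymmSndFDerivAt (by
      rw [minSmoothness_of_isRCLikeNormedField]; exact WithTop.coe_le_coe.2 (le_top (a := (2 : ℕ∞))))
    exact fun a c => h a c
  have key : ∀ X Y, fderiv ℝ (fderiv ℝ c.action) b X (c.connection b Y v)
      + fderiv ℝ c.action b (fderiv ℝ c.connection b X Y v)
      = fderiv ℝ (fderiv ℝ (fderiv ℝ c.action)) b X Y v := by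
    intro X Y
    have h1 := d2.clm_apply ((dc.clm_apply (hasFDerivAt_const Y b)).clm_apply (hasFDerivAt_const v b))
    have h2 := (d3.clm_apply (hasFDerivAt_const Y b)).clm_apply (hasFDerivAt_const v b)
    have h3 := h1.unique (h2.congr_of_eventuallyEq (Filter.eventually_of_mem
      (c.action.open_source.mem_nhds hb) fun y hy => fderiv_connection hy Y v))
    have h4 := DFunLike.congr_fun h3 X
    simp at h4
    rw [← h4]
    abel
  have k1 := key X Y
  have k2 := key Y X
  rw [sym, ← k2] at k1
  simp only [add_apply, sub_apply, ContinuousLinearMap.comp_apply, map_add, map_sub,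
    fderiv_connection hb, zero_apply, map_zero]
  rw [← sub_eq_zero] at k1
  rw [← k1]
  abel

theorem dAction_parallel {A : ConnectionForm n (Eucl n)} (hb : b ∈ c.action.source)
    (hA : A b = c.connection b) (j : Fin n) (X : Eucl n) :
    covDeriv (dualConnection A) (c.dAction j) b X = 0 := by
  have d2 : HasFDerivAt (fderiv ℝ c.action) (fderiv ℝ (fderiv ℝ c.action) b) b :=
    ((contDiffAt_fderiv hb).differentiableAt (by simp)).hasFDerivAt
  have d3 := (ContinuousLinearMap.compL ℝ (Eucl n) (Eucl n) ℝ
    (EuclideanSpace.proj j : Eucl n →L[ℝ] ℝ)).hasFDerivAt.comp b d2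
  have ev : c.dAction j =ᶠ[𝓝 b] (ContinuousLinearMap.compL ℝ (Eucl n) (Eucl n) ℝ
      (EuclideanSpace.proj j : Eucl n →L[ℝ] ℝ)) ∘ fderiv ℝ c.action := by
    filter_upwards [c.action.open_source.mem_nhds hb] with y hy
    ext v
    exact c.dAction_apply hy j v
  ext v
  rw [covDeriv, (d3.congr_of_eventuallyEq ev).fderiv]
  have h1 : (dualConnection A b X (c.dAction j b)) v = -(c.dAction j b (A b X v)) := rfl
  rw [add_apply, h1, hA, c.dAction_apply hb, fderiv_connection hb]
  exact add_neg_cancel _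

end ActionAngleChart

variable (Ω f) in
open Classical in
/-- The connection form of the canonical connection. -/
def canonicalConnection : ConnectionForm n (Eucl n) := fun b =>
  if h : ∃ c : ActionAngleChart Ω f, b ∈ c.action.source then h.choose.connection b else 0

variable [IsManifold (𝓡 (2 * n)) ∞ M] [T2Space M]

theorem canonicalConnection_eq (c : ActionAngleChart Ω f) {b : Eucl n} (hb : b ∈ c.action.source) :
    canonicalConnection Ω f b = c.connection b := by
  have h : ∃ c : ActionAngleChart Ω f, b ∈ c.action.source := ⟨c, hb⟩
  rw [canonicalConnection, dif_pos h]
  exact c.connection_eq _ hb h.choose_spec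

theorem canonicalConnection_eventuallyEq (c : ActionAngleChart Ω f) {b : Eucl n}
    (hb : b ∈ c.action.source) : canonicalConnection Ω f =ᶠ[𝓝 b] c.connection :=
  Filter.eventually_of_mem (c.action.open_source.mem_nhds hb) fun _ hy => canonicalConnection_eq c hy

theorem isCanonicalConnection_canonicalConnection (hf : IsIntegrableSystem Ω f) :
    IsCanonicalConnection Ω f (canonicalConnection Ω f) := by
  refine ⟨fun b hb => ?_, fun c => c.isPullbackOfD fun b hb => canonicalConnection_eq c hb⟩
  obtain ⟨c, hc⟩ := exists_actionAngleChart hf hb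
  exact ((ActionAngleChart.contDiffAt_connection hc).congr_of_eventuallyEq
    (canonicalConnection_eventuallyEq c hc)).contDiffWithinAt

theorem IsCanonicalConnection.eqOn (hf : IsIntegrableSystem Ω f) {A : ConnectionForm n (Eucl n)}
    (hA : IsCanonicalConnection Ω f A) : EqOn A (canonicalConnection Ω f) (regularValues f) := by
  intro b hb
  obtain ⟨c, hc⟩ := exists_actionAngleChart hf hb
  rw [canonicalConnection_eq c hc, ActionAngleChart.eq_connection_of_pullback (hA.pullback c) hc]

theorem isFlatOn_canonicalConnection (hf : IsIntegrableSystem Ω f) :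
    IsFlatOn (canonicalConnection Ω f) (regularValues f) := by
  intro b hb X Y
  obtain ⟨c, hc⟩ := exists_actionAngleChart hf hb
  rw [(canonicalConnection_eventuallyEq c hc).fderiv_eq, canonicalConnection_eq c hc]
  exact ActionAngleChart.connection_flat hc X Y

end CanonicalConnection

/-! ### Torus coverings and lifts. -/

section Covering

open Set Topology

variable {n : ℕ}

/-- A set with closed preimage is the image of a compact subset of `K`, hence closed in the
Hausdorff target. -/
theorem isQuotientMap_of_isCompact_image {E Y : Type*} [TopologicalSpace E] [TopologicalSpace Y]
    [T2Space Y] {q : E → Y} (hq : Continuous q) {K : Set E} (hK : IsCompact K)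
    (h : ∀ y, ∃ e ∈ K, q e = y) : IsQuotientMap q := by
  refine isQuotientMap_iff_isClosed.2 ⟨fun y => (h y).imp fun e he => he.2, fun s =>
    ⟨fun hs => hs.preimage hq, fun hs => ?_⟩⟩
  have : s = q '' (K ∩ q ⁻¹' s) := by
    ext y
    constructor
    · intro hy
      obtain ⟨e, heK, rfl⟩ := h y
      exact ⟨e, ⟨heK, hy⟩, rfl⟩
    · rintro ⟨e, ⟨-, he⟩, rfl⟩
      exact he
  rw [this]
  exact ((hK.inter_right hs).image hq).isClosed

/-- Quotients by free actions of `ℤⁿ` which lift to translations of `ℝⁿ` are coverings. -/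
theorem isCoveringMap_of_deck {E Y : Type*} [TopologicalSpace E] [TopologicalSpace Y]
    {q : E → Y} (hq : IsQuotientMap q) (v : E → Eucl n) (hv : Continuous v)
    (act : (Fin n → ℤ) → E → E) (act_cont : ∀ k, Continuous (act k)) (act_zero : ∀ e, act 0 e = e)
    (act_add : ∀ k l e, act (k + l) e = act k (act l e))
    (v_act : ∀ k e, v (act k e) = v e + (2 * Real.pi) • intVec k)
    (h : ∀ e e', q e = q e' ↔ ∃ k, e' = act k e) : IsCoveringMap q := by
  let _ : AddAction (Fin n → ℤ) E :=
    { vadd := act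
      zero_vadd := act_zero
      add_vadd := act_add }
  refine IsAddQuotientCoveringMap.isCoveringMap q (Fin n → ℤ) ⟨hq, ⟨act_cont⟩, ?_, ?_⟩
  · intro e e'
    rw [eq_comm, h]
    exact exists_congr fun k => eq_comm
  · intro e
    -- A nonzero group element moves v by at least 2π, whereas two points of this set have values of
    -- v less than 2 apart.
    refine ⟨{e' | ‖v e' - v e‖ < 1}, ?_, ?_⟩
    · have c : Continuous fun e' => ‖v e' - v e‖ := by fun_prop
      exact (isOpen_lt c continuous_const).mem_nhds (by simp)
    · rintro k ⟨_, ⟨e', he', rfl⟩, he''⟩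
      have h1 : ‖v (act k e') - v e‖ < 1 := he''
      rw [v_act] at h1
      have h2 : ‖(2 * Real.pi) • (intVec k : Eucl n)‖ < 2 := by
        calc ‖(2 * Real.pi) • (intVec k : Eucl n)‖
            = ‖(v e' + (2 * Real.pi) • intVec k - v e) - (v e' - v e)‖ := by congr 1; abel
          _ ≤ _ := norm_sub_le _ _
          _ < 1 + 1 := add_lt_add h1 he'
          _ = 2 := by norm_num
      funext i
      have h3 := (PiLp.norm_apply_le ((2 * Real.pi) • (intVec k : Eucl n)) i).trans_lt h2
      simp only [PiLp.smul_apply, intVec_apply, smul_eq_mul, norm_mul, Real.norm_eq_abs] at h3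
      rw [abs_of_pos Real.pi_pos, abs_two] at h3
      have h4 : |(k i : ℝ)| < 1 := by
        nlinarith [Real.pi_gt_three, abs_nonneg (k i : ℝ)]
      have h5 : |k i| < 1 := by exact_mod_cast h4
      exact Int.abs_lt_one_iff.1 h5

/-- Every vector is congruent modulo `2πℤⁿ` to a vector in a given bounded set. -/
theorem exists_bounded_representative (x : Eucl n) :
    ∃ k : Fin n → ℤ, x + (2 * Real.pi) • intVec k ∈
      Metric.closedBall (0 : Eucl n) (∑ _j : Fin n, 2 * Real.pi) := by
  refine ⟨fun j => -⌊x j / (2 * Real.pi)⌋, ?_⟩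
  rw [mem_closedBall_zero_iff]
  set y := x + (2 * Real.pi) • intVec fun j => -⌊x j / (2 * Real.pi)⌋
  have hy : y = ∑ j, y j • EuclideanSpace.single j (1 : ℝ) := by
    ext j
    simp [Pi.single_apply]
  rw [hy]
  refine (norm_sum_le _ _).trans (Finset.sum_le_sum fun j _ => ?_)
  have hp : 0 < 2 * Real.pi := by positivity
  have h1 : y j = 2 * Real.pi * Int.fract (x j / (2 * Real.pi)) := by
    simp only [y, PiLp.add_apply, PiLp.smul_apply, intVec_apply, smul_eq_mul, Int.cast_neg]
    rw [← Int.self_sub_floor]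
    field_simp
    ring
  rw [norm_smul, PiLp.norm_single, norm_one, mul_one, h1, Real.norm_of_nonneg
    (mul_nonneg hp.le (Int.fract_nonneg _))]
  exact mul_le_of_le_one_right hp.le (Int.fract_lt_one _).le

theorem intVec_zero : intVec (0 : Fin n → ℤ) = 0 := by ext i; simp

theorem intVec_add (k l : Fin n → ℤ) : (intVec (k + l) : Eucl n) = intVec k + intVec l := by
  ext i; simp

theorem intVec_neg (k : Fin n → ℤ) : (intVec (-k) : Eucl n) = -intVec k := by ext i; simp

/-- Maps invariant exactly under `2πℤⁿ` onto Hausdorff spaces are coverings. -/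
theorem isCoveringMap_of_lattice {K Y : Type*} [TopologicalSpace K] [CompactSpace K]
    [TopologicalSpace Y] [T2Space Y] {q : K × Eucl n → Y} (hq : Continuous q)
    (hs : Function.Surjective q)
    (h : ∀ e e', q e = q e' ↔ ∃ k, e' = (e.1, e.2 + (2 * Real.pi) • intVec k)) :
    IsCoveringMap q := by
  have hquot : IsQuotientMap q := by
    refine isQuotientMap_of_isCompact_image hq (K := univ ×ˢ Metric.closedBall 0 (∑ _j : Fin n, 2 * Real.pi))
      (isCompact_univ.prod (isCompact_closedBall _ _)) fun y => ?_
    obtain ⟨⟨t, x⟩, rfl⟩ := hs y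
    obtain ⟨k, hk⟩ := exists_bounded_representative x
    exact ⟨(t, x + (2 * Real.pi) • intVec k), ⟨mem_univ _, hk⟩, ((h (t, x) _).2 ⟨k, rfl⟩).symm⟩
  refine isCoveringMap_of_deck hquot Prod.snd continuous_snd
    (fun k e => (e.1, e.2 + (2 * Real.pi) • intVec k)) (fun k => by fun_prop) (fun e => ?_)
    (fun k l e => ?_) (fun k e => rfl) h
  · simp [intVec_zero]
  · simp only [intVec_add, smul_add]
    rw [add_assoc, add_comm ((2 * Real.pi) • intVec k)]

theorem isCoveringMap_of_lattice' {Y : Type*} [TopologicalSpace Y] [T2Space Y] {q : Eucl n → Y}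
    (hq : Continuous q) (hs : Function.Surjective q)
    (h : ∀ e e', q e = q e' ↔ ∃ k, e' = e + (2 * Real.pi) • intVec k) :
    IsCoveringMap q := by
  have hquot : IsQuotientMap q := by
    refine isQuotientMap_of_isCompact_image hq (isCompact_closedBall 0 (∑ _j : Fin n, 2 * Real.pi))
      fun y => ?_
    obtain ⟨x, rfl⟩ := hs y
    obtain ⟨k, hk⟩ := exists_bounded_representative x
    exact ⟨_, hk, ((h _ _).2 ⟨k, rfl⟩).symm⟩
  refine isCoveringMap_of_deck hquot id continuous_id (fun k e => e + (2 * Real.pi) • intVec k)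
    (fun k => by fun_prop) (fun e => ?_) (fun k l e => ?_) (fun k e => rfl) h
  · simp [intVec_zero]
  · simp only [intVec_add, smul_add]
    rw [add_assoc, add_comm ((2 * Real.pi) • intVec k)]

/-- `π` is the universal covering of an `n`-torus `X`, with deck group `2πℤⁿ`. -/
structure IsTorusCover {X : Type*} [TopologicalSpace X] [ChartedSpace (Eucl n) X] (π : Eucl n → X) :
    Prop where
  covering : IsCoveringMap π
  surj : Function.Surjective π
  eq_iff : ∀ x y, π x = π y ↔ ∃ k, y = x + (2 * Real.pi) • intVec k
  diffeo : ∀ x, ∃ Φ : PartialDiffeomorph 𝓘(ℝ, Eucl n) (𝓡 n) (Eucl n) X ∞,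
    x ∈ Φ.source ∧ ∀ z ∈ Φ.source, Φ z = π z

variable {X : Type*} [TopologicalSpace X] [ChartedSpace (Eucl n) X] {π : Eucl n → X}

theorem IsTorusCover.smooth (h : IsTorusCover π) : ContMDiff 𝓘(ℝ, Eucl n) (𝓡 n) ∞ π := by
  intro x
  obtain ⟨Φ, hx, e⟩ := h.diffeo x
  exact (Φ.contMDiffOn_toFun.contMDiffAt (Φ.open_source.mem_nhds hx)).congr_of_eventuallyEq
    (Filter.eventually_of_mem (Φ.open_source.mem_nhds hx) fun z hz => (e z hz).symm)

theorem IsTorusCover.add_int (h : IsTorusCover π) (x : Eucl n) (k : Fin n → ℤ) :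
    π (x + (2 * Real.pi) • intVec k) = π x := ((h.eq_iff _ _).2 ⟨k, rfl⟩).symm

/-- Continuous lifts of smooth maps are smooth. -/
theorem IsTorusCover.contMDiffAt_lift (h : IsTorusCover π) {E H W : Type*} [NormedAddCommGroup E]
    [NormedSpace ℝ E] [TopologicalSpace H] {I : ModelWithCorners ℝ E H} [TopologicalSpace W]
    [ChartedSpace H W] {g : W → Eucl n} {w : W} (hg : ContinuousAt g w)
    (hs : ContMDiffAt I (𝓡 n) ∞ (fun w => π (g w)) w) :
    ContMDiffAt I 𝓘(ℝ, Eucl n) ∞ g w := by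
  obtain ⟨Φ, hx, e⟩ := h.diffeo (g w)
  have hw : π (g w) ∈ Φ.target := by rw [← e _ hx]; exact Φ.map_source hx
  have h1 : ContMDiffAt (𝓡 n) 𝓘(ℝ, Eucl n) ∞ Φ.symm (π (g w)) :=
    Φ.contMDiffOn_invFun.contMDiffAt (Φ.open_target.mem_nhds hw)
  refine (h1.comp w hs).congr_of_eventuallyEq ?_
  filter_upwards [hg.preimage_mem_nhds (Φ.open_source.mem_nhds hx)] with w' hw'
  have : Φ.symm (Φ (g w')) = g w' := Φ.left_inv hw'
  simp only [Function.comp]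
  rw [← e _ hw', this]

theorem IsTorusCover.exists_lift (h : IsTorusCover π) {W : Type} [NormedAddCommGroup W]
    [NormedSpace ℝ W] {g : W → X} (hg : ContMDiff 𝓘(ℝ, W) (𝓡 n) ∞ g) (w₀ : W) {e₀ : Eucl n}
    (he : π e₀ = g w₀) :
    ∃ g' : W → Eucl n, ContDiff ℝ ∞ g' ∧ (∀ w, π (g' w) = g w) ∧ g' w₀ = e₀ := by
  obtain ⟨G, ⟨hG0, hG⟩, -⟩ := h.covering.existsUnique_continuousMap_lifts ⟨g, hg.continuous⟩ w₀ e₀ he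
  have hG' : ∀ w, π (G w) = g w := fun w => congrFun hG w
  refine ⟨G, ?_, hG', hG0⟩
  rw [← contMDiff_iff_contDiff]
  intro w
  refine h.contMDiffAt_lift G.continuous.continuousAt ?_
  simp only [hG']
  exact hg w

/-- Two lifts of the same map differ by a constant period. -/
theorem IsTorusCover.lift_unique (h : IsTorusCover π) {W : Type*} [TopologicalSpace W]
    [PreconnectedSpace W] [Nonempty W] {g g' : W → Eucl n} (hg : Continuous g) (hg' : Continuous g')
    (e : ∀ w, π (g w) = π (g' w)) : ∃ k : Fin n → ℤ, ∀ w, g' w = g w + (2 * Real.pi) • intVec k := by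
  obtain ⟨w₀⟩ := ‹Nonempty W›
  obtain ⟨k, hk⟩ := (h.eq_iff _ _).1 (e w₀)
  refine ⟨k, congrFun (h.covering.eq_of_comp_eq hg' (by fun_prop) (funext fun w => ?_) w₀ hk)⟩
  simp only [Function.comp]
  rw [h.add_int, e]

/-- Lifts of self-maps are equivariant. -/
theorem IsTorusCover.exists_matrix (h : IsTorusCover π) {φ : X → X} {g : Eucl n → Eucl n}
    (hg : Continuous g) (e : ∀ x, π (g x) = φ (π x)) :
    ∃ A : Matrix (Fin n) (Fin n) ℤ, ∀ x k,
      g (x + (2 * Real.pi) • intVec k) = g x + (2 * Real.pi) • ofInt A (intVec k) := by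
  -- Both functions of x lift the same map, so they differ by a lattice vector independent of x;
  -- this makes l additive in k.
  have h1 : ∀ k, ∃ l, ∀ x, g (x + (2 * Real.pi) • intVec k) = g x + (2 * Real.pi) • intVec l :=
    fun k => h.lift_unique hg (by fun_prop) fun x => by rw [e, e, h.add_int]
  choose L hL using h1
  have hp : (2 * Real.pi) ≠ 0 := by positivity
  have Ladd : ∀ k l, L (k + l) = L k + L l := by
    intro k l
    apply intVec_injective
    have h2 := hL (k + l) 0
    rw [intVec_add, smul_add, ← add_assoc, hL, hL, add_assoc, add_left_cancel_iff, ← smul_add] at h2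
    rw [intVec_add]
    exact (smul_right_injective _ hp h2).symm
  let L' : (Fin n → ℤ) →+ (Fin n → ℤ) := AddMonoidHom.mk' L Ladd
  refine ⟨LinearMap.toMatrix' L'.toIntLinearMap, fun x k => ?_⟩
  rw [hL, ofInt_intVec, LinearMap.toMatrix'_mulVec]
  rfl

end Covering

/-! ### First homology of a torus, by winding vectors. -/

section TorusHomology

open Set

variable {n : ℕ} {X : Type*} [TopologicalSpace X] [ChartedSpace (Eucl n) X] {π : Eucl n → X}

theorem SmoothSimplex.ext' {d : ℕ} [ChartedSpace (Eucl d) X] {W : Type} [NormedAddCommGroup W]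
    [NormedSpace ℝ W] {K : Set W} {σ σ' : SmoothSimplex d K X} (e : ∀ p, σ.toFun p = σ'.toFun p) :
    σ = σ' := by
  cases σ
  cases σ'
  obtain rfl := funext e
  rfl

variable (π) in
/-- `ρ` is a lift of the path `σ` to the covering space. -/
def IsPathLift (σ : SmoothPath n X) (ρ : ℝ → Eucl n) : Prop :=
  ContDiff ℝ ∞ ρ ∧ ∀ t : Icc (0 : ℝ) 1, π (ρ t) = σ.toFun t

namespace IsTorusCover

variable (h : IsTorusCover π)

include h in
theorem exists_pathLift (σ : SmoothPath n X) : ∃ ρ, IsPathLift π σ ρ := by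
  obtain ⟨g, hg, e⟩ := σ.smooth
  obtain ⟨e₀, he₀⟩ := h.surj (g 0)
  obtain ⟨ρ, hρ, hπ, -⟩ := h.exists_lift hg 0 he₀
  exact ⟨ρ, hρ, fun t => (hπ t).trans (e t)⟩

include h in
theorem pathLift_unique {σ : SmoothPath n X} {ρ ρ' : ℝ → Eucl n} (hρ : IsPathLift π σ ρ)
    (hρ' : IsPathLift π σ ρ') :
    ∃ k : Fin n → ℤ, ∀ t ∈ Icc (0 : ℝ) 1, ρ' t = ρ t + (2 * Real.pi) • intVec k := by
  obtain ⟨k, hk⟩ := h.lift_unique (W := Icc (0 : ℝ) 1) (g := fun t => ρ t) (g' := fun t => ρ' t)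
    (hρ.1.continuous.comp continuous_subtype_val) (hρ'.1.continuous.comp continuous_subtype_val)
    fun t => (hρ.2 t).trans (hρ'.2 t).symm
  exact ⟨k, fun t ht => hk ⟨t, ht⟩⟩

/-- The path `π ∘ ρ`. -/
def path (ρ : ℝ → Eucl n) (hρ : ContDiff ℝ ∞ ρ) : SmoothPath n X :=
  ⟨fun t => π (ρ t), fun t => π (ρ t), h.smooth.comp hρ.contMDiff, fun _ => rfl⟩

/-- The triangle `π ∘ G`. -/
def triangle (G : ℝ × ℝ → Eucl n) (hG : ContDiff ℝ ∞ G) : SmoothTriangle n X :=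
  ⟨fun t => π (G t), fun t => π (G t), h.smooth.comp hG.contMDiff, fun _ => rfl⟩

variable (n X) in
/-- Singular `1`-chains modulo boundaries. -/
abbrev ChainsModBoundaries : Type _ := (SmoothPath n X →₀ ℤ) ⧸ LinearMap.range (boundary2 n X)

variable (n X) in
/-- The class of a path modulo boundaries. -/
def pathClass (σ : SmoothPath n X) : ChainsModBoundaries n X :=
  Submodule.Quotient.mk (Finsupp.single σ 1)

theorem pathClass_triangle (τ : SmoothTriangle n X) :
    pathClass n X (face0 τ) - pathClass n X (face1 τ) + pathClass n X (face2 τ) = 0 := by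
  refine (Submodule.Quotient.mk_eq_zero _).2 ⟨Finsupp.single τ 1, ?_⟩
  simp [boundary2]

/-- The projection of a straight segment. -/
def segment (a b : Eucl n) : SmoothPath n X := h.path (fun t => a + t • (b - a)) (by fun_prop)

/-- The affine triangle with vertices a, b, c in the covering space projects to a smooth singular
triangle with these edges. -/
theorem segment_add (a b c : Eucl n) :
    pathClass n X (h.segment a c) = pathClass n X (h.segment a b) + pathClass n X (h.segment b c) := by
  have h1 := pathClass_triangle
    (h.triangle (fun p => a + p.1 • (b - a) + p.2 • (c - a)) (by fun_prop))
  have e0 : face0 (h.triangle (fun p => a + p.1 • (b - a) + p.2 • (c - a)) (by fun_prop))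
      = h.segment b c := SmoothSimplex.ext' fun t => congrArg π (by module)
  have e1 : face1 (h.triangle (fun p => a + p.1 • (b - a) + p.2 • (c - a)) (by fun_prop))
      = h.segment a c := SmoothSimplex.ext' fun t => congrArg π (by module)
  have e2 : face2 (h.triangle (fun p => a + p.1 • (b - a) + p.2 • (c - a)) (by fun_prop))
      = h.segment a b := SmoothSimplex.ext' fun t => congrArg π (by module)
  rw [e0, e1, e2] at h1
  rw [← sub_eq_zero, ← neg_eq_zero, ← h1]
  abel

theorem segment_self (a : Eucl n) : pathClass n X (h.segment a a) = 0 := by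
  have := h.segment_add a a a
  simpa using this

theorem segment_translate (a b : Eucl n) (k : Fin n → ℤ) :
    h.segment (a + (2 * Real.pi) • intVec k) (b + (2 * Real.pi) • intVec k) = h.segment a b := by
  refine SmoothSimplex.ext' fun t => ?_
  refine Eq.trans (congrArg π ?_) (h.add_int _ k)
  module

/-- A path is homologous to the projection of a straight segment. -/
theorem pathClass_eq_segment {σ : SmoothPath n X} {ρ : ℝ → Eucl n} (hρ : IsPathLift π σ ρ) :
    pathClass n X σ = pathClass n X (h.segment (ρ 0) (ρ 1)) := by
  have hs := hρ.1
  -- A straight-line homotopy with fixed endpoints. Its square is cut along the diagonal into two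
  -- triangles; the diagonal cancels and the constant sides have class zero.
  let H : ℝ × ℝ → Eucl n := fun p => (1 - p.2) • ρ p.1 + p.2 • (ρ 0 + p.1 • (ρ 1 - ρ 0))
  have hH : ContDiff ℝ ∞ H := by fun_prop
  have h1 := pathClass_triangle (h.triangle (fun p => H (p.1 + p.2, p.2)) (by fun_prop))
  have h2 := pathClass_triangle (h.triangle (fun p => H (p.2, p.1 + p.2)) (by fun_prop))
  have e0 : face0 (h.triangle (fun p => H (p.1 + p.2, p.2)) (by fun_prop))
      = h.segment (ρ 1) (ρ 1) := SmoothSimplex.ext' fun t => congrArg π (by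
    show H (1 - t.1 + t.1, t.1) = _
    simp only [H, sub_add_cancel]
    module)
  have e1 : face1 (h.triangle (fun p => H (p.1 + p.2, p.2)) (by fun_prop))
      = h.path (fun t => H (t, t)) (by fun_prop) := SmoothSimplex.ext' fun t => congrArg π (by
    show H (0 + t.1, t.1) = _
    simp only [zero_add])
  have e2 : face2 (h.triangle (fun p => H (p.1 + p.2, p.2)) (by fun_prop)) = σ :=
    SmoothSimplex.ext' fun t => (congrArg π (by
      show H (t.1 + 0, 0) = ρ t
      simp only [H, add_zero]
      module)).trans (hρ.2 t)
  have e0' : face0 (h.triangle (fun p => H (p.2, p.1 + p.2)) (by fun_prop))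
      = h.segment (ρ 0) (ρ 1) := SmoothSimplex.ext' fun t => congrArg π (by
    show H (t.1, 1 - t.1 + t.1) = _
    simp only [H, sub_add_cancel]
    module)
  have e1' : face1 (h.triangle (fun p => H (p.2, p.1 + p.2)) (by fun_prop))
      = h.path (fun t => H (t, t)) (by fun_prop) := SmoothSimplex.ext' fun t => congrArg π (by
    show H (t.1, 0 + t.1) = _
    simp only [zero_add])
  have e2' : face2 (h.triangle (fun p => H (p.2, p.1 + p.2)) (by fun_prop))
      = h.segment (ρ 0) (ρ 0) := SmoothSimplex.ext' fun t => congrArg π (by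
    show H (0, t.1 + 0) = _
    simp only [H, add_zero]
    module)
  rw [e0, e1, e2, segment_self] at h1
  rw [e0', e1', e2', segment_self] at h2
  rw [← sub_eq_zero]
  have := h1.trans h2.symm
  rw [zero_sub, add_zero, neg_add_eq_sub] at this
  rw [sub_left_inj.1 this, sub_self]

/-- A set-theoretic section of the covering. -/
def sec (x : X) : Eucl n := Function.surjInv h.surj x

theorem π_sec (x : X) : π (h.sec x) = x := Function.surjInv_eq h.surj x

/-- For paths that are not closed, the winding is measured against the values of `sec` at the
endpoints. These corrections depend on the boundary only, so they disappear on cycles. -/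
theorem exists_winding (σ : SmoothPath n X) : ∃ m : Fin n → ℤ, ∀ ρ, IsPathLift π σ ρ →
    ρ 1 - ρ 0 = h.sec (σ.toFun ⟨1, by simp⟩) - h.sec (σ.toFun ⟨0, by simp⟩)
      + (2 * Real.pi) • intVec m := by
  obtain ⟨ρ, hρ⟩ := h.exists_pathLift σ
  have h0 := (h.π_sec _).trans (hρ.2 ⟨0, by simp⟩).symm
  have h1 := (h.π_sec _).trans (hρ.2 ⟨1, by simp⟩).symm
  obtain ⟨k0, hk0⟩ := (h.eq_iff _ _).1 h0
  obtain ⟨k1, hk1⟩ := (h.eq_iff _ _).1 h1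
  refine ⟨k1 - k0, fun ρ' hρ' => ?_⟩
  obtain ⟨k, hk⟩ := h.pathLift_unique hρ hρ'
  rw [hk 0 (by simp), hk 1 (by simp), sub_eq_add_neg k1, intVec_add, intVec_neg]
  simp only at hk0 hk1
  rw [hk0, hk1]
  module

/-- The winding vector of a path. -/
def winding (σ : SmoothPath n X) : Fin n → ℤ := (h.exists_winding σ).choose

theorem winding_spec {σ : SmoothPath n X} {ρ : ℝ → Eucl n} (hρ : IsPathLift π σ ρ) :
    ρ 1 - ρ 0 = h.sec (σ.toFun ⟨1, by simp⟩) - h.sec (σ.toFun ⟨0, by simp⟩)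
      + (2 * Real.pi) • intVec (h.winding σ) := (h.exists_winding σ).choose_spec ρ hρ

/-- The winding vector of a chain. -/
def windingChain : (SmoothPath n X →₀ ℤ) →ₗ[ℤ] (Fin n → ℤ) :=
  Finsupp.linearCombination ℤ h.winding

/-- A triangle lifts as a whole, so the displacements along its lifted edges add up to zero, and so
do the corrections by `sec` at the vertices. -/
theorem windingChain_boundary2 (c : SmoothTriangle n X →₀ ℤ) :
    h.windingChain (boundary2 n X c) = 0 := by
  have : h.windingChain.comp (boundary2 n X) = 0 := by
    ext1 τ
    ext1
    obtain ⟨g, hg, e⟩ := τ.smooth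
    obtain ⟨e₀, he₀⟩ := h.surj (g 0)
    obtain ⟨G, hG, hπ, -⟩ := h.exists_lift hg 0 he₀
    have l0 : IsPathLift π (face0 τ) fun t => G (1 - t, t) := ⟨by fun_prop, fun t => (hπ _).trans (e ⟨_, _⟩)⟩
    have l1 : IsPathLift π (face1 τ) fun t => G (0, t) := ⟨by fun_prop, fun t => (hπ _).trans (e ⟨_, _⟩)⟩
    have l2 : IsPathLift π (face2 τ) fun t => G (t, 0) := ⟨by fun_prop, fun t => (hπ _).trans (e ⟨_, _⟩)⟩
    have w0 := h.winding_spec l0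
    have w1 := h.winding_spec l1
    have w2 := h.winding_spec l2
    simp only [face0, face1, face2, sub_zero, sub_self] at w0 w1 w2
    have key : h.winding (face0 τ) - h.winding (face1 τ) + h.winding (face2 τ) = 0 := by
      apply intVec_injective
      have hp : (2 * Real.pi) ≠ 0 := by positivity
      apply smul_right_injective _ hp
      simp only
      rw [intVec_add, sub_eq_add_neg, intVec_add, intVec_neg, intVec_zero, smul_zero]
      rw [← sub_eq_iff_eq_add'] at w0 w1 w2
      simp only [smul_add, smul_neg]
      rw [← sub_eq_iff_eq_add'.2 (h.winding_spec l0), ← sub_eq_iff_eq_add'.2 (h.winding_spec l1),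
        ← sub_eq_iff_eq_add'.2 (h.winding_spec l2)]
      simp only [face0, face1, face2, sub_zero, sub_self]
      abel
    simpa [windingChain, boundary2] using key
  exact LinearMap.congr_fun this c

/-- The class of the loop with a given winding vector. -/
def loopClass : (Fin n → ℤ) →ₗ[ℤ] ChainsModBoundaries n X :=
  (AddMonoidHom.mk' (fun k => pathClass n X (h.segment 0 ((2 * Real.pi) • intVec k))) fun k l => by
    rw [h.segment_add 0 ((2 * Real.pi) • intVec k), intVec_add, smul_add]
    congr 2
    have := h.segment_translate 0 ((2 * Real.pi) • intVec l) k
    rw [zero_add, add_comm] at this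
    exact this).toIntLinearMap

theorem loopClass_apply (k : Fin n → ℤ) :
    h.loopClass k = pathClass n X (h.segment 0 ((2 * Real.pi) • intVec k)) := rfl

/-- Modulo boundaries a path is a segment between lifts of its endpoints. Joining these to 0 through
the points chosen by `sec` splits off a term in the boundary and leaves the loop of the winding
vector. Hence a cycle without winding is a boundary. -/
theorem mkQ_eq (c : SmoothPath n X →₀ ℤ) :
    (Submodule.Quotient.mk c : ChainsModBoundaries n X)
      = Finsupp.linearCombination ℤ (fun x => pathClass n X (h.segment 0 (h.sec x)))
          (boundary1 n X c) + h.loopClass (h.windingChain c) := by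
  have : (LinearMap.range (boundary2 n X)).mkQ
      = (Finsupp.linearCombination ℤ fun x => pathClass n X (h.segment 0 (h.sec x))).comp
          (boundary1 n X) + h.loopClass.comp h.windingChain := by
    ext1 σ
    ext1
    obtain ⟨ρ, hρ⟩ := h.exists_pathLift σ
    have h0 := (h.π_sec _).trans (hρ.2 ⟨0, by simp⟩).symm
    obtain ⟨k0, hk0⟩ := (h.eq_iff _ _).1 h0
    have h1 := h.winding_spec hρ
    simp only at hk0
    rw [hk0] at h1
    have hk1 : ρ 1 = h.sec (σ.toFun ⟨1, by simp⟩) + (2 * Real.pi) • intVec (k0 + h.winding σ) := by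
      rw [intVec_add, ← sub_eq_zero, ← sub_eq_zero.2 h1]
      module
    have aux : ∀ a k, pathClass n X (h.segment 0 (a + (2 * Real.pi) • intVec k))
        = pathClass n X (h.segment 0 a) + h.loopClass k := by
      intro a k
      rw [h.segment_add 0 ((2 * Real.pi) • intVec k), loopClass_apply, add_comm]
      have := h.segment_translate 0 a k
      rw [zero_add] at this
      rw [this]
    have key : pathClass n X σ = pathClass n X (h.segment 0 (h.sec (σ.toFun ⟨1, by simp⟩)))
        - pathClass n X (h.segment 0 (h.sec (σ.toFun ⟨0, by simp⟩))) + h.loopClass (h.winding σ) := by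
      rw [h.pathClass_eq_segment hρ]
      have h2 := h.segment_add 0 (ρ 0) (ρ 1)
      rw [hk0, hk1, aux, aux, map_add] at h2
      rw [hk0, hk1]
      have h3 := sub_eq_zero.2 h2
      rw [← sub_eq_zero, ← neg_eq_zero, ← h3]
      abel
    have h4 : h.windingChain (Finsupp.single σ 1) = h.winding σ := by simp [windingChain]
    have h5 : boundary1 n X (Finsupp.single σ 1) = Finsupp.single (σ.toFun ⟨1, by simp⟩) 1
        - Finsupp.single (σ.toFun ⟨0, by simp⟩) 1 := by
      rw [boundary1, Finsupp.linearCombination_single, one_smul]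
    simp only [LinearMap.comp_apply, LinearMap.add_apply, Finsupp.lsingle_apply, h4, h5, map_sub,
      Finsupp.linearCombination_single, one_smul]
    exact key
  exact LinearMap.congr_fun this c

/-- The isomorphism `H₁(X, ℤ) → ℤⁿ`. -/
def degree : SingH1 n X →ₗ[ℤ] (Fin n → ℤ) :=
  Submodule.liftQ _ (h.windingChain.comp (cycles1 n X).subtype) <| by
    rintro ⟨c, hc⟩ ⟨a, ha⟩
    have ha' : boundary2 n X a = c := ha
    show h.windingChain c = 0
    rw [← ha', windingChain_boundary2]

theorem degree_homologyClass (c : cycles1 n X) : h.degree (homologyClass c) = h.windingChain c.1 := rfl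

theorem degree_injective : Function.Injective h.degree := by
  rw [← LinearMap.ker_eq_bot, LinearMap.ker_eq_bot']
  intro a
  obtain ⟨c, rfl⟩ := Submodule.Quotient.mk_surjective _ a
  intro hc
  have h1 := h.mkQ_eq c.1
  have h2 : h.windingChain c.1 = 0 := hc
  have h3 : boundary1 n X c.1 = 0 := c.2
  rw [h2, h3, map_zero, map_zero, add_zero, Submodule.Quotient.mk_eq_zero] at h1
  exact (Submodule.Quotient.mk_eq_zero _).2 h1

theorem boundary1_single {σ : SmoothPath n X}
    (e : σ.toFun ⟨1, by simp⟩ = σ.toFun ⟨0, by simp⟩) : Finsupp.single σ 1 ∈ cycles1 n X := by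
  rw [LinearMap.mem_ker, boundary1, Finsupp.linearCombination_single, one_smul, e, sub_self]

theorem degree_single {σ : SmoothPath n X} {ρ : ℝ → Eucl n} (hρ : IsPathLift π σ ρ) {k : Fin n → ℤ}
    (hk : ρ 1 - ρ 0 = (2 * Real.pi) • intVec k) (hc : Finsupp.single σ 1 ∈ cycles1 n X) :
    h.degree (homologyClass ⟨Finsupp.single σ 1, hc⟩) = k := by
  rw [degree_homologyClass]
  have e : σ.toFun ⟨1, by simp⟩ = σ.toFun ⟨0, by simp⟩ := by
    rw [← hρ.2, ← hρ.2]
    refine ((h.eq_iff _ _).2 ⟨k, ?_⟩).symm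
    rw [← hk]
    simp
  have h1 := h.winding_spec hρ
  rw [hk, e, sub_self, zero_add] at h1
  have hp : (2 * Real.pi) ≠ 0 := by positivity
  have h2 := intVec_injective (smul_right_injective _ hp h1)
  simp [windingChain, h2]

/-- The loop with a given winding vector. -/
def loop (k : Fin n → ℤ) : SmoothPath n X := h.segment 0 ((2 * Real.pi) • intVec k)

theorem loop_mem (k : Fin n → ℤ) : Finsupp.single (h.loop k) 1 ∈ cycles1 n X := by
  refine boundary1_single ?_
  show π _ = π _
  have := h.add_int 0 k
  simpa using this

theorem degree_loop (k : Fin n → ℤ) :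
    h.degree (homologyClass ⟨Finsupp.single (h.loop k) 1, h.loop_mem k⟩) = k := by
  have hl : IsPathLift π (h.loop k) (fun t => 0 + t • ((2 * Real.pi) • intVec k - 0)) :=
    ⟨by fun_prop, fun _ => rfl⟩
  refine h.degree_single hl ?_ _
  simp only [one_smul, zero_smul, sub_zero, zero_add]

/-- The isomorphism `H₁(X, ℤ) ≃ ℤⁿ`. -/
def degreeEquiv : SingH1 n X ≃ₗ[ℤ] (Fin n → ℤ) :=
  LinearEquiv.ofBijective h.degree ⟨h.degree_injective, fun k => ⟨_, h.degree_loop k⟩⟩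

/-- The basis of `H₁(X, ℤ)` formed by the coordinate loops. -/
def basis : Module.Basis (Fin n) ℤ (SingH1 n X) := Module.Basis.ofEquivFun h.degreeEquiv

theorem basis_eq_of_degree {a : SingH1 n X} {j : Fin n} (ha : h.degree a = Pi.single j 1) :
    h.basis j = a := by
  have : h.degreeEquiv a = Pi.single j 1 := ha
  rw [basis, Module.Basis.coe_ofEquivFun]
  show h.degreeEquiv.symm (Function.update 0 j 1) = a
  rw [LinearEquiv.symm_apply_eq, this]
  rfl

/-- Every class is that of a straight loop, and the image of the loop of k lifts to a path from g(0)
to g(2πk) = g(0) + 2πAk. -/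
theorem degree_homologyMap {φ : X → X} (hφ : ContMDiff (𝓡 n) (𝓡 n) ∞ φ) {g : Eucl n → Eucl n}
    (hg : ContDiff ℝ ∞ g) (e : ∀ x, π (g x) = φ (π x)) {A : Matrix (Fin n) (Fin n) ℤ}
    (hA : ∀ x k, g (x + (2 * Real.pi) • intVec k) = g x + (2 * Real.pi) • ofInt A (intVec k))
    (a : SingH1 n X) : h.degree (homologyMap φ hφ a) = A.mulVec (h.degree a) := by
  obtain ⟨k, rfl⟩ : ∃ k, a = homologyClass ⟨Finsupp.single (h.loop k) 1, h.loop_mem k⟩ :=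
    ⟨h.degree a, h.degree_injective (h.degree_loop _).symm⟩
  rw [degree_loop]
  have hl : IsPathLift π (pushSimplex φ hφ (h.loop k))
      fun t => g (0 + t • ((2 * Real.pi) • intVec k - 0)) :=
    ⟨by fun_prop, fun t => e _⟩
  have hc : Finsupp.single (pushSimplex φ hφ (h.loop k)) 1 ∈ cycles1 n X := by
    refine boundary1_single (congrArg φ ?_)
    show π _ = π _
    have := h.add_int 0 k
    simpa using this
  have e1 : homologyMap φ hφ (homologyClass ⟨Finsupp.single (h.loop k) 1, h.loop_mem k⟩)
      = homologyClass ⟨Finsupp.single (pushSimplex φ hφ (h.loop k)) 1, hc⟩ := by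
    refine congrArg homologyClass (Subtype.ext ?_)
    exact Finsupp.mapDomain_single
  rw [e1]
  refine h.degree_single hl ?_ hc
  have := hA 0 k
  rw [zero_add, ofInt_intVec] at this
  simp [this]

end IsTorusCover

end TorusHomology

/-! ### First de Rham cohomology of a torus and the period pairing. -/

section DeRham

open Set Filter

/-- Local primitives transfer smoothness and closedness between the covering space and the charts of
the torus without pulling back second derivatives by hand. -/
theorem contDiffAt_and_symmetric_of_eventuallyEq_fderiv {E : Type*} [NormedAddCommGroup E]
    [NormedSpace ℝ E] {α : E → E →L[ℝ] ℝ} {g : E → ℝ} {x : E} (hg : ContDiffAt ℝ ∞ g x)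
    (e : α =ᶠ[𝓝 x] fderiv ℝ g) :
    ContDiffAt ℝ ∞ α x ∧ ∀ u v, fderiv ℝ α x u v = fderiv ℝ α x v u := by
  refine ⟨(hg.fderiv_right (m := ∞) (by simp)).congr_of_eventuallyEq e, fun u v => ?_⟩
  rw [e.fderiv_eq]
  exact (hg.isSymmSndFDerivAt (by rw [minSmoothness_of_isRCLikeNormedField]; exact WithTop.coe_le_coe.2 le_top)) u v

theorem exists_primitive_near {E : Type*} [NormedAddCommGroup E] [NormedSpace ℝ E] {β : E → E →L[ℝ] ℝ}
    {V : Set E} (hV : IsOpen V) (hβ : ContDiffOn ℝ ∞ β V)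
    (sym : ∀ y ∈ V, ∀ u v, fderiv ℝ β y u v = fderiv ℝ β y v u) {y : E} (hy : y ∈ V) :
    ∃ b : E → ℝ, ContDiffAt ℝ ∞ b y ∧ ∀ᶠ z in 𝓝 y, fderiv ℝ b z = β z := by
  obtain ⟨r, hr, hb⟩ := Metric.isOpen_iff.1 hV y hy
  obtain ⟨b, hb'⟩ := (convex_ball y r).exists_forall_hasFDerivAt_of_fderiv_symmetric
    Metric.isOpen_ball ((hβ.mono hb).differentiableOn (by simp)) fun z hz => sym z (hb hz)
  have e : EqOn (fderiv ℝ b) β (Metric.ball y r) := fun z hz => (hb' z hz).fderiv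
  have h1 : ContDiffOn ℝ ∞ b (Metric.ball y r) :=
    (contDiffOn_infty_iff_fderiv_of_isOpen Metric.isOpen_ball).2
      ⟨fun z hz => (hb' z hz).differentiableAt.differentiableWithinAt, (hβ.mono hb).congr e⟩
  exact ⟨b, h1.contDiffAt (Metric.ball_mem_nhds y hr),
    eventually_of_mem (Metric.ball_mem_nhds y hr) e⟩

variable {n : ℕ} {X : Type*} [TopologicalSpace X] [ChartedSpace (Eucl n) X]

/-- The value of a `1`-form at a point. -/
def OneForm.at (θ : OneForm n X) (x : X) : Eucl n →L[ℝ] ℝ := θ x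

variable {π : Eucl n → X}

variable (π) in
/-- `G` is a primitive of the pullback of `θ` by the covering map. -/
def IsPrimitive (θ : OneForm n X) (G : Eucl n → ℝ) : Prop :=
  ContDiff ℝ ∞ G ∧ ∀ x, fderiv ℝ G x = (θ.at (π x)).comp (mder n π x)

theorem apply_symm_of_eqOn {Φ : PartialDiffeomorph 𝓘(ℝ, Eucl n) (𝓡 n) (Eucl n) X ∞}
    (e : ∀ z ∈ Φ.source, Φ z = π z) {w : X} (hw : w ∈ Φ.target) : π (Φ.symm w) = w :=
  (e _ (Φ.map_target hw)).symm.trans (Φ.right_inv hw)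

namespace IsTorusCover

variable (h : IsTorusCover π)

include h

theorem mdifferentiableAt (x : Eucl n) : MDifferentiableAt 𝓘(ℝ, Eucl n) (𝓡 n) π x :=
  (h.smooth x).mdifferentiableAt (by simp)

omit h in
theorem apply_sec_π (h : IsTorusCover π) {N : Type*} {G : Eucl n → N}
    (per : ∀ x k, G (x + (2 * Real.pi) • intVec k) = G x) (z : Eucl n) : G (h.sec (π z)) = G z := by
  obtain ⟨k, hk⟩ := (h.eq_iff _ _).1 (h.π_sec (π z)).symm
  rw [hk, per]

omit h in
/-- Periodic smooth maps descend to smooth maps. -/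
theorem contMDiff_comp_sec (h : IsTorusCover π) {E H N : Type*} [NormedAddCommGroup E]
    [NormedSpace ℝ E] [TopologicalSpace H] {I : ModelWithCorners ℝ E H} [TopologicalSpace N]
    [ChartedSpace H N] {G : Eucl n → N} (hG : ContMDiff 𝓘(ℝ, Eucl n) I ∞ G)
    (per : ∀ x k, G (x + (2 * Real.pi) • intVec k) = G x) :
    ContMDiff (𝓡 n) I ∞ fun x => G (h.sec x) := by
  intro x
  obtain ⟨z, rfl⟩ := h.surj x
  obtain ⟨Φ, hz, e⟩ := h.diffeo z
  have ht : π z ∈ Φ.target := by rw [← e z hz]; exact Φ.map_source hz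
  refine (hG.contMDiffAt.comp (π z)
    (Φ.contMDiffOn_invFun.contMDiffAt (Φ.open_target.mem_nhds ht))).congr_of_eventuallyEq ?_
  filter_upwards [Φ.open_target.mem_nhds ht] with w hw
  show G (h.sec w) = G (Φ.symm w)
  rw [← h.apply_sec_π per (Φ.symm w), apply_symm_of_eqOn e hw]

theorem mder_bijective (x : Eucl n) : Function.Bijective (mder n π x) := by
  obtain ⟨Φ, hx, e⟩ := h.diffeo x
  have := PartialDiffeomorph.mder_bijective Φ hx
  rwa [mder_congr (Filter.eventually_of_mem (Φ.open_source.mem_nhds hx) e)] at this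

theorem mder_add_int (x : Eucl n) (k : Fin n → ℤ) :
    mder n π (x + (2 * Real.pi) • intVec k) = mder n π x := by
  have h1 : (π ∘ fun x => x + (2 * Real.pi) • intVec k) = π := funext fun x => h.add_int x k
  have h2 := mder_comp (g := π) (k := fun x => x + (2 * Real.pi) • intVec k) (x := x)
    (h.mdifferentiableAt _) (by fun_prop)
  rw [h1, fderiv_add_const, fderiv_fun_id] at h2
  exact h2.symm

/-- A local primitive of θ in a chart, composed with π, is a local primitive of the pullback. So the
pullback is closed, and ℝⁿ is convex. -/
theorem exists_isPrimitive [IsManifold (𝓡 n) ∞ X] {θ : OneForm n X}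
    (hθ : θ ∈ closedForms n X) : ∃ G, IsPrimitive π θ G := by
  set α : Eucl n → Eucl n →L[ℝ] ℝ := fun x => (θ.at (π x)).comp (mder n π x) with hα
  have key : ∀ x, ContDiffAt ℝ ∞ α x ∧ ∀ u v, fderiv ℝ α x u v = fderiv ℝ α x v u := by
    intro x
    set x₀ := π x
    set c := extChartAt (𝓡 n) x₀
    have hx : π x ∈ c.source := mem_extChartAt_source _
    obtain ⟨b, hb, hb'⟩ := exists_primitive_near (isOpen_extChartAt_target (I := 𝓡 n) x₀) (hθ x₀).1
      (hθ x₀).2 (c.map_source hx)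
    have hu : ContMDiffAt 𝓘(ℝ, Eucl n) 𝓘(ℝ, Eucl n) ∞ (c ∘ π) x :=
      (contMDiffAt_extChartAt (I := 𝓡 n) (x := x₀)).comp x (h.smooth x)
    have hu' : ContDiffAt ℝ ∞ (c ∘ π) x := contMDiffAt_iff_contDiffAt.1 hu
    refine contDiffAt_and_symmetric_of_eventuallyEq_fderiv (g := b ∘ c ∘ π) (hb.comp x hu') ?_
    have hs : ∀ᶠ z in 𝓝 x, π z ∈ c.source :=
      h.smooth.continuous.continuousAt.preimage_mem_nhds ((isOpen_extChartAt_source x₀).mem_nhds hx)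
    have hd : ∀ᶠ z in 𝓝 x, DifferentiableAt ℝ (c ∘ π) z :=
      ((hu'.of_le (m := 1) (by simp)).eventually (by simp)).mono fun z hz =>
        hz.differentiableAt (by simp)
    have hbd : ∀ᶠ z in 𝓝 (c (π x)), DifferentiableAt ℝ b z :=
      ((hb.of_le (m := 1) (by simp)).eventually (by simp)).mono fun z hz =>
        hz.differentiableAt (by simp)
    filter_upwards [hs.eventually_nhds, hd, hu'.continuousAt.eventually hbd,
      hu'.continuousAt.eventually hb'] with z hz hdz hbz hbz'
    have hz0 : π z ∈ c.source := hz.self_of_nhds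
    rw [fderiv_comp z hbz hdz, hbz']
    have hcs : MDifferentiableAt 𝓘(ℝ, Eucl n) (𝓡 n) c.symm ((c ∘ π) z) :=
      ((contMDiffOn_extChartAt_symm x₀).contMDiffAt
        ((isOpen_extChartAt_target (I := 𝓡 n) x₀).mem_nhds (c.map_source hz0))).mdifferentiableAt
        (n := ∞) (by simp)
    have h1 := mder_comp (g := c.symm) (k := c ∘ π) hcs hdz
    have h3 : mder n (c.symm ∘ c ∘ π) z = mder n π z :=
      mder_congr (hz.mono fun w hw => c.left_inv hw)
    rw [h3] at h1
    have h2 : c.symm ((c ∘ π) z) = π z := c.left_inv hz0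
    show (θ.at (π z)).comp (mder n π z) = _
    rw [h1, ← h2]
    rfl
  obtain ⟨G, hG⟩ := (convex_univ (𝕜 := ℝ) (E := Eucl n)).exists_forall_hasFDerivAt_of_fderiv_symmetric
    isOpen_univ (fun x _ => ((key x).1.differentiableAt (by simp)).differentiableWithinAt)
    fun x _ => (key x).2
  have e : fderiv ℝ G = α := funext fun x => (hG x (mem_univ x)).fderiv
  refine ⟨G, contDiff_infty_iff_fderiv.2
    ⟨fun x => (hG x (mem_univ x)).differentiableAt, ?_⟩, fun x => congrFun e x⟩
  rw [e, contDiff_iff_contDiffAt]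
  exact fun x => (key x).1

/-- Composing G with local inverses of π gives local primitives of θ in every chart. -/
theorem mem_closedForms [IsManifold (𝓡 n) ∞ X] {θ : OneForm n X} {G : Eucl n → ℝ}
    (hG : IsPrimitive π θ G) : θ ∈ closedForms n X := by
  have key : ∀ x₀, ∀ y ∈ (extChartAt (𝓡 n) x₀).target, ContDiffAt ℝ ∞ (oneFormInChart θ x₀) y ∧
      ∀ u v, fderiv ℝ (oneFormInChart θ x₀) y u v = fderiv ℝ (oneFormInChart θ x₀) y v u := by
    intro x₀ y hy
    set c := extChartAt (𝓡 n) x₀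
    obtain ⟨z, hz⟩ := h.surj (c.symm y)
    obtain ⟨Φ, hzΦ, e⟩ := h.diffeo z
    have hc : ContMDiffAt 𝓘(ℝ, Eucl n) (𝓡 n) ∞ c.symm y := (contMDiffOn_extChartAt_symm x₀).contMDiffAt
      ((isOpen_extChartAt_target (I := 𝓡 n) x₀).mem_nhds hy)
    have ht : c.symm y ∈ Φ.target := by rw [← hz, ← e z hzΦ]; exact Φ.map_source hzΦ
    have hk : ContDiffAt ℝ ∞ (Φ.symm ∘ c.symm) y := contMDiffAt_iff_contDiffAt.1 <|
      (Φ.contMDiffOn_invFun.contMDiffAt (Φ.open_target.mem_nhds ht)).comp y hc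
    refine contDiffAt_and_symmetric_of_eventuallyEq_fderiv (g := G ∘ Φ.symm ∘ c.symm)
      (hG.1.contDiffAt.comp y hk) ?_
    have hd : ∀ᶠ w in 𝓝 y, DifferentiableAt ℝ (Φ.symm ∘ c.symm) w :=
      ((hk.of_le (m := 1) (by simp)).eventually (by simp)).mono fun z hz =>
        hz.differentiableAt (by simp)
    have hm : ∀ᶠ w in 𝓝 y, π ((Φ.symm ∘ c.symm) w) = c.symm w := by
      filter_upwards [hc.continuousAt.preimage_mem_nhds (Φ.open_target.mem_nhds ht)] with w hw
      exact apply_symm_of_eqOn e hw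
    filter_upwards [hm.eventually_nhds, hd] with w hw hdw
    have h1 : mder n (π ∘ Φ.symm ∘ c.symm) w = mder n c.symm w := mder_congr hw
    rw [fderiv_comp w ((hG.1.differentiable (by simp)) _) hdw, hG.2, ContinuousLinearMap.comp_assoc,
      ← mder_comp (h.mdifferentiableAt _) hdw, h1, hw.self_of_nhds]
    rfl
  exact fun x₀ => ⟨fun y hy => (key x₀ y hy).1.contDiffWithinAt, fun y hy => (key x₀ y hy).2⟩

omit h in
theorem isPrimitive_add {θ θ' : OneForm n X} {G G' : Eucl n → ℝ} (hG : IsPrimitive π θ G)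
    (hG' : IsPrimitive π θ' G') : IsPrimitive π (θ + θ') (G + G') := by
  refine ⟨hG.1.add hG'.1, fun x => ?_⟩
  rw [fderiv_add (hG.1.differentiable (by simp) x) (hG'.1.differentiable (by simp) x), hG.2, hG'.2]
  rfl

omit h in
theorem isPrimitive_smul {θ : OneForm n X} {G : Eucl n → ℝ} (hG : IsPrimitive π θ G) (r : ℝ) :
    IsPrimitive π (r • θ) (r • G) := by
  refine ⟨hG.1.const_smul r, fun x => ?_⟩
  rw [fderiv_const_smul (hG.1.differentiable (by simp) x), hG.2]
  rfl

/-- The pulled-back form is invariant under the lattice, so the increment has derivative zero: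
periods do not depend on the base point. -/
theorem primitive_add_int {θ : OneForm n X} {G : Eucl n → ℝ} (hG : IsPrimitive π θ G)
    (x y : Eucl n) (k : Fin n → ℤ) :
    G (x + (2 * Real.pi) • intVec k) - G x = G (y + (2 * Real.pi) • intVec k) - G y := by
  have hd := hG.1.differentiable (by simp)
  refine is_const_of_fderiv_eq_zero (𝕜 := ℝ)
    (f := fun x => G (x + (2 * Real.pi) • intVec k) - G x) ?_ (fun x => ?_) x y
  · exact (hd.comp (differentiable_id.add_const _)).sub hd
  · have h1 : DifferentiableAt ℝ (fun x => G (x + (2 * Real.pi) • intVec k)) x :=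
      (hd.comp (differentiable_id.add_const _)) x
    rw [fderiv_fun_sub h1 (hd x), fderiv_comp_add_right, hG.2, hG.2, h.mder_add_int, h.add_int, sub_self]

omit h in
theorem primitive_unique {θ : OneForm n X} {G G' : Eucl n → ℝ} (hG : IsPrimitive π θ G)
    (hG' : IsPrimitive π θ G') (x y : Eucl n) : G x - G y = G' x - G' y := by
  have hd := hG.1.differentiable (by simp)
  have hd' := hG'.1.differentiable (by simp)
  have := is_const_of_fderiv_eq_zero (𝕜 := ℝ) (f := fun x => G x - G' x) (hd.sub hd')
    (fun x => by rw [fderiv_fun_sub (hd x) (hd' x), hG.2, hG'.2, sub_self]) x y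
  linarith

variable [IsManifold (𝓡 n) ∞ X]

omit h in
theorem exists_primitive (h : IsTorusCover π) (θ : closedForms n X) : ∃ G, IsPrimitive π θ.1 G :=
  h.exists_isPrimitive θ.2

omit h

/-- The periods of a closed `1`-form, as a function on the lattice. -/
def period (h : IsTorusCover π) (θ : closedForms n X) : (Fin n → ℤ) →ₗ[ℤ] ℝ :=
  (AddMonoidHom.mk' (fun k => (h.exists_primitive θ).choose (0 + (2 * Real.pi) • intVec k)
      - (h.exists_primitive θ).choose 0) fun k l => by
    have h1 := h.primitive_add_int (h.exists_primitive θ).choose_spec 0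
      (0 + (2 * Real.pi) • intVec k) l
    have h2 : (0 : Eucl n) + (2 * Real.pi) • intVec (k + l)
      = 0 + (2 * Real.pi) • intVec k + (2 * Real.pi) • intVec l := by rw [intVec_add]; module
    rw [h2]
    linarith).toIntLinearMap

theorem period_eq {h : IsTorusCover π} {θ : closedForms n X} {G : Eucl n → ℝ}
    (hG : IsPrimitive π θ.1 G) (x : Eucl n) (k : Fin n → ℤ) :
    h.period θ k = G (x + (2 * Real.pi) • intVec k) - G x := by
  rw [h.primitive_add_int hG x 0]
  exact primitive_unique (h.exists_primitive θ).choose_spec hG _ _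

/-- The periods of closed `1`-forms. -/
def periodMap (h : IsTorusCover π) : closedForms n X →ₗ[ℝ] ((Fin n → ℤ) →ₗ[ℤ] ℝ) where
  toFun := h.period
  map_add' θ θ' := by
    obtain ⟨G, hG⟩ := h.exists_primitive θ
    obtain ⟨G', hG'⟩ := h.exists_primitive θ'
    refine LinearMap.ext fun k => ?_
    rw [LinearMap.add_apply, period_eq hG 0, period_eq hG' 0,
      period_eq (θ := θ + θ') (isPrimitive_add hG hG') 0]
    simp only [Pi.add_apply]
    ring
  map_smul' r θ := by
    obtain ⟨G, hG⟩ := h.exists_primitive θ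
    refine LinearMap.ext fun k => ?_
    rw [RingHom.id_apply, LinearMap.smul_apply, period_eq hG 0,
      period_eq (θ := r • θ) (isPrimitive_smul hG r) 0]
    simp only [Pi.smul_apply, smul_eq_mul]
    ring

theorem periodMap_apply {h : IsTorusCover π} {θ : closedForms n X} {G : Eucl n → ℝ}
    (hG : IsPrimitive π θ.1 G) (x : Eucl n) (k : Fin n → ℤ) :
    h.periodMap θ k = G (x + (2 * Real.pi) • intVec k) - G x := period_eq (h := h) hG x k

omit [IsManifold (𝓡 n) ∞ X] in
theorem isPrimitive_of_exact (h : IsTorusCover π) {θ : OneForm n X} {g : X → ℝ}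
    (hg : ContMDiff (𝓡 n) 𝓘(ℝ, ℝ) ∞ g) (e : ∀ x, θ x = mfderiv (𝓡 n) 𝓘(ℝ, ℝ) g x) :
    IsPrimitive π θ (g ∘ π) := by
  refine ⟨(hg.comp h.smooth).contDiff, fun x => ?_⟩
  have := mfderiv_comp x (hg.mdifferentiableAt (by simp)) (h.mdifferentiableAt x)
  rw [mfderiv_eq_fderiv] at this
  refine this.trans ?_
  rw [← e]
  rfl

/-- The period pairing. -/
def periodPairing (h : IsTorusCover π) : DeRhamH1 n X →ₗ[ℝ] (SingH1 n X →ₗ[ℤ] ℝ) :=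
  Submodule.liftQ _
    { toFun := fun θ => (h.periodMap θ).comp h.degree
      map_add' := fun θ θ' => by rw [map_add, LinearMap.add_comp]
      map_smul' := fun r θ => by rw [map_smul]; rfl } <| by
    rintro θ ⟨g, hg, e⟩
    refine LinearMap.ext fun a => ?_
    show h.periodMap θ (h.degree a) = 0
    rw [periodMap_apply (h.isPrimitive_of_exact hg e) 0]
    rw [Function.comp_apply, Function.comp_apply, h.add_int, sub_self]

theorem periodPairing_apply (h : IsTorusCover π) (θ : closedForms n X) (a : SingH1 n X) :
    h.periodPairing (deRhamClass θ) a = h.periodMap θ (h.degree a) := rfl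

omit [IsManifold (𝓡 n) ∞ X] in
-- The fundamental theorem of calculus along a lift. `pathIntegral` uses a chosen smooth extension
-- of the path; on [0, 1] its lift differs from ρ by a lattice vector, which changes both values of
-- G by the same amount.
theorem pathIntegral_eq (h : IsTorusCover π) {θ : OneForm n X} {G : Eucl n → ℝ}
    (hG : IsPrimitive π θ G) {σ : SmoothPath n X} {ρ : ℝ → Eucl n} (hρ : IsPathLift π σ ρ) :
    pathIntegral θ σ = G (ρ 1) - G (ρ 0) := by
  obtain ⟨hg, e⟩ := σ.smooth.choose_spec
  obtain ⟨e₀, he₀⟩ := h.surj (σ.smooth.choose 0)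
  obtain ⟨ρ', hρ', hπ, -⟩ := h.exists_lift hg 0 he₀
  have hl : IsPathLift π σ ρ' := ⟨hρ', fun t => (hπ t).trans (e t)⟩
  obtain ⟨k, hk⟩ := h.pathLift_unique hl hρ
  rw [hk 0 (by simp), hk 1 (by simp)]
  have h1 := h.primitive_add_int hG (ρ' 0) (ρ' 1) k
  have hf : σ.smooth.choose = π ∘ ρ' := funext fun t => (hπ t).symm
  have h2 : ∀ t, θ (σ.smooth.choose t) (mfderiv 𝓘(ℝ, ℝ) (𝓡 n) σ.smooth.choose t (1 : ℝ))
      = deriv (G ∘ ρ') t := by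
    intro t
    rw [hf, ← fderiv_apply_one_eq_deriv, fderiv_comp t (hG.1.differentiable (by simp) _)
      (hρ'.differentiable (by simp) t), hG.2, ContinuousLinearMap.comp_assoc,
      ← mder_comp (h.mdifferentiableAt _) (hρ'.differentiable (by simp) t)]
    rfl
  have hGρ : ContDiff ℝ ∞ (G ∘ ρ') := hG.1.comp hρ'
  have h3 : pathIntegral θ σ = G (ρ' 1) - G (ρ' 0) := by
    rw [pathIntegral]
    simp only [h2]
    exact intervalIntegral.integral_deriv_eq_sub (fun t _ => hGρ.differentiable (by simp) t)
      ((hGρ.continuous_deriv (by simp)).intervalIntegrable _ _)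
  linarith

/-- The counterpart of `mkQ_eq` for integrals: on cycles only the period of the winding vector
survives. -/
theorem chainIntegral_eq (h : IsTorusCover π) {θ : closedForms n X} {G : Eucl n → ℝ}
    (hG : IsPrimitive π θ.1 G) (c : SmoothPath n X →₀ ℤ) :
    chainIntegral θ.1 c = Finsupp.linearCombination ℤ (fun x => G (h.sec x)) (boundary1 n X c)
      + h.periodMap θ (h.windingChain c) := by
  have h0 : chainIntegral θ.1 c = Finsupp.linearCombination ℤ (pathIntegral θ.1) c := by
    rw [chainIntegral, Finsupp.linearCombination_apply]
    simp only [zsmul_eq_mul]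
  rw [h0]
  have : Finsupp.linearCombination ℤ (pathIntegral θ.1)
      = (Finsupp.linearCombination ℤ fun x => G (h.sec x)).comp (boundary1 n X)
        + (h.periodMap θ).comp h.windingChain := by
    ext1 σ
    ext1
    obtain ⟨ρ, hρ⟩ := h.exists_pathLift σ
    obtain ⟨k0, hk0⟩ := (h.eq_iff _ _).1 ((h.π_sec _).trans (hρ.2 ⟨0, by simp⟩).symm)
    have h1 := h.winding_spec hρ
    simp only at hk0
    rw [hk0] at h1
    have hk1 : ρ 1 = h.sec (σ.toFun ⟨1, by simp⟩) + (2 * Real.pi) • intVec (k0 + h.winding σ) := by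
      rw [intVec_add, ← sub_eq_zero, ← sub_eq_zero.2 h1]
      module
    have h4 : h.windingChain (Finsupp.single σ 1) = h.winding σ := by simp [windingChain]
    have h5 : boundary1 n X (Finsupp.single σ 1) = Finsupp.single (σ.toFun ⟨1, by simp⟩) 1
        - Finsupp.single (σ.toFun ⟨0, by simp⟩) 1 := by
      rw [boundary1, Finsupp.linearCombination_single, one_smul]
    simp only [LinearMap.comp_apply, LinearMap.add_apply, Finsupp.lsingle_apply, h4, h5, map_sub,
      Finsupp.linearCombination_single, one_smul]
    rw [h.pathIntegral_eq hG hρ, hk0, hk1]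
    have h6 := periodMap_apply (h := h) hG (h.sec (σ.toFun ⟨1, by simp⟩)) (k0 + h.winding σ)
    have h7 := periodMap_apply (h := h) hG (h.sec (σ.toFun ⟨0, by simp⟩)) k0
    rw [map_add] at h6
    linarith
  exact LinearMap.congr_fun this c

theorem isPeriodPairing (h : IsTorusCover π) : IsPeriodPairing h.periodPairing := by
  intro θ c
  obtain ⟨G, hG⟩ := h.exists_primitive θ
  have hc : boundary1 n X c.1 = 0 := c.2
  rw [periodPairing_apply, h.chainIntegral_eq hG, hc, map_zero, zero_add]
  rfl

/-- If all periods vanish, the primitive on ℝⁿ is invariant under the lattice and descends to a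
smooth primitive on `X`. -/
theorem periodPairing_injective (h : IsTorusCover π) : Function.Injective h.periodPairing := by
  rw [← LinearMap.ker_eq_bot, LinearMap.ker_eq_bot']
  intro a
  obtain ⟨θ, rfl⟩ := Submodule.Quotient.mk_surjective _ a
  intro h0
  obtain ⟨G, hG⟩ := h.exists_primitive θ
  have hper : ∀ x k, G (x + (2 * Real.pi) • intVec k) = G x := by
    intro x k
    have h1 := LinearMap.congr_fun h0 (homologyClass ⟨Finsupp.single (h.loop k) 1, h.loop_mem k⟩)
    have h2 : h.periodMap θ (h.degree (homologyClass ⟨Finsupp.single (h.loop k) 1, h.loop_mem k⟩))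
      = 0 := h1
    rw [degree_loop, periodMap_apply hG x] at h2
    linarith
  have hg0 := h.apply_sec_π hper
  have hs : ContMDiff (𝓡 n) 𝓘(ℝ, ℝ) ∞ fun x => G (h.sec x) := h.contMDiff_comp_sec hG.1.contMDiff hper
  refine (Submodule.Quotient.mk_eq_zero _).2 ⟨_, hs, fun x => ?_⟩
  obtain ⟨z, rfl⟩ := h.surj x
  have h1 := mfderiv_comp z (hs.mdifferentiableAt (by simp)) (h.mdifferentiableAt z)
  have h2 : ((fun x => G (h.sec x)) ∘ π) = G := funext hg0
  rw [h2, mfderiv_eq_fderiv] at h1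
  have h3 := (hG.2 z).symm.trans h1
  refine ContinuousLinearMap.ext fun v => ?_
  obtain ⟨u, rfl⟩ := (h.mder_bijective z).2 v
  exact DFunLike.congr_fun h3 u

/-- A linear function on ℝⁿ has translation-invariant differential, which descends to `X`; its
values on 2πℤⁿ are the periods and can be prescribed on a basis. -/
theorem periodPairing_surjective (h : IsTorusCover π) : Function.Surjective h.periodPairing := by
  intro l
  let Λ : Eucl n →L[ℝ] ℝ := LinearMap.toContinuousLinearMap
    (∑ j, (l (h.basis j) / (2 * Real.pi)) • (EuclideanSpace.proj j : Eucl n →L[ℝ] ℝ).toLinearMap)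
  have hΛ : ∀ v, Λ v = ∑ j, (l (h.basis j) / (2 * Real.pi)) * v j := fun v => by simp [Λ]
  let D : ∀ x : X, Eucl n ≃L[ℝ] Eucl n := fun x =>
    (LinearEquiv.ofBijective (mder n π (h.sec x)).toLinearMap
      (h.mder_bijective (h.sec x))).toContinuousLinearEquiv
  -- The discontinuity of `sec` does no harm: the differential of π is the same at all points over
  -- x.
  let θ : OneForm n X := fun x => (Λ.comp (D x).symm.toContinuousLinearMap : Eucl n →L[ℝ] ℝ)
  have hθ : IsPrimitive π θ Λ := by
    refine ⟨Λ.contDiff, fun z => ?_⟩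
    rw [Λ.fderiv]
    ext v
    obtain ⟨k, hk⟩ := (h.eq_iff _ _).1 (h.π_sec (π z))
    have h1 : mder n π z = mder n π (h.sec (π z)) := by
      conv_lhs => rw [hk]
      rw [h.mder_add_int]
    show Λ v = Λ ((D (π z)).symm (mder n π z v))
    rw [h1]
    exact congrArg Λ ((D (π z)).symm_apply_apply v).symm
  refine ⟨deRhamClass ⟨θ, h.mem_closedForms hθ⟩, h.basis.ext fun j => ?_⟩
  have h3 : h.degree (h.basis j) = Pi.single j 1 := by
    ext i
    have h2 : h.basis.repr (h.basis j) i = h.degree (h.basis j) i := rfl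
    rw [← h2]
    simp [Finsupp.single_apply, Pi.single_apply, eq_comm]
  rw [periodPairing_apply, h3, periodMap_apply (θ := ⟨θ, h.mem_closedForms hθ⟩) hθ 0, zero_add,
    map_zero, sub_zero, hΛ, Finset.sum_eq_single j]
  · simp [intVec_apply]
  · intro i _ hij
    simp [intVec_apply, hij]
  · simp

theorem periodPairing_bijective (h : IsTorusCover π) : Function.Bijective h.periodPairing :=
  ⟨h.periodPairing_injective, h.periodPairing_surjective⟩

/-- Pullback by the inverse of a diffeomorphism is dual to push-forward. -/
theorem pullbackForm_symm (h : IsTorusCover π) (φ : Diffeomorph (𝓡 n) (𝓡 n) X X ∞)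
    (θ : closedForms n X) : ∃ θ' : closedForms n X, θ'.1 = pullbackForm φ.symm θ.1 ∧
      ∀ a, h.periodPairing (deRhamClass θ') (homologyMap φ φ.contMDiff a)
        = h.periodPairing (deRhamClass θ) a := by
  obtain ⟨G, hG⟩ := h.exists_primitive θ
  obtain ⟨e₀, he₀⟩ := h.surj (φ (π 0))
  obtain ⟨g, hg, hgπ, -⟩ := h.exists_lift (φ.contMDiff.comp h.smooth) 0 he₀
  obtain ⟨e₁, he₁⟩ := h.surj (φ.symm (π 0))
  obtain ⟨k, hk, hkπ, -⟩ := h.exists_lift (φ.symm.contMDiff.comp h.smooth) 0 he₁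
  obtain ⟨A, hA⟩ := h.exists_matrix hg.continuous hgπ
  obtain ⟨A', hA'⟩ := h.exists_matrix hk.continuous hkπ
  have hp : IsPrimitive π (pullbackForm φ.symm θ.1) (G ∘ k) := by
    refine ⟨hG.1.comp hk, fun x => ?_⟩
    have hkd := hk.differentiable (by simp) x
    have h1 : π ∘ k = φ.symm ∘ π := funext hkπ
    have h2 : mder n (π ∘ k) x = (mfderiv (𝓡 n) (𝓡 n) φ.symm (π x)).comp (mder n π x) := by
      rw [h1]
      exact mfderiv_comp x (φ.symm.contMDiff.mdifferentiableAt (by simp)) (h.mdifferentiableAt x)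
    rw [fderiv_comp x (hG.1.differentiable (by simp) _) hkd, hG.2, ContinuousLinearMap.comp_assoc,
      ← mder_comp (h.mdifferentiableAt _) hkd, h2, hkπ]
    rfl
  refine ⟨⟨_, h.mem_closedForms hp⟩, rfl, fun a => ?_⟩
  rw [periodPairing_apply, periodPairing_apply, h.degree_homologyMap φ.contMDiff hg hgπ hA,
    periodMap_apply (θ := ⟨_, h.mem_closedForms hp⟩) hp (g 0), periodMap_apply hG (k (g 0))]
  -- k ∘ g lifts the identity, so it is a lattice translation; both sides become the same increment
  -- of G.
  obtain ⟨l, hl⟩ := h.lift_unique continuous_id (hk.continuous.comp hg.continuous) fun x => by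
    show π x = π (k (g x))
    rw [hkπ, Function.comp_apply, hgπ, Function.comp_apply, φ.symm_apply_apply]
  simp only [Function.comp_apply, id] at hl ⊢
  rw [← ofInt_intVec, ← hA, hl, hl]
  congr 2
  module

end IsTorusCover

end DeRham

/-! ### Perfect pairings, dual bases and contragredients. -/

section Duality

variable {n : ℕ} {H V : Type*} [AddCommGroup H] [Module ℤ H] [AddCommGroup V] [Module ℝ V]
  {P : V →ₗ[ℝ] (H →ₗ[ℤ] ℝ)}

/-- The contragredient of an automorphism with respect to a perfect pairing. -/
theorem exists_contragredient (hP : Function.Bijective P) (μ : H ≃ₗ[ℤ] H) :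
    ∃ ν : V ≃ₗ[ℝ] V, ∀ a z, P (ν a) (μ z) = P a z := by
  let Pe := LinearEquiv.ofBijective P hP
  refine ⟨Pe.trans ((LinearEquiv.congrLeft ℝ ℝ μ).trans Pe.symm), fun a z => ?_⟩
  have h : P (Pe.symm ((LinearEquiv.congrLeft ℝ ℝ μ) (Pe a))) = (LinearEquiv.congrLeft ℝ ℝ μ) (Pe a) :=
    Pe.apply_symm_apply _
  show P (Pe.symm ((LinearEquiv.congrLeft ℝ ℝ μ) (Pe a))) (μ z) = P a z
  rw [h]
  show P a (μ.symm (μ z)) = P a z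
  rw [μ.symm_apply_apply]

theorem exists_dualBasis (hP : Function.Bijective P) (e : Module.Basis (Fin n) ℤ H) :
    ∃ ε : Module.Basis (Fin n) ℝ V, ∀ i j, P (ε i) (e j) = if i = j then 1 else 0 := by
  let Pe := LinearEquiv.ofBijective P hP
  refine ⟨Module.Basis.ofEquivFun (Pe.trans (e.constr ℝ).symm), fun i j => ?_⟩
  rw [Module.Basis.coe_ofEquivFun]
  have h : P (Pe.symm (e.constr ℝ (Pi.single i 1))) = e.constr ℝ (Pi.single i 1) :=
    Pe.apply_symm_apply _
  refine (LinearMap.congr_fun h (e j)).trans ?_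
  rw [e.constr_basis, Pi.single_apply]
  simp only [eq_comm]

theorem repr_dualBasis {e : Module.Basis (Fin n) ℤ H} {ε : Module.Basis (Fin n) ℝ V}
    (h : ∀ i j, P (ε i) (e j) = if i = j then 1 else 0) (a : V) (i : Fin n) :
    ε.repr a i = P a (e i) := by
  conv_rhs => rw [← ε.sum_repr a, map_sum, LinearMap.sum_apply]
  simp [h]

/-- Coordinates in the dual basis are values of the pairing. So the (i, j) entry is P(ν ε_j)(e_i) =
P(ε_j)(μ⁻¹ e_i), the (j, i) entry of the matrix of μ⁻¹. -/
theorem toMatrix_contragredient {e : Module.Basis (Fin n) ℤ H} {ε : Module.Basis (Fin n) ℝ V}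
    (h : ∀ i j, P (ε i) (e j) = if i = j then 1 else 0) {μ : H ≃ₗ[ℤ] H} {ν : V ≃ₗ[ℝ] V}
    (hν : ∀ a z, P (ν a) (μ z) = P a z) :
    LinearMap.toMatrix ε ε ν.toLinearMap
      = ((LinearMap.toMatrix e e μ.toLinearMap)⁻¹).transpose.map fun k : ℤ => (k : ℝ) := by
  have h1 : (LinearMap.toMatrix e e μ.toLinearMap)⁻¹ = LinearMap.toMatrix e e μ.symm.toLinearMap := by
    refine Matrix.inv_eq_left_inv ?_
    rw [← LinearMap.toMatrix_comp, LinearEquiv.symm_comp, LinearMap.toMatrix_id]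
  ext i j
  rw [h1, LinearMap.toMatrix_apply, repr_dualBasis h, Matrix.map_apply, Matrix.transpose_apply,
    LinearMap.toMatrix_apply]
  have h2 := hν (ε j) (μ.symm (e i))
  rw [μ.apply_symm_apply] at h2
  refine h2.trans ?_
  conv_lhs => rw [← e.sum_repr (μ.symm (e i)), map_sum]
  simp [h]

end Duality

/-! ### The monodromy determined by a deck matrix. -/

section TorusMonodromy

variable {n : ℕ} {X : Type*} [TopologicalSpace X] [ChartedSpace (Eucl n) X] {π : Eucl n → X}

theorem IsTorusCover.toMatrix_of_degree (h : IsTorusCover π) {F : SingH1 n X →ₗ[ℤ] SingH1 n X}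
    {A : Matrix (Fin n) (Fin n) ℤ} (hF : ∀ a, h.degree (F a) = A.mulVec (h.degree a)) :
    LinearMap.toMatrix h.basis h.basis F = A := by
  ext i j
  rw [LinearMap.toMatrix_apply]
  have h2 : ∀ a i, h.basis.repr a i = h.degree a i := fun a i => rfl
  have h3 : h.degree (h.basis j) = Pi.single j 1 := by
    ext i
    rw [← h2]
    simp [Finsupp.single_apply, Pi.single_apply, eq_comm]
  rw [h2, hF, h3, Matrix.mulVec_single_one]
  rfl

theorem IsTorusCover.exists_homologyEquiv (h : IsTorusCover π) {Z : Matrix (Fin n) (Fin n) ℤ}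
    (hZ : IsUnit Z.det) :
    ∃ μ : SingH1 n X ≃ₗ[ℤ] SingH1 n X, ∀ a, h.degree (μ a) = Z.mulVec (h.degree a) := by
  refine ⟨h.degreeEquiv.trans ((Matrix.toLin'OfInv (Matrix.nonsing_inv_mul Z hZ)
    (Matrix.mul_nonsing_inv Z hZ)).trans h.degreeEquiv.symm), fun a => ?_⟩
  exact h.degreeEquiv.apply_symm_apply _

variable (π) in
/-- `φ` lifts to a map of the covering space which acts on the deck group by the matrix `Z`. -/
def HasDeckMatrix (φ : X → X) (Z : Matrix (Fin n) (Fin n) ℤ) : Prop :=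
  ∃ g : Eucl n → Eucl n, ContDiff ℝ ∞ g ∧ (∀ x, π (g x) = φ (π x)) ∧
    ∀ x k, g (x + (2 * Real.pi) • intVec k) = g x + (2 * Real.pi) • ofInt Z (intVec k)

/-- The classical and the quantum monodromy of a family of diffeomorphisms acting by the same
matrix on the deck group. -/
theorem IsTorusCover.exists_monodromy [IsManifold (𝓡 n) ∞ X] (h : IsTorusCover π)
    {Z : Matrix (Fin n) (Fin n) ℤ} (hZ : IsUnit Z.det)
    {D : Diffeomorph (𝓡 n) (𝓡 n) X X ∞ → Prop} (hD : ∀ φ, D φ → HasDeckMatrix π φ Z) :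
    ∃ (μ : SingH1 n X ≃ₗ[ℤ] SingH1 n X) (ν : DeRhamH1 n X ≃ₗ[ℝ] DeRhamH1 n X),
      (∀ φ, D φ → ∀ a, μ a = homologyMap φ φ.contMDiff a) ∧
      (∀ φ, D φ → ∀ θ : closedForms n X, ∃ θ' : closedForms n X,
        θ'.1 = pullbackForm φ.symm θ.1 ∧ ν (deRhamClass θ) = deRhamClass θ') ∧
      ∀ a z, h.periodPairing (ν a) (μ z) = h.periodPairing a z := by
  obtain ⟨μ, hμ⟩ := h.exists_homologyEquiv hZ
  -- The map on cohomology is defined algebraically; injectivity of the pairing then identifies it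
  -- with pullback by the inverse of each φ.
  obtain ⟨ν, hν⟩ := exists_contragredient h.periodPairing_bijective μ
  have key : ∀ φ, D φ → ∀ a, μ a = homologyMap φ φ.contMDiff a := by
    intro φ hφ a
    obtain ⟨g, hg, e, hA⟩ := hD φ hφ
    apply h.degree_injective
    rw [hμ, h.degree_homologyMap φ.contMDiff hg e hA]
  refine ⟨μ, ν, key, fun φ hφ θ => ?_, hν⟩
  obtain ⟨θ', hθ', e⟩ := h.pullbackForm_symm φ θ
  refine ⟨θ', hθ', h.periodPairing_injective (LinearMap.ext fun z => ?_)⟩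
  obtain ⟨z, rfl⟩ := μ.surjective z
  rw [hν, key φ hφ, e]

end TorusMonodromy

/-! ### Smooth structures given by local sections of a covering. -/

section Atlases

open Set

theorem mem_contDiffGroupoid {d : ℕ} {e : OpenPartialHomeomorph (Eucl d) (Eucl d)}
    (h : ContDiffOn ℝ ∞ e e.source) (h' : ContDiffOn ℝ ∞ e.symm e.target) :
    e ∈ contDiffGroupoid ∞ (𝓡 d) := by
  rw [contDiffGroupoid, mem_groupoid_of_pregroupoid]
  constructor
  · show ContDiffOn ℝ ∞ ((𝓡 d) ∘ e ∘ (𝓡 d).symm) ((𝓡 d).symm ⁻¹' e.source ∩ range (𝓡 d))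
    exact h.mono inter_subset_left
  · show ContDiffOn ℝ ∞ ((𝓡 d) ∘ e.symm ∘ (𝓡 d).symm) ((𝓡 d).symm ⁻¹' e.target ∩ range (𝓡 d))
    exact h'.mono inter_subset_left

theorem mem_maximalAtlas_of_contMDiffOn {d : ℕ} {X : Type*} [TopologicalSpace X]
    [ChartedSpace (Eucl d) X] [IsManifold (𝓡 d) ∞ X] {e : OpenPartialHomeomorph X (Eucl d)}
    (h : ContMDiffOn (𝓡 d) (𝓡 d) ∞ e e.source) (h' : ContMDiffOn (𝓡 d) (𝓡 d) ∞ e.symm e.target) :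
    e ∈ IsManifold.maximalAtlas (𝓡 d) ∞ X := by
  refine mem_maximalAtlas_iff.2 fun e' he' => ?_
  have hm : e' ∈ IsManifold.maximalAtlas (𝓡 d) ∞ X := IsManifold.subset_maximalAtlas he'
  have h1 := contMDiffOn_of_mem_maximalAtlas hm
  have h2 := contMDiffOn_symm_of_mem_maximalAtlas hm
  have h3 : ContDiffOn ℝ ∞ (e.symm ≫ₕ e') (e.symm ≫ₕ e').source := by
    rw [← contMDiffOn_iff_contDiffOn]
    exact h1.comp (h'.mono fun z hz => (by simpa using hz.1)) fun z hz => by simpa using hz.2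
  have h4 : ContDiffOn ℝ ∞ (e'.symm ≫ₕ e) (e'.symm ≫ₕ e).source := by
    rw [← contMDiffOn_iff_contDiffOn]
    exact h.comp (h2.mono fun z hz => (by simpa using hz.1)) fun z hz => by simpa using hz.2
  exact ⟨mem_contDiffGroupoid h3 h4, mem_contDiffGroupoid h4 h3⟩

variable {n : ℕ} {Y : Type*} [TopologicalSpace Y] {π : Eucl n → Y}

/-- The charts of the base of a covering are the local sections. -/
abbrev sectionChartedSpace (hl : IsLocalHomeomorph π) (hs : Function.Surjective π) :
    ChartedSpace (Eucl n) Y where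
  atlas := {e | ∀ z, e.symm z = π z}
  chartAt y := hl.localInverseAt (Function.surjInv hs y)
  mem_chart_source y := by
    have := hl.apply_self_mem_localInverseAt_source (x := Function.surjInv hs y)
    rwa [Function.surjInv_eq hs y] at this
  chart_mem_atlas y z := by rw [hl.localInverseAt_symm]

/-- A transition between two local sections lifts the identity, so it is locally a translation by a
lattice vector. -/
theorem isManifold_sectionChartedSpace (hl : IsLocalHomeomorph π) (hs : Function.Surjective π)
    (h : ∀ x y, π x = π y ↔ ∃ k, y = x + (2 * Real.pi) • intVec k) :
    letI := sectionChartedSpace hl hs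
    IsManifold (𝓡 n) ∞ Y := by
  let := sectionChartedSpace hl hs
  refine isManifold_of_contDiffOn _ _ _ fun e e' he he' => ?_
  show ContDiffOn ℝ ∞ (e.symm ≫ₕ e') ((e.symm ≫ₕ e').source ∩ range (𝓡 n))
  intro z hz
  have hz' := hz.1
  set τ := e.symm ≫ₕ e'
  have hτ : ∀ w ∈ τ.source, π (τ w) = π w := by
    intro w hw
    have h1 : w ∈ e.target ∧ e.symm w ∈ e'.source := by simpa [τ] using hw
    rw [← he' (τ w), ← he w]
    exact e'.left_inv h1.2
  obtain ⟨k, hk⟩ := (h _ _).1 (hτ z hz').symm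
  obtain ⟨Φ, hΦ, hΦπ⟩ := hl z
  have hc : ContinuousAt (fun w => τ w - (2 * Real.pi) • intVec k) z :=
    (τ.continuousAt hz').sub continuousAt_const
  have hz0 : τ z - (2 * Real.pi) • intVec k = z := by rw [hk]; simp
  have hn : ∀ᶠ w in 𝓝 z, τ w - (2 * Real.pi) • intVec k ∈ Φ.source := by
    refine hc.preimage_mem_nhds ?_
    rw [hz0]
    exact Φ.open_source.mem_nhds hΦ
  have : τ =ᶠ[𝓝 z] fun w => w + (2 * Real.pi) • intVec k := by
    filter_upwards [hn, Φ.open_source.mem_nhds hΦ, τ.open_source.mem_nhds hz'] with w hw hw' hws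
    have h1 : τ w - (2 * Real.pi) • intVec k = w := by
      refine Φ.injOn hw hw' ?_
      rw [← hΦπ, ← hτ w hws]
      exact (h _ _).2 ⟨k, by simp⟩
    rw [← h1]
    simp only [sub_add_cancel]
    rw [h1]
  exact (ContDiffAt.congr_of_eventuallyEq (by fun_prop) this).contDiffWithinAt

end Atlases

/-! ### Liouville tori as embedded submanifolds covered by ℝⁿ. -/

section Fibres

open Set

variable {n : ℕ} {M : Type*} [TopologicalSpace M] [ChartedSpace (Eucl (2 * n)) M]
  {Ω : SymplecticForm (2 * n) M} {f : M → Eucl n}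

namespace ActionAngleChart

variable (c : ActionAngleChart Ω f) {b : Eucl n}

/-- The fibre over `b`, parametrised by the angles. -/
def fibreMap (hb : b ∈ c.action.source) (φ : Eucl n) : Fibre f b :=
  ⟨c.param (c.action b, φ), c.f_param hb φ⟩

theorem coe_fibreMap (hb : b ∈ c.action.source) (φ : Eucl n) :
    (c.fibreMap hb φ : M) = c.param (c.action b, φ) := rfl

theorem contMDiff_param (hb : b ∈ c.action.source) :
    ContMDiff 𝓘(ℝ, Eucl n) (𝓡 (2 * n)) ∞ fun φ => c.param (c.action b, φ) := by
  have h1 : ContMDiff 𝓘(ℝ, Eucl n) 𝓘(ℝ, Eucl n × Eucl n) ∞ fun φ : Eucl n => (c.action b, φ) :=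
    ContDiff.contMDiff (by fun_prop)
  exact fun φ => (c.param_smooth.contMDiffAt ((c.action.open_target.prod isOpen_univ).mem_nhds
    ⟨c.action.map_source hb, mem_univ _⟩)).comp φ (h1 φ)

theorem continuous_fibreMap (hb : b ∈ c.action.source) : Continuous (c.fibreMap hb) :=
  (c.contMDiff_param hb).continuous.subtype_mk _

theorem fibreMap_surjective (hb : b ∈ c.action.source) : Function.Surjective (c.fibreMap hb) := by
  rintro ⟨x, rfl⟩
  obtain ⟨φ, hφ⟩ := c.surj_param (x := x) hb
  exact ⟨φ, Subtype.ext hφ⟩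

theorem fibreMap_eq_iff (hb : b ∈ c.action.source) (φ φ' : Eucl n) :
    c.fibreMap hb φ = c.fibreMap hb φ' ↔ ∃ k, φ' = φ + (2 * Real.pi) • intVec k := by
  rw [← c.param_eq_iff' (c.action.map_source hb), Subtype.ext_iff]
  rfl

theorem isCoveringMap_fibreMap [T2Space M] (hb : b ∈ c.action.source) :
    IsCoveringMap (c.fibreMap hb) :=
  isCoveringMap_of_lattice' (c.continuous_fibreMap hb) (c.fibreMap_surjective hb)
    (c.fibreMap_eq_iff hb)

theorem mder_param_injective {J : Eucl n} (hJ : J ∈ c.action.target) (φ : Eucl n) :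
    Function.Injective (mder (2 * n) c.param (J, φ)) := by
  rw [injective_iff_map_eq_zero]
  intro u hu
  refine stdForm_nondegenerate fun v => ?_
  rw [stdForm_eq_sum, ← c.darboux J hJ φ u v]
  show Ω.at _ (mder (2 * n) c.param (J, φ) u) (mder (2 * n) c.param (J, φ) v) = 0
  rw [hu, map_zero]
  rfl

theorem exists_partialDiffeomorph_param [IsManifold (𝓡 (2 * n)) ∞ M] {J : Eucl n}
    (hJ : J ∈ c.action.target) (φ : Eucl n) :
    ∃ Φ : PartialDiffeomorph 𝓘(ℝ, Eucl n × Eucl n) (𝓡 (2 * n)) (Eucl n × Eucl n) M ∞,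
      (J, φ) ∈ Φ.source ∧ ∀ z ∈ Φ.source, Φ z = c.param z := by
  obtain ⟨Φ, h1, -, h2⟩ := isLocalDiffeomorphAt_of_injective (by simp; ring)
    ((c.action.open_target.prod isOpen_univ).mem_nhds ⟨hJ, mem_univ φ⟩) c.param_smooth
    (c.mder_param_injective hJ φ)
  exact ⟨Φ, h1, h2⟩

/-- The Liouville tori are embedded submanifolds. -/
theorem exists_chartedSpace_fibre [IsManifold (𝓡 (2 * n)) ∞ M] [T2Space M]
    (hb : b ∈ c.action.source) : ∃ _ : ChartedSpace (Eucl n) (Fibre f b),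
      IsManifold (𝓡 n) ∞ (Fibre f b) ∧
      Manifold.IsSmoothEmbedding (𝓡 n) (𝓡 (2 * n)) ∞ (Subtype.val : Fibre f b → M) := by
  have hl := (c.isCoveringMap_fibreMap hb).isLocalHomeomorph
  have hs := c.fibreMap_surjective hb
  let cs := sectionChartedSpace hl hs
  have hm := isManifold_sectionChartedSpace hl hs (c.fibreMap_eq_iff hb)
  refine ⟨cs, hm, Manifold.IsImmersionOfComplement.isImmersion (F := Eucl n) fun q => ?_,
    Topology.IsEmbedding.subtypeVal⟩
  obtain ⟨x, rfl⟩ := hs q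
  have hJ := c.action.map_source hb
  obtain ⟨Φ, hx, hΦ⟩ := c.exists_partialDiffeomorph_param hJ x
  have hO : IsOpen {z | (c.action b, z) ∈ Φ.source} := Φ.open_source.preimage (by fun_prop)
  let L : (Eucl n × Eucl n) ≃L[ℝ] Eucl (2 * n) := ContinuousLinearEquiv.ofFinrankEq (by simp; ring)
  -- Swapping the factors and shifting the actions by I(b) turns the fibre into the slice z ↦ L (z,
  -- 0), the normal form of an immersion.
  let T : (Eucl n × Eucl n) ≃ₜ Eucl (2 * n) :=
    ((Homeomorph.prodComm (Eucl n) (Eucl n)).trans ((Homeomorph.refl (Eucl n)).prodCongr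
      (Homeomorph.addRight (-c.action b)))).trans L.toHomeomorph
  have hT : ∀ z, T z = L (z.2, z.1 + -c.action b) := fun z => rfl
  have hT' : ∀ z, T.symm z = ((L.symm z).2 + - -c.action b, (L.symm z).1) := fun z => rfl
  have hTs : ContMDiff 𝓘(ℝ, Eucl n × Eucl n) (𝓡 (2 * n)) ∞ T := by
    rw [contMDiff_iff_contDiff, funext hT]
    fun_prop
  have hTs' : ContMDiff (𝓡 (2 * n)) 𝓘(ℝ, Eucl n × Eucl n) ∞ T.symm := by
    rw [contMDiff_iff_contDiff, funext hT']
    fun_prop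
  let cod := Φ.symm.toOpenPartialHomeomorph ≫ₕ T.toOpenPartialHomeomorph
  let R := (hl.localInverseAt x).symm.restrOpen _ hO
  have hR : ∀ z, R z = c.fibreMap hb z := fun z => congrFun (hl.localInverseAt_symm x) z
  have hRx : x ∈ R.source := ⟨hl.self_mem_localInverseAt_target, hx⟩
  have hcod : ∀ z, (c.action b, z) ∈ Φ.source →
      c.param (c.action b, z) ∈ cod.source ∧ cod (c.param (c.action b, z)) = L (z, 0) := by
    intro z hz
    rw [← hΦ _ hz]
    have h1 : Φ.symm (Φ (c.action b, z)) = (c.action b, z) := Φ.left_inv hz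
    refine ⟨⟨Φ.map_source hz, mem_univ _⟩, ?_⟩
    show T (Φ.symm (Φ (c.action b, z))) = _
    rw [h1, hT, add_neg_cancel]
  refine Manifold.IsImmersionAtOfComplement.mk_of_continuousAt continuous_subtype_val.continuousAt
    L R.symm cod ?_ (hcod x hx).1 ?_ ?_ ?_
  · have := R.map_source hRx
    rwa [hR] at this
  · exact IsManifold.subset_maximalAtlas hR
  · refine mem_maximalAtlas_of_contMDiffOn ?_ ?_
    · exact hTs.comp_contMDiffOn (Φ.contMDiffOn_invFun.mono fun z hz => hz.1)
    · exact Φ.contMDiffOn_toFun.comp hTs'.contMDiffOn fun z hz => hz.2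
  · intro z hz
    have hz' : z ∈ R.source := by simpa using hz
    have h1 := (hcod z hz'.2).2
    rw [← c.coe_fibreMap hb, ← hR] at h1
    exact h1

/-- Any smooth structure for which the inclusion is an embedding will do: smoothness into the fibre
is tested in `M`, and the differential is injective because that of `param` is. The inverse function
theorem gives the local diffeomorphisms. -/
theorem isTorusCover_fibreMap [IsManifold (𝓡 (2 * n)) ∞ M] [T2Space M] (hb : b ∈ c.action.source)
    [ChartedSpace (Eucl n) (Fibre f b)] [IsManifold (𝓡 n) ∞ (Fibre f b)]
    (he : Manifold.IsSmoothEmbedding (𝓡 n) (𝓡 (2 * n)) ∞ (Subtype.val : Fibre f b → M)) :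
    IsTorusCover (c.fibreMap hb) := by
  have hs : ContMDiff 𝓘(ℝ, Eucl n) (𝓡 n) ∞ (c.fibreMap hb) :=
    (ContMDiff.iff_comp_isImmersion he.isImmersion).2
      ⟨c.continuous_fibreMap hb, c.contMDiff_param hb⟩
  refine ⟨c.isCoveringMap_fibreMap hb, c.fibreMap_surjective hb, c.fibreMap_eq_iff hb, fun x => ?_⟩
  have hJ := c.action.map_source hb
  have inj : Function.Injective (mder n (c.fibreMap hb) x) := by
    have h1 := mfderiv_comp x (he.contMDiff.mdifferentiableAt (by simp))
      (hs.mdifferentiableAt (by simp) (x := x))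
    have h2 := mder_comp (d := 2 * n) (g := c.param) (k := fun φ => (c.action b, φ)) (x := x)
      ((c.param_smooth.contMDiffAt ((c.action.open_target.prod isOpen_univ).mem_nhds
        ⟨hJ, mem_univ _⟩)).mdifferentiableAt (n := ∞) (by simp)) (by fun_prop)
    rw [injective_iff_map_eq_zero]
    intro v hv
    have h3 : mder (2 * n) (c.param ∘ fun φ => (c.action b, φ)) x v = 0 := by
      have h4 := DFunLike.congr_fun h1 v
      refine h4.trans ?_
      refine (congrArg (mfderiv (𝓡 n) (𝓡 (2 * n)) (Subtype.val : Fibre f b → M) _) hv).trans ?_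
      exact map_zero _
    rw [h2, ContinuousLinearMap.comp_apply] at h3
    have h4 := (injective_iff_map_eq_zero _).1 (c.mder_param_injective hJ x) _ h3
    have h5 : HasFDerivAt (fun φ : Eucl n => (c.action b, φ)) (ContinuousLinearMap.inr ℝ _ _) x :=
      (hasFDerivAt_const _ _).prodMk (hasFDerivAt_id x)
    rw [h5.fderiv] at h4
    exact congrArg Prod.snd h4
  obtain ⟨Φ, h1, -, h2⟩ := isLocalDiffeomorphAt_of_injective (by simp) Filter.univ_mem
    hs.contMDiffOn inj
  exact ⟨Φ, h1, h2⟩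

theorem isAngleBasis_basis [IsManifold (𝓡 (2 * n)) ∞ M] [T2Space M] (hb : b ∈ c.action.source)
    [ChartedSpace (Eucl n) (Fibre f b)] (h : IsTorusCover (c.fibreMap hb)) :
    IsAngleBasis c b h.basis := by
  intro j
  refine ⟨h.loop (Pi.single j 1), h.loop_mem _, fun t => ?_, ?_⟩
  · show c.param (c.action b, 0 + (t : ℝ) • ((2 * Real.pi) • intVec (Pi.single j 1) - 0)) = _
    congr 2
    ext i
    by_cases hij : i = j
    · subst hij
      simp [mul_comm]
    · simp [hij]
  · exact h.basis_eq_of_degree (h.degree_loop _)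

end ActionAngleChart

end Fibres

/-! ### Parallel frames and holonomy. -/

section Holonomy

open Set

variable {n : ℕ} {A : ConnectionForm n (Eucl n)} {γ : ℝ → Eucl n}

theorem eq_of_hasDerivWithinAt_zero {F : Type*} [NormedAddCommGroup F] [NormedSpace ℝ F] {s : ℝ → F}
    (h : ∀ t ∈ Icc (0 : ℝ) 1, HasDerivWithinAt s 0 (Icc 0 1) t) : s 1 = s 0 := by
  refine constant_of_derivWithin_zero (fun t ht => (h t ht).differentiableWithinAt) (fun t ht => ?_) 1
    (right_mem_Icc.2 zero_le_one)
  have ht' : t ∈ Icc (0 : ℝ) 1 := ⟨ht.1, ht.2.le⟩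
  exact (h t ht').derivWithin (uniqueDiffOn_Icc_zero_one t ht')

theorem inverse_apply_apply {L : Eucl n →L[ℝ] Eucl n} (h : IsUnit L) (v : Eucl n) :
    Ring.inverse L (L v) = v :=
  DFunLike.congr_fun (Ring.inverse_mul_cancel _ h) v

theorem apply_inverse_apply {L : Eucl n →L[ℝ] Eucl n} (h : IsUnit L) (v : Eucl n) :
    L (Ring.inverse L v) = v :=
  DFunLike.congr_fun (Ring.mul_inverse_cancel _ h) v

variable (A γ) in
/-- `K t` is a covariantly constant isomorphism from the fibre over `γ t` to a fixed space. -/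
structure IsParallelFrame (K : ℝ → Eucl n →L[ℝ] Eucl n) : Prop where
  isUnit : ∀ t ∈ Icc (0 : ℝ) 1, IsUnit (K t)
  deriv : ∀ t ∈ Icc (0 : ℝ) 1,
    HasDerivWithinAt K ((K t).comp (A (γ t) (derivWithin γ (Icc 0 1) t))) (Icc 0 1) t

variable {K : ℝ → Eucl n →L[ℝ] Eucl n}

theorem IsParallelFrame.deriv_inverse (h : IsParallelFrame A γ K) {t : ℝ} (ht : t ∈ Icc (0 : ℝ) 1) :
    HasDerivWithinAt (fun t => Ring.inverse (K t))
      (-(A (γ t) (derivWithin γ (Icc 0 1) t)).comp (Ring.inverse (K t))) (Icc 0 1) t := by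
  obtain ⟨u, hu⟩ := h.isUnit t ht
  have h1 := hasFDerivAt_ringInverse (𝕜 := ℝ) u
  rw [hu] at h1
  have h2 := h1.comp_hasDerivWithinAt t (h.deriv t ht)
  refine h2.congr_deriv ?_
  rw [← hu, Ring.inverse_unit]
  rw [neg_apply, ContinuousLinearMap.mulLeftRight_apply]
  congr 1
  set B := A (γ t) (derivWithin γ (Icc 0 1) t)
  show ↑u⁻¹ * ((u : Eucl n →L[ℝ] Eucl n) * B) * ↑u⁻¹ = B * ↑u⁻¹
  rw [← mul_assoc, Units.inv_mul, one_mul]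

/-- Parallel sections are those for which K s is constant, so transport is K(1)⁻¹ K(0). -/
theorem IsParallelFrame.isHolonomy (h : IsParallelFrame A γ K) :
    IsHolonomy A γ ((Ring.inverse (K 1)).comp (K 0)).toLinearMap := by
  have h0 : (0 : ℝ) ∈ Icc (0 : ℝ) 1 := left_mem_Icc.2 zero_le_one
  have h1 : (1 : ℝ) ∈ Icc (0 : ℝ) 1 := right_mem_Icc.2 zero_le_one
  refine ⟨fun v => ⟨fun t => Ring.inverse (K t) (K 0 v), fun t ht => ?_, ?_⟩, fun s hs => ?_⟩
  · refine ((h.deriv_inverse ht).clm_apply (hasDerivWithinAt_const t _ (K 0 v))).congr_deriv ?_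
    simp
  · exact inverse_apply_apply (h.isUnit 0 h0) v
  · have key : K 1 (s 1) = K 0 (s 0) := eq_of_hasDerivWithinAt_zero (s := fun t => K t (s t))
      fun t ht => by
        refine ((h.deriv t ht).clm_apply (hs t ht)).congr_deriv ?_
        simp
    show s 1 = Ring.inverse (K 1) (K 0 (s 0))
    rw [← key, inverse_apply_apply (h.isUnit 1 h1)]

/-- The transport of covectors in a covariantly constant frame. -/
def dualTransport (K : ℝ → Eucl n →L[ℝ] Eucl n) : (Eucl n →L[ℝ] ℝ) →ₗ[ℝ] (Eucl n →L[ℝ] ℝ) where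
  toFun β := β.comp ((Ring.inverse (K 0)).comp (K 1))
  map_add' _ _ := rfl
  map_smul' _ _ := rfl

/-- Dually, s ∘ K⁻¹ is constant along parallel covector fields. -/
theorem IsParallelFrame.isHolonomy_dual (h : IsParallelFrame A γ K) :
    IsHolonomy (dualConnection A) γ (dualTransport K) := by
  have h0 : (0 : ℝ) ∈ Icc (0 : ℝ) 1 := left_mem_Icc.2 zero_le_one
  have h1 : (1 : ℝ) ∈ Icc (0 : ℝ) 1 := right_mem_Icc.2 zero_le_one
  constructor
  · intro β
    refine ⟨fun t => (β.comp (Ring.inverse (K 0))).comp (K t), fun t ht => ?_, ?_⟩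
    · set β' := β.comp (Ring.inverse (K 0))
      have h2 := (hasDerivWithinAt_const t (Icc (0 : ℝ) 1) β').clm_comp (h.deriv t ht)
      refine h2.congr_deriv ?_
      ext v
      simp [dualConnection]
    · ext v
      simp only [ContinuousLinearMap.comp_apply, inverse_apply_apply (h.isUnit 0 h0)]
  · intro s hs
    have key : (s 1).comp (Ring.inverse (K 1)) = (s 0).comp (Ring.inverse (K 0)) := by
      refine eq_of_hasDerivWithinAt_zero (s := fun t => (s t).comp (Ring.inverse (K t))) fun t ht => ?_
      have h2 := (hs t ht).clm_comp (h.deriv_inverse ht)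
      refine h2.congr_deriv ?_
      ext v
      simp [dualConnection]
    ext v
    have h2 := DFunLike.congr_fun key (K 1 v)
    rw [ContinuousLinearMap.comp_apply, inverse_apply_apply (h.isUnit 1 h1)] at h2
    exact h2

theorem IsParallelFrame.dualTransport_apply (h : IsParallelFrame A γ K) (β : Eucl n →L[ℝ] ℝ)
    (v : Eucl n) : dualTransport K β (((Ring.inverse (K 1)).comp (K 0)) v) = β v := by
  have h0 : (0 : ℝ) ∈ Icc (0 : ℝ) 1 := left_mem_Icc.2 zero_le_one
  have h1 : (1 : ℝ) ∈ Icc (0 : ℝ) 1 := right_mem_Icc.2 zero_le_one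
  show β (Ring.inverse (K 0) (K 1 (Ring.inverse (K 1) (K 0 v)))) = β v
  rw [apply_inverse_apply (h.isUnit 1 h1), inverse_apply_apply (h.isUnit 0 h0)]

theorem IsHolonomy.unique {F : Type} [NormedAddCommGroup F] [NormedSpace ℝ F]
    {A : ConnectionForm n F} {T T' : F →ₗ[ℝ] F} (h : IsHolonomy A γ T) (h' : IsHolonomy A γ T') :
    T = T' := by
  ext v
  obtain ⟨s, hs, rfl⟩ := h.1 v
  rw [← h.2 s hs, h'.2 s hs]

/-- The determinant is continuous and never zero along the path, so it keeps its sign. This excludes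
determinant -1 for the monodromy. -/
theorem det_pos_of_parallelFrame (h : IsParallelFrame A γ K) : 0 < (K 1).det * (K 0).det := by
  have hc : ContinuousOn (fun t => (K t).det) (Icc (0 : ℝ) 1) := by
    refine ContinuousLinearMap.continuous_det.comp_continuousOn fun t ht => ?_
    exact (h.deriv t ht).continuousWithinAt
  have hne : ∀ t ∈ Icc (0 : ℝ) 1, (K t).det ≠ 0 := by
    intro t ht
    have h1 := congrArg (fun L : Eucl n →L[ℝ] Eucl n => LinearMap.det L.toLinearMap)
      (Ring.mul_inverse_cancel _ (h.isUnit t ht))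
    have h2 : LinearMap.det (K t).toLinearMap * LinearMap.det (Ring.inverse (K t)).toLinearMap = 1 := by
      rw [← LinearMap.det_comp]
      exact h1.trans LinearMap.det_id
    exact left_ne_zero_of_mul_eq_one h2
  have h0 : (0 : ℝ) ∈ Icc (0 : ℝ) 1 := left_mem_Icc.2 zero_le_one
  have h1 : (1 : ℝ) ∈ Icc (0 : ℝ) 1 := right_mem_Icc.2 zero_le_one
  rcases lt_or_gt_of_ne (hne 0 h0) with ha | ha <;> rcases lt_or_gt_of_ne (hne 1 h1) with hb | hb
  · exact mul_pos_of_neg_of_neg hb ha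
  · obtain ⟨t, ht, h2⟩ := isPreconnected_Icc.intermediate_value h0 h1 hc ⟨ha.le, hb.le⟩
    exact absurd h2 (hne t ht)
  · obtain ⟨t, ht, h2⟩ := isPreconnected_Icc.intermediate_value h1 h0 hc ⟨hb.le, ha.le⟩
    exact absurd h2 (hne t ht)
  · exact mul_pos hb ha

end Holonomy

/-! ### Transport of angle coordinates along a path. -/

section Transport

open Set

variable {n : ℕ} {M : Type*} [TopologicalSpace M] [ChartedSpace (Eucl (2 * n)) M]
  {Ω : SymplecticForm (2 * n) M} {f : M → Eucl n}

/-- The angle coordinates of two charts differ, on each fibre, by an affine unimodular map. -/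
theorem ActionAngleChart.exists_affine_transition [IsManifold (𝓡 (2 * n)) ∞ M] [T2Space M]
    (c c' : ActionAngleChart Ω f) {y : Eucl n} (hy : y ∈ c.action.source)
    (hy' : y ∈ c'.action.source) :
    ∃ (Z : Matrix (Fin n) (Fin n) ℤ) (ψ : Eucl n), IsUnit Z.det ∧
      (∀ φ, c'.param (c'.action y, φ) = c.param (c.action y, ofInt Z φ + ψ)) ∧
      fderiv ℝ c'.action y = (ofInt Z.transpose).comp (fderiv ℝ c.action y) := by
  obtain ⟨Z, hZ, e⟩ := c.exists_transition c' hy hy'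
  obtain ⟨ψ, hψ⟩ := c.surj_param (x := c'.param (c'.action y, 0)) (by rwa [c'.f_param hy'])
  rw [c'.f_param hy'] at hψ
  refine ⟨Z, ψ, hZ, fun φ => ?_, fderiv_of_coframe c hy hy' e⟩
  rw [← c.lift_coframe hy, ← c'.lift_coframe hy'] at hψ
  have := c.isPolarization_lift.translate c'.isPolarization_lift hy hy' hψ (c'.coframe y φ)
  rw [← map_add, zero_add, c'.lift_coframe hy', e, ContinuousLinearMap.comp_apply, ← map_add,
    c.lift_coframe hy] at this
  rw [← this, add_comm]

/-- A continuous family of angular parametrisations `Θ t` of the fibres over `γ t`, `0 ≤ t ≤ T`,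
together with the covariantly constant frame `K t` of the corresponding actions. -/
structure IsAngleTransport (A : ConnectionForm n (Eucl n)) (γ : ℝ → Eucl n)
    (c₀ : ActionAngleChart Ω f) (T : ℝ) (Θ : ℝ → Eucl n → M) (K : ℝ → Eucl n →L[ℝ] Eucl n) :
    Prop where
  continuousOn : ContinuousOn (Function.uncurry Θ) (Icc 0 T ×ˢ univ)
  deriv : ∀ t ∈ Icc 0 T,
    HasDerivWithinAt K ((K t).comp (A (γ t) (derivWithin γ (Icc 0 1) t))) (Icc 0 T) t
  start : ∀ φ, Θ 0 φ = c₀.param (c₀.action (γ 0), φ)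
  start_frame : K 0 = fderiv ℝ c₀.action (γ 0)
  local_form : ∀ t ∈ Icc 0 T, ∃ (c : ActionAngleChart Ω f) (N : Matrix (Fin n) (Fin n) ℤ)
    (φ₀ : Eucl n), γ t ∈ c.action.source ∧ IsUnit N.det ∧
      (∀ φ, Θ t φ = c.param (c.action (γ t), ofInt N φ + φ₀)) ∧
      K t = (ofInt N.transpose).comp (fderiv ℝ c.action (γ t))

variable {γ : ℝ → Eucl n}

theorem IsAngleTransport.init (c₀ : ActionAngleChart Ω f)
    (h0 : γ 0 ∈ c₀.action.source) {A : ConnectionForm n (Eucl n)} :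
    IsAngleTransport A γ c₀ 0 (fun _ φ => c₀.param (c₀.action (γ 0), φ))
      (fun _ => fderiv ℝ c₀.action (γ 0)) := by
  refine ⟨?_, ?_, fun _ => rfl, rfl, ?_⟩
  · exact ((c₀.contMDiff_param h0).continuous.comp continuous_snd).continuousOn
  · intro t ht
    have ht0 : t = 0 := by simpa using ht
    subst ht0
    rw [Icc_self]
    exact HasFDerivWithinAt.singleton
  · intro t ht
    have ht0 : t = 0 := by simpa using ht
    subst ht0
    exact ⟨c₀, 1, 0, h0, by simp, by simp, by simp⟩

theorem IsAngleTransport.congr {A : ConnectionForm n (Eucl n)} {c₀ : ActionAngleChart Ω f} {T : ℝ}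
    {Θ Θ' : ℝ → Eucl n → M} {K K' : ℝ → Eucl n →L[ℝ] Eucl n} (h : IsAngleTransport A γ c₀ T Θ K)
    (hT : 0 ≤ T) (e : ∀ t ∈ Icc 0 T, Θ' t = Θ t) (e' : ∀ t ∈ Icc 0 T, K' t = K t) :
    IsAngleTransport A γ c₀ T Θ' K' := by
  have h0 := left_mem_Icc.2 hT
  refine ⟨h.continuousOn.congr fun z hz => congrFun (e z.1 hz.1) z.2, fun t ht => ?_,
    fun φ => ?_, ?_, fun t ht => ?_⟩
  · rw [e' t ht]
    exact (h.deriv t ht).congr e' (e' t ht)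
  · rw [e 0 h0, h.start]
  · rw [e' 0 h0, h.start_frame]
  · rw [e t ht, e' t ht]
    exact h.local_form t ht

/-- At time T the family is rewritten in the chart `c` by an affine transition; from then on the
integer matrix and the shift stay constant. The frame continues because the differentials of the
actions of `c` are covariantly constant. -/
theorem IsAngleTransport.extend [IsManifold (𝓡 (2 * n)) ∞ M] [T2Space M]
    {A : ConnectionForm n (Eucl n)} (hA : IsCanonicalConnection Ω f A)
    (hγ : ContDiffOn ℝ 1 γ (Icc 0 1)) {c₀ : ActionAngleChart Ω f} {T T' : ℝ}
    (hT : 0 ≤ T) (hTT' : T ≤ T') (hT' : T' ≤ 1) {c : ActionAngleChart Ω f}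
    (hc : ∀ t ∈ Icc T T', γ t ∈ c.action.source) {Θ : ℝ → Eucl n → M}
    {K : ℝ → Eucl n →L[ℝ] Eucl n} (h : IsAngleTransport A γ c₀ T Θ K) :
    ∃ Θ' K', IsAngleTransport A γ c₀ T' Θ' K' := by
  obtain ⟨c', N', φ', hy', hN', eΘ, eK⟩ := h.local_form T (right_mem_Icc.2 hT)
  have hy := hc T (left_mem_Icc.2 hTT')
  obtain ⟨Z, ψ, hZ, eZ, eZ'⟩ := c.exists_affine_transition c' hy hy'
  set N := Z * N'
  set φ₀ := ofInt Z φ' + ψ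
  have hN : IsUnit N.det := by rw [Matrix.det_mul]; exact hZ.mul hN'
  set Θ₁ : ℝ → Eucl n → M := fun t φ => c.param (c.action (γ t), ofInt N φ + φ₀)
  set K₁ : ℝ → Eucl n →L[ℝ] Eucl n := fun t => (ofInt N.transpose).comp (fderiv ℝ c.action (γ t))
  have gΘ : Θ T = Θ₁ T := by
    funext φ
    rw [eΘ, eZ, map_add]
    simp only [Θ₁, N, φ₀, ofInt_mul, ContinuousLinearMap.comp_apply, add_assoc]
  have gK : K T = K₁ T := by
    rw [eK, eZ', ← ContinuousLinearMap.comp_assoc, ← ofInt_mul, ← Matrix.transpose_mul]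
  have sub : Icc T T' ⊆ Icc 0 1 := Icc_subset_Icc hT hT'
  have contΘ₁ : ContinuousOn (Function.uncurry Θ₁) (Icc T T' ×ˢ univ) := by
    have h1 : ContinuousOn (fun t => c.action (γ t)) (Icc T T') :=
      c.action.continuousOn.comp (hγ.continuousOn.mono sub) hc
    have h2 : ContinuousOn (fun z : ℝ × Eucl n => (c.action (γ z.1), ofInt N z.2 + φ₀))
        (Icc T T' ×ˢ univ) :=
      (h1.comp continuousOn_fst fun z hz => hz.1).prodMk (by fun_prop)
    exact c.param_smooth.continuousOn.comp h2 fun z hz =>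
      ⟨c.action.map_source (hc _ hz.1), mem_univ _⟩
  have derK₁ : ∀ t ∈ Icc T T', HasDerivWithinAt K₁
      ((K₁ t).comp (A (γ t) (derivWithin γ (Icc 0 1) t))) (Icc T T') t := by
    intro t ht
    have hg := ((hγ.differentiableOn (by simp)) t (sub ht)).hasDerivWithinAt.mono sub
    have hcs := hc t ht
    have h1 := (((ActionAngleChart.contDiffAt_fderiv hcs).differentiableAt (by simp)).hasFDerivAt).comp_hasDerivWithinAt
      t hg
    refine ((hasDerivWithinAt_const _ _ (ofInt N.transpose)).clm_comp h1).congr_deriv ?_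
    rw [ActionAngleChart.eq_connection_of_pullback (hA.pullback c) hcs]
    ext1 v
    simp only [ContinuousLinearMap.zero_comp, zero_add, K₁, ContinuousLinearMap.comp_apply,
      Function.comp_apply, ActionAngleChart.fderiv_connection hcs]
  have hu : Icc 0 T ∪ Icc T T' = Icc 0 T' := Icc_union_Icc_eq_Icc hT hTT'
  set Θ' : ℝ → Eucl n → M := fun t => if t ≤ T then Θ t else Θ₁ t with hΘ'
  set K' : ℝ → Eucl n →L[ℝ] Eucl n := fun t => if t ≤ T then K t else K₁ t with hK'
  have e1 : ∀ t ∈ Icc 0 T, Θ' t = Θ t := fun t ht => if_pos ht.2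
  have e2 : ∀ t ∈ Icc 0 T, K' t = K t := fun t ht => if_pos ht.2
  have e3 : ∀ t ∈ Icc T T', Θ' t = Θ₁ t := by
    intro t ht
    rcases ht.1.eq_or_lt with rfl | hlt
    · rw [← gΘ]; exact if_pos le_rfl
    · exact if_neg hlt.not_ge
  have e4 : ∀ t ∈ Icc T T', K' t = K₁ t := by
    intro t ht
    rcases ht.1.eq_or_lt with rfl | hlt
    · rw [← gK]; exact if_pos le_rfl
    · exact if_neg hlt.not_ge
  have h' := h.congr hT e1 e2
  have der2 : ∀ t ∈ Icc T T', HasDerivWithinAt K'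
      ((K' t).comp (A (γ t) (derivWithin γ (Icc 0 1) t))) (Icc T T') t := by
    intro t ht
    rw [e4 t ht]
    exact (derK₁ t ht).congr e4 (e4 t ht)
  refine ⟨Θ', K', ?_, fun t ht => ?_, h'.start, h'.start_frame, fun t ht => ?_⟩
  · rw [← hu, union_prod]
    refine h'.continuousOn.union_of_isClosed
      (contΘ₁.congr fun z hz => congrFun (e3 z.1 hz.1) z.2) (isClosed_Icc.prod isClosed_univ)
      (isClosed_Icc.prod isClosed_univ)
  · rw [← hu]
    rcases lt_trichotomy t T with hlt | rfl | hlt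
    · refine (h'.deriv t ⟨ht.1, hlt.le⟩).union (HasFDerivWithinAt.of_notMem_closure ?_)
      rw [isClosed_Icc.closure_eq]
      exact fun hh => absurd hh.1 hlt.not_ge
    · exact (h'.deriv t ⟨ht.1, le_rfl⟩).union (der2 t ⟨le_rfl, ht.2⟩)
    · refine HasDerivWithinAt.union (HasFDerivWithinAt.of_notMem_closure ?_) (der2 t ⟨hlt.le, ht.2⟩)
      rw [isClosed_Icc.closure_eq]
      exact fun hh => absurd hh.2 hlt.not_ge
  · rcases le_total t T with hle | hle
    · exact h'.local_form t ⟨ht.1, hle⟩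
    · have htt : t ∈ Icc T T' := ⟨hle, ht.2⟩
      exact ⟨c, N, φ₀, hc t htt, hN, fun φ => congrFun (e3 t htt) φ, e4 t htt⟩

/-- The interval is subdivided so that each piece of γ lies in the domain of one chart; finitely
many extensions reach the end. -/
theorem exists_angleTransport [IsManifold (𝓡 (2 * n)) ∞ M] [T2Space M]
    (hf : IsIntegrableSystem Ω f)
    {A : ConnectionForm n (Eucl n)} (hA : IsCanonicalConnection Ω f A)
    (hγ : ContDiffOn ℝ 1 γ (Icc 0 1)) (hγB : ∀ t ∈ Icc (0 : ℝ) 1, γ t ∈ regularValues f)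
    (c₀ : ActionAngleChart Ω f) (h0 : γ 0 ∈ c₀.action.source) :
    ∃ Θ K, IsAngleTransport A γ c₀ 1 Θ K := by
  have hγc : Continuous fun t : unitInterval => γ t := hγ.continuousOn.domRestrict
  obtain ⟨t, t0, tm, ⟨m, hm⟩, ht⟩ := exists_monotone_Icc_subset_open_cover_unitInterval
    (c := fun c : ActionAngleChart Ω f => (fun t : unitInterval => γ t) ⁻¹' c.action.source)
    (fun c => c.action.open_source.preimage hγc) fun t _ => by
      obtain ⟨c, hc⟩ := exists_actionAngleChart hf (hγB t t.2)
      exact mem_iUnion.2 ⟨c, hc⟩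
  have key : ∀ k, ∃ Θ K, IsAngleTransport A γ c₀ (t k) Θ K := by
    intro k
    induction k with
    | zero =>
      rw [t0]
      exact ⟨_, _, IsAngleTransport.init c₀ h0⟩
    | succ k ih =>
      obtain ⟨Θ, K, h⟩ := ih
      obtain ⟨c, hc⟩ := ht k
      refine h.extend hA hγ (t k).2.1 (tm k.le_succ) (t (k + 1)).2.2 (c := c) fun s hs => ?_
      exact @hc ⟨s, (t k).2.1.trans hs.1, hs.2.trans (t (k + 1)).2.2⟩ hs
  have := key m
  rwa [hm m le_rfl] at this

end Transport

/-! ### Determinants and inverses of integer matrices. -/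

section Unimodular

variable {n : ℕ}

theorem det_ofInt (Z : Matrix (Fin n) (Fin n) ℤ) : (ofInt Z).det = (Z.det : ℝ) := by
  have h : LinearMap.toMatrix (EuclideanSpace.basisFun (Fin n) ℝ).toBasis
      (EuclideanSpace.basisFun (Fin n) ℝ).toBasis (ofInt Z).toLinearMap = Z.map (Int.castRingHom ℝ) := by
    ext i j
    rw [LinearMap.toMatrix_apply]
    simp [ofInt_apply]
  show LinearMap.det (ofInt Z).toLinearMap = _
  rw [← LinearMap.det_toMatrix (EuclideanSpace.basisFun (Fin n) ℝ).toBasis, h]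
  exact ((Int.castRingHom ℝ).map_det Z).symm

theorem exists_inverse {Z : Matrix (Fin n) (Fin n) ℤ} (hZ : IsUnit Z.det) :
    ∃ Z' : Matrix (Fin n) (Fin n) ℤ, (∀ v, ofInt Z' (ofInt Z v) = v) ∧ ∀ v, ofInt Z (ofInt Z' v) = v := by
  refine ⟨Z⁻¹, fun v => ?_, fun v => ?_⟩
  · rw [← ContinuousLinearMap.comp_apply, ← ofInt_mul, Matrix.nonsing_inv_mul Z hZ, ofInt_one]
    rfl
  · rw [← ContinuousLinearMap.comp_apply, ← ofInt_mul, Matrix.mul_nonsing_inv Z hZ, ofInt_one]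
    rfl

theorem isUnit_of_inverse {L L' : Eucl n →L[ℝ] Eucl n} (h : ∀ v, L' (L v) = v)
    (h' : ∀ v, L (L' v) = v) : IsUnit L :=
  ⟨⟨L, L', ContinuousLinearMap.ext h', ContinuousLinearMap.ext h⟩, rfl⟩

end Unimodular

/-! ### Monodromy diffeomorphisms and their deck matrix. -/

section Monodromy

open Set

variable {n : ℕ} {M : Type*} [TopologicalSpace M] [ChartedSpace (Eucl (2 * n)) M]
  {Ω : SymplecticForm (2 * n) M} {f : M → Eucl n} {γ : ℝ → Eucl n} {A : ConnectionForm n (Eucl n)}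
  {c₀ : ActionAngleChart Ω f} {Θ : ℝ → Eucl n → M} {K : ℝ → Eucl n →L[ℝ] Eucl n}

namespace IsAngleTransport

section Fibrewise

variable {T : ℝ} (h : IsAngleTransport A γ c₀ T Θ K) {t : ℝ} (ht : t ∈ Icc 0 T)

include h ht

theorem eq_iff (φ φ' : Eucl n) :
    Θ t φ = Θ t φ' ↔ ∃ k, φ' = φ + (2 * Real.pi) • intVec k := by
  obtain ⟨c, N, φ₀, hc, hN, e, -⟩ := h.local_form t ht
  obtain ⟨N', h1, h2⟩ := exists_inverse hN
  rw [e, e, c.param_eq_iff' (c.action.map_source hc)]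
  constructor
  · rintro ⟨k, hk⟩
    refine ⟨N'.mulVec k, ?_⟩
    have h3 : ofInt N φ' = ofInt N φ + (2 * Real.pi) • intVec k := by
      rw [← add_left_inj φ₀, hk]
      abel
    rw [← ofInt_intVec, ← h1 φ', h3, map_add, map_smul, h1]
  · rintro ⟨k, rfl⟩
    refine ⟨N.mulVec k, ?_⟩
    rw [← ofInt_intVec, map_add, map_smul]
    abel

theorem add_int (φ : Eucl n) (k : Fin n → ℤ) : Θ t (φ + (2 * Real.pi) • intVec k) = Θ t φ :=
  ((h.eq_iff ht _ _).2 ⟨k, rfl⟩).symm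

theorem apply_base (φ : Eucl n) : f (Θ t φ) = γ t := by
  obtain ⟨c, N, φ₀, hc, -, e, -⟩ := h.local_form t ht
  rw [e, c.f_param hc]

theorem surj {x : M} (hx : f x = γ t) : ∃ φ, Θ t φ = x := by
  obtain ⟨c, N, φ₀, hc, hN, e, -⟩ := h.local_form t ht
  obtain ⟨N', -, h2⟩ := exists_inverse hN
  rw [← hx] at hc e
  obtain ⟨φ, hφ⟩ := c.surj_param hc
  exact ⟨ofInt N' (φ - φ₀), by rw [e, h2, sub_add_cancel, hφ]⟩

theorem smooth : ContMDiff 𝓘(ℝ, Eucl n) (𝓡 (2 * n)) ∞ (Θ t) := by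
  obtain ⟨c, N, φ₀, hc, -, e, -⟩ := h.local_form t ht
  have h1 : ContMDiff 𝓘(ℝ, Eucl n) 𝓘(ℝ, Eucl n) ∞ fun φ : Eucl n => ofInt N φ + φ₀ :=
    ContDiff.contMDiff (by fun_prop)
  rw [funext e]
  exact (c.contMDiff_param hc).comp h1

theorem mder_injective (φ : Eucl n) : Function.Injective (mder (2 * n) (Θ t) φ) := by
  obtain ⟨c, N, φ₀, hc, hN, e, -⟩ := h.local_form t ht
  obtain ⟨N', h1, -⟩ := exists_inverse hN
  have hJ := c.action.map_source hc
  set k : Eucl n → Eucl n × Eucl n := fun φ => (c.action (γ t), ofInt N φ + φ₀)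
  have hk : HasFDerivAt k ((0 : Eucl n →L[ℝ] Eucl n).prod (ofInt N)) φ :=
    (hasFDerivAt_const _ _).prodMk ((ofInt N).hasFDerivAt.add_const _)
  have h2 := mder_comp (d := 2 * n) (g := c.param) (k := k) (x := φ)
    ((c.param_smooth.contMDiffAt ((c.action.open_target.prod isOpen_univ).mem_nhds
      ⟨hJ, mem_univ _⟩)).mdifferentiableAt (n := ∞) (by simp)) hk.differentiableAt
  have h3 : Θ t = c.param ∘ k := funext e
  rw [h3, h2, hk.fderiv]
  refine (c.mder_param_injective hJ _).comp fun v w hvw => ?_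
  have h4 : ofInt N v = ofInt N w := congrArg Prod.snd hvw
  rw [← h1 v, h4, h1]

end Fibrewise

theorem isParallelFrame (h : IsAngleTransport A γ c₀ 1 Θ K) : IsParallelFrame A γ K := by
  refine ⟨fun t ht => ?_, h.deriv⟩
  obtain ⟨c, N, φ₀, hc, hN, -, e⟩ := h.local_form t ht
  rw [← Matrix.det_transpose] at hN
  obtain ⟨N', h1, h2⟩ := exists_inverse hN
  rw [e]
  exact (isUnit_of_inverse h1 h2).mul
    (isUnit_of_inverse (c.fderiv_symm_fderiv hc) (c.fderiv_fderiv_symm hc))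

/-- Back over the starting point the current chart is compared with `c₀`: the same matrix changes
the angles directly and the actions through its transpose. This is where monodromy and holonomy
meet. -/
theorem exists_matrix [IsManifold (𝓡 (2 * n)) ∞ M] [T2Space M]
    (h : IsAngleTransport A γ c₀ 1 Θ K) (h1 : γ 1 = γ 0)
    (hc₀ : γ 0 ∈ c₀.action.source) : ∃ (Z : Matrix (Fin n) (Fin n) ℤ) (φ₀ : Eucl n), Z.det = 1 ∧
      (∀ φ, Θ 1 φ = c₀.param (c₀.action (γ 0), ofInt Z φ + φ₀)) ∧
      K 1 = (ofInt Z.transpose).comp (K 0) := by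
  obtain ⟨c, N, φ₀, hc, hN, eΘ, eK⟩ := h.local_form 1 (by simp)
  rw [h1] at hc eΘ eK
  obtain ⟨Z, ψ, hZ, eZ, eZ'⟩ := c₀.exists_affine_transition c hc₀ hc
  have hK : K 1 = (ofInt (Z * N).transpose).comp (K 0) := by
    rw [eK, eZ', h.start_frame, ← ContinuousLinearMap.comp_assoc, ← ofInt_mul,
      ← Matrix.transpose_mul]
  refine ⟨Z * N, ofInt Z φ₀ + ψ, ?_, fun φ => ?_, hK⟩
  · have hu : IsUnit (Z * N).det := by rw [Matrix.det_mul]; exact hZ.mul hN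
    -- A unimodular matrix has determinant ±1; here its product with the square of det K(0) is
    -- positive.
    have hpos := det_pos_of_parallelFrame h.isParallelFrame
    have hd : (K 1).det = ((Z * N).det : ℝ) * (K 0).det := by
      rw [hK, ← Matrix.det_transpose, ← det_ofInt]
      exact LinearMap.det_comp _ _
    rw [hd, mul_assoc] at hpos
    have h2 : (0 : ℝ) < (Z * N).det := pos_of_mul_pos_left hpos (mul_self_nonneg _)
    have h3 : 0 < (Z * N).det := by exact_mod_cast h2
    rcases Int.isUnit_iff.1 hu with h4 | h4
    · exact h4
    · omega
  · rw [eΘ, eZ, map_add, ofInt_mul, ContinuousLinearMap.comp_apply, add_assoc]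

variable {b : Eucl n}

/-- The family of tori over γ is covered by [0, 1] × ℝⁿ through Θ. The homotopy (t, φ) ↦ Φ_t(π φ)
lifts to a family that is the identity at t = 0 and commutes with the lattice for every t. Hence the
lattice matrix of Φ₁ comes from Θ₁ alone, whatever the transport. -/
theorem hasDeckMatrix [T2Space M] (h : IsAngleTransport A γ c₀ 1 Θ K) (hb : b ∈ c₀.action.source)
    (h0 : γ 0 = b) [ChartedSpace (Eucl n) (Fibre f b)]
    (hπ : IsTorusCover (c₀.fibreMap hb)) {Z : Matrix (Fin n) (Fin n) ℤ} {φ₀ : Eucl n}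
    (hZ : ∀ φ, Θ 1 φ = c₀.param (c₀.action b, ofInt Z φ + φ₀))
    {χ : Diffeomorph (𝓡 n) (𝓡 n) (Fibre f b) (Fibre f b) ∞} (hχ : IsMonodromyDiffeo f b γ χ) :
    HasDeckMatrix (c₀.fibreMap hb) χ Z := by
  obtain ⟨Φ, hΦ, e⟩ := hχ
  -- The torus bundle pulled back by γ; keeping t as a coordinate forces lifts to preserve it.
  let E := {z : unitInterval × M // f z.2 = γ z.1}
  let q : unitInterval × Eucl n → E := fun z => ⟨(z.1, Θ z.1 z.2), h.apply_base z.1.2 z.2⟩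
  have hqc : Continuous q := by
    refine Continuous.subtype_mk (continuous_fst.prodMk ?_) _
    exact h.continuousOn.comp_continuous (f := fun z : unitInterval × Eucl n => ((z.1 : ℝ), z.2))
      (by fun_prop) fun z => ⟨z.1.2, mem_univ _⟩
  have hqs : Function.Surjective q := by
    rintro ⟨⟨t, x⟩, hx⟩
    obtain ⟨φ, hφ⟩ := h.surj t.2 hx
    exact ⟨(t, φ), Subtype.ext (Prod.ext rfl hφ)⟩
  have hq : IsCoveringMap q := by
    refine isCoveringMap_of_lattice hqc hqs fun z z' => ?_
    constructor
    · intro hz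
      have e1 : z.1 = z'.1 := congrArg (fun w : E => w.1.1) hz
      have e2 : Θ z.1 z.2 = Θ z'.1 z'.2 := congrArg (fun w : E => w.1.2) hz
      rw [← e1] at e2
      obtain ⟨k, hk⟩ := (h.eq_iff z.1.2 _ _).1 e2
      exact ⟨k, Prod.ext e1.symm hk⟩
    · rintro ⟨k, rfl⟩
      exact Subtype.ext (Prod.ext rfl (h.add_int z.1.2 z.2 k).symm)
  have hΦb : ∀ (t : unitInterval) x, f (Φ t x) = γ t := fun t x => by
    have : Φ t x ∈ f ⁻¹' {γ t} := by
      rw [← hΦ.range_eq t t.2]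
      exact mem_range_self x
    exact this
  let H : C(unitInterval × Eucl n, E) :=
    ⟨fun z => ⟨(z.1, Φ z.1 (c₀.fibreMap hb z.2)), hΦb _ _⟩, by
      refine Continuous.subtype_mk (continuous_fst.prodMk ?_) _
      exact hΦ.continuousOn.comp_continuous
        (f := fun z : unitInterval × Eucl n => ((z.1 : ℝ), c₀.fibreMap hb z.2))
        ((continuous_subtype_val.comp continuous_fst).prodMk
          ((c₀.continuous_fibreMap hb).comp continuous_snd)) fun z => ⟨z.1.2, mem_univ _⟩⟩
  let i : C(Eucl n, unitInterval × Eucl n) := ⟨fun φ => (0, φ), by fun_prop⟩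
  have H0 : ∀ φ, H (0, φ) = q (i φ) := fun φ => Subtype.ext <| Prod.ext rfl <| by
    show Φ 0 (c₀.fibreMap hb φ) = Θ 0 φ
    rw [hΦ.start, h.start, h0]
    rfl
  let L := hq.liftHomotopy H i H0
  have hL : ∀ z, q (L z) = H z := fun z => congrFun (hq.liftHomotopy_lifts H i H0) z
  have hL0 : ∀ φ, L (0, φ) = (0, φ) := hq.liftHomotopy_zero H i H0
  have hL1 : ∀ z, (L z).1 = z.1 := fun z => congrArg (fun w : E => w.1.1) (hL z)
  have hL2 : ∀ z, Θ z.1 (L z).2 = Φ z.1 (c₀.fibreMap hb z.2) := fun z => by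
    have : Θ (L z).1 (L z).2 = _ := congrArg (fun w : E => w.1.2) (hL z)
    rwa [hL1] at this
  have equi : ∀ φ k, (L (1, φ + (2 * Real.pi) • intVec k)).2
      = (L (1, φ)).2 + (2 * Real.pi) • intVec k := by
    intro φ k
    -- Two lifts of one path in E that coincide at t = 0, where the lifted homotopy is the identity.
    have h1 := hq.eq_of_comp_eq (A := unitInterval)
      (g₁ := fun t => L (t, φ + (2 * Real.pi) • intVec k))
      (g₂ := fun t => (t, (L (t, φ)).2 + (2 * Real.pi) • intVec k))
      (by fun_prop) (by fun_prop) (funext fun t => ?_) 0 (by simp only [hL0])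
    · exact congrArg Prod.snd (congrFun h1 1)
    · simp only [Function.comp_apply]
      rw [hL]
      refine Subtype.ext (Prod.ext rfl ?_)
      show Φ t (c₀.fibreMap hb (φ + _)) = Θ t (_ + _)
      rw [h.add_int t.2, hL2 (t, φ), hπ.add_int]
  have hgc : Continuous fun φ => ofInt Z (L (1, φ)).2 + φ₀ := by fun_prop
  have hgπ : ∀ φ, c₀.fibreMap hb (ofInt Z (L (1, φ)).2 + φ₀) = χ (c₀.fibreMap hb φ) := by
    intro φ
    refine Subtype.ext ?_
    rw [e, c₀.coe_fibreMap, ← hZ]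
    exact hL2 (1, φ)
  refine ⟨_, ?_, hgπ, fun φ k => ?_⟩
  · rw [← contMDiff_iff_contDiff]
    intro φ
    refine hπ.contMDiffAt_lift hgc.continuousAt ?_
    simp only [hgπ]
    exact (χ.contMDiff.comp hπ.smooth) φ
  · simp only [equi, map_add, map_smul]
    abel

/-- Each Θ_t is invariant exactly under the lattice, so it descends to a diffeomorphism from Λ_b
onto the fibre over γ(t). At t = 1 it is induced by an affine map with unimodular linear part, whose
inverse is explicit. -/
theorem exists_monodromyDiffeo (h : IsAngleTransport A γ c₀ 1 Θ K) (hb : b ∈ c₀.action.source)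
    (h0 : γ 0 = b) [ChartedSpace (Eucl n) (Fibre f b)]
    (hπ : IsTorusCover (c₀.fibreMap hb)) {Z : Matrix (Fin n) (Fin n) ℤ} {φ₀ : Eucl n}
    (hd : IsUnit Z.det) (hZ : ∀ φ, Θ 1 φ = c₀.param (c₀.action b, ofInt Z φ + φ₀)) :
    ∃ χ, IsMonodromyDiffeo f b γ χ := by
  obtain ⟨Z', hZ1, hZ2⟩ := exists_inverse hd
  set π := c₀.fibreMap hb
  let F : Eucl n → Fibre f b := fun φ => π (ofInt Z φ + φ₀)
  let F' : Eucl n → Fibre f b := fun φ => π (ofInt Z' (φ - φ₀))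
  have perF : ∀ φ k, F (φ + (2 * Real.pi) • intVec k) = F φ := by
    intro φ k
    refine ((hπ.eq_iff _ _).2 ⟨Z.mulVec k, ?_⟩).symm
    rw [← ofInt_intVec, map_add, map_smul]
    abel
  have perF' : ∀ φ k, F' (φ + (2 * Real.pi) • intVec k) = F' φ := by
    intro φ k
    refine ((hπ.eq_iff _ _).2 ⟨Z'.mulVec k, ?_⟩).symm
    rw [← ofInt_intVec, ← map_smul, ← map_add]
    congr 1
    abel
  have sF : ContMDiff 𝓘(ℝ, Eucl n) (𝓡 n) ∞ F := hπ.smooth.comp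
    (ContDiff.contMDiff (by fun_prop : ContDiff ℝ ∞ fun φ : Eucl n => ofInt Z φ + φ₀))
  have sF' : ContMDiff 𝓘(ℝ, Eucl n) (𝓡 n) ∞ F' := hπ.smooth.comp
    (ContDiff.contMDiff (by fun_prop : ContDiff ℝ ∞ fun φ : Eucl n => ofInt Z' (φ - φ₀)))
  let χ : Diffeomorph (𝓡 n) (𝓡 n) (Fibre f b) (Fibre f b) ∞ :=
    { toFun := fun x => F (hπ.sec x)
      invFun := fun x => F' (hπ.sec x)
      left_inv := fun x => by
        refine (hπ.apply_sec_π perF' _).trans ?_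
        simp only [F', add_sub_cancel_right, hZ1]
        exact hπ.π_sec x
      right_inv := fun x => by
        refine (hπ.apply_sec_π perF _).trans ?_
        simp only [F, sub_add_cancel, hZ2]
        exact hπ.π_sec x
      contMDiff_toFun := hπ.contMDiff_comp_sec sF perF
      contMDiff_invFun := hπ.contMDiff_comp_sec sF' perF' }
  have sec_apply : ∀ t ∈ Icc (0 : ℝ) 1, ∀ φ, Θ t (hπ.sec (π φ)) = Θ t φ := fun t ht φ =>
    hπ.apply_sec_π (h.add_int ht) φ
  refine ⟨χ, fun t x => Θ t (hπ.sec x), ⟨?_, fun x => ?_, fun t ht => ?_, fun t ht x => ?_,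
    fun t ht x y hxy => ?_, fun t ht => ?_⟩, fun x => (hZ _).symm⟩
  · rintro ⟨t, x⟩ ⟨ht, -⟩
    obtain ⟨z, rfl⟩ := hπ.surj x
    obtain ⟨Ψ, hz, e⟩ := hπ.diffeo z
    have hzt : π z ∈ Ψ.target := by rw [← e z hz]; exact Ψ.map_source hz
    have hc : ContinuousAt (fun w : ℝ × Fibre f b => (w.1, Ψ.symm w.2)) (t, π z) :=
      continuousAt_fst.prodMk (ContinuousAt.comp (f := Prod.snd)
        ((Ψ.contMDiffOn_invFun.contMDiffAt (Ψ.open_target.mem_nhds hzt)).continuousAt)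
        continuousAt_snd)
    have h2 := (h.continuousOn (t, Ψ.symm (π z)) ⟨ht, mem_univ _⟩).comp (f := fun w :
      ℝ × Fibre f b => (w.1, Ψ.symm w.2)) (s := Icc 0 1 ×ˢ univ) (x := (t, π z))
      hc.continuousWithinAt fun w hw => ⟨hw.1, mem_univ _⟩
    -- Periodicity allows the discontinuous `sec` to be replaced by a smooth local section; this
    -- yields joint continuity.
    have key : ∀ t ∈ Icc (0 : ℝ) 1, ∀ y ∈ Ψ.target, Θ t (hπ.sec y) = Θ t (Ψ.symm y) := by
      intro t ht y hy
      rw [← sec_apply t ht (Ψ.symm y), apply_symm_of_eqOn e hy]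
    refine h2.congr_of_eventuallyEq ?_ (key t ht _ hzt)
    have hn : ∀ᶠ w in 𝓝[Icc (0 : ℝ) 1 ×ˢ univ] (t, π z), w.2 ∈ Ψ.target :=
      nhdsWithin_le_nhds (continuousAt_snd.preimage_mem_nhds (Ψ.open_target.mem_nhds hzt))
    filter_upwards [hn, self_mem_nhdsWithin] with w hw hw'
    exact key w.1 hw'.1 w.2 hw
  · obtain ⟨z, rfl⟩ := hπ.surj x
    rw [sec_apply 0 (by simp), h.start, h0]
    rfl
  · exact hπ.contMDiff_comp_sec (h.smooth ht) (h.add_int ht)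
  · obtain ⟨z, rfl⟩ := hπ.surj x
    have hs := hπ.contMDiff_comp_sec (h.smooth ht) (h.add_int ht)
    have h2 := mfderiv_comp z (hs.mdifferentiableAt (by simp)) (hπ.mdifferentiableAt z)
    have h3 : (fun x => Θ t (hπ.sec x)) ∘ π = Θ t := funext (sec_apply t ht)
    rw [h3] at h2
    intro v w hvw
    obtain ⟨v, rfl⟩ := (hπ.mder_bijective z).2 v
    obtain ⟨w, rfl⟩ := (hπ.mder_bijective z).2 w
    have h4 : mder (2 * n) (Θ t) z v = mder (2 * n) (Θ t) z w :=
      (DFunLike.congr_fun h2 v).trans (hvw.trans (DFunLike.congr_fun h2 w).symm)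
    rw [h.mder_injective ht z h4]
  · obtain ⟨k, hk⟩ := (h.eq_iff ht _ _).1 hxy
    rw [← hπ.π_sec x, ← hπ.π_sec y, hk, hπ.add_int]
  · ext x
    constructor
    · rintro ⟨y, rfl⟩
      exact h.apply_base ht _
    · intro hx
      obtain ⟨φ, hφ⟩ := h.surj ht hx
      exact ⟨π φ, (sec_apply t ht φ).trans hφ⟩

end IsAngleTransport

end Monodromy

end LiouvilleMonodromy

end

/-! ### Assembly: holonomy and monodromy have the same matrix in every chart. -/

theorem proposition3 {n : ℕ} {M : Type*} [TopologicalSpace M] [T2Space M]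
    [SecondCountableTopology M] [ChartedSpace (Eucl (2 * n)) M] [IsManifold (𝓡 (2 * n)) ∞ M]
    (Ω : SymplecticForm (2 * n) M) (f : M → Eucl n) (hf : IsIntegrableSystem Ω f) :
    -- the domains of the local action variables form an open cover of `B`
    IsOpen (regularValues f) ∧
    (∀ c : ActionAngleChart Ω f, c.action.source ⊆ regularValues f) ∧
    (∀ b ∈ regularValues f, ∃ c : ActionAngleChart Ω f, b ∈ c.action.source) ∧
    -- the pullbacks of `d` glue to a unique connection on `B`, and it is flat
    ∃ A : ConnectionForm n (Eucl n), IsCanonicalConnection Ω f A ∧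
      (∀ A', IsCanonicalConnection Ω f A' → Set.EqOn A' A (regularValues f)) ∧
      IsFlatOn A (regularValues f) ∧
      -- the differentials of the local action variables are covariantly constant, and two
      -- systems of local action variables differ by a locally constant unimodular matrix
      (∀ c : ActionAngleChart Ω f, ∀ b ∈ c.action.source, ∀ (j : Fin n) (X : Eucl n),
        covDeriv (dualConnection A) (c.dAction j) b X = 0) ∧
      (∀ c c' : ActionAngleChart Ω f, ∀ b ∈ c.action.source ∩ c'.action.source,
        ∃ Z : Matrix (Fin n) (Fin n) ℤ, IsUnit Z.det ∧
          ∀ᶠ y in 𝓝 b, ∀ j, c'.dAction j y = ∑ i, (Z i j : ℝ) • c.dAction i y) ∧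
      -- each Liouville torus is an embedded submanifold
      (∀ b ∈ regularValues f, ∃ cs : ChartedSpace (Eucl n) (Fibre f b),
        IsManifold (𝓡 n) ∞ (Fibre f b) ∧
        Manifold.IsSmoothEmbedding (𝓡 n) (𝓡 (2 * n)) ∞ (Subtype.val : Fibre f b → M)) ∧
      -- holonomy and monodromy along loops `γ` in `B`
      ∀ b ∈ regularValues f, ∀ [ChartedSpace (Eucl n) (Fibre f b)]
        [IsManifold (𝓡 n) ∞ (Fibre f b)],
        Manifold.IsSmoothEmbedding (𝓡 n) (𝓡 (2 * n)) ∞ (Subtype.val : Fibre f b → M) →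
        -- de Rham duality between `H₁` and `H¹`
        ∃ P : DeRhamH1 n (Fibre f b) →ₗ[ℝ] (SingH1 n (Fibre f b) →ₗ[ℤ] ℝ),
          IsPeriodPairing P ∧ Function.Bijective P ∧
          ∀ γ : ℝ → Eucl n, ContDiffOn ℝ 1 γ (Set.Icc 0 1) →
            (∀ t ∈ Set.Icc (0 : ℝ) 1, γ t ∈ regularValues f) → γ 0 = b → γ 1 = b →
            (∃ φ, IsMonodromyDiffeo f b γ φ) ∧
            ∃ (μc : SingH1 n (Fibre f b) ≃ₗ[ℤ] SingH1 n (Fibre f b))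
              (μq : DeRhamH1 n (Fibre f b) ≃ₗ[ℝ] DeRhamH1 n (Fibre f b)),
              IsClassicalMonodromy f b γ μc ∧ IsQuantumMonodromy f b γ μq ∧
              -- the holonomy is the monodromy
              (∃ (T : Eucl n →ₗ[ℝ] Eucl n) (T' : (Eucl n →L[ℝ] ℝ) →ₗ[ℝ] (Eucl n →L[ℝ] ℝ)),
                IsHolonomy A γ T ∧ IsHolonomy (dualConnection A) γ T' ∧
                (∀ α v, T' α (T v) = α v) ∧
                ∀ c : ActionAngleChart Ω f, b ∈ c.action.source →
                  ∃ (Z : Matrix.SpecialLinearGroup (Fin n) ℤ)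
                    (e : Module.Basis (Fin n) ℤ (SingH1 n (Fibre f b))),
                    IsAngleBasis c b e ∧
                    (∀ j, T' (c.dAction j b) = ∑ i, ((Z.1 i j : ℤ) : ℝ) • c.dAction i b) ∧
                    LinearMap.toMatrix e e μc.toLinearMap = Z.1) ∧
              -- the quantum monodromy is the inverse transpose of the classical one
              (∀ (a : DeRhamH1 n (Fibre f b)) (z : SingH1 n (Fibre f b)),
                P (μq a) (μc z) = P a z) ∧
              ∀ e : Module.Basis (Fin n) ℤ (SingH1 n (Fibre f b)),
                (∃ ε : Module.Basis (Fin n) ℝ (DeRhamH1 n (Fibre f b)),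
                  ∀ i j, P (ε i) (e j) = if i = j then 1 else 0) ∧
                ∀ ε : Module.Basis (Fin n) ℝ (DeRhamH1 n (Fibre f b)),
                  (∀ i j, P (ε i) (e j) = if i = j then 1 else 0) →
                  LinearMap.toMatrix ε ε μq.toLinearMap =
                    ((LinearMap.toMatrix e e μc.toLinearMap)⁻¹).transpose.map
                      (fun k : ℤ => (k : ℝ)) := by
  refine ⟨isOpen_regularValues hf, fun c => c.source_subset hf,
    fun b hb => exists_actionAngleChart hf hb, canonicalConnection Ω f,
    isCanonicalConnection_canonicalConnection hf, fun A' hA' => hA'.eqOn hf,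
    isFlatOn_canonicalConnection hf, fun c b hb j X =>
      ActionAngleChart.dAction_parallel hb (canonicalConnection_eq c hb) j X, ?_, ?_, ?_⟩
  · rintro c c' b ⟨hb, hb'⟩
    obtain ⟨Z, hZ, e⟩ := c.exists_transition c' hb hb'
    exact ⟨Z, hZ, (c.eventually_transition c' hb hb' e).mono fun y hy j => c.dAction_of_coframe c' hy j⟩
  · intro b hb
    obtain ⟨c, hc⟩ := exists_actionAngleChart hf hb
    exact c.exists_chartedSpace_fibre hc
  intro b hb _ _ he
  obtain ⟨c₀, hc₀⟩ := exists_actionAngleChart hf hb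
  have hπ₀ := c₀.isTorusCover_fibreMap hc₀ he
  refine ⟨hπ₀.periodPairing, hπ₀.isPeriodPairing, hπ₀.periodPairing_bijective, ?_⟩
  intro γ hγ hγB h0 h1
  have hA := isCanonicalConnection_canonicalConnection hf
  -- Each chart at b gives its own matrix and frame. The results for different charts are compared
  -- below through the holonomy and the monodromy diffeomorphisms, which do not depend on a chart.
  have key : ∀ (c : ActionAngleChart Ω f) (hc : b ∈ c.action.source),
      ∃ (Z : Matrix (Fin n) (Fin n) ℤ) (K : ℝ → Eucl n →L[ℝ] Eucl n), Z.det = 1 ∧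
        IsParallelFrame (canonicalConnection Ω f) γ K ∧
        (∀ j, dualTransport K (c.dAction j b) = ∑ i, ((Z i j : ℤ) : ℝ) • c.dAction i b) ∧
        (∃ χ, IsMonodromyDiffeo f b γ χ) ∧
        ∀ χ, IsMonodromyDiffeo f b γ χ → HasDeckMatrix (c.fibreMap hc) χ Z := by
    intro c hc
    obtain ⟨Θ, K, h⟩ := exists_angleTransport hf hA hγ hγB c (by rwa [h0])
    obtain ⟨Z, φ₀, hd, hΘ, hK⟩ := h.exists_matrix (h1.trans h0.symm) (by rwa [h0])
    rw [h0] at hΘ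
    have hπ := c.isTorusCover_fibreMap hc he
    refine ⟨Z, K, hd, h.isParallelFrame, fun j => ?_,
      h.exists_monodromyDiffeo hc h0 hπ (by rw [hd]; exact isUnit_one) hΘ,
      fun χ hχ => h.hasDeckMatrix hc h0 hπ hΘ hχ⟩
    -- K(0) is dI at b and K(1) = Zᵀ K(0), so dI_j ∘ K(0)⁻¹ K(1) is the j-th component of Zᵀ dI.
    ext v
    have e1 : c.dAction j b (Ring.inverse (K 0) (K 1 v)) = (K 0 (Ring.inverse (K 0) (K 1 v))) j := by
      rw [c.dAction_apply hc, h.start_frame, h0]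
    refine e1.trans ?_
    rw [apply_inverse_apply (h.isParallelFrame.isUnit 0 (by simp)), hK, h.start_frame, h0,
      ContinuousLinearMap.comp_apply, ofInt_apply]
    simp [c.dAction_apply hc]
  obtain ⟨Z₀, K₀, hd₀, hK₀, -, hχ₀, hD₀⟩ := key c₀ hc₀
  obtain ⟨χ₀, hχ₀'⟩ := hχ₀
  obtain ⟨μ, ν, hμ, hν, hP⟩ := hπ₀.exists_monodromy (by rw [hd₀]; exact isUnit_one)
    (D := IsMonodromyDiffeo f b γ) hD₀
  refine ⟨⟨χ₀, hχ₀'⟩, μ, ν, hμ, hν, ⟨_, dualTransport K₀, hK₀.isHolonomy, hK₀.isHolonomy_dual,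
    hK₀.dualTransport_apply, fun c hc => ?_⟩, hP,
    fun e => ⟨exists_dualBasis hπ₀.periodPairing_bijective e,
      fun ε hε => toMatrix_contragredient hε hP⟩⟩
  obtain ⟨Z, K, hd, hK, hT, -, hD⟩ := key c hc
  have hπ := c.isTorusCover_fibreMap hc he
  refine ⟨⟨Z, hd⟩, hπ.basis, c.isAngleBasis_basis hc hπ, fun j => ?_, ?_⟩
  -- Parallel transport is unique, so the frame built from `c₀` may be exchanged for the one built
  -- from `c`.
  · rw [hK₀.isHolonomy_dual.unique hK.isHolonomy_dual]
    exact hT j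
  -- One and the same diffeomorphism χ₀ computes μ in the angle basis of any chart.
  · obtain ⟨g, hg, e, hgZ⟩ := hD χ₀ hχ₀'
    refine hπ.toMatrix_of_degree fun a => ?_
    show hπ.degree (μ a) = _
    rw [hμ χ₀ hχ₀', hπ.degree_homologyMap χ₀.contMDiff hg e hgZ]
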